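/- Let $N,d$ be integers with $N\ge 1$, $d\ge 0$, let $p\ge 2$, $a\in\mathbb R^d$, $e_N$ the last unit vector of $\mathbb R^N$, and write $x=(x',x_N)\in\mathbb R^{N-1}\times\mathbb R$, $Q=(-\frac12,\frac12)^N$, $Q'=(-\frac12,\frac12)^{N-1}$. All norms of matrices and third-order tensors are Euclidean (Frobenius) norms. Let $W:\mathbb R^{d\times N}\to[0,\infty)$ be such that (H1) $W$ is continuous, and $W(\xi)=0$ if and only if $\xi\in\{A,B\}$, where $A=-B=a\otimes e_N$; (H2) there is $C>1$ with $\frac1C|\xi|^p-C\le W(\xi)\le C(|\xi|^p+1)$ for all $\xi$; (H3) there are $r,c,C>0$ with $c|\xi-A|^p\le W(\xi)\le C|\xi-A|^p$ whenever $|\xi-A|\le r$, and $c|\xi-B|^p\le W(\xi)\le C|\xi-B|^p$ whenever $|\xi-B|\le r$; (H4) $W(\xi_1,\dots,\xi_i,\dots,\xi_N)=W(\xi_1,\dots,-\xi_i,\dots,\xi_N)$ for every $i=1,\dots,N$, where $\xi_1,\dots,\xi_N$ are the columns of $\xi$. For $\varepsilon>0$, $\lambda\le 0$ and $u\in W^{2,2}(Q;\mathbb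 R^d)$ put $$F_\varepsilon(u,\lambda)=\int_Q \frac1\varepsilon W(\nabla u)+\varepsilon|\nabla^2u|^2+\varepsilon\min\{\lambda^2,|\nabla^2u|^2\}\,dx\in[0,\infty].$$ For $\gamma\ge 0$ let $$\mathcal A(\gamma)=\Big\{(u,\lambda)\in W^{2,2}(Q;\mathbb R^d)\times(-\infty,0]:\ \int_Q\max\{\lambda+|\nabla^2u|,0\}\,dx\le\gamma\Big\},$$ and let $\tilde\Phi(\gamma)$ be the infimum of $\liminf_{h\to\infty}F_{\varepsilon_h}(u_h,\lambda_h)$ over all sequences $\varepsilon_h\to0^+$ and all sequences $(u_h,\lambda_h)\in\mathcal A(\gamma)$ with $u_h\to|x_N|a$ in $L^1(Q;\mathbb R^d)$. **Proposition.** Let $\gamma\ge0$ and $\delta>0$. Then there exist sequences $\varepsilon_h\to0^+$ and $(u_h,\lambda_h)\in\mathcal A(\gamma+\delta)$ such that - $u_h\in W^{2,\infty}(Q;\mathbb R^d)$ for every $h$; - $u_h\to|x_N|a$ in $L^1(Q;\mathbb R^d)$; - for every $h$, $\nabla u_h=a\otimes e_N$ near $x_N=\frac12$ and $\nabla u_h=-a\otimes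 e_N$ near $x_N=-\frac12$, i.e. almost everywhere in $Q\cap\{x_N>\frac12-\eta_h\}$ and in $Q\cap\{x_N<-\frac12+\eta_h\}$, respectively, for some $\eta_h>0$; - for every $h$, $u_h$ is $Q'$-periodic in $x'$: it is the restriction to $Q$ of a function on $\mathbb R^{N-1}\times(-\frac12,\frac12)$ that has period one in each of $x_1,\dots,x_{N-1}$ and belongs to $W^{2,\infty}(\mathbb R^{N-1}\times(-\frac12,\frac12);\mathbb R^d)$; - $\lim_{h\to\infty}F_{\varepsilon_h}(u_h,\lambda_h)=\tilde\Phi(\gamma)$. -/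

import Mathlib

open MeasureTheory Filter Topology
open scoped ENNReal ContDiff

noncomputable section

namespace SurfaceTension

/-- Euclidean space `ℝ^m`. -/
abbrev Space (m : ℕ) := EuclideanSpace ℝ (Fin m)

/-! ### Weak derivatives and second order Sobolev spaces -/

/-- `g` is a weak partial derivative of `f` in direction `e_j` on the open set `U`. -/
def IsWeakPartial {m : ℕ} (U : Set (Space m)) (j : Fin m) (f g : Space m → ℝ) : Prop :=
  LocallyIntegrableOn f U ∧ LocallyIntegrableOn g U ∧
    ∀ φ : Space m → ℝ, ContDiff ℝ ∞ φ → HasCompactSupport φ → tsupport φ ⊆ U →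
      ∫ x in U, f x * fderiv ℝ φ x (EuclideanSpace.single j 1) = -∫ x in U, g x * φ x

/-- `f` has a weak partial derivative in direction `e_j` on `U`. -/
def HasWeakPartial {m : ℕ} (U : Set (Space m)) (j : Fin m) (f : Space m → ℝ) : Prop :=
  ∃ g, IsWeakPartial U j f g

open Classical in
/-- A representative of the weak partial derivative of `f` in direction `e_j` on `U` (which is
unique up to null subsets of `U`); it is only used where `HasWeakPartial U j f` holds. -/
def weakPartial {m : ℕ} (U : Set (Space m)) (j : Fin m) (f : Space m → ℝ) : Space m → ℝ :=
  if h : HasWeakPartial U j f then h.choose else 0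

/-- The weak gradient of `u : U → ℝ^d`, with entries `∂_j u_i`. -/
def weakGrad {m d : ℕ} (U : Set (Space m)) (u : Space m → Space d) (x : Space m) :
    Matrix (Fin d) (Fin m) ℝ :=
  Matrix.of fun i j => weakPartial U j (fun y => u y i) x

/-- The weak second gradient of `u : U → ℝ^d`, with entries `∂_k ∂_j u_i`. -/
def weakHess {m d : ℕ} (U : Set (Space m)) (u : Space m → Space d) (x : Space m) :
    Fin d → Fin m → Fin m → ℝ :=
  fun i j k => weakPartial U k (weakPartial U j (fun y => u y i)) x

/-- `u ∈ W^{2,q}(U; ℝ^d)`, for an open set `U` and `1 ≤ q ≤ ∞`. -/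
structure MemW2 {m d : ℕ} (q : ℝ≥0∞) (U : Set (Space m)) (u : Space m → Space d) : Prop where
  memLp : ∀ i, MemLp (fun y => u y i) q (volume.restrict U)
  hasGrad : ∀ i j, HasWeakPartial U j (fun y => u y i)
  memLp_grad : ∀ i j, MemLp (weakPartial U j (fun y => u y i)) q (volume.restrict U)
  hasHess : ∀ i j k, HasWeakPartial U k (weakPartial U j (fun y => u y i))
  memLp_hess : ∀ i j k,
    MemLp (weakPartial U k (weakPartial U j (fun y => u y i))) q (volume.restrict U)

/-! ### Tensors -/

/-- The Euclidean (Frobenius) norm of a matrix. -/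
def matNorm {d m : ℕ} (ξ : Matrix (Fin d) (Fin m) ℝ) : ℝ :=
  √(∑ i, ∑ j, ξ i j ^ 2)

/-- The Euclidean norm of a third order tensor. -/
def tensorNorm {d m : ℕ} (T : Fin d → Fin m → Fin m → ℝ) : ℝ :=
  √(∑ i, ∑ j, ∑ k, T i j k ^ 2)

/-- The matrix `a ⊗ e_N`, where `N = n + 1`. -/
def tensorLast {d : ℕ} (n : ℕ) (a : Space d) : Matrix (Fin d) (Fin (n + 1)) ℝ :=
  Matrix.vecMulVec (fun i => a i) (Pi.single (Fin.last n) 1)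

/-! ### The potential -/

/-- `W` is nonnegative, continuous, and vanishes exactly at `a ⊗ e_N` and `-a ⊗ e_N`. -/
structure IsTwoWell {n d : ℕ} (W : Matrix (Fin d) (Fin (n + 1)) ℝ → ℝ) (a : Space d) :
    Prop where
  nonneg : ∀ ξ, 0 ≤ W ξ
  cont : Continuous W
  zero_iff : ∀ ξ, W ξ = 0 ↔ ξ = tensorLast n a ∨ ξ = -tensorLast n a

/-- `W` has growth of order `p` at infinity. -/
def HasGrowth {n d : ℕ} (W : Matrix (Fin d) (Fin (n + 1)) ℝ → ℝ) (p : ℝ) : Prop :=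
  ∃ C : ℝ, 1 < C ∧ ∀ ξ,
    1 / C * matNorm ξ ^ p - C ≤ W ξ ∧ W ξ ≤ C * (matNorm ξ ^ p + 1)

/-- Near each of its wells `A`, `W` is comparable to `|ξ - A|^p`. -/
def HasWellGrowth {n d : ℕ} (W : Matrix (Fin d) (Fin (n + 1)) ℝ → ℝ) (a : Space d) (p : ℝ) :
    Prop :=
  ∃ r c C : ℝ, 0 < r ∧ 0 < c ∧ 0 < C ∧
    ∀ A : Matrix (Fin d) (Fin (n + 1)) ℝ, A = tensorLast n a ∨ A = -tensorLast n a →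
      ∀ ξ, matNorm (ξ - A) ≤ r →
        c * matNorm (ξ - A) ^ p ≤ W ξ ∧ W ξ ≤ C * matNorm (ξ - A) ^ p

/-- `W` does not change when the sign of one column of its argument is changed. -/
def IsColumnEven {n d : ℕ} (W : Matrix (Fin d) (Fin (n + 1)) ℝ → ℝ) : Prop :=
  ∀ (j : Fin (n + 1)) (ξ : Matrix (Fin d) (Fin (n + 1)) ℝ),
    W (ξ.updateCol j (fun i => -ξ i j)) = W ξ

/-! ### The cell problem -/

/-- The open unit cube `Q = (-1/2, 1/2)^m`. -/
def cube (m : ℕ) : Set (Space m) := {x | ∀ i, x i ∈ Set.Ioo (-1 / 2 : ℝ) (1 / 2)}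

/-- The slab `ℝ^{N-1} × (-1/2, 1/2)`, where `N = n + 1`. -/
def slab (n : ℕ) : Set (Space (n + 1)) := {x | x (Fin.last n) ∈ Set.Ioo (-1 / 2 : ℝ) (1 / 2)}

/-- `F_ε(u, λ) = ∫_Q (1/ε) W(∇u) + ε |∇²u|² + ε min {λ², |∇²u|²} dx`, with values in `[0, ∞]`. -/
def energy {n d : ℕ} (W : Matrix (Fin d) (Fin (n + 1)) ℝ → ℝ) (ε : ℝ)
    (u : Space (n + 1) → Space d) (l : ℝ) : ℝ≥0∞ :=
  ∫⁻ x in cube (n + 1), ENNReal.ofReal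
    (1 / ε * W (weakGrad (cube (n + 1)) u x)
      + ε * tensorNorm (weakHess (cube (n + 1)) u x) ^ 2
      + ε * min (l ^ 2) (tensorNorm (weakHess (cube (n + 1)) u x) ^ 2))

/-- The admissible class `𝒜(γ)` of pairs `(u, λ) ∈ W^{2,2}(Q; ℝ^d) × (-∞, 0]` with
`∫_Q max {λ + |∇²u|, 0} dx ≤ γ`. -/
def Admissible (n d : ℕ) (γ : ℝ) : Set ((Space (n + 1) → Space d) × ℝ) :=
  {q | MemW2 2 (cube (n + 1)) q.1 ∧ q.2 ≤ 0 ∧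
    ∫ x in cube (n + 1), max (q.2 + tensorNorm (weakHess (cube (n + 1)) q.1 x)) 0 ≤ γ}

/-- `u_h → |x_N| a` in `L¹(Q; ℝ^d)`. -/
def TendstoRoof {n d : ℕ} (a : Space d) (u : ℕ → Space (n + 1) → Space d) : Prop :=
  Tendsto (fun h => eLpNorm (fun x => u h x - |x (Fin.last n)| • a) 1
    (volume.restrict (cube (n + 1)))) atTop (𝓝 0)

/-- `ε_h` is a sequence of positive numbers that tends to `0`. -/
def IsVanishing (ε : ℕ → ℝ) : Prop := (∀ h, 0 < ε h) ∧ Tendsto ε atTop (𝓝 0)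

/-- The asymptotic cell formula `Φ̃(γ)`: the infimum of `liminf_h F_{ε_h}(u_h, λ_h)` over all
vanishing sequences `ε_h` and all `(u_h, λ_h) ∈ 𝒜(γ)` with `u_h → |x_N| a` in `L¹(Q; ℝ^d)`. -/
def PhiTilde {n d : ℕ} (W : Matrix (Fin d) (Fin (n + 1)) ℝ → ℝ) (a : Space d) (γ : ℝ) : ℝ≥0∞ :=
  sInf {s | ∃ (ε : ℕ → ℝ) (u : ℕ → Space (n + 1) → Space d) (l : ℕ → ℝ),
    IsVanishing ε ∧ (∀ h, (u h, l h) ∈ Admissible n d γ) ∧ TendstoRoof a u ∧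
      s = liminf (fun h => energy W (ε h) (u h) (l h)) atTop}

/-- `∇u = a ⊗ e_N` near `x_N = 1/2` and `∇u = -a ⊗ e_N` near `x_N = -1/2`. -/
def GradMatches {n d : ℕ} (a : Space d) (u : Space (n + 1) → Space d) : Prop :=
  ∃ η : ℝ, 0 < η ∧ ∀ᵐ x ∂(volume.restrict (cube (n + 1))),
    (1 / 2 - η < x (Fin.last n) → weakGrad (cube (n + 1)) u x = tensorLast n a) ∧
    (x (Fin.last n) < -1 / 2 + η → weakGrad (cube (n + 1)) u x = -tensorLast n a)

/-- `u` is `Q'`-periodic in `x'` as a `W^{2,∞}` function: it has period one in each of the first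
`N - 1` coordinates and is of class `W^{2,∞}` on the whole slab `ℝ^{N-1} × (-1/2, 1/2)`, that is,
also across the translated faces of the cube. -/
def IsPeriodicW2 {n d : ℕ} (u : Space (n + 1) → Space d) : Prop :=
  (∀ x ∈ slab n, ∀ j : Fin n, u (x + EuclideanSpace.single j.castSucc 1) = u x) ∧
    MemW2 ∞ (slab n) u

end SurfaceTension

end

open SurfaceTension

/-!
Almost optimal competitors for `PhiTilde W a γ` are replaced by functions that are periodic in `x'`
and affine near the top and the bottom of the cube, at an arbitrarily small loss of energy and of
constraint.

*From a competitor to a cell.* A competitor `(u, l)` with small `ε` is mollified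
(`exists_smooth_approx`) and blown up to a cube of side `k + 2`, where `k` is a large power of two.
Energy and constraint per unit area do not change. A continuous reflection of the lateral variables
across the faces of a unit grid would make `u` periodic on each of the `k ^ n` tiles, and would
preserve the energy by the symmetry of `W`, but not the second gradient, so that the reflection is
smoothed in layers of thickness `ε` (`foldMap`). In a layer, the new second gradient is bounded by
the old one plus the lateral gradient over `ε`. The wells have no lateral part, so that
`exists_layer_constant` bounds the cost of the layers by a multiple of the energy they contain, up
to a small constant, and averaging over the position of the grid makes this energy a fraction of
order `ε` of the total (`exists_fold_shift`, `exists_folded_tiles`).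

On each tile there is now a function on a column of height of order `k`, whose gradient is close to
`a ⊗ e_N` in the upper part and to `-a ⊗ e_N` in the lower one (`exists_grad_close`). At a height
that carries only a share `1 / k` of energy and constraint, the function is frozen, which means that
it is continued with constant slope `a` (`exists_freeze`). The trace at that height is close to a
constant by Poincaré's inequality, which allows a transition to an affine function
(`exists_cap`), and the additive constant is removed over a large height (`exists_lift`). All these
modifications act on the vertical lines of the function only (`LateralFactor`), so that the lateral
symmetries survive, and the tile extends to a cell of period two: a smooth periodic function that
equals `|x_N| a` away from `x_N = 0` (`IsCell`).

*One cell instead of many.* There need not be a tile on which both energy and constraint are at most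
their averages over the tiles. Therefore cells are placed next to each other, each of them on half
of a large period; they agree away from `x_N = 0`, and the cost of the interfaces is of lower order
in the period. The set of pairs attained by cells (`Attain`) is thus closed under taking midpoints,
hence under averages over the `k ^ n` tiles (`Attain.midpoint`, `Attain.average_tiles`).

*From a cell to the sequence.* Scaling down a cell gives admissible functions on the cube with
arbitrarily small `ε` (`IsCell.exists_profile`) and with energy at most `PhiTilde W a γ` plus a
small number. As the constraint has been relaxed to `γ + δ`, the energy could fall below
`PhiTilde W a γ`. In that case `ε` is decreased further: the energy of a fixed function tends to
infinity as `ε` tends to zero, because its gradient leaves the wells somewhere, so that it takes the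
value `PhiTilde W a γ` for some smaller `ε` (`IsProfile.exists_energy_eq`).
-/

open MeasureTheory Filter Topology
open scoped ENNReal ContDiff

noncomputable section

namespace SurfaceTension

open scoped Real
open ENNReal (ofReal ofReal_mul ofReal_mono ofReal_add ofReal_ne_top ofReal_toReal ofReal_one
  ofReal_pow ofReal_pos)
open Set (Icc Ioo Ioi Ioc univ mem_univ)
open Real (pi_pos smoothTransition smoothTransition.nonneg smoothTransition.le_one sin cos
  rpow_nonneg rpow_le_rpow)
open Real.smoothTransition (zero_of_nonpos one_of_one_le)
open Finset (sum_congr sum_le_sum sum_nonneg sum_add_distrib)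
open Fin (last lastCases castSucc cons snoc)
open EuclideanSpace (single proj)

/-- The space `ℝ^N`, where `N = n + 1`. -/
notation "Pt" n:max => Space (n + 1)

/-- The space of `d × N` matrices, where `N = n + 1`. -/
notation "Mat" d:max n:max => Matrix (Fin d) (Fin (n + 1)) ℝ

/-- Smoothness of functions between real normed spaces. -/
notation "Smooth" => ContDiff ℝ ∞

/-! ### Euclidean norms of matrices and tensors -/

/-- The smooth transition from zero to one on the unit interval. -/
notation "step" => smoothTransition

section Norms

variable {d m : ℕ}

lemma matNorm_eq_norm (ξ : Matrix (Fin d) (Fin m) ℝ) :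
    matNorm ξ = ‖(WithLp.toLp 2 (fun q : Fin d × Fin m => ξ q.1 q.2) :
      EuclideanSpace ℝ (Fin d × Fin m))‖ := by
  simp [matNorm, EuclideanSpace.norm_eq, Fintype.sum_prod_type]

lemma tensorNorm_eq_norm (T : Fin d → Fin m → Fin m → ℝ) :
    tensorNorm T = ‖(WithLp.toLp 2 (fun q : Fin d × Fin m × Fin m => T q.1 q.2.1 q.2.2) :
      EuclideanSpace ℝ (Fin d × Fin m × Fin m))‖ := by
  simp [tensorNorm, EuclideanSpace.norm_eq, Fintype.sum_prod_type]

lemma matNorm_nonneg (ξ : Matrix (Fin d) (Fin m) ℝ) : 0 ≤ matNorm ξ := Real.sqrt_nonneg _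

lemma tensorNorm_nonneg (T : Fin d → Fin m → Fin m → ℝ) : 0 ≤ tensorNorm T := Real.sqrt_nonneg _

lemma matNorm_zero : matNorm (0 : Matrix (Fin d) (Fin m) ℝ) = 0 := by simp [matNorm]

lemma matNorm_add_le (ξ ζ : Matrix (Fin d) (Fin m) ℝ) :
    matNorm (ξ + ζ) ≤ matNorm ξ + matNorm ζ := by
  simp only [matNorm_eq_norm]
  exact norm_add_le (WithLp.toLp 2 (fun q : Fin d × Fin m => ξ q.1 q.2) :
    EuclideanSpace ℝ (Fin d × Fin m)) (WithLp.toLp 2 (fun q : Fin d × Fin m => ζ q.1 q.2))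

lemma abs_le_matNorm (ξ : Matrix (Fin d) (Fin m) ℝ) (i : Fin d) (j : Fin m) :
    |ξ i j| ≤ matNorm ξ := by
  rw [matNorm_eq_norm]
  exact PiLp.norm_apply_le (WithLp.toLp 2 (fun q : Fin d × Fin m => ξ q.1 q.2) :
    EuclideanSpace ℝ (Fin d × Fin m)) (i, j)

lemma abs_le_tensorNorm (T : Fin d → Fin m → Fin m → ℝ) (i : Fin d) (j k : Fin m) :
    |T i j k| ≤ tensorNorm T := by
  rw [tensorNorm_eq_norm]
  exact PiLp.norm_apply_le (WithLp.toLp 2 (fun q : Fin d × Fin m × Fin m => T q.1 q.2.1 q.2.2) :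
    EuclideanSpace ℝ (Fin d × Fin m × Fin m)) (i, j, k)

/-- A Euclidean norm is controlled by an entrywise bound `|x_i| ≤ α |y_i| + b`. -/
lemma euclidean_norm_le_of_abs_le {ι : Type*} [Fintype ι] (x y : ι → ℝ) {α b : ℝ}
    (hα : 0 ≤ α) (hb : 0 ≤ b) (h : ∀ i, |x i| ≤ α * |y i| + b) :
    ‖(WithLp.toLp 2 x : EuclideanSpace ℝ ι)‖ ≤
      α * ‖(WithLp.toLp 2 y : EuclideanSpace ℝ ι)‖ + √(Fintype.card ι) * b := by
  have h1 : ‖(WithLp.toLp 2 x : EuclideanSpace ℝ ι)‖ ≤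
      ‖(WithLp.toLp 2 (fun i => α * |y i| + b) : EuclideanSpace ℝ ι)‖ := by
    simp only [EuclideanSpace.norm_eq]
    refine Real.sqrt_le_sqrt (sum_le_sum fun i _ => ?_)
    refine pow_le_pow_left₀ (norm_nonneg _) ?_ 2
    simpa using (h i).trans (le_abs_self _)
  have h2 : (WithLp.toLp 2 (fun i => α * |y i| + b) : EuclideanSpace ℝ ι) =
      α • WithLp.toLp 2 (fun i => |y i|) + WithLp.toLp 2 (fun _ => b) := by
    ext i; simp
  have h3 : ‖(WithLp.toLp 2 (fun i => |y i|) : EuclideanSpace ℝ ι)‖ =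
      ‖(WithLp.toLp 2 y : EuclideanSpace ℝ ι)‖ := by
    simp [EuclideanSpace.norm_eq]
  have h4 : ‖(WithLp.toLp 2 (fun _ => b) : EuclideanSpace ℝ ι)‖ = √(Fintype.card ι) * b := by
    simp [EuclideanSpace.norm_eq, Real.sqrt_sq hb]
  rw [h2] at h1
  refine h1.trans ((norm_add_le _ _).trans ?_)
  rw [norm_smul, h3, h4, Real.norm_of_nonneg hα]

lemma matNorm_le_of_abs_le {ξ ζ : Matrix (Fin d) (Fin m) ℝ} {α b : ℝ} (hα : 0 ≤ α) (hb : 0 ≤ b)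
    (h : ∀ i j, |ξ i j| ≤ α * |ζ i j| + b) :
    matNorm ξ ≤ α * matNorm ζ + √(d * m : ℕ) * b := by
  simp only [matNorm_eq_norm]
  simpa using euclidean_norm_le_of_abs_le (fun q : Fin d × Fin m => ξ q.1 q.2)
    (fun q => ζ q.1 q.2) hα hb fun q => h q.1 q.2

lemma tensorNorm_le_of_abs_le {T S : Fin d → Fin m → Fin m → ℝ} {α b : ℝ} (hα : 0 ≤ α)
    (hb : 0 ≤ b) (h : ∀ i j k, |T i j k| ≤ α * |S i j k| + b) :
    tensorNorm T ≤ α * tensorNorm S + √(d * (m * m) : ℕ) * b := by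
  simp only [tensorNorm_eq_norm]
  simpa using euclidean_norm_le_of_abs_le (fun q : Fin d × Fin m × Fin m => T q.1 q.2.1 q.2.2)
    (fun q => S q.1 q.2.1 q.2.2) hα hb fun q => h q.1 q.2.1 q.2.2

lemma matNorm_le_matNorm {ξ ζ : Matrix (Fin d) (Fin m) ℝ} (h : ∀ i j, |ξ i j| ≤ |ζ i j|) :
    matNorm ξ ≤ matNorm ζ := by
  simpa using matNorm_le_of_abs_le (α := 1) (b := 0) zero_le_one le_rfl (by simpa using h)

lemma tensorNorm_le_tensorNorm {T S : Fin d → Fin m → Fin m → ℝ}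
    (h : ∀ i j k, |T i j k| ≤ |S i j k|) : tensorNorm T ≤ tensorNorm S := by
  simpa using tensorNorm_le_of_abs_le (α := 1) (b := 0) zero_le_one le_rfl (by simpa using h)

lemma continuous_matNorm : Continuous (matNorm : Matrix (Fin d) (Fin m) ℝ → ℝ) := by
  unfold matNorm; fun_prop

lemma continuous_tensorNorm : Continuous (tensorNorm : (Fin d → Fin m → Fin m → ℝ) → ℝ) := by
  unfold tensorNorm; fun_prop

lemma isCompact_matNorm_le (R : ℝ) : IsCompact {ξ : Matrix (Fin d) (Fin m) ℝ | matNorm ξ ≤ R} := by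
  have hK : IsCompact (Set.univ.pi fun _ : Fin d => Set.univ.pi fun _ : Fin m => Icc (-R) R) :=
    isCompact_univ_pi fun _ => isCompact_univ_pi fun _ => isCompact_Icc
  refine hK.of_isClosed_subset (isClosed_le continuous_matNorm continuous_const) ?_
  intro ξ hξ i _ j _
  exact abs_le.1 ((abs_le_matNorm ξ i j).trans hξ)

end Norms

/-! ### Two-sided bounds for the potential -/

/-- The matrix `a ⊗ e_N`. -/
notation "tens" a:max => tensorLast _ a

section Potential

variable {n d : ℕ}

/-- The part of a matrix that consists of its first `N - 1` columns. -/
def latPart (ξ : Mat d n) : Mat d n := Matrix.of fun i j => if j = last n then 0 else ξ i j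

lemma tensorLast_castSucc (a : Space d) (i : Fin d) (j : Fin n) :
    tensorLast n a i j.castSucc = 0 := by
  simp [tensorLast, Matrix.vecMulVec_apply, Fin.castSucc_ne_last]

lemma tensorLast_of_ne (a : Space d) (i : Fin d) {j : Fin (n + 1)} (hj : j ≠ last n) :
    tensorLast n a i j = 0 := by
  simp [tensorLast, Matrix.vecMulVec_apply, hj]

lemma tensorLast_last (a : Space d) (i : Fin d) : tensorLast n a i (last n) = a i := by
  simp [tensorLast, Matrix.vecMulVec_apply]

/-- Growth and coercivity of `W` with respect to its wells, valid for all matrices. -/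
structure WellBounds (W : Mat d n → ℝ) (a : Space d) (p C : ℝ) : Prop where
  one_le : 1 ≤ C
  upper : ∀ ξ, W ξ ≤ C * matNorm (ξ - tensorLast n a) ^ p
  upper_neg : ∀ ξ, W ξ ≤ C * matNorm (ξ + tensorLast n a) ^ p
  lower : ∀ ξ, min (matNorm (ξ - tensorLast n a)) (matNorm (ξ + tensorLast n a)) ^ p ≤ C * W ξ

lemma matNorm_neg {m : ℕ} (ξ : Matrix (Fin d) (Fin m) ℝ) : matNorm (-ξ) = matNorm ξ := by
  simp [matNorm]

/-- Away from the well `X`, the growth condition is absorbed by `matNorm (ξ - X) ^ p`. -/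
lemma exists_upper_bound_of_growth {W : Mat d n → ℝ} {p : ℝ} (hp : 2 ≤ p)
    (hW₂ : HasGrowth W p) (X : Mat d n) {r C₀ : ℝ} (hr : 0 < r)
    (hX : ∀ ξ, matNorm (ξ - X) ≤ r → W ξ ≤ C₀ * matNorm (ξ - X) ^ p) :
    ∃ C, ∀ ξ, W ξ ≤ C * matNorm (ξ - X) ^ p := by
  obtain ⟨C₁, hC₁, hg⟩ := hW₂
  have hM := matNorm_nonneg X
  refine ⟨max C₀ (C₁ * ((1 + matNorm X / r) ^ p + (1 / r) ^ p)), fun ξ => ?_⟩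
  have h0 := matNorm_nonneg (ξ - X)
  have hpow : 0 ≤ matNorm (ξ - X) ^ p := rpow_nonneg h0 p
  by_cases h : matNorm (ξ - X) ≤ r
  · exact (hX ξ h).trans (mul_le_mul_of_nonneg_right (le_max_left _ _) hpow)
  · push Not at h
    refine le_trans ?_ (mul_le_mul_of_nonneg_right (le_max_right _ _) hpow)
    have h1 : matNorm ξ ≤ (1 + matNorm X / r) * matNorm (ξ - X) := by
      have h2 : matNorm ξ ≤ matNorm (ξ - X) + matNorm X := by simpa using matNorm_add_le (ξ - X) X
      have h3 : matNorm X ≤ matNorm X / r * matNorm (ξ - X) := by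
        rw [div_mul_eq_mul_div, le_div_iff₀ hr]
        exact mul_le_mul_of_nonneg_left h.le hM
      linarith
    have h4 : matNorm ξ ^ p ≤ (1 + matNorm X / r) ^ p * matNorm (ξ - X) ^ p := by
      rw [← Real.mul_rpow (by positivity) h0]
      exact rpow_le_rpow (matNorm_nonneg _) h1 (by linarith)
    have h5 : 1 ≤ (1 / r) ^ p * matNorm (ξ - X) ^ p := by
      rw [← Real.mul_rpow (by positivity) h0]
      refine Real.one_le_rpow ?_ (by linarith)
      rw [one_div, ← div_eq_inv_mul, le_div_iff₀ hr]; linarith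
    calc W ξ ≤ C₁ * (matNorm ξ ^ p + 1) := (hg ξ).2
      _ ≤ C₁ * ((1 + matNorm X / r) ^ p * matNorm (ξ - X) ^ p
          + (1 / r) ^ p * matNorm (ξ - X) ^ p) := by gcongr
      _ = _ := by ring

/-- Away from the wells, the coercivity of `W` follows from its growth at infinity and from
compactness. -/
lemma exists_wellBounds {W : Mat d n → ℝ} {a : Space d} {p : ℝ}
    (hp : 2 ≤ p) (hW₁ : IsTwoWell W a) (hW₂ : HasGrowth W p) (hW₃ : HasWellGrowth W a p) :
    ∃ C, WellBounds W a p C := by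
  obtain ⟨r, c, C₀, hr, hc, hC₀, hwell⟩ := hW₃
  set A := tensorLast n a
  obtain ⟨Ca, hCa⟩ := exists_upper_bound_of_growth hp hW₂ A hr fun ξ h =>
    (hwell A (Or.inl rfl) ξ h).2
  obtain ⟨Cb, hCb⟩ := exists_upper_bound_of_growth hp hW₂ (-A) hr fun ξ h =>
    (hwell (-A) (Or.inr rfl) ξ h).2
  have hp0 : 0 ≤ p := by linarith
  have hlow : ∃ Cc, ∀ ξ, min (matNorm (ξ - A)) (matNorm (ξ + A)) ^ p ≤ Cc * W ξ := by
    obtain ⟨C₁, hC₁, hg⟩ := hW₂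
    set R : ℝ := max (matNorm A) ((2 * C₁ ^ 2) ^ (1 / p))
    have hR0 : 0 ≤ R := (matNorm_nonneg A).trans (le_max_left _ _)
    have hcont : Continuous fun ξ : Mat d n => min (matNorm (ξ - A)) (matNorm (ξ + A)) :=
      (continuous_matNorm.comp (continuous_id.sub continuous_const)).min
        (continuous_matNorm.comp (continuous_id.add continuous_const))
    have hcomp : IsCompact {ξ : Mat d n |
        matNorm ξ ≤ R ∧ r ≤ min (matNorm (ξ - A)) (matNorm (ξ + A))} :=
      (isCompact_matNorm_le R).inter_right (isClosed_le continuous_const hcont)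
    obtain ⟨m₀, hm₀, hm⟩ : ∃ m₀ > 0, ∀ ξ, matNorm ξ ≤ R →
        r ≤ min (matNorm (ξ - A)) (matNorm (ξ + A)) → m₀ ≤ W ξ := by
      rcases Set.eq_empty_or_nonempty {ξ : Mat d n |
        matNorm ξ ≤ R ∧ r ≤ min (matNorm (ξ - A)) (matNorm (ξ + A))} with he | hne
      · refine ⟨1, one_pos, fun ξ h1 h2 => ?_⟩
        have : ξ ∈ (∅ : Set (Mat d n)) := he ▸ ⟨h1, h2⟩
        exact this.elim
      · obtain ⟨ξ₀, hξ₀, hmin⟩ := hcomp.exists_isMinOn hne hW₁.cont.continuousOn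
        refine ⟨W ξ₀, lt_of_le_of_ne (hW₁.nonneg _) fun h => ?_, fun ξ h1 h2 => hmin ⟨h1, h2⟩⟩
        rcases (hW₁.zero_iff ξ₀).1 h.symm with h' | h'
        · have := hξ₀.2.trans (min_le_left _ _)
          rw [h'] at this; simp [A, matNorm_zero] at this; linarith
        · have := hξ₀.2.trans (min_le_right _ _)
          rw [h'] at this; simp [A, matNorm_zero] at this; linarith
    refine ⟨max (1 / c) (max ((R + matNorm A) ^ p / m₀) (2 ^ p * (2 * C₁))), fun ξ => ?_⟩
    set D := min (matNorm (ξ - A)) (matNorm (ξ + A)) with hD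
    have hD0 : 0 ≤ D := le_min (matNorm_nonneg _) (matNorm_nonneg _)
    have hW0 := hW₁.nonneg ξ
    have hDle : D ≤ matNorm ξ + matNorm A := (min_le_right _ _).trans (matNorm_add_le _ _)
    rcases le_or_gt D r with h | h
    · refine le_trans ?_ (mul_le_mul_of_nonneg_right (le_max_left _ _) hW0)
      rw [one_div, ← div_eq_inv_mul, le_div_iff₀ hc, mul_comm]
      rcases min_choice (matNorm (ξ - A)) (matNorm (ξ + A)) with h' | h'
      · rw [hD, h'] at h ⊢; exact (hwell A (Or.inl rfl) ξ h).1
      · rw [hD, h'] at h ⊢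
        have := (hwell (-A) (Or.inr rfl) ξ (by simpa using h)).1
        simpa using this
    · refine le_trans ?_ (mul_le_mul_of_nonneg_right (le_max_right _ _) hW0)
      rcases le_or_gt (matNorm ξ) R with h' | h'
      · refine le_trans ?_ (mul_le_mul_of_nonneg_right (le_max_left _ _) hW0)
        have h1 := hm ξ h' h.le
        have h2 : D ^ p ≤ (R + matNorm A) ^ p :=
          rpow_le_rpow hD0 (hDle.trans (by linarith)) hp0
        rw [div_mul_eq_mul_div, le_div_iff₀ hm₀]
        exact mul_le_mul h2 h1 hm₀.le (by have := matNorm_nonneg A; positivity)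
      · refine le_trans ?_ (mul_le_mul_of_nonneg_right (le_max_right _ _) hW0)
        have h1 : D ≤ 2 * matNorm ξ := by grind
        have h2 : 2 * C₁ ^ 2 ≤ matNorm ξ ^ p := by
          have h3 : (2 * C₁ ^ 2) ^ (1 / p) ≤ matNorm ξ := ((le_max_right _ _).trans_lt h').le
          calc 2 * C₁ ^ 2 = ((2 * C₁ ^ 2) ^ (1 / p)) ^ p := by
                rw [← Real.rpow_mul (by positivity), one_div_mul_cancel (by linarith), Real.rpow_one]
            _ ≤ _ := rpow_le_rpow (by positivity) h3 hp0
        have h4 : matNorm ξ ^ p ≤ 2 * C₁ * W ξ := by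
          have h5 := (hg ξ).1
          have hC0 : 0 < C₁ := by linarith
          have h6 : matNorm ξ ^ p - C₁ ^ 2 ≤ C₁ * W ξ := by
            have := mul_le_mul_of_nonneg_left h5 hC0.le
            field_simp at this ⊢; nlinarith
          linarith
        calc D ^ p ≤ (2 * matNorm ξ) ^ p := rpow_le_rpow hD0 h1 hp0
          _ = 2 ^ p * matNorm ξ ^ p := Real.mul_rpow (by norm_num) (matNorm_nonneg _)
          _ ≤ 2 ^ p * (2 * C₁ * W ξ) := by gcongr
          _ = _ := by ring
  obtain ⟨Cc, hCc⟩ := hlow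
  refine ⟨max 1 (max Ca (max Cb Cc)), le_max_left _ _, fun ξ => ?_, fun ξ => ?_, fun ξ => ?_⟩
  · exact (hCa ξ).trans (mul_le_mul_of_nonneg_right (by simp) (rpow_nonneg (matNorm_nonneg _) _))
  · have := hCb ξ
    rw [sub_neg_eq_add] at this
    exact this.trans (mul_le_mul_of_nonneg_right (by simp) (rpow_nonneg (matNorm_nonneg _) _))
  · exact (hCc ξ).trans (mul_le_mul_of_nonneg_right (by simp) (hW₁.nonneg _))

lemma WellBounds.pos {W : Mat d n → ℝ} {a : Space d} {p C : ℝ}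
    (h : WellBounds W a p C) : 0 < C := one_pos.trans_le h.one_le

/-- `W` controls the lateral columns, since these vanish at both wells. -/
lemma WellBounds.latPart_le {W : Mat d n → ℝ} {a : Space d} {p C : ℝ}
    (h : WellBounds W a p C) (hp : 2 ≤ p) (ξ : Mat d n) :
    matNorm (latPart ξ) ^ p ≤ C * W ξ := by
  refine le_trans (rpow_le_rpow (matNorm_nonneg _) ?_ (by linarith)) (h.lower ξ)
  refine le_min (matNorm_le_matNorm fun i j => ?_) (matNorm_le_matNorm fun i j => ?_) <;>
  by_cases hj : j = last n <;> simp [latPart, hj, tensorLast_of_ne]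

/-- Shrinking the lateral columns increases `W` by a bounded factor at most. -/
lemma WellBounds.le_of_lateral_contraction {W : Mat d n → ℝ} {a : Space d}
    {p C : ℝ} (h : WellBounds W a p C) (hp : 2 ≤ p) {ξ ζ : Mat d n}
    (hlast : ∀ i, ζ i (last n) = ξ i (last n)) (hlat : ∀ i j, |ζ i j| ≤ |ξ i j|) :
    W ζ ≤ C ^ 2 * W ξ := by
  have key : ∀ b : Space d, matNorm (ζ - tensorLast n b) ≤ matNorm (ξ - tensorLast n b) := by
    intro b
    refine matNorm_le_matNorm fun i j => ?_
    by_cases hj : j = last n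
    · subst hj; simp [hlast]
    · simpa [tensorLast_of_ne b i hj] using hlat i j
  have hneg : tensorLast n (-a) = -tensorLast n a := by
    ext i j; by_cases hj : j = last n
    · subst hj; simp [tensorLast_last]
    · simp [tensorLast_of_ne _ _ hj]
  have key2 := key (-a)
  rw [hneg, sub_neg_eq_add, sub_neg_eq_add] at key2
  have hp0 : 0 ≤ p := by linarith
  have hC := h.pos
  have hlow := h.lower ξ
  rcases min_choice (matNorm (ξ - tensorLast n a)) (matNorm (ξ + tensorLast n a)) with h' | h' <;>
    rw [h'] at hlow
  · calc W ζ ≤ C * matNorm (ζ - tensorLast n a) ^ p := h.upper ζ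
      _ ≤ C * matNorm (ξ - tensorLast n a) ^ p := by
        gcongr
        · exact matNorm_nonneg _
        · exact key a
      _ ≤ C * (C * W ξ) := by gcongr
      _ = _ := by ring
  · calc W ζ ≤ C * matNorm (ζ + tensorLast n a) ^ p := h.upper_neg ζ
      _ ≤ C * matNorm (ξ + tensorLast n a) ^ p := by
        gcongr
        exact matNorm_nonneg _
      _ ≤ C * (C * W ξ) := by gcongr
      _ = _ := by ring

end Potential

/-- Lower powers are controlled by higher powers up to a small constant. -/
lemma rpow_le_add_mul_rpow {q p τ y : ℝ} (hq : 0 < q) (hqp : q ≤ p) (hτ : 0 < τ) (hy : 0 ≤ y) :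
    y ^ q ≤ τ + τ ^ (1 - p / q) * y ^ p := by
  have hz : 0 ≤ y ^ q := rpow_nonneg hy q
  rcases le_or_gt (y ^ q) τ with h | h
  · have : 0 ≤ τ ^ (1 - p / q) * y ^ p := by positivity
    linarith
  · have h1 : y ^ p = (y ^ q) ^ (p / q) := by rw [← Real.rpow_mul hy, mul_div_cancel₀ _ hq.ne']
    have h2 : τ ^ (p / q - 1) ≤ (y ^ q) ^ (p / q - 1) :=
      rpow_le_rpow hτ.le h.le (by rw [sub_nonneg, le_div_iff₀ hq]; linarith)
    have hzp : 0 < y ^ q := hτ.trans h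
    have h3 : (y ^ q) ^ (p / q) = (y ^ q) * (y ^ q) ^ (p / q - 1) := by
      rw [Real.rpow_sub_one hzp.ne']; field_simp
    have h4 : τ ^ (1 - p / q) * τ ^ (p / q - 1) = 1 := by rw [← Real.rpow_add hτ]; simp
    rw [h1, h3]
    have h5 : y ^ q * 1 ≤ y ^ q * (τ ^ (1 - p / q) * (y ^ q) ^ (p / q - 1)) := by
      refine mul_le_mul_of_nonneg_left ?_ hz
      exact h4.symm.le.trans (mul_le_mul_of_nonneg_left h2 (by positivity))
    nlinarith

/-! ### Classical derivatives -/

section Classical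

variable {m d : ℕ}

/-- The classical partial derivative in direction `e_j`. -/
def pd (j : Fin m) (g : Space m → ℝ) (x : Space m) : ℝ := fderiv ℝ g x (single j 1)

/-- The classical gradient, with entries `∂_j u_i`. -/
def grad (u : Space m → Space d) (x : Space m) : Matrix (Fin d) (Fin m) ℝ :=
  Matrix.of fun i j => pd j (fun y => u y i) x

/-- The classical second gradient, with entries `∂_k ∂_j u_i`. -/
def hess (u : Space m → Space d) (x : Space m) : Fin d → Fin m → Fin m → ℝ :=
  fun i j k => pd k (pd j fun y => u y i) x

/-- The Euclidean norm of the classical second gradient. -/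
notation "hessNorm" u:max x:max => tensorNorm (hess u x)

lemma grad_apply (u : Space m → Space d) (x : Space m) (i : Fin d) (j : Fin m) :
    grad u x i j = pd j (fun y => u y i) x := rfl

lemma contDiff_pd {g : Space m → ℝ} (hg : Smooth g) (j : Fin m) : Smooth (pd j g) :=
  (hg.fderiv_right (m := ∞) (by simp)).clm_apply contDiff_const

lemma ContDiff.coord {u : Space m → Space d} (hu : Smooth u) (i : Fin d) :
    Smooth fun y => u y i := contDiff_euclidean.1 hu i

lemma smooth_diff {E : Type*} [NormedAddCommGroup E] [NormedSpace ℝ E] {g : E → ℝ} (hg : Smooth g) :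
    Differentiable ℝ g :=
  hg.differentiable (by simp)

lemma continuous_grad {u : Space m → Space d} (hu : Smooth u) : Continuous (grad u) :=
  continuous_pi fun i => continuous_pi fun j => (contDiff_pd (ContDiff.coord hu i) j).continuous

lemma continuous_hess {u : Space m → Space d} (hu : Smooth u) : Continuous (hess u) :=
  continuous_pi fun i => continuous_pi fun j => continuous_pi fun k =>
    (contDiff_pd (contDiff_pd (ContDiff.coord hu i) j) k).continuous

lemma pd_congr {f g : Space m → ℝ} {x : Space m} (h : f =ᶠ[𝓝 x] g) (j : Fin m) :
    pd j f x = pd j g x := by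
  unfold pd; rw [h.fderiv_eq]

lemma pd_eventuallyEq {f g : Space m → ℝ} {x : Space m} (h : f =ᶠ[𝓝 x] g) (j : Fin m) :
    pd j f =ᶠ[𝓝 x] pd j g := by
  filter_upwards [h.eventuallyEq_nhds] with y hy using pd_congr hy j

lemma grad_congr {u v : Space m → Space d} {x : Space m} (h : u =ᶠ[𝓝 x] v) :
    grad u x = grad v x := by
  ext i j
  exact pd_congr (h.fun_comp fun y => y i) j

lemma hess_congr {u v : Space m → Space d} {x : Space m} (h : u =ᶠ[𝓝 x] v) :
    hess u x = hess v x := by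
  ext i j k
  exact pd_congr (pd_eventuallyEq (h.fun_comp fun y => y i) j) k

lemma pd_const (c : ℝ) (j : Fin m) (x : Space m) : pd j (fun _ => c) x = 0 := by simp [pd]

lemma pd_add {f g : Space m → ℝ} (hf : Differentiable ℝ f) (hg : Differentiable ℝ g)
    (j : Fin m) (x : Space m) : pd j (fun y => f y + g y) x = pd j f x + pd j g x := by
  unfold pd; rw [fderiv_fun_add (hf x) (hg x)]; rfl

lemma pd_sub {f g : Space m → ℝ} (hf : Differentiable ℝ f) (hg : Differentiable ℝ g)
    (j : Fin m) (x : Space m) : pd j (fun y => f y - g y) x = pd j f x - pd j g x := by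
  unfold pd; rw [fderiv_fun_sub (hf x) (hg x)]; rfl

lemma pd_mul {f g : Space m → ℝ} (hf : Differentiable ℝ f) (hg : Differentiable ℝ g)
    (j : Fin m) (x : Space m) :
    pd j (fun y => f y * g y) x = f x * pd j g x + pd j f x * g x := by
  unfold pd; rw [fderiv_fun_mul (hf x) (hg x)]; simp [mul_comm]

lemma pd_const_mul {g : Space m → ℝ} (hg : Differentiable ℝ g) (c : ℝ)
    (j : Fin m) (x : Space m) : pd j (fun y => c * g y) x = c * pd j g x := by
  unfold pd; rw [fderiv_const_mul (hg x)]; rfl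

lemma hasFDerivAt_comp_coord {φ : ℝ → ℝ} (hφ : Differentiable ℝ φ) (i : Fin m) (x : Space m) :
    HasFDerivAt (fun y : Space m => φ (y i))
      (deriv φ (x i) • (proj i : Space m →L[ℝ] ℝ)) x :=
  (hφ (x i)).hasDerivAt.comp_hasFDerivAt x (proj i : Space m →L[ℝ] ℝ).hasFDerivAt

lemma pd_comp_coord {φ : ℝ → ℝ} (hφ : Differentiable ℝ φ) (i j : Fin m) (x : Space m) :
    pd j (fun y => φ (y i)) x = if j = i then deriv φ (x i) else 0 := by
  unfold pd
  rw [(hasFDerivAt_comp_coord hφ i x).fderiv]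
  by_cases h : j = i
  · subst h; simp
  · simp [h, Ne.symm h]

lemma smooth_comp_coord {φ : ℝ → ℝ} (hφ : Smooth φ) (i : Fin m) :
    Smooth fun y : Space m => φ (y i) :=
  hφ.comp (proj i : Space m →L[ℝ] ℝ).contDiff

/-- The map that applies the function `γ i` to the `i`-th coordinate. -/
def diagMap (γ : Fin m → ℝ → ℝ) (x : Space m) : Space m := WithLp.toLp 2 fun i => γ i (x i)

@[simp] theorem diagMap_apply (γ : Fin m → ℝ → ℝ) (x : Space m) (i : Fin m) :
    diagMap γ x i = γ i (x i) := rfl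

lemma contDiff_diagMap {γ : Fin m → ℝ → ℝ} (hγ : ∀ i, Smooth (γ i)) : Smooth (diagMap γ) :=
  contDiff_euclidean.2 fun i => smooth_comp_coord (hγ i) i

lemma smooth_deriv {φ : ℝ → ℝ} (hφ : Smooth φ) : Smooth (deriv φ) :=
  (contDiff_infty_iff_deriv.1 hφ).2

lemma pd_comp_diagMap {γ : Fin m → ℝ → ℝ} (hγ : ∀ i, Smooth (γ i)) {g : Space m → ℝ}
    (hg : Differentiable ℝ g) (j : Fin m) (x : Space m) :
    pd j (fun y => g (diagMap γ y)) x = deriv (γ j) (x j) * pd j g (diagMap γ x) := by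
  have hd : DifferentiableAt ℝ (diagMap γ) x := (contDiff_diagMap hγ).differentiable (by simp) x
  have h1 : fderiv ℝ (diagMap γ) x (single j 1) =
      deriv (γ j) (x j) • single j (1 : ℝ) := by
    ext i
    have h2 : fderiv ℝ (diagMap γ) x (single j 1) i =
        pd j (fun y => diagMap γ y i) x := by
      unfold pd
      rw [show (fun y => diagMap γ y i) = (proj i : Space m →L[ℝ] ℝ) ∘ diagMap γ
        from rfl, fderiv_comp x (proj i : Space m →L[ℝ] ℝ).differentiableAt hd,
        ContinuousLinearMap.fderiv]
      rfl
    rw [h2]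
    simp only [diagMap_apply]
    rw [pd_comp_coord (smooth_diff (hγ i))]
    by_cases h : j = i
    · subst h; simp
    · simp [h, Ne.symm h]
  unfold pd
  rw [show (fun y => g (diagMap γ y)) = g ∘ diagMap γ from rfl, fderiv_comp x (hg _) hd]
  simp [h1]

lemma pd_pd_comp_diagMap {γ : Fin m → ℝ → ℝ} (hγ : ∀ i, Smooth (γ i)) {g : Space m → ℝ}
    (hg : Smooth g) (j k : Fin m) (x : Space m) :
    pd k (pd j fun y => g (diagMap γ y)) x =
      deriv (γ j) (x j) * deriv (γ k) (x k) * pd k (pd j g) (diagMap γ x) +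
        (if k = j then deriv (deriv (γ j)) (x j) else 0) * pd j g (diagMap γ x) := by
  have h1 : pd j (fun y => g (diagMap γ y)) =
      fun y => deriv (γ j) (y j) * pd j g (diagMap γ y) := by
    ext y; exact pd_comp_diagMap hγ (smooth_diff hg) j y
  have hs := contDiff_pd hg j
  rw [h1, pd_mul (smooth_diff (smooth_comp_coord (smooth_deriv (hγ j)) j))
    (g := fun y => pd j g (diagMap γ y))
    (smooth_diff (hs.comp (contDiff_diagMap hγ))),
    pd_comp_diagMap hγ (smooth_diff hs),
    pd_comp_coord (smooth_diff (smooth_deriv (hγ j)))]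
  ring

/-- Derivatives of a product with a function of one coordinate. -/
lemma pd_pd_coord_mul {φ : ℝ → ℝ} (hφ : Smooth φ) {g : Space m → ℝ} (hg : Smooth g)
    (i j k : Fin m) (x : Space m) :
    pd k (pd j fun y => φ (y i) * g y) x =
      φ (x i) * pd k (pd j g) x + (if k = i then deriv φ (x i) else 0) * pd j g x +
        (if j = i then deriv φ (x i) else 0) * pd k g x +
          (if j = i then (if k = i then deriv (deriv φ) (x i) else 0) else 0) * g x := by
  have hφd := smooth_diff hφ
  have hgd := smooth_diff hg
  have h1 : pd j (fun y => φ (y i) * g y) =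
      fun y => φ (y i) * pd j g y + (if j = i then deriv φ (y i) else 0) * g y := by
    ext y
    rw [pd_mul (smooth_diff (smooth_comp_coord hφ i)) hgd, pd_comp_coord hφd]
  have hs := smooth_diff (contDiff_pd hg j)
  rw [h1]
  by_cases hj : j = i
  · simp only [hj, if_true]
    subst hj
    rw [pd_add (f := fun y => φ (y j) * pd j g y) (g := fun y => deriv φ (y j) * g y)
      ((smooth_diff (smooth_comp_coord hφ j)).mul hs)
      ((smooth_diff (smooth_comp_coord (smooth_deriv hφ) j)).mul hgd),
      pd_mul (smooth_diff (smooth_comp_coord hφ j)) hs,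
      pd_mul (smooth_diff (smooth_comp_coord (smooth_deriv hφ) j)) hgd,
      pd_comp_coord hφd, pd_comp_coord (smooth_diff (smooth_deriv hφ))]
    ring
  · simp only [hj, if_false, zero_mul, add_zero]
    rw [pd_mul (smooth_diff (smooth_comp_coord hφ i)) hs, pd_comp_coord hφd]

lemma pd_coord_mul {φ : ℝ → ℝ} (hφ : Smooth φ) {g : Space m → ℝ} (hg : Smooth g)
    (i j : Fin m) (x : Space m) :
    pd j (fun y => φ (y i) * g y) x =
      φ (x i) * pd j g x + (if j = i then deriv φ (x i) else 0) * g x := by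
  rw [pd_mul (smooth_diff (smooth_comp_coord hφ i)) (smooth_diff hg),
    pd_comp_coord (smooth_diff hφ)]

lemma pd_pd_add {f g : Space m → ℝ} (hf : Smooth f) (hg : Smooth g) (j k : Fin m) (x : Space m) :
    pd k (pd j fun y => f y + g y) x = pd k (pd j f) x + pd k (pd j g) x := by
  rw [show (pd j fun y => f y + g y) = fun y => pd j f y + pd j g y from funext fun y =>
    pd_add (smooth_diff hf) (smooth_diff hg) j y,
    pd_add (smooth_diff (contDiff_pd hf j)) (smooth_diff (contDiff_pd hg j))]

lemma pd_pd_sub {f g : Space m → ℝ} (hf : Smooth f) (hg : Smooth g) (j k : Fin m) (x : Space m) :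
    pd k (pd j fun y => f y - g y) x = pd k (pd j f) x - pd k (pd j g) x := by
  rw [show (pd j fun y => f y - g y) = fun y => pd j f y - pd j g y from funext fun y =>
    pd_sub (smooth_diff hf) (smooth_diff hg) j y,
    pd_sub (smooth_diff (contDiff_pd hf j)) (smooth_diff (contDiff_pd hg j))]

end Classical

/-! ### Energy and constraint densities -/

section Densities

variable {n d : ℕ}

/-- The energy density, as a function of the first and second gradient. -/
def eFun (W : Mat d n → ℝ) (ε l : ℝ) (ξ : Mat d n) (t : ℝ) : ℝ :=
  1 / ε * W ξ + ε * t ^ 2 + ε * min (l ^ 2) (t ^ 2)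

/-- The energy density of a smooth function. -/
def eDens (W : Mat d n → ℝ) (ε l : ℝ) (u : Pt n → Space d) (x : Pt n) : ℝ :=
  eFun W ε l (grad u x) (hessNorm u x)

/-- The density of the constraint, for a smooth function. -/
def cDens (l : ℝ) (u : Pt n → Space d) (x : Pt n) : ℝ := max (l + hessNorm u x) 0

/-- The energy of a smooth function on the set `S`. -/
notation "eInt" W:max ε:max l:max u:max S:max => ∫⁻ x in S, ofReal (eDens W ε l u x)

/-- The integral over `S` in the constraint, for a smooth function. -/
notation "cInt" l:max u:max S:max => ∫⁻ x in S, ofReal (cDens l u x)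

variable {W : Mat d n → ℝ} {ε l : ℝ} {u v : Pt n → Space d}

lemma eFun_nonneg (hW : ∀ ξ, 0 ≤ W ξ) (hε : 0 < ε) (ξ : Mat d n) (t : ℝ) :
    0 ≤ eFun W ε l ξ t := by
  have := hW ξ; unfold eFun; positivity

/-- The term with the minimum is dominated by the one before it. -/
lemma eFun_le (hε : 0 < ε) (ξ : Mat d n) (t : ℝ) :
    eFun W ε l ξ t ≤ 1 / ε * W ξ + 2 * (ε * t ^ 2) := by
  have : ε * min (l ^ 2) (t ^ 2) ≤ ε * t ^ 2 := by gcongr; exact min_le_right _ _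
  unfold eFun; linarith

lemma le_eFun (hε : 0 < ε) (ξ : Mat d n) (t : ℝ) : 1 / ε * W ξ + ε * t ^ 2 ≤ eFun W ε l ξ t := by
  have : 0 ≤ ε * min (l ^ 2) (t ^ 2) := by positivity
  unfold eFun; linarith

lemma eDens_nonneg (hW : ∀ ξ, 0 ≤ W ξ) (hε : 0 < ε) (x : Pt n) :
    0 ≤ eDens W ε l u x := eFun_nonneg hW hε _ _

lemma cDens_nonneg (x : Pt n) : 0 ≤ cDens l u x := le_max_right _ _

lemma cDens_le (hl : l ≤ 0) (x : Pt n) : cDens l u x ≤ hessNorm u x :=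
  max_le (by linarith) (tensorNorm_nonneg _)

lemma continuous_eDens (hW : Continuous W) (hu : Smooth u) : Continuous (eDens W ε l u) := by
  have h1 := continuous_grad hu
  have h2 := continuous_tensorNorm.comp (continuous_hess hu)
  unfold eDens eFun
  exact ((continuous_const.mul (hW.comp h1)).add (continuous_const.mul (h2.pow 2))).add
    (continuous_const.mul (continuous_const.min (h2.pow 2)))

lemma continuous_cDens (hu : Smooth u) : Continuous (cDens l u) :=
  (continuous_const.add (continuous_tensorNorm.comp (continuous_hess hu))).max continuous_const

lemma eDens_congr {x : Pt n} (h : u =ᶠ[𝓝 x] v) : eDens W ε l u x = eDens W ε l v x := by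
  unfold eDens; rw [grad_congr h, hess_congr h]

lemma cDens_congr {x : Pt n} (h : u =ᶠ[𝓝 x] v) : cDens l u x = cDens l v x := by
  unfold cDens; rw [hess_congr h]

lemma columns_sign_invariant (hW : IsColumnEven W) {σ : Fin (n + 1) → ℝ}
    (hσ : ∀ j, σ j = 1 ∨ σ j = -1) (ξ : Mat d n) :
    W (Matrix.of fun i j => σ j * ξ i j) = W ξ := by
  classical
  have key : ∀ s : Finset (Fin (n + 1)),
      W (Matrix.of fun i j => if j ∈ s then σ j * ξ i j else ξ i j) = W ξ := by
    intro s
    induction s using Finset.induction_on with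
    | empty => simp; rfl
    | insert j s hj ih =>
      rw [← ih]
      rcases hσ j with h | h
      · congr 1; ext i k
        by_cases hk : k = j
        · subst hk; simp [hj, h]
        · simp [hk]
      · rw [← hW j (Matrix.of fun i j => if j ∈ s then σ j * ξ i j else ξ i j)]
        congr 1; ext i k
        by_cases hk : k = j
        · subst hk; simp [hj, h]
        · simp [hk]
  simpa using key Finset.univ

lemma grad_comp_diagMap {γ : Fin (n + 1) → ℝ → ℝ} (hγ : ∀ i, Smooth (γ i))
    (hu : Smooth u) (x : Pt n) (i : Fin d) (j : Fin (n + 1)) :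
    grad (fun y => u (diagMap γ y)) x i j = deriv (γ j) (x j) * grad u (diagMap γ x) i j :=
  pd_comp_diagMap hγ (smooth_diff (ContDiff.coord hu i)) j x

lemma hess_comp_diagMap {γ : Fin (n + 1) → ℝ → ℝ} (hγ : ∀ i, Smooth (γ i))
    (hu : Smooth u) (x : Pt n) (i : Fin d) (j k : Fin (n + 1)) :
    hess (fun y => u (diagMap γ y)) x i j k =
      deriv (γ j) (x j) * deriv (γ k) (x k) * hess u (diagMap γ x) i j k +
        (if k = j then deriv (deriv (γ j)) (x j) else 0) * grad u (diagMap γ x) i j :=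
  pd_pd_comp_diagMap hγ (ContDiff.coord hu i) j k x

/-- The coordinatewise isometry `x ↦ (σ_i x_i + b_i)_i`. -/
def signMap (σ b : Fin (n + 1) → ℝ) : Pt n → Pt n := diagMap fun i s => σ i * s + b i

lemma contDiff_affine (σ b : ℝ) : Smooth fun s : ℝ => σ * s + b := by fun_prop

lemma deriv_affine (σ b : ℝ) : deriv (fun s : ℝ => σ * s + b) = fun _ => σ := by
  ext s; simp

lemma contDiff_signMap (σ b : Fin (n + 1) → ℝ) : Smooth (signMap σ b) :=
  contDiff_diagMap fun _ => contDiff_affine _ _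

lemma abs_sign {s : ℝ} (h : s = 1 ∨ s = -1) : |s| = 1 := by rcases h with h | h <;> simp [h]

lemma tensorNorm_hess_comp_signMap (hu : Smooth u) {σ : Fin (n + 1) → ℝ}
    (hσ : ∀ j, σ j = 1 ∨ σ j = -1) (b : Fin (n + 1) → ℝ) (x : Pt n) :
    tensorNorm (hess (fun y => u (signMap σ b y)) x) = tensorNorm (hess u (signMap σ b x)) := by
  unfold tensorNorm signMap
  congr 1
  refine sum_congr rfl fun i _ => sum_congr rfl fun j _ =>
    sum_congr rfl fun k _ => ?_
  rw [hess_comp_diagMap (fun _ => contDiff_affine _ _) hu]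
  simp only [deriv_affine, deriv_const, ite_self, zero_mul, add_zero, mul_pow]
  rw [← sq_abs (σ j), ← sq_abs (σ k), abs_sign (hσ j), abs_sign (hσ k)]
  simp

lemma eDens_comp_signMap (hW : IsColumnEven W) (hu : Smooth u) {σ : Fin (n + 1) → ℝ}
    (hσ : ∀ j, σ j = 1 ∨ σ j = -1) (b : Fin (n + 1) → ℝ) (x : Pt n) :
    eDens W ε l (fun y => u (signMap σ b y)) x = eDens W ε l u (signMap σ b x) := by
  unfold eDens eFun
  rw [tensorNorm_hess_comp_signMap hu hσ]
  congr 3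
  rw [← columns_sign_invariant hW hσ (grad u (signMap σ b x))]
  congr 1
  ext i j
  unfold signMap
  rw [grad_comp_diagMap (fun _ => contDiff_affine _ _) hu]
  simp

lemma cDens_comp_signMap (hu : Smooth u) {σ : Fin (n + 1) → ℝ}
    (hσ : ∀ j, σ j = 1 ∨ σ j = -1) (b : Fin (n + 1) → ℝ) (x : Pt n) :
    cDens l (fun y => u (signMap σ b y)) x = cDens l u (signMap σ b x) := by
  unfold cDens
  rw [tensorNorm_hess_comp_signMap hu hσ]

lemma measurePreserving_signMap {σ : Fin (n + 1) → ℝ}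
    (hσ : ∀ j, σ j = 1 ∨ σ j = -1) (b : Fin (n + 1) → ℝ) :
    MeasurePreserving (signMap σ b) := by
  have h1 : ∀ i, MeasurePreserving (fun s : ℝ => σ i * s + b i) := by
    intro i
    have h2 := measurePreserving_add_right (volume : Measure ℝ) (b i)
    rcases hσ i with h | h
    · simpa [h] using h2
    · simpa [h, Function.comp_def] using
        h2.comp (Measure.measurePreserving_neg (volume : Measure ℝ))
  have h3 := volume_preserving_pi h1
  have h4 := ((PiLp.volume_preserving_toLp (Fin (n + 1))).comp h3).comp
    (PiLp.volume_preserving_ofLp (Fin (n + 1)))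
  exact h4

lemma lintegral_comp_signMap {σ : Fin (n + 1) → ℝ}
    (hσ : ∀ j, σ j = 1 ∨ σ j = -1) (b : Fin (n + 1) → ℝ) (f : Pt n → ENNReal)
    (s : Set (Pt n)) :
    ∫⁻ x in signMap σ b ⁻¹' s, f (signMap σ b x) = ∫⁻ x in s, f x := by
  have hinv : Function.LeftInverse (signMap σ (fun i => -(σ i * b i))) (signMap σ b) := by
    intro x; ext i
    rcases hσ i with h | h <;> simp [signMap, h]
  have hinv' : Function.RightInverse (signMap σ (fun i => -(σ i * b i))) (signMap σ b) := by
    intro x; ext i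
    rcases hσ i with h | h <;> simp [signMap, h]
  have hemb : MeasurableEmbedding (signMap σ b) := by
    refine (MeasurableEquiv.mk ⟨signMap σ b, signMap σ (fun i => -(σ i * b i)), hinv, hinv'⟩
      ?_ ?_).measurableEmbedding
    · exact (contDiff_signMap _ _).continuous.measurable
    · exact (contDiff_signMap _ _).continuous.measurable
  exact (measurePreserving_signMap hσ b).setLIntegral_comp_preimage_emb hemb f s

/-- The rescaled function `x ↦ u(r x) / r`, which has the same gradients as `u`. -/
def rescale (r : ℝ) (u : Pt n → Space d) (x : Pt n) : Space d := r⁻¹ • u (r • x)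

lemma contDiff_rescale (r : ℝ) (hu : Smooth u) : Smooth (rescale r u) :=
  (hu.comp (contDiff_const_smul r)).const_smul _

lemma smul_eq_diagMap (r : ℝ) (x : Pt n) :
    r • x = diagMap (fun _ s => r * s + 0) x := by ext i; simp

lemma grad_rescale {r : ℝ} (hr : 0 < r) (hu : Smooth u) (x : Pt n) :
    grad (rescale r u) x = grad u (r • x) := by
  ext i j
  have h1 := grad_comp_diagMap (γ := fun _ s => r * s + 0) (fun _ => contDiff_affine _ _) hu x i j
  simp only [← smul_eq_diagMap, deriv_affine] at h1
  rw [grad_apply] at h1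
  rw [grad_apply]
  simp only [rescale, PiLp.smul_apply, smul_eq_mul]
  rw [pd_const_mul (g := fun y => u (r • y) i)
    (smooth_diff (ContDiff.coord (hu.comp (contDiff_const_smul r)) i)), h1, inv_mul_cancel_left₀ hr.ne']

lemma hess_rescale {r : ℝ} (hr : 0 < r) (hu : Smooth u) (x : Pt n) :
    hess (rescale r u) x = r • hess u (r • x) := by
  ext i j k
  have h0 : (pd j fun y => rescale r u y i) = fun y => pd j (fun z => u z i) (r • y) := by
    ext y
    exact congrFun (congrFun (grad_rescale hr hu y) i) j
  have h1 := pd_comp_diagMap (γ := fun _ s => r * s + 0) (fun _ => contDiff_affine _ _)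
    (smooth_diff (contDiff_pd (ContDiff.coord hu i) j)) k x
  simp only [← smul_eq_diagMap, deriv_affine] at h1
  simp only [hess, Pi.smul_apply, smul_eq_mul]
  rw [h0, h1]

lemma tensorNorm_smul {m : ℕ} {r : ℝ} (hr : 0 ≤ r) (T : Fin d → Fin m → Fin m → ℝ) :
    tensorNorm (r • T) = r * tensorNorm T := by
  simp only [tensorNorm_eq_norm]
  rw [← Real.norm_of_nonneg hr, ← norm_smul, Real.norm_of_nonneg hr]
  rfl

lemma eDens_rescale {r : ℝ} (hr : 0 < r) (hu : Smooth u) (x : Pt n) :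
    eDens W (ε / r) (r * l) (rescale r u) x = r * eDens W ε l u (r • x) := by
  unfold eDens eFun
  rw [grad_rescale hr hu, hess_rescale hr hu, tensorNorm_smul hr.le, mul_pow, mul_pow,
    ← mul_min_of_nonneg _ _ (sq_nonneg r)]
  field_simp

lemma cDens_rescale {r : ℝ} (hr : 0 < r) (hu : Smooth u) (x : Pt n) :
    cDens (r * l) (rescale r u) x = r * cDens l u (r • x) := by
  unfold cDens
  rw [hess_rescale hr hu, tensorNorm_smul hr.le, mul_max_of_nonneg _ _ hr.le]
  ring_nf

lemma lintegral_comp_smul_preimage {r : ℝ} (hr : 0 < r) (f : Pt n → ENNReal) (s : Set (Pt n)) :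
    ∫⁻ x in (fun x => r • x) ⁻¹' s, f (r • x) = ofReal ((r ^ (n + 1))⁻¹) * ∫⁻ x in s, f x := by
  have hemb : MeasurableEmbedding (fun x : Pt n => r • x) :=
    (Homeomorph.smulOfNeZero r hr.ne').measurableEmbedding
  have h := Measure.map_addHaar_smul (volume : Measure (Pt n)) hr.ne'
  rw [← hemb.lintegral_map, ← hemb.restrict_map, h]
  simp [Measure.restrict_smul, abs_of_pos hr]

end Densities

/-! ### Cylinders over lateral sets -/

section Cylinders

variable {n : ℕ}

/-- The space of the lateral coordinates, with the maximum norm. -/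
notation "Lat" n:max => Fin n → ℝ

/-- The point with lateral coordinates `y` and last coordinate `s`. -/
def mk (y : Lat n) (s : ℝ) : Pt n := WithLp.toLp 2 (snoc (α := fun _ => ℝ) y s)

/-- The lateral coordinates of a point. -/
def lat (x : Pt n) : Lat n := fun j => x j.castSucc

@[simp] theorem mk_castSucc (y : Lat n) (s : ℝ) (j : Fin n) : mk y s j.castSucc = y j := by
  simp [mk]

@[simp] theorem mk_last (y : Lat n) (s : ℝ) : mk y s (last n) = s := by simp [mk]

@[simp] theorem lat_mk (y : Lat n) (s : ℝ) : lat (mk y s) = y := by ext j; simp [lat]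

lemma mk_lat (x : Pt n) : mk (lat x) (x (last n)) = x := by
  ext i; refine lastCases ?_ (fun j => ?_) i <;> simp [lat]

lemma continuous_mk : Continuous fun q : (Lat n) × ℝ => mk q.1 q.2 := by
  refine (PiLp.continuous_toLp 2 _).comp (continuous_pi fun i => ?_)
  refine lastCases ?_ (fun j => ?_) i
  · simpa using continuous_snd
  · simpa [Function.comp_def] using (continuous_apply j).comp continuous_fst

lemma continuous_lat : Continuous (lat : Pt n → Lat n) := by
  unfold lat; fun_prop

lemma measurable_mk : Measurable fun q : (Lat n) × ℝ => mk q.1 q.2 := continuous_mk.measurable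

/-- The set of points with lateral coordinates in `S` and last coordinate in `I`. -/
def cyl (S : Set (Lat n)) (I : Set ℝ) : Set (Pt n) := {x | lat x ∈ S ∧ x (last n) ∈ I}

lemma measurable_last : Measurable fun x : Pt n => x (last n) := by fun_prop

lemma measurableSet_cyl {S : Set (Lat n)} {I : Set ℝ} (hS : MeasurableSet S)
    (hI : MeasurableSet I) : MeasurableSet (cyl S I) :=
  (continuous_lat.measurable hS).inter (measurable_last hI)

lemma measurePreserving_mk : MeasurePreserving (fun q : (Lat n) × ℝ => mk q.1 q.2) := by
  have h1 := (volume_preserving_piFinSuccAbove (fun _ : Fin (n + 1) => ℝ) (last n)).symm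
  have h2 := (PiLp.volume_preserving_toLp (Fin (n + 1))).comp
    (h1.comp (Measure.measurePreserving_swap (μ := (volume : Measure (Lat n)))
      (ν := (volume : Measure ℝ))))
  rw [Measure.volume_eq_prod]
  convert h2 using 1
  ext q i
  refine lastCases ?_ (fun j => ?_) i
  · simp [MeasurableEquiv.piFinSuccAbove, Fin.insertNthEquiv]
  · simp [MeasurableEquiv.piFinSuccAbove, Fin.insertNthEquiv]

lemma lintegral_eq_lintegral_mk {f : Pt n → ENNReal} (hf : Measurable f) :
    ∫⁻ x, f x = ∫⁻ y : Lat n, ∫⁻ s : ℝ, f (mk y s) := by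
  rw [← measurePreserving_mk.lintegral_comp hf, Measure.volume_eq_prod,
    lintegral_prod (fun q : (Lat n) × ℝ => f (mk q.1 q.2)) (hf.comp measurable_mk).aemeasurable]

lemma lintegral_cyl {f : Pt n → ENNReal} (hf : Measurable f) {S : Set (Lat n)}
    {I : Set ℝ} (hS : MeasurableSet S) (hI : MeasurableSet I) :
    ∫⁻ x in cyl S I, f x = ∫⁻ y in S, ∫⁻ s in I, f (mk y s) := by
  rw [← lintegral_indicator (measurableSet_cyl hS hI),
    lintegral_eq_lintegral_mk (hf.indicator (measurableSet_cyl hS hI)),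
    ← lintegral_indicator hS]
  congr 1; ext y
  by_cases hy : y ∈ S
  · rw [Set.indicator_of_mem hy, ← lintegral_indicator hI]
    congr 1; ext s
    by_cases hs : s ∈ I
    · rw [Set.indicator_of_mem hs, Set.indicator_of_mem]; simp [cyl, hy, hs]
    · rw [Set.indicator_of_notMem hs, Set.indicator_of_notMem]; simp [cyl, hs]
  · rw [Set.indicator_of_notMem hy]
    refine (lintegral_congr fun s => ?_).trans lintegral_zero
    rw [Set.indicator_of_notMem]; simp [cyl, hy]

lemma lintegral_cyl_swap {f : Pt n → ENNReal} (hf : Measurable f)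
    {S : Set (Lat n)} {I : Set ℝ} (hS : MeasurableSet S) (hI : MeasurableSet I) :
    ∫⁻ x in cyl S I, f x = ∫⁻ s in I, ∫⁻ y in S, f (mk y s) := by
  rw [lintegral_cyl hf hS hI,
    lintegral_lintegral_swap (f := fun y s => f (mk y s)) (hf.comp measurable_mk).aemeasurable]

lemma volume_cyl {S : Set (Lat n)} {I : Set ℝ} (hS : MeasurableSet S)
    (hI : MeasurableSet I) : volume (cyl S I) = volume S * volume I := by
  have := lintegral_cyl (f := fun _ => 1) measurable_const hS hI
  simpa [mul_comm] using this

lemma cyl_mono {S S' : Set (Lat n)} {I I' : Set ℝ} (hS : S ⊆ S') (hI : I ⊆ I') :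
    cyl S I ⊆ cyl S' I' := fun _ hx => ⟨hS hx.1, hI hx.2⟩

/-- The closed lateral cube with all coordinates in `[c, c + r]`. -/
def latCube (n : ℕ) (c r : ℝ) : Set (Lat n) := Icc (fun _ => c) (fun _ => c + r)

/-- The closed lateral unit cube. -/
notation "unitCube" => latCube _ 0 1

lemma measurableSet_latCube (c r : ℝ) : MeasurableSet (latCube n c r) := measurableSet_Icc

lemma volume_latCube_one (c : ℝ) : volume (latCube n c 1) = 1 := by
  rw [latCube, Real.volume_Icc_pi]; simp

lemma mem_latCube {c r : ℝ} {y : Fin n → ℝ} : y ∈ latCube n c r ↔ ∀ j, y j ∈ Icc c (c + r) := by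
  simp only [latCube, Set.mem_Icc, Pi.le_def]
  exact ⟨fun h j => ⟨h.1 j, h.2 j⟩, fun h => ⟨fun j => (h j).1, fun j => (h j).2⟩⟩

lemma lintegral_add_const_le {S T : Set (Lat n)} {J : (Lat n) → ENNReal} (c : Lat n)
    (h : ∀ y ∈ S, y + c ∈ T) : ∫⁻ y in S, J (y + c) ≤ ∫⁻ y in T, J y := by
  have h1 := (measurePreserving_add_right (volume : Measure (Lat n)) c).setLIntegral_comp_preimage_emb
    (measurableEmbedding_addRight c) J T
  rw [← h1]
  exact lintegral_mono_set h

end Cylinders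

/-! ### Cut-off functions and the folding map -/

section Folding

/-- A continuous function that is constant outside a bounded interval is bounded. -/
lemma exists_bound_of_eventually_const {f : ℝ → ℝ} (hf : Continuous f) {a b : ℝ}
    (ha : ∀ x ≤ a, f x = f a) (hb : ∀ x, b ≤ x → f x = f b) : ∃ C, ∀ x, |f x| ≤ C := by
  obtain ⟨C, hC⟩ := (isCompact_Icc (a := a) (b := b)).exists_bound_of_continuousOn hf.continuousOn
  refine ⟨max C (max |f a| |f b|), fun x => ?_⟩
  rcases le_total x a with h | h
  · rw [ha x h]; simp
  · rcases le_total b x with h' | h'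
    · rw [hb x h']; simp
    · exact (hC x ⟨h, h'⟩).trans (le_max_left _ _)

lemma deriv_eq_zero_of_isMax {f : ℝ → ℝ} {x : ℝ} (h : ∀ y, f y ≤ f x) : deriv f x = 0 :=
  IsLocalMax.deriv_eq_zero (Filter.Eventually.of_forall h)

lemma deriv_eq_zero_of_isMin {f : ℝ → ℝ} {x : ℝ} (h : ∀ y, f x ≤ f y) : deriv f x = 0 :=
  IsLocalMin.deriv_eq_zero (Filter.Eventually.of_forall h)

lemma smooth_step : Smooth step := Real.smoothTransition.contDiff

lemma deriv_step_of_nonpos {x : ℝ} (hx : x ≤ 0) : deriv step x = 0 :=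
  deriv_eq_zero_of_isMin fun y => by
    rw [zero_of_nonpos hx]; exact smoothTransition.nonneg y

lemma deriv_step_of_one_le {x : ℝ} (hx : 1 ≤ x) : deriv step x = 0 :=
  deriv_eq_zero_of_isMax fun y => by
    rw [one_of_one_le hx]; exact smoothTransition.le_one y

lemma deriv2_step_of_le {x : ℝ} (hx : x ≤ 0) :
    deriv (deriv step) x = 0 := by
  refine deriv_eq_zero_of_isMin fun y => ?_
  rw [deriv_step_of_nonpos hx]
  exact Real.smoothTransition.monotone.deriv_nonneg

lemma deriv2_step_of_one_le {x : ℝ} (hx : 1 ≤ x) :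
    deriv (deriv step) x = 0 := by
  refine deriv_eq_zero_of_isMin fun y => ?_
  rw [deriv_step_of_one_le hx]
  exact Real.smoothTransition.monotone.deriv_nonneg

lemma exists_bound_step : ∃ C, 1 ≤ C ∧ ∀ x, |deriv step x| ≤ C ∧
    |deriv (deriv step) x| ≤ C := by
  have hs := smooth_deriv smooth_step
  obtain ⟨C₁, h₁⟩ := exists_bound_of_eventually_const hs.continuous (a := 0) (b := 1)
    (fun x hx => by rw [deriv_step_of_nonpos hx, deriv_step_of_nonpos le_rfl])
    (fun x hx => by rw [deriv_step_of_one_le hx, deriv_step_of_one_le le_rfl])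
  obtain ⟨C₂, h₂⟩ := exists_bound_of_eventually_const (smooth_deriv hs).continuous (a := 0) (b := 1)
    (fun x hx => by rw [deriv2_step_of_le hx, deriv2_step_of_le le_rfl])
    (fun x hx => by
      rw [deriv2_step_of_one_le hx, deriv2_step_of_one_le le_rfl])
  exact ⟨max 1 (max C₁ C₂), le_max_left _ _, fun x => ⟨(h₁ x).trans (by simp), (h₂ x).trans (by simp)⟩⟩

/-- A smooth odd function with values in `[-1, 1]` that is `1` on `[1, ∞)`. -/
def smoothSign (y : ℝ) : ℝ := step y - step (-y)

lemma contDiff_smoothSign : Smooth smoothSign :=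
  smooth_step.sub (smooth_step.comp contDiff_neg)

lemma smoothSign_neg (y : ℝ) : smoothSign (-y) = -smoothSign y := by simp [smoothSign]

lemma abs_smoothSign_le (y : ℝ) : |smoothSign y| ≤ 1 := by
  have h1 := smoothTransition.nonneg y
  have h2 := smoothTransition.nonneg (-y)
  have h3 := smoothTransition.le_one y
  have h4 := smoothTransition.le_one (-y)
  rw [abs_le, smoothSign]; constructor <;> linarith

lemma smoothSign_of_one_le {y : ℝ} (hy : 1 ≤ y) : smoothSign y = 1 := by
  rw [smoothSign, one_of_one_le hy,
    zero_of_nonpos (by linarith), sub_zero]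

lemma smoothSign_nonneg {y : ℝ} (hy : 0 ≤ y) : 0 ≤ smoothSign y := by
  rw [smoothSign, zero_of_nonpos (x := -y) (by linarith), sub_zero]
  exact smoothTransition.nonneg y

lemma deriv_smoothSign (y : ℝ) :
    deriv smoothSign y = deriv step y + deriv step (-y) := by
  have hd := smooth_diff smooth_step
  have h2 : HasDerivAt (fun y => step (-y)) (-deriv step (-y)) y := by
    simpa [Function.comp_def] using (hd (-y)).hasDerivAt.comp y (hasDerivAt_neg y)
  have := ((hd y).hasDerivAt.sub h2).deriv
  rw [sub_neg_eq_add] at this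
  exact this

/-- The derivative of the smoothed triangular wave `foldFun ε`. -/
def foldSlope (ε s : ℝ) : ℝ := smoothSign (sin (π * s) / ε)

/-- A smoothed triangular wave of period two: it is even, and on `[ε, 1 - ε]` it differs from the
identity by a constant. -/
def foldFun (ε s : ℝ) : ℝ := ∫ t in (0 : ℝ)..s, foldSlope ε t

variable {ε : ℝ}

lemma contDiff_foldSlope (ε : ℝ) : Smooth (foldSlope ε) := contDiff_smoothSign.comp
    ((Real.contDiff_sin.comp (contDiff_const.mul contDiff_id)).div_const ε)

lemma hasDerivAt_foldFun (ε s : ℝ) : HasDerivAt (foldFun ε) (foldSlope ε s) s :=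
  intervalIntegral.integral_hasDerivAt_right
    ((contDiff_foldSlope ε).continuous.intervalIntegrable _ _)
    ((contDiff_foldSlope ε).continuous.stronglyMeasurableAtFilter _ _)
    (contDiff_foldSlope ε).continuous.continuousAt

lemma deriv_foldFun (ε : ℝ) : deriv (foldFun ε) = foldSlope ε :=
  funext fun s => (hasDerivAt_foldFun ε s).deriv

lemma contDiff_foldFun (ε : ℝ) : Smooth (foldFun ε) := by
  rw [contDiff_infty_iff_deriv, deriv_foldFun]
  exact ⟨fun s => (hasDerivAt_foldFun ε s).differentiableAt, contDiff_foldSlope ε⟩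

lemma foldSlope_neg (ε s : ℝ) : foldSlope ε (-s) = -foldSlope ε s := by
  rw [foldSlope, foldSlope, ← smoothSign_neg]; congr 1; simp; ring

lemma foldSlope_add_two (ε s : ℝ) : foldSlope ε (s + 2) = foldSlope ε s := by
  rw [foldSlope, foldSlope, show π * (s + 2) = π * s + 2 * π by ring, Real.sin_add_two_pi]

lemma foldFun_neg (ε s : ℝ) : foldFun ε (-s) = foldFun ε s := by
  have h : ∀ x, deriv (fun s => foldFun ε (-s) - foldFun ε s) x = 0 := by
    intro x
    have h1 : HasDerivAt (fun s => foldFun ε (-s)) (-foldSlope ε (-x)) x := by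
      simpa [Function.comp_def] using (hasDerivAt_foldFun ε (-x)).comp x (hasDerivAt_neg x)
    have := (h1.fun_sub (hasDerivAt_foldFun ε x)).deriv
    rw [foldSlope_neg] at this
    simpa using this
  have hd : Differentiable ℝ fun s => foldFun ε (-s) - foldFun ε s :=
    (smooth_diff ((contDiff_foldFun ε).comp contDiff_neg)).sub
      (smooth_diff (contDiff_foldFun ε))
  have := is_const_of_deriv_eq_zero hd h s 0
  simp only [neg_zero, sub_self] at this
  linarith

lemma foldFun_add_two (ε s : ℝ) : foldFun ε (s + 2) = foldFun ε s := by
  have h : ∀ x, deriv (fun s => foldFun ε (s + 2) - foldFun ε s) x = 0 := by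
    intro x
    have h1 : HasDerivAt (fun s => foldFun ε (s + 2)) (foldSlope ε (x + 2)) x :=
      (hasDerivAt_foldFun ε (x + 2)).comp_add_const x 2
    have := (h1.fun_sub (hasDerivAt_foldFun ε x)).deriv
    rw [foldSlope_add_two] at this
    simpa using this
  have hd : Differentiable ℝ fun s => foldFun ε (s + 2) - foldFun ε s :=
    (smooth_diff ((contDiff_foldFun ε).comp (contDiff_id.add contDiff_const))).sub
      (smooth_diff (contDiff_foldFun ε))
  have := is_const_of_deriv_eq_zero hd h s (-1)
  simp only [foldFun_neg, show (-1 : ℝ) + 2 = 1 by norm_num, sub_self] at this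
  linarith

lemma abs_foldSlope_le (ε s : ℝ) : |foldSlope ε s| ≤ 1 := abs_smoothSign_le _

lemma foldSlope_eq_one (hε : 0 < ε) {s : ℝ} (hs : s ∈ Icc ε (1 - ε)) : foldSlope ε s = 1 := by
  have key : ∀ t, ε ≤ t → t ≤ 1 / 2 → ε ≤ sin (π * t) := by
    intro t h1 h2
    have := Real.mul_le_sin (x := π * t) (by have := pi_pos; nlinarith)
      (by have := pi_pos; nlinarith)
    have h3 : 2 / π * (π * t) = 2 * t := by field_simp
    linarith
  refine smoothSign_of_one_le ((le_div_iff₀ hε).2 ?_)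
  rw [one_mul]
  rcases le_total s (1 / 2) with h | h
  · exact key s hs.1 h
  · have := key (1 - s) (by linarith [hs.2]) (by linarith)
    rwa [show π * (1 - s) = π - π * s by ring, Real.sin_pi_sub] at this

lemma deriv_foldSlope_of_eq_one {s : ℝ} (h : foldSlope ε s = 1) : deriv (foldSlope ε) s = 0 :=
  deriv_eq_zero_of_isMax fun y => by rw [h]; exact (abs_le.1 (abs_foldSlope_le ε y)).2

lemma exists_bound_deriv_foldSlope :
    ∃ C, 0 ≤ C ∧ ∀ ε s : ℝ, 0 < ε → |deriv (foldSlope ε) s| ≤ C / ε := by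
  obtain ⟨C, hC1, hC⟩ := exists_bound_step
  refine ⟨2 * C * π, by have := pi_pos; positivity, fun ε s hε => ?_⟩
  have h1 : HasDerivAt (fun s => sin (π * s) / ε) (cos (π * s) * π / ε) s := by
    have := ((Real.hasDerivAt_sin (π * s)).comp s ((hasDerivAt_id s).const_mul π)).div_const ε
    simpa using this
  have h2 := ((smooth_diff contDiff_smoothSign (sin (π * s) / ε)).hasDerivAt.comp
    s h1).deriv
  rw [show foldSlope ε = smoothSign ∘ fun s => sin (π * s) / ε from rfl, h2, abs_mul,
    deriv_smoothSign]
  have h3 : |deriv step (sin (π * s) / ε) +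
      deriv step (-(sin (π * s) / ε))| ≤ 2 * C :=
    (abs_add_le _ _).trans (by linarith [(hC (sin (π * s) / ε)).1, (hC (-(sin (π * s) / ε))).1])
  have h4 : |cos (π * s) * π / ε| ≤ π / ε := by
    rw [abs_div, abs_mul, abs_of_pos hε, abs_of_pos pi_pos]
    gcongr
    exact mul_le_of_le_one_left Real.pi_pos.le (Real.abs_cos_le_one _)
  calc _ ≤ 2 * C * (π / ε) := mul_le_mul h3 h4 (abs_nonneg _) (by linarith)
    _ = _ := by ring

lemma foldFun_mem_Icc (hε : 0 < ε) {s : ℝ} (hs : s ∈ Icc (0 : ℝ) 1) :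
    foldFun ε s ∈ Icc (0 : ℝ) 1 := by
  have hi := (contDiff_foldSlope ε).continuous.intervalIntegrable (μ := volume) 0 s
  constructor
  · refine intervalIntegral.integral_nonneg hs.1 fun t ht => smoothSign_nonneg (div_nonneg ?_ hε.le)
    refine Real.sin_nonneg_of_nonneg_of_le_pi (mul_nonneg Real.pi_pos.le ht.1) ?_
    have := pi_pos
    nlinarith [ht.2, hs.2]
  · have := intervalIntegral.integral_mono_on hs.1 hi (intervalIntegrable_const (c := (1 : ℝ)))
      fun t _ => (abs_le.1 (abs_foldSlope_le ε t)).2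
    simp at this
    exact this.trans hs.2

lemma foldFun_eq_sub (hε : 0 < ε) {s : ℝ} (hs : s ∈ Icc ε (1 - ε)) :
    foldFun ε s = s - (ε - foldFun ε ε) := by
  have hi : ∀ a b, IntervalIntegrable (foldSlope ε) volume a b := fun a b =>
    (contDiff_foldSlope ε).continuous.intervalIntegrable a b
  have h1 := intervalIntegral.integral_add_adjacent_intervals (hi 0 ε) (hi ε s)
  have h2 : ∫ t in ε..s, foldSlope ε t = ∫ _ in ε..s, (1 : ℝ) := by
    refine intervalIntegral.integral_congr fun t ht => ?_
    rw [Set.uIcc_of_le hs.1] at ht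
    exact foldSlope_eq_one hε ⟨ht.1, ht.2.trans hs.2⟩
  rw [h2] at h1
  simp only [intervalIntegral.integral_const, smul_eq_mul, mul_one] at h1
  unfold foldFun at *
  linarith

end Folding

/-! ### Estimates in transition layers -/

/-- In a layer where the second gradient `Hv` of the modified function exceeds that of the original
one by `q / ε`, where `q` is a distance of gradients, the modified energy and constraint densities
are controlled by the original energy density `e`, by `Q / ε` with `q ^ p ≤ Q`, and by a small
multiple of `1 / ε`. A layer has thickness of order `ε`, so that the last term is harmless. -/
lemma exists_layer_constant {p : ℝ} (hp : 2 ≤ p) {M τ : ℝ} (hM : 0 ≤ M) (hτ : 0 < τ) :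
    ∃ D, 0 ≤ D ∧ ∀ ε e H q Q w Hv : ℝ, 0 < ε → 0 ≤ q → 0 ≤ H → 0 ≤ Hv →
      ε * H ^ 2 ≤ e → q ^ p ≤ Q → w ≤ M * (ε * e + Q) → Hv ≤ M * (H + q / ε) →
      1 / ε * w + 2 * (ε * Hv ^ 2) + Hv ≤ τ / ε + D * (e + Q / ε) := by
  set σ : ℝ := τ / (4 * M ^ 2 + 2 * M + 1)
  have hden : 0 < 4 * M ^ 2 + 2 * M + 1 := by positivity
  have hσ0 : 0 < σ := div_pos hτ hden
  have hσeq : σ * (4 * M ^ 2 + 2 * M + 1) = τ := div_mul_cancel₀ _ hden.ne'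
  -- Young's inequality for `q ^ 2` and for `q`, against `q ^ p`, with a small additive constant `σ`
  set c₁ := σ ^ (1 - p / 2) with hc₁
  set c₂ := σ ^ (1 - p / 1)
  have hc₁0 : 0 ≤ c₁ := by positivity
  have hc₂0 : 0 ≤ c₂ := by positivity
  refine ⟨M + 4 * M ^ 2 + 4 * M ^ 2 * c₁ + M * c₂ + M / σ, by positivity, ?_⟩
  intro ε e H q Q w Hv hε hq hH hHv he hQ hw hHvle
  have he0 : 0 ≤ e := le_trans (by positivity) he
  have hQ0 : 0 ≤ Q := (rpow_nonneg hq p).trans hQ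
  have h1 : q ^ 2 ≤ σ + c₁ * Q := by
    have := rpow_le_add_mul_rpow (q := 2) (p := p) (by norm_num) hp hσ0 hq
    rw [Real.rpow_two] at this
    exact this.trans (by gcongr)
  have h2 : q ≤ σ + c₂ * Q := by
    have := rpow_le_add_mul_rpow (q := 1) (p := p) (by norm_num) (by linarith) hσ0 hq
    rw [Real.rpow_one] at this
    exact this.trans (by gcongr)
  have h3 : H ≤ σ / ε + e / σ := by
    have h4 : ε * H ≤ σ + (ε * H) ^ 2 / σ := by
      rw [← sub_nonneg]
      have : σ + (ε * H) ^ 2 / σ - ε * H = ((σ - ε * H / 2) ^ 2 + 3 / 4 * (ε * H) ^ 2) / σ := by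
        field_simp; ring
      rw [this]; positivity
    have h5 : (ε * H) ^ 2 / σ ≤ ε * (e / σ) := by
      rw [mul_div_assoc']
      gcongr
      nlinarith
    have h6 : σ / ε + e / σ = (σ + ε * (e / σ)) / ε := by field_simp
    rw [h6, le_div_iff₀ hε, mul_comm]
    linarith
  have h7 : Hv ^ 2 ≤ 2 * M ^ 2 * (H ^ 2 + q ^ 2 / ε ^ 2) := by
    have h8 : Hv ^ 2 ≤ (M * (H + q / ε)) ^ 2 := pow_le_pow_left₀ hHv hHvle 2
    have h9 : (H + q / ε) ^ 2 ≤ 2 * (H ^ 2 + (q / ε) ^ 2) := by nlinarith [sq_nonneg (H - q / ε)]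
    rw [mul_pow] at h8
    rw [div_pow] at h9
    have := mul_le_mul_of_nonneg_left h9 (sq_nonneg M)
    linarith
  have hw' : 1 / ε * w ≤ M * (e + Q / ε) := by
    have := mul_le_mul_of_nonneg_left hw (one_div_pos.2 hε).le
    refine this.trans_eq ?_
    field_simp
  have hH' : 2 * (ε * Hv ^ 2) ≤ 4 * M ^ 2 * (e + (σ + c₁ * Q) / ε) := by
    have : ε * Hv ^ 2 ≤ 2 * M ^ 2 * (ε * H ^ 2 + q ^ 2 / ε) := by
      have := mul_le_mul_of_nonneg_left h7 hε.le
      refine this.trans_eq ?_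
      field_simp
    have h10 : q ^ 2 / ε ≤ (σ + c₁ * Q) / ε := by gcongr
    have h11 : 2 * M ^ 2 * (ε * H ^ 2 + q ^ 2 / ε) ≤ 2 * M ^ 2 * (e + (σ + c₁ * Q) / ε) := by gcongr
    linarith
  have hHv' : Hv ≤ M * (σ / ε + e / σ + (σ + c₂ * Q) / ε) := by
    refine hHvle.trans ?_
    gcongr
  have hexp : M * (e + Q / ε) + 4 * M ^ 2 * (e + (σ + c₁ * Q) / ε) +
      M * (σ / ε + e / σ + (σ + c₂ * Q) / ε) =
      σ * (4 * M ^ 2 + 2 * M) / ε + ((M + 4 * M ^ 2 + M / σ) * e +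
        (M + 4 * M ^ 2 * c₁ + M * c₂) * (Q / ε)) := by
    field_simp; ring
  have hQε : 0 ≤ Q / ε := div_nonneg hQ0 hε.le
  have hfin : σ * (4 * M ^ 2 + 2 * M) / ε ≤ τ / ε := by gcongr; rw [← hσeq]; nlinarith
  have h12 : (M + 4 * M ^ 2 + M / σ) * e ≤
      (M + 4 * M ^ 2 + 4 * M ^ 2 * c₁ + M * c₂ + M / σ) * e := by
    refine mul_le_mul_of_nonneg_right ?_ he0
    have : 0 ≤ 4 * M ^ 2 * c₁ + M * c₂ := by positivity
    linarith
  have h13 : (M + 4 * M ^ 2 * c₁ + M * c₂) * (Q / ε) ≤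
      (M + 4 * M ^ 2 + 4 * M ^ 2 * c₁ + M * c₂ + M / σ) * (Q / ε) := by
    refine mul_le_mul_of_nonneg_right ?_ hQε
    have : 0 ≤ 4 * M ^ 2 + M / σ := by positivity
    linarith
  rw [mul_add]
  linarith

section FoldMap

variable {n d : ℕ} {W : Mat d n → ℝ} {a : Space d} {p C ε l : ℝ} {u : Pt n → Space d}

/-- The map that folds all lateral coordinates by the triangular wave, shifted by `b`. -/
def foldMap (ε : ℝ) (b : Lat n) : Pt n → Pt n :=
  diagMap (snoc (α := fun _ => ℝ → ℝ) (fun i s => b i + foldFun ε s) fun s => s)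

lemma contDiff_foldMap_coord (ε : ℝ) (b : Lat n) (i : Fin (n + 1)) :
    Smooth (snoc (α := fun _ => ℝ → ℝ) (fun i s => b i + foldFun ε s) (fun s => s) i) := by
  refine lastCases ?_ (fun j => ?_) i
  · simp only [Fin.snoc_last]; exact contDiff_id
  · simp only [Fin.snoc_castSucc]; exact contDiff_const.add (contDiff_foldFun ε)

lemma contDiff_foldMap (ε : ℝ) (b : Lat n) : Smooth (foldMap ε b) :=
  contDiff_diagMap (contDiff_foldMap_coord ε b)

lemma foldMap_last (ε : ℝ) (b : Lat n) (x : Pt n) :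
    foldMap ε b x (last n) = x (last n) := by simp [foldMap]

lemma foldMap_mk (ε : ℝ) (b : Lat n) (y : Lat n) (s : ℝ) :
    foldMap ε b (mk y s) = mk (fun i => b i + foldFun ε (y i)) s := by
  ext i; refine lastCases ?_ (fun j => ?_) i <;> simp [foldMap]

lemma grad_foldMap_castSucc (hu : Smooth u) (b : Lat n) (x : Pt n) (i : Fin d)
    (j : Fin n) : grad (fun y => u (foldMap ε b y)) x i j.castSucc =
      foldSlope ε (x j.castSucc) * grad u (foldMap ε b x) i j.castSucc := by
  have := grad_comp_diagMap (contDiff_foldMap_coord ε b) hu x i j.castSucc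
  simpa [foldMap, Fin.snoc_castSucc, deriv_foldFun] using this

lemma grad_foldMap_last (hu : Smooth u) (b : Lat n) (x : Pt n) (i : Fin d) :
    grad (fun y => u (foldMap ε b y)) x i (last n) = grad u (foldMap ε b x) i (last n) := by
  have := grad_comp_diagMap (contDiff_foldMap_coord ε b) hu x i (last n)
  simpa [foldMap, Fin.snoc_last] using this

lemma abs_grad_foldMap_le (hu : Smooth u) (b : Lat n) (x : Pt n) (i : Fin d)
    (j : Fin (n + 1)) :
    |grad (fun y => u (foldMap ε b y)) x i j| ≤ |grad u (foldMap ε b x) i j| := by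
  refine lastCases ?_ (fun j => ?_) j
  · rw [grad_foldMap_last hu]
  · rw [grad_foldMap_castSucc hu, abs_mul]
    exact mul_le_of_le_one_left (abs_nonneg _) (abs_foldSlope_le _ _)

/-- Folding does not increase the distance of the gradient from a matrix `c ⊗ e_N`. -/
lemma matNorm_grad_foldMap_sub_le (hu : Smooth u) (b : Lat n) (x : Pt n)
    (c : Space d) : matNorm (grad (fun y => u (foldMap ε b y)) x - tensorLast n c) ≤
      matNorm (grad u (foldMap ε b x) - tensorLast n c) := by
  refine matNorm_le_matNorm fun i j => ?_
  by_cases hj : j = last n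
  · subst hj; simp [grad_foldMap_last hu]
  · simpa [tensorLast_of_ne c i hj] using abs_grad_foldMap_le hu b x i j

lemma hess_foldMap_of_pure (hu : Smooth u) (b : Lat n) {x : Pt n}
    (hx : ∀ j : Fin n, foldSlope ε (x j.castSucc) = 1) :
    hess (fun y => u (foldMap ε b y)) x = hess u (foldMap ε b x) := by
  have h1 : ∀ j : Fin (n + 1), deriv (snoc (α := fun _ => ℝ → ℝ) (fun i s => b i + foldFun ε s)
      (fun s => s) j) (x j) = 1 := by
    intro j; refine lastCases ?_ (fun j => ?_) j
    · simp
    · simp [deriv_foldFun, hx j]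
  have h2 : ∀ j : Fin (n + 1), deriv (deriv (snoc (α := fun _ => ℝ → ℝ)
      (fun i s => b i + foldFun ε s) (fun s => s) j)) (x j) = 0 := by
    intro j; refine lastCases ?_ (fun j => ?_) j
    · simp
    · simp [deriv_foldFun, deriv_foldSlope_of_eq_one (hx j)]
  ext i j k
  have := hess_comp_diagMap (contDiff_foldMap_coord ε b) hu x i j k
  rw [h1, h1, h2] at this
  simpa [foldMap] using this

lemma grad_foldMap_of_pure (hu : Smooth u) (b : Lat n) {x : Pt n}
    (hx : ∀ j : Fin n, foldSlope ε (x j.castSucc) = 1) :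
    grad (fun y => u (foldMap ε b y)) x = grad u (foldMap ε b x) := by
  ext i j
  refine lastCases ?_ (fun j => ?_) j
  · exact grad_foldMap_last hu b x i
  · rw [grad_foldMap_castSucc hu, hx, one_mul]

/-- The pointwise cost of folding, where the second gradient of the folding map, of order `1 / ε`,
multiplies the lateral gradient of `u` only. The latter vanishes at the wells. -/
lemma exists_fold_layer_bound (hwb : WellBounds W a p C) (hp : 2 ≤ p) (hW : ∀ ξ, 0 ≤ W ξ) {τ : ℝ}
    (hτ : 0 < τ) : ∃ D, 0 ≤ D ∧ ∀ (ε l : ℝ) (u : Pt n → Space d) (b : Lat n)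
      (x : Pt n), 0 < ε → l ≤ 0 → Smooth u →
      eDens W ε l (fun y => u (foldMap ε b y)) x + cDens l (fun y => u (foldMap ε b y)) x ≤
        τ / ε + D * eDens W ε l u (foldMap ε b x) := by
  obtain ⟨K, hK0, hK⟩ := exists_bound_deriv_foldSlope
  set K' := √(d * ((n + 1) * (n + 1)) : ℕ) * K with hK'
  have hK'0 : 0 ≤ K' := by positivity
  have hC := hwb.pos
  obtain ⟨D, hD0, hD⟩ := exists_layer_constant hp (M := C ^ 2 + K' + 1) (by positivity) hτ
  refine ⟨D * (1 + C), by positivity, fun ε l u b x hε hl hu => ?_⟩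
  set v := fun y => u (foldMap ε b y) with hv
  set g := grad u (foldMap ε b x)
  set H := tensorNorm (hess u (foldMap ε b x)) with hH
  set e := eDens W ε l u (foldMap ε b x)
  have hele : 1 / ε * W g + ε * H ^ 2 ≤ e := le_eFun hε _ _
  have hWg := hW g
  have hWe : W g ≤ ε * e := by
    have : 1 / ε * W g ≤ e := by have : 0 ≤ ε * H ^ 2 := by positivity
                                 linarith
    rw [one_div, ← div_eq_inv_mul, div_le_iff₀ hε] at this
    linarith
  have he0 : 0 ≤ e := eDens_nonneg hW hε _
  have hH0 : 0 ≤ H := tensorNorm_nonneg _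
  have hHe : ε * H ^ 2 ≤ e := by
    have : 0 ≤ 1 / ε * W g := by positivity
    linarith
  have hHv : hessNorm v x ≤ H + K' * (matNorm (latPart g) / ε) := by
    have := tensorNorm_le_of_abs_le (T := hess v x) (S := hess u (foldMap ε b x)) (α := 1)
      (b := K / ε * matNorm (latPart g)) zero_le_one
      (mul_nonneg (div_nonneg hK0 hε.le) (matNorm_nonneg _)) ?_
    · rw [one_mul] at this
      refine this.trans_eq ?_
      rw [hK']; ring
    · intro i j k
      have h1 := hess_comp_diagMap (contDiff_foldMap_coord ε b) hu x i j k
      have hcontr : ∀ j : Fin (n + 1), |deriv (snoc (α := fun _ => ℝ → ℝ)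
          (fun i s => b i + foldFun ε s) (fun s => s) j) (x j)| ≤ 1 := by
        intro j; refine lastCases ?_ (fun j => ?_) j
        · simp
        · simpa [deriv_foldFun] using abs_foldSlope_le _ _
      have h2 : |(if k = j then deriv (deriv (snoc (α := fun _ => ℝ → ℝ)
          (fun i s => b i + foldFun ε s) (fun s => s) j)) (x j) else 0) * g i j| ≤
          K / ε * matNorm (latPart g) := by
        have hnn : 0 ≤ K / ε * matNorm (latPart g) :=
          mul_nonneg (div_nonneg hK0 hε.le) (matNorm_nonneg _)
        by_cases hkj : k = j
        · rw [if_pos hkj, abs_mul]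
          revert hnn
          refine lastCases ?_ (fun j => ?_) j
          · simp
          · intro _
            simp only [Fin.snoc_castSucc, deriv_const_add', deriv_foldFun]
            refine mul_le_mul (hK ε _ hε) ?_ (abs_nonneg _) (div_nonneg hK0 hε.le)
            have := abs_le_matNorm (latPart g) i j.castSucc
            simpa [latPart, Fin.castSucc_ne_last] using this
        · rw [if_neg hkj, zero_mul, abs_zero]; exact hnn
      refine (congrArg abs h1).le.trans ((abs_add_le _ _).trans (add_le_add ?_ h2))
      rw [abs_mul, abs_mul, one_mul]
      exact mul_le_of_le_one_left (abs_nonneg _) (mul_le_one₀ (hcontr j) (abs_nonneg _) (hcontr k))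
  have hlat := hwb.latPart_le hp g
  have hWv : W (grad v x) ≤ C ^ 2 * W g :=
    hwb.le_of_lateral_contraction hp (fun i => grad_foldMap_last hu b x i)
      fun i j => abs_grad_foldMap_le hu b x i j
  have hq0 := matNorm_nonneg (latPart g)
  have key := hD ε e H (matNorm (latPart g)) (C * (ε * e)) (W (grad v x)) (hessNorm v x)
    hε hq0 hH0 (tensorNorm_nonneg _) hHe (hlat.trans (by gcongr)) ?_ ?_
  · have h1 := eFun_le (W := W) (l := l) hε (grad v x) (hessNorm v x)
    have h2 := cDens_le (u := v) hl x
    have h3 : e + C * (ε * e) / ε = (1 + C) * e := by field_simp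
    rw [h3] at key
    unfold eDens
    linarith
  · have h4 : C ^ 2 * W g ≤ C ^ 2 * (ε * e) := by gcongr
    have h5 : 0 ≤ (C ^ 2 + K' + 1) * (C * (ε * e)) := by positivity
    have h6 : 0 ≤ (K' + 1) * (ε * e) := by positivity
    nlinarith
  · have h7 : 0 ≤ matNorm (latPart g) / ε := by positivity
    have h8 : 0 ≤ (C ^ 2 + K') * H := by positivity
    have h9 : 0 ≤ (C ^ 2 + 1) * (matNorm (latPart g) / ε) := by positivity
    nlinarith

end FoldMap

/-! ### Folding a large cube into periodic tiles -/

section Tiles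

variable {n d : ℕ}

/-- The lateral unit cube without its boundary layer of thickness `ε`. -/
def latPure (n : ℕ) (ε : ℝ) : Set (Lat n) := Icc (fun _ => ε) (fun _ => 1 - ε)

/-- The boundary layer of thickness `ε` of the lateral unit cube. -/
def latLayer (n : ℕ) (ε : ℝ) : Set (Lat n) := unitCube \ latPure n ε

lemma mem_latPure {ε : ℝ} {y : Fin n → ℝ} : y ∈ latPure n ε ↔ ∀ j, y j ∈ Icc ε (1 - ε) := by
  simp only [latPure, Set.mem_Icc, Pi.le_def]
  exact ⟨fun h j => ⟨h.1 j, h.2 j⟩, fun h => ⟨fun j => (h j).1, fun j => (h j).2⟩⟩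

lemma measurableSet_latPure (ε : ℝ) : MeasurableSet (latPure n ε) := measurableSet_Icc

lemma measurableSet_latLayer (ε : ℝ) : MeasurableSet (latLayer n ε) :=
  (measurableSet_latCube 0 1).diff (measurableSet_latPure ε)

lemma volume_latLayer_le {ε : ℝ} (hε : 0 < ε) : volume (latLayer n ε) ≤ ofReal (2 * n * ε) := by
  have hsub : latLayer n ε ⊆ ⋃ j : Fin n, Set.univ.pi (fun i => if i = j then
      Icc 0 ε ∪ Icc (1 - ε) 1 else Icc (0 : ℝ) 1) := by
    intro y hy
    obtain ⟨h1, h2⟩ := hy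
    rw [mem_latCube] at h1
    rw [mem_latPure] at h2
    push Not at h2
    obtain ⟨j, hj⟩ := h2
    refine Set.mem_iUnion.2 ⟨j, fun i _ => ?_⟩
    have h3 := h1 i
    rw [zero_add] at h3
    by_cases hij : i = j
    · subst hij
      simp only [if_true]
      rw [Set.mem_Icc, not_and_or, not_le, not_le] at hj
      rcases hj with h | h
      · exact Or.inl ⟨h3.1, h.le⟩
      · exact Or.inr ⟨h.le, h3.2⟩
    · simpa [hij] using h3
  refine (measure_mono hsub).trans ((measure_iUnion_le _).trans ?_)
  rw [tsum_fintype]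
  have hle : ∀ j : Fin n, volume (Set.univ.pi (fun i => if i = j then
      Icc 0 ε ∪ Icc (1 - ε) 1 else Icc (0 : ℝ) 1)) ≤ ofReal (2 * ε) := by
    intro j
    rw [volume_pi_pi, Finset.prod_eq_single j]
    · simp only [if_true]
      refine (measure_union_le _ _).trans ?_
      rw [Real.volume_Icc, Real.volume_Icc, ← ofReal_add (by linarith) (by linarith)]
      exact ofReal_mono (by linarith)
    · intro i _ hij; simp [hij]
    · simp
  refine (sum_le_sum fun j _ => hle j).trans ?_
  rw [Finset.sum_const, Finset.card_univ, Fintype.card_fin, nsmul_eq_mul,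
    ← ENNReal.ofReal_natCast, ← ofReal_mul (by positivity)]
  exact ofReal_mono (by linarith)

/-- The lateral position of the tile with index `j`. -/
def tileShift {k : ℕ} (j : Fin n → Fin k) : Lat n := fun i => (j i : ℕ)

/-- The folding map, shifted by `b` and to the tile with index `j`. -/
notation:max "tileFold" ε:max b:max j:max => foldMap ε (b + tileShift j)

lemma tileShift_mem {k : ℕ} (j : Fin n → Fin k) (i : Fin n) :
    0 ≤ tileShift j i ∧ tileShift j i + 1 ≤ k := by
  refine ⟨Nat.cast_nonneg _, ?_⟩
  have : ((j i : ℕ) : ℝ) + 1 ≤ k := by exact_mod_cast (j i).2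
  exact this

/-- Averaging over the shift: for some position of the tiles, the layers along which they are folded
carry only a share of the integral of `f` that is proportional to their thickness. -/
lemma exists_fold_shift {f : Pt n → ENNReal} (hf : Measurable f) {ε : ℝ} (hε : 0 < ε)
    (k : ℕ) (c : ℝ) {I : Set ℝ} (hI : MeasurableSet I) :
    ∃ b ∈ latCube n c 1, ∑ j : Fin n → Fin k,
      ∫⁻ x in cyl (latLayer n ε) I, f (tileFold ε b j x) ≤
        ofReal (k ^ n * (2 * n * ε)) * ∫⁻ x in cyl (latCube n c (k + 1)) I, f x := by
  set J : (Lat n) → ENNReal := fun y => ∫⁻ s in I, f (mk y s)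
  have hJm : Measurable J := (hf.comp measurable_mk).lintegral_prod_right'
  set g : Lat n → Lat n := fun y i => foldFun ε (y i) with hg
  have hgm : Measurable g := by
    refine measurable_pi_lambda _ fun i => ?_
    exact (contDiff_foldFun ε).continuous.measurable.comp (measurable_pi_apply i)
  have hfold : ∀ b : Lat n, ∫⁻ x in cyl (latLayer n ε) I, f (foldMap ε b x) =
      ∫⁻ y in latLayer n ε, J (b + g y) := by
    intro b
    rw [lintegral_cyl (f := fun x => f (foldMap ε b x))
      (hf.comp (contDiff_foldMap ε b).continuous.measurable)
      (measurableSet_latLayer ε) hI]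
    refine lintegral_congr fun y => lintegral_congr fun s => ?_
    simp only [foldMap_mk]; rfl
  set T := ∫⁻ x in cyl (latCube n c (k + 1)) I, f x
  have hTJ : T = ∫⁻ y in latCube n c (k + 1), J y :=
    lintegral_cyl hf (measurableSet_latCube _ _) hI
  set Φ : (Lat n) → ENNReal := fun b => ∑ j : Fin n → Fin k,
    ∫⁻ y in latLayer n ε, J (b + tileShift j + g y)
  have hmeas : ∀ j : Fin n → Fin k, Measurable fun q : (Lat n) × (Lat n) =>
      J (q.1 + tileShift j + g q.2) := fun j =>
    hJm.comp ((measurable_fst.add_const _).add (hgm.comp measurable_snd))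
  have hΦm : Measurable Φ := Finset.measurable_sum _ fun j _ => (hmeas j).lintegral_prod_right'
  have hone := volume_latCube_one (n := n) c
  obtain ⟨b, hb, hle⟩ := exists_le_setLAverage (μ := volume) (s := latCube n c 1) (f := Φ)
    (by rw [hone]; simp) (by rw [hone]; simp) hΦm.aemeasurable
  refine ⟨b, hb, ?_⟩
  simp only [hfold]
  refine hle.trans ?_
  rw [setLAverage_eq, hone, div_one, lintegral_finsetSum _ fun j _ => (hmeas j).lintegral_prod_right']
  have hterm : ∀ j : Fin n → Fin k, ∫⁻ b in latCube n c 1, ∫⁻ y in latLayer n ε,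
      J (b + tileShift j + g y) ≤ ofReal (2 * n * ε) * T := by
    intro j
    rw [lintegral_lintegral_swap (f := fun b y => J (b + tileShift j + g y)) (hmeas j).aemeasurable]
    calc ∫⁻ y in latLayer n ε, ∫⁻ b in latCube n c 1, J (b + tileShift j + g y)
        ≤ ∫⁻ _ in latLayer n ε, T := by
          refine setLIntegral_mono' (measurableSet_latLayer ε) fun y hy => ?_
          rw [hTJ]
          simp only [add_assoc]
          refine lintegral_add_const_le (tileShift j + g y) fun b hb => ?_
          rw [mem_latCube] at hb ⊢
          intro i
          have h1 := hb i
          have h2 := tileShift_mem j i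
          have h3 := foldFun_mem_Icc hε (s := y i) (by simpa using mem_latCube.1 hy.1 i)
          simp only [Pi.add_apply, hg]
          constructor <;> linarith [h1.1, h1.2, h3.1, h3.2]
      _ = T * volume (latLayer n ε) := by simp
      _ ≤ T * ofReal (2 * n * ε) := by gcongr; exact volume_latLayer_le hε
      _ = _ := mul_comm _ _
  refine (sum_le_sum fun j _ => hterm j).trans ?_
  rw [Finset.sum_const, nsmul_eq_mul, ← mul_assoc, ofReal_mul (by positivity)]
  simp [ofReal_pow]

/-- Away from the layers, folding is a translation onto disjoint parts of the large cube. -/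
lemma sum_lintegral_pure_le {f : Pt n → ENNReal} (hf : Measurable f) {ε : ℝ} (hε : 0 < ε)
    (hε2 : ε ≤ 1 / 2) (k : ℕ) {c : ℝ} {b : Fin n → ℝ} (hb : b ∈ latCube n c 1) {I : Set ℝ}
    (hI : MeasurableSet I) :
    ∑ j : Fin n → Fin k, ∫⁻ x in cyl (latPure n ε) I, f (tileFold ε b j x) ≤
      ∫⁻ x in cyl (latCube n c (k + 1)) I, f x := by
  set J : (Lat n) → ENNReal := fun y => ∫⁻ s in I, f (mk y s) with hJ
  set s₀ := ε - foldFun ε ε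
  set e : (Fin n → Fin k) → (Lat n) := fun j i => b i + tileShift j i - s₀ with he
  set P : (Fin n → Fin k) → Set (Lat n) := fun j => Icc (fun i => ε + e j i)
    (fun i => 1 - ε + e j i) with hP
  have hmemP : ∀ j y, y ∈ P j ↔ ∀ i, ε + e j i ≤ y i ∧ y i ≤ 1 - ε + e j i := by
    intro j y
    simp only [hP, Set.mem_Icc, Pi.le_def]
    exact ⟨fun h i => ⟨h.1 i, h.2 i⟩, fun h => ⟨fun i => (h i).1, fun i => (h i).2⟩⟩
  have hfold : ∀ j : Fin n → Fin k,
      ∫⁻ x in cyl (latPure n ε) I, f (tileFold ε b j x) ≤ ∫⁻ y in P j, J y := by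
    intro j
    rw [lintegral_cyl (f := fun x => f (tileFold ε b j x))
      (hf.comp (contDiff_foldMap ε _).continuous.measurable)
      (measurableSet_latPure ε) hI]
    calc ∫⁻ y in latPure n ε, ∫⁻ s in I, f (tileFold ε b j (mk y s))
        = ∫⁻ y in latPure n ε, J (y + e j) := by
          refine setLIntegral_congr_fun (measurableSet_latPure ε) fun y hy => ?_
          refine lintegral_congr fun s => ?_
          rw [foldMap_mk]
          congr 2
          ext i
          rw [foldFun_eq_sub hε (mem_latPure.1 hy i)]
          simp only [he, Pi.add_apply]; ring
      _ ≤ _ := by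
          refine lintegral_add_const_le (e j) fun y hy => (hmemP j _).2 fun i => ?_
          have := mem_latPure.1 hy i
          simp only [Pi.add_apply]
          constructor <;> linarith [this.1, this.2]
  have hdisj : Pairwise (Function.onFun Disjoint P) := by
    intro j j' hjj'
    rw [Function.onFun, Set.disjoint_left]
    intro y hy hy'
    apply hjj'
    ext i
    have h1 := (hmemP j y).1 hy i
    have h2 := (hmemP j' y).1 hy' i
    simp only [he, tileShift] at h1 h2
    have h3 : ((j i : ℕ) : ℝ) < (j' i : ℕ) + 1 := by linarith [h1.1, h2.2]
    have h4 : ((j' i : ℕ) : ℝ) < (j i : ℕ) + 1 := by linarith [h1.2, h2.1]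
    have h3' : (j i : ℕ) < (j' i : ℕ) + 1 := by exact_mod_cast h3
    have h4' : (j' i : ℕ) < (j i : ℕ) + 1 := by exact_mod_cast h4
    omega
  refine (sum_le_sum fun j _ => hfold j).trans ?_
  rw [← tsum_fintype (L := .unconditional _), ← lintegral_iUnion (fun j => measurableSet_Icc) hdisj,
    lintegral_cyl hf (measurableSet_latCube _ _) hI]
  refine lintegral_mono_set (Set.iUnion_subset fun j y hy => mem_latCube.2 fun i => ?_)
  have h1 := (hmemP j y).1 hy i
  have h2 := tileShift_mem j i
  have h3 := mem_latCube.1 hb i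
  have h4 := foldFun_mem_Icc hε (s := ε) ⟨hε.le, by linarith⟩
  have h5 : foldFun ε ε ≤ ε := by
    have hi := (contDiff_foldSlope ε).continuous.intervalIntegrable (μ := volume) 0 ε
    have := intervalIntegral.integral_mono_on hε.le hi (intervalIntegrable_const (c := (1 : ℝ)))
      fun t _ => (abs_le.1 (abs_foldSlope_le ε t)).2
    simpa [foldFun] using this
  simp only [he] at h1
  constructor <;> linarith [h1.1, h1.2, h3.1, h3.2, h4.1]

lemma latCube_eq_union {ε : ℝ} (hε : 0 < ε) : unitCube = latPure n ε ∪ latLayer n ε := by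
  rw [latLayer, Set.union_sdiff_cancel]
  intro y hy
  rw [mem_latCube]; intro j
  have := mem_latPure.1 hy j
  constructor <;> linarith [this.1, this.2]

lemma lintegral_tile_le {f : Pt n → ENNReal} {ε : ℝ} (hε : 0 < ε) (I : Set ℝ) :
    ∫⁻ x in cyl unitCube I, f x ≤
      (∫⁻ x in cyl (latPure n ε) I, f x) + ∫⁻ x in cyl (latLayer n ε) I, f x := by
  have : cyl unitCube I = cyl (latPure n ε) I ∪ cyl (latLayer n ε) I := by
    rw [latCube_eq_union hε]; ext x; simp [cyl, or_and_right]
  rw [this]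
  exact lintegral_union_le _ _ _

variable {W : Mat d n → ℝ} {a : Space d} {p C : ℝ}

/-- A large cube can be folded into periodic tiles with a small increase of energy. The additional
function `f` is carried along. -/
lemma exists_folded_tiles (hwb : WellBounds W a p C) (hp : 2 ≤ p) (hW : ∀ ξ, 0 ≤ W ξ)
    (hWc : Continuous W) (k : ℕ) {R κ Emax : ℝ} (hR : 0 < R) (hκ : 0 < κ) (hE : 0 ≤ Emax) (c : ℝ) :
    ∃ ε₀, 0 < ε₀ ∧ ε₀ ≤ 1 / 2 ∧ ∀ (ε l : ℝ) (u : Pt n → Space d), 0 < ε → ε ≤ ε₀ → l ≤ 0 →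
      Smooth u → ∀ f : Pt n → ENNReal, Measurable f →
      (∫⁻ x in cyl (latCube n c (k + 1)) (Icc (-R) R),
        (ofReal (eDens W ε l u x) + f x)) ≤ ofReal Emax →
      ∃ b : Lat n, (∑ j : Fin n → Fin k, eInt W ε l (fun y => u (tileFold ε b j y))
        (cyl unitCube (Icc (-R) R)) ≤
          eInt W ε l u (cyl (latCube n c (k + 1)) (Icc (-R) R)) + ofReal κ) ∧
        (∑ j : Fin n → Fin k, cInt l (fun y => u (tileFold ε b j y)) (cyl unitCube (Icc (-R) R)) ≤
          cInt l u (cyl (latCube n c (k + 1)) (Icc (-R) R)) + ofReal κ) ∧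
        (∑ j : Fin n → Fin k, ∫⁻ x in cyl unitCube (Icc (-R) R),
            f (tileFold ε b j x) ≤
          (∫⁻ x in cyl (latCube n c (k + 1)) (Icc (-R) R), f x) + ofReal κ) := by
  set A : ℝ := k ^ n * (2 * n) with hA
  have hA0 : 0 ≤ A := by positivity
  obtain ⟨D, hD0, hD⟩ := exists_fold_layer_bound hwb hp hW
    (τ := κ / (2 * (A * (2 * R) + 1))) (by positivity)
  refine ⟨min (1 / 2) (κ / (2 * ((D + 1) * A * Emax + 1))), by positivity, min_le_left _ _, ?_⟩
  intro ε l u hε hεle hl hu f hf hle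
  set I := Icc (-R) R
  have hIm : MeasurableSet I := measurableSet_Icc
  have heu : Continuous (eDens W ε l u) := continuous_eDens hWc hu
  have hem : Measurable fun x => ofReal (eDens W ε l u x) := heu.measurable.ennreal_ofReal
  have hcm : Measurable fun x => ofReal (cDens l u x) :=
    (continuous_cDens hu).measurable.ennreal_ofReal
  have hε2 : ε ≤ 1 / 2 := hεle.trans (min_le_left _ _)
  obtain ⟨b, hb, hbl⟩ := exists_fold_shift (hem.add hf) hε k c hIm
  -- the energy in the layers is of order `ε`, as the layers carry a share of this order
  have hsmall : ofReal (k ^ n * (2 * n * ε)) * ofReal Emax ≤ ofReal (κ / (2 * (D + 1))) := by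
    rw [← ofReal_mul (by positivity)]
    refine ofReal_mono ?_
    have h1 : ε ≤ κ / (2 * ((D + 1) * A * Emax + 1)) := hεle.trans (min_le_right _ _)
    rw [le_div_iff₀ (by positivity)] at h1 ⊢
    have h2 : 0 ≤ ε := hε.le
    calc _ = ε * (2 * ((D + 1) * A * Emax)) := by rw [hA]; ring
      _ ≤ ε * (2 * ((D + 1) * A * Emax + 1)) := by gcongr; linarith
      _ ≤ κ := h1
  have hlay := hbl.trans ((mul_le_mul_right hle _).trans hsmall)
  -- the term `τ / ε` of the layer estimate, integrated over layers of volume of order `ε`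
  have hvol : ∑ _j : Fin n → Fin k, ofReal (κ / (2 * (A * (2 * R) + 1)) / ε) *
      volume (cyl (latLayer n ε) I) ≤ ofReal (κ / 2) := by
    rw [Finset.sum_const, nsmul_eq_mul, volume_cyl (measurableSet_latLayer ε) hIm,
      Real.volume_Icc]
    calc _ ≤ ofReal (k ^ n) * (ofReal (κ / (2 * (A * (2 * R) + 1)) / ε) *
        (ofReal (2 * n * ε) * ofReal (R - -R))) := by
          gcongr
          · simp [ofReal_pow]
          · exact volume_latLayer_le hε
      _ = ofReal (k ^ n * (κ / (2 * (A * (2 * R) + 1)) / ε * (2 * n * ε * (R - -R)))) := by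
          rw [ofReal_mul (q := κ / _ / ε * _) (by positivity),
            ofReal_mul (q := 2 * n * ε * (R - -R)) (by positivity),
            ofReal_mul (q := R - -R) (by positivity)]
      _ ≤ _ := by
          refine ofReal_mono ?_
          have : (k : ℝ) ^ n * (κ / (2 * (A * (2 * R) + 1)) / ε * (2 * n * ε * (R - -R))) =
              κ / 2 * (A * (2 * R) / (A * (2 * R) + 1)) := by
            rw [hA]; field_simp; ring
          rw [this]
          refine mul_le_of_le_one_right (by positivity) ?_
          rw [div_le_one (by positivity)]; linarith
  have hDle : ofReal D * ofReal (κ / (2 * (D + 1))) ≤ ofReal (κ / 2) := by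
    rw [← ofReal_mul hD0]
    refine ofReal_mono ?_
    have : D * (κ / (2 * (D + 1))) = κ / 2 * (D / (D + 1)) := by field_simp
    rw [this]
    refine mul_le_of_le_one_right (by positivity) ?_
    rw [div_le_one (by positivity)]; linarith
  have hpure : ∀ j : Fin n → Fin k, ∀ x ∈ cyl (latPure n ε) I, ∀ i : Fin n,
      foldSlope ε (x i.castSucc) = 1 := fun j x hx i =>
    foldSlope_eq_one hε (mem_latPure.1 hx.1 i)
  have hPm : MeasurableSet (cyl (latPure n ε) I) :=
    measurableSet_cyl (measurableSet_latPure ε) hIm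
  have hLm : MeasurableSet (cyl (latLayer n ε) I) :=
    measurableSet_cyl (measurableSet_latLayer ε) hIm
  -- a density whose value for the folded function is controlled by the layer estimate
  have main : ∀ (dn : (Pt n → Space d) → Pt n → ℝ), Measurable (fun x => ofReal (dn u x)) →
      (∀ (b : Lat n) (x : Pt n), (∀ i : Fin n, foldSlope ε (x i.castSucc) = 1) →
        dn (fun y => u (foldMap ε b y)) x = dn u (foldMap ε b x)) →
      (∀ (b : Lat n) (x : Pt n), dn (fun y => u (foldMap ε b y)) x ≤
        κ / (2 * (A * (2 * R) + 1)) / ε + D * eDens W ε l u (foldMap ε b x)) →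
      ∑ j : Fin n → Fin k, ∫⁻ x in cyl unitCube I,
        ofReal (dn (fun y => u (tileFold ε b j y)) x) ≤
      (∫⁻ x in cyl (latCube n c (k + 1)) I, ofReal (dn u x)) + ofReal κ := by
    intro dn hdm hdp hdl
    have h1 : ∀ j : Fin n → Fin k, ∫⁻ x in cyl unitCube I,
        ofReal (dn (fun y => u (tileFold ε b j y)) x) ≤
        (∫⁻ x in cyl (latPure n ε) I, ofReal (dn u (tileFold ε b j x))) +
        (ofReal (κ / (2 * (A * (2 * R) + 1)) / ε) * volume (cyl (latLayer n ε) I) +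
        ofReal D * ∫⁻ x in cyl (latLayer n ε) I,
          (ofReal (eDens W ε l u (tileFold ε b j x)) +
            f (tileFold ε b j x))) := by
      intro j
      refine (lintegral_tile_le hε I).trans (add_le_add ?_ ?_)
      · refine (setLIntegral_congr_fun hPm fun x hx => ?_).le
        simp only [hdp _ x (hpure j x hx)]
      · calc _ ≤ ∫⁻ x in cyl (latLayer n ε) I,
            (ofReal (κ / (2 * (A * (2 * R) + 1)) / ε) + ofReal D *
              (ofReal (eDens W ε l u (tileFold ε b j x)) +
            f (tileFold ε b j x))) := by
              refine lintegral_mono fun x => ?_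
              refine (ofReal_mono (hdl _ x)).trans (ENNReal.ofReal_add_le.trans ?_)
              rw [ofReal_mul hD0]
              gcongr
              exact le_self_add
          _ = _ := by
              rw [lintegral_add_left measurable_const, lintegral_const_mul']
              · simp
              · exact ofReal_ne_top
    refine (sum_le_sum fun j _ => h1 j).trans ?_
    rw [sum_add_distrib, sum_add_distrib]
    refine add_le_add (sum_lintegral_pure_le hdm hε hε2 k hb hIm) ?_
    rw [← add_halves κ, ofReal_add (by positivity) (by positivity)]
    rw [add_halves κ]
    refine add_le_add hvol ?_
    rw [← Finset.mul_sum]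
    exact (mul_le_mul_right hlay _).trans hDle
  refine ⟨b, ?_, ?_, ?_⟩
  · refine main (fun v x => eDens W ε l v x) hem ?_ ?_
    · intro b x hx
      unfold eDens; rw [grad_foldMap_of_pure hu b hx, hess_foldMap_of_pure hu b hx]
    · intro b x
      exact le_trans (le_add_of_nonneg_right (cDens_nonneg _)) (hD ε l u b x hε hl hu)
  · refine main (fun v x => cDens l v x) hcm ?_ ?_
    · intro b x hx
      unfold cDens; rw [hess_foldMap_of_pure hu b hx]
    · intro b x
      exact le_trans (le_add_of_nonneg_left (eDens_nonneg hW hε _)) (hD ε l u b x hε hl hu)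
  · have h1 : ∀ j : Fin n → Fin k, ∫⁻ x in cyl unitCube I,
        f (tileFold ε b j x) ≤
        (∫⁻ x in cyl (latPure n ε) I, f (tileFold ε b j x)) +
        ∫⁻ x in cyl (latLayer n ε) I, (ofReal (eDens W ε l u (tileFold ε b j x)) +
            f (tileFold ε b j x)) := fun j =>
      (lintegral_tile_le hε I).trans (add_le_add le_rfl (lintegral_mono fun x => le_add_self))
    refine (sum_le_sum fun j _ => h1 j).trans ?_
    rw [sum_add_distrib]
    refine add_le_add (sum_lintegral_pure_le hf hε hε2 k hb hIm) (hlay.trans ?_)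
    refine ofReal_mono (div_le_self hκ.le ?_)
    linarith

end Tiles

/-! ### Freezing a function above a well chosen height -/

section Freezing

variable {n d : ℕ}

/-- `V` depends on the lateral variables through the vertical lines of `v` only, so that it inherits
the lateral symmetries of `v`. -/
def LateralFactor (v V : Pt n → Space d) : Prop :=
  ∀ y y' : Lat n, (∀ s, v (mk y s) = v (mk y' s)) → ∀ s, V (mk y s) = V (mk y' s)

/-- A smooth function that vanishes on `(-∞, -1]` and is the identity on `[0, ∞)`. -/
def smoothRamp (y : ℝ) : ℝ := y * (1 - step (-y))

lemma contDiff_smoothRamp : Smooth smoothRamp :=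
  contDiff_id.mul (contDiff_const.sub (smooth_step.comp contDiff_neg))

lemma smoothRamp_of_nonneg {y : ℝ} (hy : 0 ≤ y) : smoothRamp y = y := by
  simp [smoothRamp, zero_of_nonpos (x := -y) (by linarith)]

lemma smoothRamp_of_le {y : ℝ} (hy : y ≤ -1) : smoothRamp y = 0 := by
  simp [smoothRamp, one_of_one_le (x := -y) (by linarith)]

lemma hasDerivAt_comp_neg {f : ℝ → ℝ} (hf : Differentiable ℝ f) (y : ℝ) :
    HasDerivAt (fun y => f (-y)) (-deriv f (-y)) y := by
  simpa [Function.comp_def] using (hf (-y)).hasDerivAt.comp y (hasDerivAt_neg y)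

lemma deriv_smoothRamp : deriv smoothRamp =
    fun y => 1 - step (-y) + y * deriv step (-y) := by
  ext y
  have h := (hasDerivAt_id y).mul ((hasDerivAt_comp_neg
    (smooth_diff smooth_step) y).const_sub 1)
  have h2 := h.deriv
  rw [show smoothRamp = (id * fun y => 1 - step (-y)) from rfl, h2]
  simp

lemma deriv_smoothRamp_of_nonneg {y : ℝ} (hy : 0 ≤ y) : deriv smoothRamp y = 1 := by
  simp [deriv_smoothRamp, zero_of_nonpos (x := -y) (by linarith),
    deriv_step_of_nonpos (x := -y) (by linarith)]

lemma deriv_smoothRamp_of_le {y : ℝ} (hy : y ≤ -1) : deriv smoothRamp y = 0 := by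
  simp [deriv_smoothRamp, one_of_one_le (x := -y) (by linarith),
    deriv_step_of_one_le (x := -y) (by linarith)]

lemma deriv2_smoothRamp (y : ℝ) : deriv (deriv smoothRamp) y =
    2 * deriv step (-y) - y * deriv (deriv step) (-y) := by
  have h1 := (hasDerivAt_comp_neg (smooth_diff smooth_step) y).const_sub 1
  have h2 := (hasDerivAt_id y).mul (hasDerivAt_comp_neg
    (smooth_diff (smooth_deriv smooth_step)) y)
  have h3 := (h1.add h2).deriv
  rw [deriv_smoothRamp, show (fun y => 1 - step (-y) +
    y * deriv step (-y)) = (fun y => 1 - step (-y)) +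
      (id * fun y => deriv step (-y)) from rfl, h3]
  simp; ring

lemma deriv2_smoothRamp_of_nonneg {y : ℝ} (hy : 0 ≤ y) : deriv (deriv smoothRamp) y = 0 := by
  simp [deriv2_smoothRamp, deriv_step_of_nonpos (x := -y) (by linarith),
    deriv2_step_of_le (x := -y) (by linarith)]

lemma deriv2_smoothRamp_of_le {y : ℝ} (hy : y ≤ -1) : deriv (deriv smoothRamp) y = 0 := by
  simp [deriv2_smoothRamp, deriv_step_of_one_le (x := -y) (by linarith),
    deriv2_step_of_one_le (x := -y) (by linarith)]

/-- The identity up to the height `t - ε`, and the constant `t` above the height `t`. -/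
def frz (ε t s : ℝ) : ℝ := s - ε * smoothRamp ((s - t) / ε)

lemma contDiff_frz (ε t : ℝ) : Smooth (frz ε t) := contDiff_id.sub (contDiff_const.mul
    (contDiff_smoothRamp.comp ((contDiff_id.sub contDiff_const).div_const ε)))

lemma hasDerivAt_comp_sub_div {f : ℝ → ℝ} (hf : Differentiable ℝ f) (ε t s : ℝ) :
    HasDerivAt (fun s => f ((s - t) / ε)) (deriv f ((s - t) / ε) / ε) s := by
  have h1 : HasDerivAt (fun s : ℝ => (s - t) / ε) (1 / ε) s :=
    ((hasDerivAt_id s).sub_const t).div_const ε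
  simpa [Function.comp_def, div_eq_mul_inv] using (hf ((s - t) / ε)).hasDerivAt.comp s h1

lemma deriv_frz {ε : ℝ} (hε : 0 < ε) (t : ℝ) :
    deriv (frz ε t) = fun s => 1 - deriv smoothRamp ((s - t) / ε) := by
  ext s
  have h := ((hasDerivAt_id s).sub ((hasDerivAt_comp_sub_div
    (smooth_diff contDiff_smoothRamp) ε t s).const_mul ε)).deriv
  rw [show frz ε t = (id - fun s => ε * smoothRamp ((s - t) / ε)) from rfl, h]
  field_simp

lemma deriv2_frz {ε : ℝ} (hε : 0 < ε) (t s : ℝ) :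
    deriv (deriv (frz ε t)) s = -(deriv (deriv smoothRamp) ((s - t) / ε) / ε) := by
  rw [deriv_frz hε]
  have h := ((hasDerivAt_comp_sub_div (smooth_diff (smooth_deriv contDiff_smoothRamp))
    ε t s).const_sub 1).deriv
  exact h

lemma frz_of_le {ε t s : ℝ} (hε : 0 < ε) (hs : s ≤ t - ε) : frz ε t s = s := by
  have : (s - t) / ε ≤ -1 := by rw [div_le_iff₀ hε]; linarith
  simp [frz, smoothRamp_of_le this]

lemma frz_of_ge {ε t s : ℝ} (hε : 0 < ε) (hs : t ≤ s) : frz ε t s = t := by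
  have : 0 ≤ (s - t) / ε := div_nonneg (by linarith) hε.le
  rw [frz, smoothRamp_of_nonneg this]; field_simp; ring

lemma deriv_frz_of_ge {ε t s : ℝ} (hε : 0 < ε) (hs : t ≤ s) : deriv (frz ε t) s = 0 := by
  have : 0 ≤ (s - t) / ε := div_nonneg (by linarith) hε.le
  rw [deriv_frz hε]; simp [deriv_smoothRamp_of_nonneg this]

lemma deriv2_frz_of_ge {ε t s : ℝ} (hε : 0 < ε) (hs : t ≤ s) : deriv (deriv (frz ε t)) s = 0 := by
  have : 0 ≤ (s - t) / ε := div_nonneg (by linarith) hε.le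
  rw [deriv2_frz hε]; simp [deriv2_smoothRamp_of_nonneg this]

lemma frz_add (ε t r : ℝ) : frz ε t (t + r) = t + frz ε 0 r := by simp [frz]; ring

lemma frz_zero_mem {ε r : ℝ} (hε : 0 < ε) (hr : r ∈ Icc (-ε) 0) : frz ε 0 r ∈ Icc (-ε) 0 := by
  have h1 : frz ε 0 r = r * step (-(r / ε)) := by
    simp only [frz, smoothRamp, sub_zero]; field_simp; ring
  have h2 := smoothTransition.nonneg (-(r / ε))
  have h3 := smoothTransition.le_one (-(r / ε))
  rw [h1]
  constructor
  · nlinarith [hr.1, hr.2]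
  · exact mul_nonpos_of_nonpos_of_nonneg hr.2 h2

lemma exists_bound_frz : ∃ K, 1 ≤ K ∧ ∀ ε t s : ℝ, 0 < ε →
    |deriv (frz ε t) s| ≤ K ∧ |deriv (deriv (frz ε t)) s| ≤ K / ε := by
  obtain ⟨C₁, h₁⟩ := exists_bound_of_eventually_const
    (smooth_deriv contDiff_smoothRamp).continuous (a := -1) (b := 0)
    (fun x hx => by rw [deriv_smoothRamp_of_le hx, deriv_smoothRamp_of_le le_rfl])
    (fun x hx => by rw [deriv_smoothRamp_of_nonneg hx, deriv_smoothRamp_of_nonneg le_rfl])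
  obtain ⟨C₂, h₂⟩ := exists_bound_of_eventually_const
    (smooth_deriv (smooth_deriv contDiff_smoothRamp)).continuous (a := -1) (b := 0)
    (fun x hx => by rw [deriv2_smoothRamp_of_le hx, deriv2_smoothRamp_of_le le_rfl])
    (fun x hx => by rw [deriv2_smoothRamp_of_nonneg hx, deriv2_smoothRamp_of_nonneg le_rfl])
  refine ⟨1 + max C₁ C₂, ?_, fun ε t s hε => ⟨?_, ?_⟩⟩
  · have := (abs_nonneg _).trans (h₁ 0)
    have := le_max_left C₁ C₂
    linarith
  · rw [deriv_frz hε]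
    have h3 := h₁ ((s - t) / ε)
    have h4 := le_max_left C₁ C₂
    have h5 := abs_sub (1 : ℝ) (deriv smoothRamp ((s - t) / ε))
    rw [abs_one] at h5
    linarith
  · rw [deriv2_frz hε, abs_neg, abs_div, abs_of_pos hε]
    gcongr
    have h3 := h₂ ((s - t) / ε)
    have h4 := le_max_right C₁ C₂
    linarith

/-- The map that applies `γ` to the last coordinate. -/
def vertMap (γ : ℝ → ℝ) : Pt n → Pt n := diagMap (snoc (α := fun _ => ℝ → ℝ) (fun _ s => s) γ)

lemma contDiff_vertMap_coord {γ : ℝ → ℝ} (hγ : Smooth γ) (i : Fin (n + 1)) :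
    Smooth (snoc (α := fun _ => ℝ → ℝ) (fun (_ : Fin n) s => s) γ i) := by
  refine lastCases ?_ (fun j => ?_) i
  · simpa only [Fin.snoc_last] using hγ
  · simp only [Fin.snoc_castSucc]; exact contDiff_id

lemma contDiff_vertMap {γ : ℝ → ℝ} (hγ : Smooth γ) : Smooth (vertMap γ : Pt n → Pt n) :=
  contDiff_diagMap (contDiff_vertMap_coord hγ)

lemma vertMap_mk (γ : ℝ → ℝ) (y : Lat n) (s : ℝ) : vertMap γ (mk y s) = mk y (γ s) := by
  ext i; refine lastCases ?_ (fun j => ?_) i <;> simp [vertMap]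

lemma vertMap_eq (γ : ℝ → ℝ) (x : Pt n) : vertMap γ x = mk (lat x) (γ (x (last n))) := by
  rw [← vertMap_mk, mk_lat]

/-- The function that agrees with `v` below the height `t - ε` and continues its values at height
`t` by slope `a`. -/
def freeze (ε t : ℝ) (a : Space d) (v : Pt n → Space d) (x : Pt n) : Space d :=
  v (vertMap (frz ε t) x) + (x (last n) - frz ε t (x (last n))) • a

variable {W : Mat d n → ℝ} {a : Space d} {p C ε l t : ℝ} {v : Pt n → Space d}

lemma contDiff_freeze (ε t : ℝ) (a : Space d) (hv : Smooth v) : Smooth (freeze ε t a v) :=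
  (hv.comp (contDiff_vertMap (contDiff_frz ε t))).add
    ((smooth_comp_coord (contDiff_id.sub (contDiff_frz ε t)) (last n)).smul contDiff_const)

lemma freeze_mk (s : ℝ) (y : Lat n) :
    freeze ε t a v (mk y s) = v (mk y (frz ε t s)) + (s - frz ε t s) • a := by
  simp [freeze, vertMap_mk]

lemma lateralFactor_freeze : LateralFactor v (freeze ε t a v) := by
  intro y y' h s
  rw [freeze_mk, freeze_mk, h]

lemma freeze_of_le (hε : 0 < ε) {x : Pt n} (hx : x (last n) ≤ t - ε) :
    freeze ε t a v x = v x := by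
  rw [← mk_lat x, freeze_mk, frz_of_le hε hx]; simp

lemma freeze_of_ge (hε : 0 < ε) {x : Pt n} (hx : t ≤ x (last n)) :
    freeze ε t a v x = v (mk (lat x) t) + (x (last n) - t) • a := by
  conv_lhs => rw [← mk_lat x]
  rw [freeze_mk, frz_of_ge hε hx]

lemma deriv_vert_coord (γ : ℝ → ℝ) (j : Fin (n + 1)) (s : ℝ) :
    deriv (snoc (α := fun _ => ℝ → ℝ) (fun (_ : Fin n) s => s) γ j) s =
      if j = last n then deriv γ s else 1 := by
  refine lastCases ?_ (fun j => ?_) j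
  · simp
  · simp [Fin.castSucc_ne_last]

lemma deriv2_vert_coord (γ : ℝ → ℝ) (j : Fin (n + 1)) (s : ℝ) :
    deriv (deriv (snoc (α := fun _ => ℝ → ℝ) (fun (_ : Fin n) s => s) γ j)) s =
      if j = last n then deriv (deriv γ) s else 0 := by
  refine lastCases ?_ (fun j => ?_) j
  · simp
  · simp [Fin.castSucc_ne_last]

lemma contDiff_vert_sub (ε t c : ℝ) : Smooth fun y : Pt n =>
    (y (last n) - frz ε t (y (last n))) * c :=
  (smooth_comp_coord (contDiff_id.sub (contDiff_frz ε t)) (last n)).mul contDiff_const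

lemma pd_vert_sub (ε t c : ℝ) (j : Fin (n + 1)) (x : Pt n) :
    pd j (fun y : Pt n => (y (last n) - frz ε t (y (last n))) * c) x =
      if j = last n then (1 - deriv (frz ε t) (x (last n))) * c else 0 := by
  have hs : Smooth fun s => (s - frz ε t s) * c :=
    (contDiff_id.sub (contDiff_frz ε t)).mul contDiff_const
  rw [pd_comp_coord (φ := fun s => (s - frz ε t s) * c) (smooth_diff hs)]
  congr 1
  have h := (((hasDerivAt_id (x (last n))).sub (smooth_diff (contDiff_frz ε t)
    (x (last n))).hasDerivAt).mul_const c).deriv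
  exact h

lemma grad_freeze_sub (hv : Smooth v) (x : Pt n) (i : Fin d) (j : Fin (n + 1)) :
    (grad (freeze ε t a v) x - tensorLast n a) i j =
      (if j = last n then deriv (frz ε t) (x (last n)) else 1) *
        (grad v (vertMap (frz ε t) x) - tensorLast n a) i j := by
  have h1 := grad_comp_diagMap (contDiff_vertMap_coord (contDiff_frz ε t)) hv x i j
  rw [grad_apply] at h1
  have h2 : grad (freeze ε t a v) x i j = pd j (fun y => v (vertMap (frz ε t) y) i +
      (y (last n) - frz ε t (y (last n))) * a i) x := rfl
  rw [Matrix.sub_apply, Matrix.sub_apply, h2, pd_add (f := fun y => v (vertMap (frz ε t) y) i)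
    (g := fun y => (y (last n) - frz ε t (y (last n))) * a i)
    (smooth_diff (ContDiff.coord (hv.comp (contDiff_vertMap (contDiff_frz ε t))) i))
    (smooth_diff (contDiff_vert_sub ε t _)), pd_vert_sub]
  change pd j (fun y => v (vertMap (frz ε t) y) i) x = _ at h1
  rw [h1, deriv_vert_coord]
  change _ * grad v (vertMap (frz ε t) x) i j + _ - _ = _
  by_cases hj : j = last n
  · subst hj; simp [tensorLast_last]; ring
  · simp [hj]

lemma hess_freeze (hv : Smooth v) (x : Pt n) (i : Fin d) (j k : Fin (n + 1)) :
    hess (freeze ε t a v) x i j k = (if j = last n then deriv (frz ε t) (x (last n)) else 1) *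
        (if k = last n then deriv (frz ε t) (x (last n)) else 1) *
          hess v (vertMap (frz ε t) x) i j k +
      (if k = j then (if j = last n then deriv (deriv (frz ε t)) (x (last n)) else 0) else 0)
        * (grad v (vertMap (frz ε t) x) - tensorLast n a) i j := by
  have h1 := hess_comp_diagMap (contDiff_vertMap_coord (contDiff_frz ε t)) hv x i j k
  have h2 : hess (freeze ε t a v) x i j k = pd k (pd j (fun y => v (vertMap (frz ε t) y) i +
      (y (last n) - frz ε t (y (last n))) * a i)) x := rfl
  have h3 : pd k (pd j fun y : Pt n =>
      (y (last n) - frz ε t (y (last n))) * a i) x =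
      if j = last n then
        (if k = last n then -deriv (deriv (frz ε t)) (x (last n)) * a i else 0) else 0 := by
    have h4 : (pd j fun y : Pt n => (y (last n) - frz ε t (y (last n))) * a i) =
        fun y => if j = last n then (1 - deriv (frz ε t) (y (last n))) * a i else 0 :=
      funext fun y => pd_vert_sub ε t (a i) j y
    rw [h4]
    by_cases hj : j = last n
    · simp only [hj, if_true]
      have hs : Smooth fun s => (1 - deriv (frz ε t) s) * a i :=
        (contDiff_const.sub (smooth_deriv (contDiff_frz ε t))).mul contDiff_const
      rw [pd_comp_coord (φ := fun s => (1 - deriv (frz ε t) s) * a i) (smooth_diff hs)]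
      congr 1
      have h := (((smooth_diff (smooth_deriv (contDiff_frz ε t))
        (x (last n))).hasDerivAt.const_sub 1).mul_const (a i)).deriv
      exact h
    · simp only [hj, if_false]
      exact pd_const _ _ _
  rw [h2, pd_pd_add (f := fun y => v (vertMap (frz ε t) y) i)
    (g := fun y => (y (last n) - frz ε t (y (last n))) * a i)
    (ContDiff.coord (hv.comp (contDiff_vertMap (contDiff_frz ε t))) i)
    (contDiff_vert_sub ε t _), h3]
  change pd k (pd j fun y => v (vertMap (frz ε t) y) i) x = _ at h1
  change pd k (pd j fun y => v (vertMap (frz ε t) y) i) x + _ = _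
  rw [h1, deriv_vert_coord, deriv_vert_coord, deriv2_vert_coord]
  change _ * hess v (vertMap (frz ε t) x) i j k + _ * grad v (vertMap (frz ε t) x) i j + _ = _
  by_cases hj : j = last n
  · subst hj
    by_cases hk : k = last n
    · subst hk; simp [tensorLast_last]; ring
    · simp [hk]
  · by_cases hk : k = j
    · subst hk; simp [hj]
    · by_cases hk' : k = last n
      · subst hk'; simp [hj, hk]
      · simp [hj, hk, hk']

/-- Above the height `t`, the frozen function costs at most a multiple of what the original one
costs on the slice at height `t`. -/
lemma eDens_freeze_le (hwb : WellBounds W a p C) (hp : 2 ≤ p)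
    (hv : Smooth v) (hε : 0 < ε) {x : Pt n} (hx : t ≤ x (last n)) :
    eDens W ε l (freeze ε t a v) x ≤ C ^ 2 * eDens W ε l v (mk (lat x) t) ∧
      cDens l (freeze ε t a v) x ≤ cDens l v (mk (lat x) t) := by
  have hΓ : vertMap (frz ε t) x = mk (lat x) t := by rw [vertMap_eq, frz_of_ge hε hx]
  have hH : hessNorm (freeze ε t a v) x ≤ tensorNorm (hess v (mk (lat x) t)) := by
    refine tensorNorm_le_tensorNorm fun i j k => ?_
    rw [hess_freeze hv, deriv_frz_of_ge hε hx, deriv2_frz_of_ge hε hx, hΓ]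
    by_cases hj : j = last n <;> by_cases hk : k = last n <;> simp [hj, hk]
  have hG : matNorm (grad (freeze ε t a v) x - tens a) ≤
      matNorm (latPart (grad v (mk (lat x) t))) := by
    refine matNorm_le_matNorm fun i j => ?_
    rw [grad_freeze_sub hv, deriv_frz_of_ge hε hx, hΓ]
    by_cases hj : j = last n
    · simp [hj]
    · simp [hj, latPart, tensorLast_of_ne a i hj]
  have hC := hwb.pos
  have hWle : W (grad (freeze ε t a v) x) ≤ C ^ 2 * W (grad v (mk (lat x) t)) := by
    calc _ ≤ C * matNorm (grad (freeze ε t a v) x - tens a) ^ p := hwb.upper _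
      _ ≤ C * matNorm (latPart (grad v (mk (lat x) t))) ^ p := by
        gcongr
        exact matNorm_nonneg _
      _ ≤ C * (C * W (grad v (mk (lat x) t))) := by gcongr; exact hwb.latPart_le hp _
      _ = _ := by ring
  refine ⟨?_, max_le_max (by linarith) le_rfl⟩
  set H₁ := hessNorm (freeze ε t a v) x
  set H₂ := tensorNorm (hess v (mk (lat x) t))
  have hH1 : 0 ≤ H₁ := tensorNorm_nonneg _
  have hC2 : 1 ≤ C ^ 2 := one_le_pow₀ hwb.one_le
  have h1 : 1 / ε * W (grad (freeze ε t a v) x) ≤ C ^ 2 * (1 / ε * W (grad v (mk (lat x) t))) := by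
    calc _ ≤ 1 / ε * (C ^ 2 * W (grad v (mk (lat x) t))) := by gcongr
      _ = _ := by ring
  have h2 : ε * H₁ ^ 2 ≤ C ^ 2 * (ε * H₂ ^ 2) := by
    calc ε * H₁ ^ 2 ≤ ε * H₂ ^ 2 := by gcongr
      _ ≤ _ := le_mul_of_one_le_left (by positivity) hC2
  have h3 : ε * min (l ^ 2) (H₁ ^ 2) ≤ C ^ 2 * (ε * min (l ^ 2) (H₂ ^ 2)) := by
    calc ε * min (l ^ 2) (H₁ ^ 2) ≤ ε * min (l ^ 2) (H₂ ^ 2) := by gcongr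
      _ ≤ _ := le_mul_of_one_le_left (by positivity) hC2
  unfold eDens eFun
  linarith

/-- The pointwise cost of freezing. The second derivative of `frz`, of order `1 / ε`, multiplies the
distance of the gradient from the well `a ⊗ e_N`. -/
lemma exists_freeze_layer_bound (hwb : WellBounds W a p C) (hp : 2 ≤ p) (hW : ∀ ξ, 0 ≤ W ξ)
    {τ : ℝ} (hτ : 0 < τ) :
    ∃ D, 0 ≤ D ∧ ∀ (ε l t : ℝ) (v : Pt n → Space d) (x : Pt n), 0 < ε → l ≤ 0 →
      Smooth v → eDens W ε l (freeze ε t a v) x + cDens l (freeze ε t a v) x ≤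
        τ / ε + D * (eDens W ε l v (vertMap (frz ε t) x) +
          matNorm (grad v (vertMap (frz ε t) x) - tens a) ^ p / ε) := by
  obtain ⟨K, hK1, hK⟩ := exists_bound_frz
  have hK0 : 0 ≤ K := by linarith
  have hC := hwb.pos
  set K' := √(d * ((n + 1) * (n + 1)) : ℕ) * K with hK'
  have hK'0 : 0 ≤ K' := by positivity
  obtain ⟨D, hD0, hD⟩ := exists_layer_constant hp (M := C * K ^ p + K ^ 2 + K') (by positivity) hτ
  refine ⟨D, hD0, fun ε l t v x hε hl hv => ?_⟩
  set V := freeze ε t a v with hV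
  set z := vertMap (frz ε t) x
  set q := matNorm (grad v z - tens a) with hq
  set H := hessNorm v z
  set e := eDens W ε l v z
  have hele : 1 / ε * W (grad v z) + ε * H ^ 2 ≤ e := le_eFun hε _ _
  have hWg := hW (grad v z)
  have hHe : ε * H ^ 2 ≤ e := by
    have : 0 ≤ 1 / ε * W (grad v z) := by positivity
    linarith
  have hH0 : 0 ≤ H := tensorNorm_nonneg _
  have hq0 : 0 ≤ q := matNorm_nonneg _
  have he0 : 0 ≤ e := eDens_nonneg hW hε _
  have hfac : ∀ j : Fin (n + 1),
      |if j = last n then deriv (frz ε t) (x (last n)) else 1| ≤ K := by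
    intro j; by_cases hj : j = last n
    · simpa [hj] using (hK ε t _ hε).1
    · simpa [hj] using hK1
  have hgV : matNorm (grad V x - tens a) ≤ K * q := by
    have := matNorm_le_of_abs_le (ξ := grad V x - tens a) (ζ := grad v z - tens a)
      (α := K) (b := 0) hK0 le_rfl ?_
    · simpa using this
    · intro i j
      rw [hV, grad_freeze_sub hv, abs_mul, add_zero]
      exact mul_le_mul_of_nonneg_right (hfac j) (abs_nonneg _)
  have hHV : hessNorm V x ≤ K ^ 2 * H + K' * (q / ε) := by
    have := tensorNorm_le_of_abs_le (T := hess V x) (S := hess v z) (α := K ^ 2)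
      (b := K / ε * q) (by positivity) (by positivity) ?_
    · refine this.trans_eq ?_
      rw [hK']; ring
    · intro i j k
      rw [hV, hess_freeze hv]
      refine (abs_add_le _ _).trans (add_le_add ?_ ?_)
      · rw [abs_mul, abs_mul, pow_two]
        exact mul_le_mul_of_nonneg_right (mul_le_mul (hfac j) (hfac k) (abs_nonneg _) hK0)
          (abs_nonneg _)
      · rw [abs_mul]
        refine mul_le_mul ?_ (abs_le_matNorm _ i j) (abs_nonneg _) (by positivity)
        by_cases hj : j = last n <;> by_cases hk : k = j
        · simpa [hj, hk] using (hK ε t _ hε).2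
        · simp only [hk, if_false, abs_zero]; positivity
        · simp only [hj, if_false, ite_self, abs_zero]; positivity
        · simp only [hk, if_false, abs_zero]; positivity
  have hqp0 : 0 ≤ q ^ p := rpow_nonneg hq0 p
  have hWV : W (grad V x) ≤ C * K ^ p * q ^ p := by
    calc W (grad V x) ≤ C * matNorm (grad V x - tens a) ^ p := hwb.upper _
      _ ≤ C * (K * q) ^ p := by
        gcongr
        exact matNorm_nonneg _
      _ = _ := by rw [Real.mul_rpow hK0 hq0]; ring
  have hKp : 0 ≤ K ^ p := rpow_nonneg hK0 p
  have key := hD ε e H q (q ^ p) (W (grad V x)) (hessNorm V x) hε hq0 hH0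
    (tensorNorm_nonneg _) hHe le_rfl ?_ ?_
  · have h1 := eFun_le (W := W) (l := l) hε (grad V x) (hessNorm V x)
    have h2 := cDens_le (u := V) hl x
    unfold eDens
    linarith
  · have h4 : 0 ≤ (K ^ 2 + K') * (q ^ p) := by positivity
    have h5 : 0 ≤ (C * K ^ p + K ^ 2 + K') * (ε * e) := by positivity
    nlinarith
  · have h7 : 0 ≤ q / ε := by positivity
    have h8 : 0 ≤ (C * K ^ p + K') * H := by positivity
    have h9 : 0 ≤ (C * K ^ p + K ^ 2) * (q / ε) := by positivity
    nlinarith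

lemma lintegral_comp_add_le {S T : Set ℝ} {J : ℝ → ENNReal} (c : ℝ) (h : ∀ s ∈ S, s + c ∈ T) :
    ∫⁻ s in S, J (s + c) ≤ ∫⁻ s in T, J s := by
  have h1 := (measurePreserving_add_right (volume : Measure ℝ) c).setLIntegral_comp_preimage_emb
    (measurableEmbedding_addRight c) J T
  rw [← h1]
  exact lintegral_mono_set h

/-- Averaging over the height at which the function is frozen. -/
lemma exists_freeze_height {f g : Pt n → ENNReal} (hf : Measurable f) (hg : Measurable g)
    {ε h : ℝ} (hε : 0 < ε) (hε1 : ε ≤ 1) (hh : 1 < h) {S : Set (Lat n)}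
    (hS : MeasurableSet S) : ∃ t ∈ Icc 2 (1 + h),
      (∫⁻ y in S, f (mk y t)) + ∫⁻ x in cyl S (Icc (t - ε) t), g (vertMap (frz ε t) x) ≤
        ofReal (1 / (h - 1)) * ((∫⁻ x in cyl S (Icc 1 (1 + h)), f x) +
          ofReal ε * ∫⁻ x in cyl S (Icc 1 (1 + h)), g x) := by
  set Jf : ℝ → ENNReal := fun s => ∫⁻ y in S, f (mk y s) with hJf
  set Jg : ℝ → ENNReal := fun s => ∫⁻ y in S, g (mk y s)
  have hJfm : Measurable Jf := (hf.comp measurable_mk).lintegral_prod_left'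
  have hJgm : Measurable Jg := (hg.comp measurable_mk).lintegral_prod_left'
  have hfz : Measurable (frz ε 0) := (contDiff_frz ε 0).continuous.measurable
  have hgm2 : Measurable fun q : ℝ × ℝ => Jg (q.1 + frz ε 0 q.2) :=
    hJgm.comp (measurable_fst.add (hfz.comp measurable_snd))
  have hlay : ∀ t, ∫⁻ x in cyl S (Icc (t - ε) t), g (vertMap (frz ε t) x) ≤
      ∫⁻ r in Icc (-ε) 0, Jg (t + frz ε 0 r) := by
    intro t
    rw [lintegral_cyl_swap (f := fun x => g (vertMap (frz ε t) x))
      (hg.comp (contDiff_vertMap (contDiff_frz ε t)).continuous.measurable) hS measurableSet_Icc]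
    simp only [vertMap_mk]
    change ∫⁻ s in Icc (t - ε) t, Jg (frz ε t s) ≤ _
    have h1 := lintegral_comp_add_le (S := Icc (t - ε) t) (T := Icc (-ε) 0)
      (J := fun r => Jg (t + frz ε 0 r)) (-t)
      (fun s hs => ⟨by linarith [hs.1], by linarith [hs.2]⟩)
    refine le_trans (le_of_eq ?_) h1
    refine lintegral_congr fun s => ?_
    rw [← frz_add]; congr 2; ring
  set F : ℝ → ENNReal := fun t => Jf t + ∫⁻ r in Icc (-ε) 0, Jg (t + frz ε 0 r)
  have hFm : Measurable F := hJfm.add hgm2.lintegral_prod_right'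
  have hvol : volume (Icc 2 (1 + h)) = ofReal (h - 1) := by rw [Real.volume_Icc]; congr 1; ring
  have hpos : 0 < h - 1 := by linarith
  obtain ⟨t, ht, hle⟩ := exists_le_setLAverage (μ := volume) (s := Icc 2 (1 + h)) (f := F)
    (by rw [hvol]; simpa using hpos) (by rw [hvol]; simp) hFm.aemeasurable
  refine ⟨t, ht, (add_le_add le_rfl (hlay t)).trans (hle.trans ?_)⟩
  rw [setLAverage_eq, hvol, one_div, ENNReal.ofReal_inv_of_pos hpos, ENNReal.div_eq_inv_mul,
    lintegral_add_left hJfm]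
  gcongr
  · rw [lintegral_cyl_swap hf hS measurableSet_Icc]
    exact lintegral_mono_set (Set.Icc_subset_Icc (by norm_num) le_rfl)
  · rw [lintegral_lintegral_swap (f := fun t r => Jg (t + frz ε 0 r)) hgm2.aemeasurable]
    calc _ ≤ ∫⁻ _ in Icc (-ε) 0, ∫⁻ x in cyl S (Icc 1 (1 + h)), g x := by
          refine setLIntegral_mono' measurableSet_Icc fun r hr => ?_
          rw [lintegral_cyl_swap hg hS measurableSet_Icc]
          have := frz_zero_mem hε hr
          exact lintegral_comp_add_le (J := Jg) (frz ε 0 r) fun s hs =>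
            ⟨by linarith [hs.1, this.1], by linarith [hs.2, this.2]⟩
      _ = _ := by simp [mul_comm]

/-- If the gradient of `v` is close to `a ⊗ e_N` on a tall column, then `v` can be frozen at some
height without much additional energy, and the energy per unit height above is small. -/
lemma exists_freeze (hwb : WellBounds W a p C) (hp : 2 ≤ p) (hW : ∀ ξ, 0 ≤ W ξ)
    (hWc : Continuous W) {h Emax : ℝ} (hh : 1 < h) (hE : 0 ≤ Emax) :
    ∃ η, 0 < η ∧ ∀ (ε l : ℝ) (v : Pt n → Space d), 0 < ε → ε ≤ η → l ≤ 0 → Smooth v →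
      eInt W ε l v (cyl unitCube (Icc 1 (1 + h))) ≤ ofReal Emax →
      ∫⁻ x in cyl unitCube (Icc 1 (1 + h)),
        ofReal (matNorm (grad v x - tens a) ^ p) ≤ ofReal η →
      ∃ t ∈ Icc 2 (1 + h), ∀ L : ENNReal, L = ofReal (2 * C ^ 2 / (h - 1)) *
        (eInt W ε l v (cyl unitCube (Icc 1 (1 + h))) +
        cInt l v (cyl unitCube (Icc 1 (1 + h))) + 1) →
        (eInt W ε l (freeze ε t a v) (cyl unitCube (Icc 1 t)) ≤
          eInt W ε l v (cyl unitCube (Icc 1 (1 + h))) + L) ∧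
        (cInt l (freeze ε t a v) (cyl unitCube (Icc 1 t)) ≤
          cInt l v (cyl unitCube (Icc 1 (1 + h))) + L) ∧
        eInt W ε l (freeze ε t a v) (cyl unitCube (Icc t (t + 1))) ≤ L ∧
        cInt l (freeze ε t a v) (cyl unitCube (Icc t (t + 1))) ≤ L := by
  have hpos : 0 < h - 1 := by linarith
  have hC1 := hwb.one_le
  obtain ⟨D, hD0, hD⟩ := exists_freeze_layer_bound (n := n) hwb hp hW (τ := 1 / (h - 1))
    (by positivity)
  set η : ℝ := min 1 (1 / (2 * (D + 1) * (Emax + 1)))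
  have hη0 : 0 < η := by positivity
  refine ⟨η, hη0, fun ε l v hε hεη hl hv heK hqK => ?_⟩
  set S := unitCube
  have hSm : MeasurableSet S := measurableSet_latCube 0 1
  have hε1 : ε ≤ 1 := hεη.trans (min_le_left _ _)
  set fe : Pt n → ENNReal := fun x => ofReal (eDens W ε l v x) with hfe
  set fc : Pt n → ENNReal := fun x => ofReal (cDens l v x) with hfc
  set fq : Pt n → ENNReal := fun x => ofReal (matNorm (grad v x - tens a) ^ p) with hfq
  have hfem : Measurable fe := (continuous_eDens hWc hv).measurable.ennreal_ofReal
  have hfcm : Measurable fc := (continuous_cDens hv).measurable.ennreal_ofReal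
  have hfqm : Measurable fq :=
    ((continuous_matNorm.comp ((continuous_grad hv).sub continuous_const)).measurable.pow_const
      p).ennreal_ofReal
  set g : Pt n → ENNReal := fun x => ofReal D * (fe x + ofReal (1 / ε) * fq x) with hg
  have hgm : Measurable g := (hfem.add (hfqm.const_mul _)).const_mul _
  -- a height that is good for the densities on its slice and for the layer estimate below it
  obtain ⟨t, ht, hle⟩ := exists_freeze_height (hfem.add hfcm) hgm hε hε1 hh hSm
  refine ⟨t, ht, fun L hL => ?_⟩
  set eK := ∫⁻ x in cyl S (Icc 1 (1 + h)), fe x with heKdef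
  set cK := ∫⁻ x in cyl S (Icc 1 (1 + h)), fc x
  have hgK : ofReal ε * ∫⁻ x in cyl S (Icc 1 (1 + h)), g x ≤ 1 := by
    simp only [hg]
    rw [lintegral_const_mul (f := fun x => fe x + ofReal (1 / ε) * fq x) _
      (hfem.add (hfqm.const_mul _)), lintegral_add_left hfem, lintegral_const_mul _ hfqm]
    calc _ ≤ ofReal ε * (ofReal D * (ofReal Emax +
          ofReal (1 / ε) * ofReal η)) := by gcongr
      _ = ofReal (ε * (D * (Emax + 1 / ε * η))) := by
          rw [ofReal_mul hε.le, ofReal_mul hD0, ofReal_add hE (by positivity),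
            ofReal_mul (by positivity)]
      _ ≤ 1 := by
          rw [ENNReal.ofReal_le_one]
          have h1 : ε * (D * (Emax + 1 / ε * η)) = D * (ε * Emax + η) := by field_simp
          rw [h1]
          have h2 : η ≤ 1 / (2 * (D + 1) * (Emax + 1)) := min_le_right _ _
          have h3 : ε * Emax + η ≤ (Emax + 1) * (1 / (2 * (D + 1) * (Emax + 1))) := by
            have h4 : ε * Emax ≤ 1 / (2 * (D + 1) * (Emax + 1)) * Emax := by
              gcongr; exact hεη.trans h2
            linarith
          have h5 : (Emax + 1) * (1 / (2 * (D + 1) * (Emax + 1))) = 1 / (2 * (D + 1)) := by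
            field_simp
          rw [h5] at h3
          calc D * (ε * Emax + η) ≤ D * (1 / (2 * (D + 1))) := by gcongr
            _ ≤ 1 := by rw [mul_one_div, div_le_one (by positivity)]; linarith
  have hslice : (∫⁻ y in S, (fe + fc) (mk y t)) +
      ∫⁻ x in cyl S (Icc (t - ε) t), g (vertMap (frz ε t) x) ≤
      ofReal (1 / (h - 1)) * (eK + cK + 1) := by
    refine hle.trans ?_
    gcongr
    exact (lintegral_add_left hfem _).le
  have hL1 : ofReal (1 / (h - 1)) * (eK + cK + 1) + ofReal (1 / (h - 1)) ≤ L := by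
    have h1 : ofReal (1 / (h - 1)) ≤ ofReal (1 / (h - 1)) * (eK + cK + 1) :=
      le_mul_of_one_le_right zero_le le_add_self
    refine (add_le_add le_rfl h1).trans ?_
    rw [← two_mul, hL, ← mul_assoc]
    gcongr
    rw [← ENNReal.ofReal_ofNat, ← ofReal_mul (by norm_num)]
    refine ofReal_mono ?_
    rw [mul_one_div]
    gcongr
    nlinarith
  -- below the layer the function is unchanged, in the layer the estimate applies, and above it
  -- the densities do not depend on the height and are controlled by the slice
  have hsplit : ∀ F : Pt n → ENNReal, ∀ fv : Pt n → ENNReal, (∀ x, x (last n) < t - ε → F x = fv x) →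
      (∀ x, F x ≤ ofReal (1 / (h - 1) / ε) + g (vertMap (frz ε t) x)) →
      ∫⁻ x in cyl S (Icc 1 t), F x ≤ (∫⁻ x in cyl S (Icc 1 (1 + h)), fv x) + L := by
    intro F fv h1 h2
    have hsub : cyl S (Icc 1 t) ⊆
        cyl S (Set.Ico 1 (t - ε)) ∪ cyl S (Icc (t - ε) t) := by
      rintro x ⟨hx1, hx2⟩
      rcases lt_or_ge (x (last n)) (t - ε) with h' | h'
      · exact Or.inl ⟨hx1, hx2.1, h'⟩
      · exact Or.inr ⟨hx1, h', hx2.2⟩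
    refine (lintegral_mono_set hsub).trans ((lintegral_union_le _ _ _).trans (add_le_add ?_ ?_))
    · rw [setLIntegral_congr_fun (measurableSet_cyl hSm measurableSet_Ico)
        (fun x hx => h1 x hx.2.2)]
      exact lintegral_mono_set (cyl_mono le_rfl fun s hs => ⟨hs.1, by linarith [hs.2, ht.2]⟩)
    · refine (lintegral_mono h2).trans ?_
      rw [lintegral_add_left measurable_const, setLIntegral_const,
        volume_cyl hSm measurableSet_Icc, volume_latCube_one, one_mul, Real.volume_Icc,
        ← ofReal_mul (by positivity)]
      have h3 : 1 / (h - 1) / ε * (t - (t - ε)) = 1 / (h - 1) := by field_simp; ring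
      rw [h3, add_comm]
      refine le_trans (add_le_add ?_ le_rfl) hL1
      exact le_add_self.trans hslice
  have hlayer : ∀ x, ofReal (eDens W ε l (freeze ε t a v) x + cDens l (freeze ε t a v) x) ≤
      ofReal (1 / (h - 1) / ε) + g (vertMap (frz ε t) x) := by
    intro x
    refine (ofReal_mono (hD ε l t v x hε hl hv)).trans (ENNReal.ofReal_add_le.trans ?_)
    rw [ofReal_mul hD0]
    simp only [hg, hfe, hfq]
    gcongr
    refine ENNReal.ofReal_add_le.trans (add_le_add le_rfl ?_)
    rw [← ofReal_mul (by positivity)]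
    exact ofReal_mono (by rw [div_eq_inv_mul, one_div])
  have hev : ∀ x : Pt n, x (last n) < t - ε → freeze ε t a v =ᶠ[𝓝 x] v := by
    intro x hx
    have hopen : IsOpen {x : Pt n | x (last n) < t - ε} := isOpen_lt (by fun_prop) continuous_const
    filter_upwards [hopen.mem_nhds hx] with y hy using freeze_of_le hε hy.le
  have hcyl : ∀ F fv : Pt n → ENNReal, Measurable F → Measurable fv →
      (∀ x, t ≤ x (last n) → F x ≤ ofReal (C ^ 2) * fv (mk (lat x) t)) →
      (∀ x, fv x ≤ (fe + fc) x) →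
      ∫⁻ x in cyl S (Icc t (t + 1)), F x ≤ L := by
    intro F fv hF hfv h1 h2
    calc _ ≤ ∫⁻ x in cyl S (Icc t (t + 1)),
          ofReal (C ^ 2) * fv (mk (lat x) t) :=
          setLIntegral_mono' (measurableSet_cyl hSm measurableSet_Icc) fun x hx => h1 x hx.2.1
      _ = ofReal (C ^ 2) * ∫⁻ y in S, fv (mk y t) := by
          have hm : Measurable fun x : Pt n => fv (mk (lat x) t) :=
            hfv.comp (measurable_mk.comp (continuous_lat.measurable.prodMk measurable_const))
          rw [lintegral_const_mul _ hm, lintegral_cyl_swap hm hSm measurableSet_Icc]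
          simp
      _ ≤ ofReal (C ^ 2) * (ofReal (1 / (h - 1)) * (eK + cK + 1)) := by
          gcongr
          refine le_trans ?_ (le_self_add.trans hslice)
          exact lintegral_mono fun y => h2 _
      _ ≤ L := by
          rw [hL, ← mul_assoc, ← ofReal_mul (by positivity)]
          gcongr
          rw [mul_one_div]
          gcongr
          nlinarith
  have hVs := contDiff_freeze ε t a hv
  have hVe : Measurable fun x => ofReal (eDens W ε l (freeze ε t a v) x) :=
    (continuous_eDens hWc hVs).measurable.ennreal_ofReal
  have hVc : Measurable fun x => ofReal (cDens l (freeze ε t a v) x) :=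
    (continuous_cDens hVs).measurable.ennreal_ofReal
  have hC2 : 1 ≤ C ^ 2 := one_le_pow₀ hC1
  refine ⟨hsplit _ fe (fun x hx => ?_) fun x => ?_, hsplit _ fc (fun x hx => ?_) fun x => ?_,
    hcyl _ fe hVe hfem (fun x hx => ?_) fun x => by simp only [Pi.add_apply]; exact le_self_add,
    hcyl _ fc hVc hfcm (fun x hx => ?_) fun x => by simp only [Pi.add_apply]; exact le_add_self⟩
  · simp only [hfe]; rw [eDens_congr (hev x hx)]
  · exact (ofReal_mono (le_add_of_nonneg_right (cDens_nonneg _))).trans (hlayer x)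
  · simp only [hfc]; rw [cDens_congr (hev x hx)]
  · exact (ofReal_mono (le_add_of_nonneg_left (eDens_nonneg hW hε _))).trans (hlayer x)
  · simp only [hfe]
    rw [← ofReal_mul (by positivity)]
    exact ofReal_mono (eDens_freeze_le hwb hp hv hε hx).1
  · simp only [hfc]
    rw [← ofReal_mul (by positivity)]
    refine ofReal_mono ((eDens_freeze_le (l := l) hwb hp hv hε hx).2.trans ?_)
    exact le_mul_of_one_le_left (cDens_nonneg _) hC2

end Freezing

/-! ### A Poincaré inequality on the unit cube -/

section Poincare

variable {n d : ℕ} {p : ℝ}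

lemma rpow_lintegral_le_lintegral_rpow {α : Type*} [MeasurableSpace α] {μ : Measure α}
    [IsProbabilityMeasure μ] {f : α → ENNReal} (hf : AEMeasurable f μ) (hp : 1 ≤ p) :
    (∫⁻ x, f x ∂μ) ^ p ≤ ∫⁻ x, f x ^ p ∂μ := by
  have hp0 : 0 < p := by linarith
  have h := eLpNorm_le_eLpNorm_of_exponent_le (p := 1) (q := ofReal p) (μ := μ) (f := f)
    (by simpa using ofReal_mono hp) hf.aestronglyMeasurable
  rw [eLpNorm_one_eq_lintegral_enorm, eLpNorm_eq_lintegral_rpow_enorm_toReal (by simpa using hp0)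
    (by simp), ENNReal.toReal_ofReal hp0.le] at h
  simp only [enorm_eq_self] at h
  calc _ ≤ ((∫⁻ x, f x ^ p ∂μ) ^ (1 / p)) ^ p := by gcongr
    _ = _ := by rw [← ENNReal.rpow_mul, one_div_mul_cancel hp0.ne', ENNReal.rpow_one]

lemma enorm_sub_rpow_le_of_hasDerivAt {f g : ℝ → Space d} (hg : Continuous g)
    (h : ∀ s, HasDerivAt f (g s) s) (hp : 1 ≤ p) {s t : ℝ} (hs : s ∈ Icc (0 : ℝ) 1)
    (ht : t ∈ Icc (0 : ℝ) 1) :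
    ‖f s - f t‖ₑ ^ p ≤ ∫⁻ r in Icc (0 : ℝ) 1, ‖g r‖ₑ ^ p := by
  have hprob : IsProbabilityMeasure (volume.restrict (Icc (0 : ℝ) 1)) := ⟨by simp⟩
  refine le_trans ?_ (rpow_lintegral_le_lintegral_rpow hg.enorm.aemeasurable hp)
  gcongr
  have h1 : ∫ r in t..s, g r = f s - f t :=
    intervalIntegral.integral_eq_sub_of_hasDerivAt (fun r _ => h r) (hg.intervalIntegrable _ _)
  rw [← h1, ← ofReal_norm, intervalIntegral.norm_integral_eq_norm_integral_uIoc, ofReal_norm]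
  refine (enorm_integral_le_lintegral_enorm _).trans (lintegral_mono_set ?_)
  intro r hr
  exact ⟨(le_min ht.1 hs.1).trans hr.1.le, hr.2.trans (max_le ht.2 hs.2)⟩

lemma lintegral_latCube_succ {F : (Lat (n + 1)) → ENNReal} (hF : Measurable F) :
    ∫⁻ x in latCube (n + 1) 0 1, F x =
      ∫⁻ s in Icc (0 : ℝ) 1, ∫⁻ y in unitCube, F (cons s y) := by
  have h1 := (volume_preserving_piFinSuccAbove (fun _ : Fin (n + 1) => ℝ) 0).symm
  have h2 : Measurable fun q : ℝ × (Lat n) => F (cons q.1 q.2) :=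
    hF.comp (by fun_prop)
  rw [← h1.setLIntegral_comp_preimage (measurableSet_latCube _ _) hF]
  have h3 : (MeasurableEquiv.piFinSuccAbove (fun _ : Fin (n + 1) => ℝ) 0).symm ⁻¹'
      latCube (n + 1) 0 1 = Icc (0 : ℝ) 1 ×ˢ unitCube := by
    ext q
    simp only [Set.mem_preimage, mem_latCube, Set.mem_prod, Fin.forall_fin_succ]
    simp [MeasurableEquiv.piFinSuccAbove, Fin.insertNthEquiv]
  rw [h3, Measure.volume_eq_prod, ← Measure.prod_restrict]
  have h4 : ∀ q : ℝ × (Lat n), F ((MeasurableEquiv.piFinSuccAbove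
      (fun _ : Fin (n + 1) => ℝ) 0).symm q) = F (cons q.1 q.2) := by
    intro q; congr 1
    ext i; refine Fin.cases ?_ (fun j => ?_) i <;>
      simp [MeasurableEquiv.piFinSuccAbove, Fin.insertNthEquiv]
  simp only [h4]
  exact lintegral_prod (fun q : ℝ × (Lat n) => F (cons q.1 q.2)) h2.aemeasurable

lemma continuous_cons : Continuous fun q : ℝ × (Lat n) =>
    (cons q.1 q.2 : Lat (n + 1)) := by
  refine continuous_pi fun i => ?_
  refine Fin.cases ?_ (fun j => ?_) i
  · simpa using continuous_fst
  · simpa [Function.comp_def] using (continuous_apply j).comp continuous_snd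

lemma lintegral_const_mul_add {α : Type*} [MeasurableSpace α] {μ : Measure α} [SFinite μ]
    {S : Set α} {I : Set ℝ} (hI : volume I = 1) (hS : μ S = 1) (K : ENNReal) {G : α → ENNReal}
    {H : ℝ → α → α → ENNReal} (hG : Measurable G)
    (hH : Measurable fun q : (ℝ × α) × α => H q.1.1 q.1.2 q.2) :
    ∫⁻ _ in I, ∫⁻ x in S, ∫⁻ t in I, ∫⁻ y in S, K * (G x + H t x y) ∂μ ∂volume ∂μ =
      K * ((∫⁻ x in S, G x ∂μ) + ∫⁻ t in I, ∫⁻ x in S, ∫⁻ y in S, H t x y ∂μ ∂μ) := by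
  have hH2 : Measurable fun q : ℝ × α => ∫⁻ y in S, H q.1 q.2 y ∂μ := hH.lintegral_prod_right'
  have e1 : ∀ x t, ∫⁻ y in S, K * (G x + H t x y) ∂μ = K * (G x + ∫⁻ y in S, H t x y ∂μ) := by
    intro x t
    have hm : Measurable fun y => H t x y := hH.comp (measurable_prodMk_left (x := (t, x)))
    rw [lintegral_const_mul _ (hm.const_add _), lintegral_add_left measurable_const]
    simp [hS]
  have e2 : ∀ x, ∫⁻ t in I, K * (G x + ∫⁻ y in S, H t x y ∂μ) =
      K * (G x + ∫⁻ t in I, ∫⁻ y in S, H t x y ∂μ) := by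
    intro x
    have hm : Measurable fun t => ∫⁻ y in S, H t x y ∂μ :=
      hH2.comp (measurable_id.prodMk measurable_const)
    rw [lintegral_const_mul _ (hm.const_add _), lintegral_add_left measurable_const]
    simp [hI]
  have hsw : Measurable fun q : α × ℝ => ∫⁻ y in S, H q.2 q.1 y ∂μ := hH2.comp measurable_swap
  simp only [e1, e2]
  have hsw2 : Measurable fun x => ∫⁻ t in I, ∫⁻ y in S, H t x y ∂μ := hsw.lintegral_prod_right'
  rw [lintegral_const, Measure.restrict_apply_univ, hI, mul_one,
    lintegral_const_mul _ (f := fun x => G x + ∫⁻ t in I, ∫⁻ y in S, H t x y ∂μ) (hG.add hsw2),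
    lintegral_add_left hG, lintegral_lintegral_swap hsw.aemeasurable]

/-- The mean oscillation of a function over the unit cube is controlled by its partial derivatives:
one coordinate is changed at a time. -/
lemma lintegral_oscillation_le (hp : 1 < p) : ∀ {n : ℕ} (f : (Lat n) → Space d)
    (g : Fin n → (Lat n) → Space d), Continuous f → (∀ j, Continuous (g j)) →
    (∀ j x, HasDerivAt (fun s => f (Function.update x j s)) (g j x) (x j)) →
    ∫⁻ x in unitCube, ∫⁻ y in unitCube, ‖f x - f y‖ₑ ^ p ≤
      (2 ^ (p - 1)) ^ n * ∑ j, ∫⁻ x in unitCube, ‖g j x‖ₑ ^ p := by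
  intro n
  induction n with
  | zero =>
    intro f g _ _ _
    have h : ∀ x y : Fin 0 → ℝ, ‖f x - f y‖ₑ ^ p = 0 := fun x y => by
      rw [Subsingleton.elim x y]; simp; linarith
    simp [h]
  | succ n ih =>
    intro f g hf hg hfg
    set S := latCube n 0 1 with hS
    set I := Icc (0 : ℝ) 1 with hI
    have hvS : volume S = 1 := volume_latCube_one 0
    have hvI : volume I = 1 := by simp [hI]
    have hcons := continuous_cons (n := n)
    have hFm : Measurable fun q : (Lat (n + 1)) × (Lat (n + 1)) => ‖f q.1 - f q.2‖ₑ ^ p :=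
      ((hf.comp continuous_fst).sub (hf.comp continuous_snd)).enorm.measurable.pow_const p
    have hFo : Measurable fun x => ∫⁻ y in latCube (n + 1) 0 1, ‖f x - f y‖ₑ ^ p :=
      hFm.lintegral_prod_right'
    have hgm : ∀ j, Measurable fun x => ‖g j x‖ₑ ^ p := fun j => (hg j).enorm.measurable.pow_const p
    have hA : (1 : ENNReal) ≤ 2 ^ (p - 1) := ENNReal.one_le_rpow (by norm_num) (by linarith)
    have h1 : ∀ s ∈ I, ∀ t ∈ I, ∀ x y : Lat n, ‖f (cons s x) - f (cons t y)‖ₑ ^ p ≤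
          2 ^ (p - 1) * ((∫⁻ r in I, ‖g 0 (cons r x)‖ₑ ^ p) +
            ‖f (cons t x) - f (cons t y)‖ₑ ^ p) := by
      intro s hs t ht x y
      have h2 : ‖f (cons s x) - f (cons t x)‖ₑ ^ p ≤
          ∫⁻ r in I, ‖g 0 (cons r x)‖ₑ ^ p := by
        refine enorm_sub_rpow_le_of_hasDerivAt (f := fun s => f (cons s x))
          (g := fun s => g 0 (cons s x))
          ((hg 0).comp (hcons.comp (continuous_id.prodMk continuous_const))) (fun r => ?_) hp.le hs ht
        have := hfg 0 (cons r x)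
        simpa [Fin.update_cons_zero] using this
      have h3 : ‖f (cons s x) - f (cons t y)‖ₑ ≤
          ‖f (cons s x) - f (cons t x)‖ₑ + ‖f (cons t x) - f (cons t y)‖ₑ := by
        rw [← sub_add_sub_cancel (f (cons s x)) (f (cons t x)) (f (cons t y))]
        exact enorm_add_le _ _
      calc _ ≤ (‖f (cons s x) - f (cons t x)‖ₑ +
            ‖f (cons t x) - f (cons t y)‖ₑ) ^ p := by gcongr
        _ ≤ _ := ENNReal.rpow_add_le_mul_rpow_add_rpow _ _ hp.le
        _ ≤ _ := by gcongr
    set G : (Lat n) → ENNReal := fun x => ∫⁻ r in I, ‖g 0 (cons r x)‖ₑ ^ p with hG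
    set H : ℝ → (Lat n) → (Lat n) → ENNReal :=
      fun t x y => ‖f (cons t x) - f (cons t y)‖ₑ ^ p
    have hg0 : Measurable fun q : (Lat n) × ℝ => ‖g 0 (cons q.2 q.1)‖ₑ ^ p :=
      (hgm 0).comp (hcons.comp (continuous_snd.prodMk continuous_fst)).measurable
    have hGm : Measurable G := hg0.lintegral_prod_right'
    have hHc : Continuous fun q : (ℝ × (Lat n)) × (Lat n) =>
        f (cons q.1.1 q.1.2) - f (cons q.1.1 q.2) :=
      (hf.comp (hcons.comp continuous_fst)).sub
        (hf.comp (hcons.comp ((continuous_fst.comp continuous_fst).prodMk continuous_snd)))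
    have hHm : Measurable fun q : (ℝ × (Lat n)) × (Lat n) => H q.1.1 q.1.2 q.2 :=
      hHc.enorm.measurable.pow_const p
    calc ∫⁻ x in latCube (n + 1) 0 1, ∫⁻ y in latCube (n + 1) 0 1, ‖f x - f y‖ₑ ^ p
        = ∫⁻ s in I, ∫⁻ x in S, ∫⁻ t in I, ∫⁻ y in S,
            ‖f (cons s x) - f (cons t y)‖ₑ ^ p := by
          rw [lintegral_latCube_succ
            (F := fun x => ∫⁻ y in latCube (n + 1) 0 1, ‖f x - f y‖ₑ ^ p) hFo]
          refine lintegral_congr fun s => lintegral_congr fun x => ?_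
          rw [lintegral_latCube_succ (F := fun y => ‖f (cons s x) - f y‖ₑ ^ p)
            ((continuous_const.sub hf).enorm.measurable.pow_const p)]
      _ ≤ ∫⁻ s in I, ∫⁻ x in S, ∫⁻ t in I, ∫⁻ y in S, 2 ^ (p - 1) * (G x + H t x y) := by
          refine setLIntegral_mono' measurableSet_Icc fun s hs => lintegral_mono fun x =>
            setLIntegral_mono' measurableSet_Icc fun t ht => lintegral_mono fun y => ?_
          exact h1 s hs t ht x y
      _ = 2 ^ (p - 1) * ((∫⁻ x in S, G x) + ∫⁻ t in I, ∫⁻ x in S, ∫⁻ y in S, H t x y) :=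
           lintegral_const_mul_add hvI hvS _ hGm hHm
      _ ≤ 2 ^ (p - 1) * ((∫⁻ x in S, G x) + ∫⁻ t in I, (2 ^ (p - 1)) ^ n *
            ∑ j : Fin n, ∫⁻ x in S, ‖g j.succ (cons t x)‖ₑ ^ p) := by
          gcongr with t
          refine ih (fun x => f (cons t x)) (fun j x => g j.succ (cons t x))
            (hf.comp (hcons.comp (continuous_const.prodMk continuous_id)))
            (fun j => (hg _).comp (hcons.comp (continuous_const.prodMk continuous_id)))
            fun j x => ?_
          have := hfg j.succ (cons t x)
          simpa [Fin.cons_update] using this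
      _ ≤ (2 ^ (p - 1)) ^ (n + 1) * ∑ j, ∫⁻ x in latCube (n + 1) 0 1, ‖g j x‖ₑ ^ p := by
          have hsm : ∀ j, Measurable fun t : ℝ => ∫⁻ x in S, ‖g j (cons t x)‖ₑ ^ p :=
            fun j => Measurable.lintegral_prod_right'
              (f := fun q : ℝ × (Lat n) => ‖g j (cons q.1 q.2)‖ₑ ^ p)
              ((hgm j).comp hcons.measurable)
          have e3 : ∀ j, ∫⁻ x in latCube (n + 1) 0 1, ‖g j x‖ₑ ^ p =
              ∫⁻ t in I, ∫⁻ x in S, ‖g j (cons t x)‖ₑ ^ p :=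
            fun j => lintegral_latCube_succ (hgm j)
          have e4 : ∫⁻ x in S, G x = ∫⁻ x in latCube (n + 1) 0 1, ‖g 0 x‖ₑ ^ p := by
            rw [e3, hG, lintegral_lintegral_swap hg0.aemeasurable]
          have e5 : ∫⁻ t in I, (2 ^ (p - 1)) ^ n *
              ∑ j : Fin n, ∫⁻ x in S, ‖g j.succ (cons t x)‖ₑ ^ p =
              (2 ^ (p - 1)) ^ n * ∑ j : Fin n, ∫⁻ t in I, ∫⁻ x in S,
                ‖g j.succ (cons t x)‖ₑ ^ p := by
            rw [lintegral_const_mul _ (Finset.measurable_sum _ fun j _ => hsm _),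
              lintegral_finsetSum _ fun j _ => hsm _]
          rw [e5, e4, Fin.sum_univ_succ, pow_succ']
          simp only [e3, mul_add, ← mul_assoc]
          gcongr
          exact le_mul_of_one_le_right zero_le (one_le_pow₀ hA)

/-- Some value of the function serves as the constant in the Poincaré inequality. -/
lemma exists_lintegral_sub_le (hp : 1 < p) (f : (Lat n) → Space d)
    (g : Fin n → (Lat n) → Space d) (hf : Continuous f) (hg : ∀ j, Continuous (g j))
    (hfg : ∀ j x, HasDerivAt (fun s => f (Function.update x j s)) (g j x) (x j)) :
    ∃ c, ∫⁻ y in unitCube, ‖f y - c‖ₑ ^ p ≤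
      (2 ^ (p - 1)) ^ n * ∑ j, ∫⁻ x in unitCube, ‖g j x‖ₑ ^ p := by
  have hm : Measurable fun q : (Lat n) × (Lat n) => ‖f q.1 - f q.2‖ₑ ^ p :=
    ((hf.comp continuous_fst).sub (hf.comp continuous_snd)).enorm.measurable.pow_const p
  obtain ⟨x, -, hx⟩ := exists_le_setLAverage (μ := volume) (s := unitCube)
    (f := fun x => ∫⁻ y in unitCube, ‖f x - f y‖ₑ ^ p) (by rw [volume_latCube_one]; simp)
    (by rw [volume_latCube_one]; simp) hm.lintegral_prod_right'.aemeasurable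
  rw [setLAverage_eq, volume_latCube_one, div_one] at hx
  refine ⟨f x, le_trans (le_of_eq ?_) (hx.trans (lintegral_oscillation_le hp f g hf hg hfg))⟩
  refine lintegral_congr fun y => ?_
  rw [enorm_sub_rev]

end Poincare

/-! ### Blending two functions along one coordinate -/

section Blending

variable {n d : ℕ}

/-- The function `V + φ(x_i) θ`. -/
def blend (i₀ : Fin (n + 1)) (φ : ℝ → ℝ) (V θ : Pt n → Space d) (x : Pt n) : Space d :=
  V x + φ (x i₀) • θ x

variable {V θ : Pt n → Space d} {φ : ℝ → ℝ} {i₀ : Fin (n + 1)}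

lemma contDiff_blend (i₀ : Fin (n + 1)) (hφ : Smooth φ) (hV : Smooth V)
    (hθ : Smooth θ) : Smooth (blend i₀ φ V θ) :=
  hV.add ((smooth_comp_coord hφ i₀).smul hθ)

lemma grad_blend (hφ : Smooth φ) (hV : Smooth V) (hθ : Smooth θ)
    (x : Pt n) (i : Fin d) (j : Fin (n + 1)) :
    grad (blend i₀ φ V θ) x i j = grad V x i j + (φ (x i₀) * grad θ x i j +
      (if j = i₀ then deriv φ (x i₀) else 0) * θ x i) := by
  change pd j (fun y => V y i + φ (y i₀) * θ y i) x = _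
  rw [pd_add (f := fun y => V y i) (g := fun y => φ (y i₀) * θ y i)
    (smooth_diff (ContDiff.coord hV i))
    (smooth_diff ((smooth_comp_coord hφ i₀).mul (ContDiff.coord hθ i))),
    pd_coord_mul (g := fun y => θ y i) hφ (ContDiff.coord hθ i)]
  rfl

lemma hess_blend (hφ : Smooth φ) (hV : Smooth V) (hθ : Smooth θ)
    (x : Pt n) (i : Fin d) (j k : Fin (n + 1)) :
    hess (blend i₀ φ V θ) x i j k = hess V x i j k + (φ (x i₀) * hess θ x i j k +
      (if k = i₀ then deriv φ (x i₀) else 0) * grad θ x i j +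
      (if j = i₀ then deriv φ (x i₀) else 0) * grad θ x i k +
      (if j = i₀ then (if k = i₀ then deriv (deriv φ) (x i₀) else 0) else 0) * θ x i) := by
  change pd k (pd j (fun y => V y i + φ (y i₀) * θ y i)) x = _
  rw [pd_pd_add (f := fun y => V y i) (g := fun y => φ (y i₀) * θ y i) (ContDiff.coord hV i)
    ((smooth_comp_coord hφ i₀).mul (ContDiff.coord hθ i)),
    pd_pd_coord_mul (g := fun y => θ y i) hφ (ContDiff.coord hθ i)]
  rfl

lemma abs_coord_le_norm (v : Space d) (i : Fin d) : |v i| ≤ ‖v‖ := by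
  simpa using PiLp.norm_apply_le v i

/-- If `θ` is the difference between an affine function of gradient `A` and `V`, up to second order
at `x`, then blending moves the gradient towards `A`. -/
lemma norms_blend_le {A : Mat d n} {K₁ K₂ : ℝ} (hφ : Smooth φ)
    (hV : Smooth V) (hθ : Smooth θ) {x : Pt n}
    (hφ01 : φ (x i₀) ∈ Icc (0 : ℝ) 1) (h1 : |deriv φ (x i₀)| ≤ K₁)
    (h2 : |deriv (deriv φ) (x i₀)| ≤ K₂)
    (hg : ∀ i j, grad θ x i j = -(grad V x - A) i j) (hh : ∀ i j k, hess θ x i j k = -hess V x i j k) :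
    matNorm (grad (blend i₀ φ V θ) x - A) ≤
        matNorm (grad V x - A) + √(d * (n + 1) : ℕ) * (K₁ * ‖θ x‖) ∧
      hessNorm (blend i₀ φ V θ) x ≤ hessNorm V x +
        √(d * ((n + 1) * (n + 1)) : ℕ) * (2 * K₁ * matNorm (grad V x - A) + K₂ * ‖θ x‖) := by
  have hK1 : 0 ≤ K₁ := (abs_nonneg _).trans h1
  have hK2 : 0 ≤ K₂ := (abs_nonneg _).trans h2
  have hq := matNorm_nonneg (grad V x - A)
  have hf : |1 - φ (x i₀)| ≤ 1 := abs_le.2 ⟨by linarith [hφ01.2], by linarith [hφ01.1]⟩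
  have hif : ∀ j : Fin (n + 1), |if j = i₀ then deriv φ (x i₀) else 0| ≤ K₁ := by
    intro j; split_ifs
    · exact h1
    · simpa using hK1
  have hif2 : ∀ j k : Fin (n + 1),
      |if j = i₀ then (if k = i₀ then deriv (deriv φ) (x i₀) else 0) else 0| ≤ K₂ := by
    intro j k; split_ifs
    · exact h2
    · simpa using hK2
    · simpa using hK2
  constructor
  · have := matNorm_le_of_abs_le (ξ := grad (blend i₀ φ V θ) x - A) (ζ := grad V x - A) (α := 1)
      (b := K₁ * ‖θ x‖) zero_le_one (by positivity) ?_
    · simpa using this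
    · intro i j
      have e : (grad (blend i₀ φ V θ) x - A) i j = (1 - φ (x i₀)) * (grad V x - A) i j +
          (if j = i₀ then deriv φ (x i₀) else 0) * θ x i := by
        rw [Matrix.sub_apply, grad_blend hφ hV hθ, hg]; simp only [Matrix.sub_apply]; ring
      rw [e]
      refine (abs_add_le _ _).trans (add_le_add ?_ ?_)
      · rw [abs_mul]; exact mul_le_mul_of_nonneg_right hf (abs_nonneg _)
      · rw [abs_mul]; exact mul_le_mul (hif j) (abs_coord_le_norm _ _) (abs_nonneg _) hK1
  · have := tensorNorm_le_of_abs_le (T := hess (blend i₀ φ V θ) x) (S := hess V x) (α := 1)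
      (b := 2 * K₁ * matNorm (grad V x - A) + K₂ * ‖θ x‖) zero_le_one (by positivity) ?_
    · simpa using this
    · intro i j k
      have e : hess (blend i₀ φ V θ) x i j k = (1 - φ (x i₀)) * hess V x i j k +
          (((if k = i₀ then deriv φ (x i₀) else 0) * -(grad V x - A) i j +
          (if j = i₀ then deriv φ (x i₀) else 0) * -(grad V x - A) i k) +
          (if j = i₀ then (if k = i₀ then deriv (deriv φ) (x i₀) else 0) else 0) * θ x i) := by
        rw [hess_blend hφ hV hθ, hh, hg, hg]; ring
      have hb : ∀ j k, |(if k = i₀ then deriv φ (x i₀) else 0) * -(grad V x - A) i j| ≤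
          K₁ * matNorm (grad V x - A) := by
        intro j k
        rw [abs_mul, abs_neg]
        exact mul_le_mul (hif k) (abs_le_matNorm _ _ _) (abs_nonneg _) hK1
      rw [e]
      refine (abs_add_le _ _).trans (add_le_add ?_ ?_)
      · rw [abs_mul]; exact mul_le_mul_of_nonneg_right hf (abs_nonneg _)
      · refine (abs_add_le _ _).trans (add_le_add ((abs_add_le _ _).trans ?_) ?_)
        · linarith [hb j k, hb k j]
        · rw [abs_mul]; exact mul_le_mul (hif2 j k) (abs_coord_le_norm _ _) (abs_nonneg _) hK2

/-- The affine function `x ↦ x_N a + c`. -/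
def affineLast (a c : Space d) (x : Pt n) : Space d := x (last n) • a + c

lemma contDiff_affineLast (a c : Space d) : Smooth (affineLast a c : Pt n → Space d) :=
  ((smooth_comp_coord contDiff_id (last n)).smul contDiff_const).add contDiff_const

lemma grad_affineLast (a c : Space d) (x : Pt n) : grad (affineLast a c) x = tens a := by
  ext i j
  change pd j (fun y : Pt n => (fun s => s * a i + c i) (y (last n))) x = _
  have hs : Smooth fun s : ℝ => s * a i + c i := (contDiff_id.mul contDiff_const).add contDiff_const
  rw [pd_comp_coord (smooth_diff hs)]
  by_cases hj : j = last n
  · subst hj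
    simp [tensorLast_last]
  · simp [hj, tensorLast_of_ne a i hj]

lemma hess_affineLast (a c : Space d) (x : Pt n) : hess (affineLast a c) x = 0 := by
  ext i j k
  have h : (pd j fun y : Pt n => affineLast a c y i) = fun _ => tensorLast n a i j := by
    ext y; exact congrFun (congrFun (grad_affineLast a c y) i) j
  change pd k (pd j fun y : Pt n => affineLast a c y i) x = 0
  rw [h, pd_const]

lemma grad_sub (hV : Smooth V) (hθ : Smooth θ) (x : Pt n) (i : Fin d)
    (j : Fin (n + 1)) : grad (fun y => V y - θ y) x i j = grad V x i j - grad θ x i j := by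
  change pd j (fun y => V y i - θ y i) x = _
  rw [pd_sub (smooth_diff (ContDiff.coord hV i))
    (smooth_diff (ContDiff.coord hθ i))]
  rfl

lemma hess_sub (hV : Smooth V) (hθ : Smooth θ) (x : Pt n) (i : Fin d) (j k : Fin (n + 1)) :
    hess (fun y => V y - θ y) x i j k = hess V x i j k - hess θ x i j k := by
  change pd k (pd j (fun y => V y i - θ y i)) x = _
  rw [pd_pd_sub (ContDiff.coord hV i) (ContDiff.coord hθ i)]
  rfl

lemma tensorNorm_zero {m : ℕ} : tensorNorm (0 : Fin d → Fin m → Fin m → ℝ) = 0 := by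
  simp [tensorNorm]

variable {W : Mat d n → ℝ} {a : Space d} {p C ε l : ℝ}

lemma WellBounds.zero (hwb : WellBounds W a p C) (hp : 2 ≤ p) (hW : ∀ ξ, 0 ≤ W ξ) :
    W (tens a) = 0 := by
  refine le_antisymm ?_ (hW _)
  have := hwb.upper (tens a)
  rwa [sub_self, matNorm_zero, Real.zero_rpow (by linarith), mul_zero] at this

lemma eDens_affineLast (hwb : WellBounds W a p C) (hp : 2 ≤ p) (hW : ∀ ξ, 0 ≤ W ξ)
    (c : Space d) (x : Pt n) : eDens W ε l (affineLast a c) x = 0 := by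
  have h : (0 : ℝ) ≤ l ^ 2 := sq_nonneg l
  simp [eDens, eFun, grad_affineLast, hess_affineLast, tensorNorm_zero, hwb.zero hp hW, h]

lemma cDens_affineLast (hl : l ≤ 0) (c : Space d) (x : Pt n) :
    cDens l (affineLast a c) x = 0 := by
  simp [cDens, hess_affineLast, tensorNorm_zero, hl]

end Blending

/-! ### Closing a frozen function by an affine one -/

section Closing

variable {n d : ℕ} {W : Mat d n → ℝ} {a : Space d} {p C : ℝ}

lemma add_rpow_le {x y : ℝ} (hx : 0 ≤ x) (hy : 0 ≤ y) (hp : 0 ≤ p) :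
    (x + y) ^ p ≤ 2 ^ p * (x ^ p + y ^ p) := by
  have h : x + y ≤ 2 * max x y := by
    rw [two_mul]; exact add_le_add (le_max_left _ _) (le_max_right _ _)
  have hm : 0 ≤ max x y := hx.trans (le_max_left _ _)
  calc (x + y) ^ p ≤ (2 * max x y) ^ p := rpow_le_rpow (by positivity) h hp
    _ = 2 ^ p * max x y ^ p := Real.mul_rpow (by norm_num) hm
    _ ≤ _ := by
      have h1 := rpow_nonneg hx p
      have h2 := rpow_nonneg hy p
      gcongr
      rcases max_choice x y with h | h <;> rw [h] <;> linarith

/-- The algebra behind the energy of a capped function. -/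
lemma exists_cap_constant (hp : 2 ≤ p) (hC : 1 ≤ C) {K : ℝ} (hK : 1 ≤ K) :
    ∃ D, 1 ≤ D ∧ ∀ ε q r H : ℝ, 0 < ε → ε ≤ 1 → 0 ≤ q → 0 ≤ r → 0 ≤ H →
      1 / ε * (C * (q + K * r) ^ p) + 2 * (ε * (H + K * (q + r)) ^ 2) ≤
        D * (ε * H ^ 2 + (q ^ p + r ^ p) / ε + ε) := by
  have hKp : 1 ≤ K ^ p := Real.one_le_rpow hK (by linarith)
  have h2p : (0 : ℝ) ≤ 2 ^ p := by positivity
  have hCK : 0 ≤ C * 2 ^ p * K ^ p := by positivity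
  refine ⟨C * 2 ^ p * K ^ p + 16 * K ^ 2, by nlinarith, ?_⟩
  intro ε q r H hε hε1 hq hr hH
  have hqp : 0 ≤ q ^ p := rpow_nonneg hq p
  have hrp : 0 ≤ r ^ p := rpow_nonneg hr p
  have h1 : (q + K * r) ^ p ≤ 2 ^ p * K ^ p * (q ^ p + r ^ p) := by
    calc _ ≤ 2 ^ p * (q ^ p + (K * r) ^ p) := add_rpow_le hq (by positivity) (by linarith)
      _ = 2 ^ p * (q ^ p + K ^ p * r ^ p) := by rw [Real.mul_rpow (by linarith) hr]
      _ ≤ 2 ^ p * (K ^ p * q ^ p + K ^ p * r ^ p) := by gcongr; exact le_mul_of_one_le_left hqp hKp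
      _ = _ := by ring
  have hsq : ∀ y : ℝ, 0 ≤ y → y ^ 2 ≤ 1 + y ^ p := by
    intro y hy
    have := rpow_le_add_mul_rpow (q := 2) (p := p) (τ := 1) (by norm_num) hp one_pos hy
    simpa using this
  have h2 : (H + K * (q + r)) ^ 2 ≤ 4 * K ^ 2 * (H ^ 2 + q ^ 2 + r ^ 2) := by
    have : H + K * (q + r) ≤ K * (H + q + r) := by nlinarith
    calc _ ≤ (K * (H + q + r)) ^ 2 := by gcongr
      _ = K ^ 2 * (H + q + r) ^ 2 := by ring
      _ ≤ K ^ 2 * (4 * (H ^ 2 + q ^ 2 + r ^ 2)) := by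
        gcongr; nlinarith [sq_nonneg (H - q), sq_nonneg (H - r), sq_nonneg (q - r)]
      _ = _ := by ring
  have h3 : ε * (q ^ 2 + r ^ 2) ≤ 2 * ε + (q ^ p + r ^ p) / ε := by
    have h4 : ε * (q ^ p + r ^ p) ≤ (q ^ p + r ^ p) / ε := by
      rw [le_div_iff₀ hε]
      have : ε * ε ≤ 1 := by nlinarith
      nlinarith
    nlinarith [hsq q hq, hsq r hr]
  have hX : 0 ≤ (q ^ p + r ^ p) / ε := by positivity
  have h5 : 1 / ε * (C * (q + K * r) ^ p) ≤ C * 2 ^ p * K ^ p * ((q ^ p + r ^ p) / ε) := by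
    calc _ ≤ 1 / ε * (C * (2 ^ p * K ^ p * (q ^ p + r ^ p))) := by gcongr
      _ = _ := by ring
  have h6 : 2 * (ε * (H + K * (q + r)) ^ 2) ≤
      16 * K ^ 2 * (ε * H ^ 2 + (q ^ p + r ^ p) / ε + ε) := by
    calc _ ≤ 2 * (ε * (4 * K ^ 2 * (H ^ 2 + q ^ 2 + r ^ 2))) := by gcongr
      _ = 8 * K ^ 2 * (ε * H ^ 2 + ε * (q ^ 2 + r ^ 2)) := by ring
      _ ≤ 8 * K ^ 2 * (ε * H ^ 2 + (2 * ε + (q ^ p + r ^ p) / ε)) := by gcongr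
      _ ≤ _ := by
        have : 0 ≤ ε * H ^ 2 := by positivity
        nlinarith [sq_nonneg K]
  have h7 : 0 ≤ C * 2 ^ p * K ^ p := by positivity
  have h8 : 0 ≤ ε * H ^ 2 + ε := by positivity
  nlinarith [mul_nonneg h7 h8]

lemma exists_linear_bound (hp : 2 ≤ p) {K : ℝ} (hK : 1 ≤ K) {σ : ℝ} (hσ : 0 < σ) :
    ∃ D, 0 ≤ D ∧ ∀ q r : ℝ, 0 ≤ q → 0 ≤ r → K * (q + r) ≤ σ + D * (q ^ p + r ^ p) := by
  set τ := σ / (2 * K) with hτ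
  have hτ0 : 0 < τ := by positivity
  refine ⟨K * τ ^ (1 - p / 1), by positivity, fun q r hq hr => ?_⟩
  have h := fun (y : ℝ) (hy : 0 ≤ y) =>
    rpow_le_add_mul_rpow (q := 1) (p := p) one_pos (by linarith) hτ0 hy
  have h1 := h q hq
  have h2 := h r hr
  rw [Real.rpow_one] at h1 h2
  calc K * (q + r) ≤ K * ((τ + τ ^ (1 - p / 1) * q ^ p) + (τ + τ ^ (1 - p / 1) * r ^ p)) := by
        gcongr
    _ = 2 * K * τ + K * τ ^ (1 - p / 1) * (q ^ p + r ^ p) := by ring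
    _ = _ := by rw [hτ]; field_simp

end Closing

section Columns

variable {n d : ℕ} {W : Mat d n → ℝ} {a : Space d} {p C ε l : ℝ}

/-! ### Capping a function of constant vertical slope -/

lemma fderiv_single_apply {m : ℕ} {V : Space m → Space d} (hV : Smooth V) (z : Space m)
    (j : Fin m) (i : Fin d) : fderiv ℝ V z (single j 1) i = grad V z i j := by
  rw [grad_apply, pd, show (fun y => V y i) = (proj i : Space d →L[ℝ] ℝ) ∘ V from rfl,
    fderiv_comp z (proj i : Space d →L[ℝ] ℝ).differentiableAt
      (hV.differentiable (by simp) z), ContinuousLinearMap.fderiv]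
  rfl

lemma mk_update (y : Lat n) (t : ℝ) (j : Fin n) (s : ℝ) : mk (Function.update y j s) t =
      mk y t + (s - y j) • single j.castSucc (1 : ℝ) := by
  ext i
  refine lastCases ?_ (fun k => ?_) i
  · simp [Fin.castSucc_ne_last, Ne.symm]
  · by_cases h : k = j
    · subst h; simp
    · simp [h]

lemma hasDerivAt_comp_mk_update {V : Pt n → Space d} (hV : Smooth V)
    (y : Lat n) (t : ℝ) (j : Fin n) :
    HasDerivAt (fun s => V (mk (Function.update y j s) t))
      (fderiv ℝ V (mk y t) (single j.castSucc 1)) (y j) := by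
  have h1 : HasDerivAt (fun s : ℝ => mk (Function.update y j s) t)
      (single j.castSucc (1 : ℝ)) (y j) := by
    simp only [mk_update]
    simpa using (((hasDerivAt_id (y j)).sub_const (y j)).smul_const
      (single j.castSucc (1 : ℝ))).const_add (mk y t)
  have h2 : HasFDerivAt V (fderiv ℝ V (mk y t)) (mk (Function.update y j (y j)) t) := by
    rw [Function.update_eq_self]
    exact (hV.differentiable (by simp) _).hasFDerivAt
  exact h2.comp_hasDerivAt (y j) h1

lemma norm_le_matNorm_of_col {ξ : Mat d n} {v : Space d}
    (j : Fin (n + 1)) (h : ∀ i, v i = ξ i j) : ‖v‖ ≤ matNorm ξ := by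
  rw [EuclideanSpace.norm_eq, matNorm]
  refine Real.sqrt_le_sqrt (sum_le_sum fun i _ => ?_)
  rw [h, Real.norm_eq_abs, sq_abs]
  exact Finset.single_le_sum (f := fun j => ξ i j ^ 2) (fun j _ => sq_nonneg _) (Finset.mem_univ j)

lemma ofReal_norm_rpow {E : Type*} [NormedAddCommGroup E] (v : E) (hp : 0 ≤ p) :
    ofReal (‖v‖ ^ p) = ‖v‖ₑ ^ p := by
  rw [← ENNReal.ofReal_rpow_of_nonneg (norm_nonneg v) hp, ofReal_norm]

lemma isOpen_lt_last (t : ℝ) : IsOpen {x : Pt n | t < x (last n)} :=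
  isOpen_lt continuous_const (by fun_prop)

/-- The function `x ↦ φ(x_N) ω(x)` inherits lateral symmetries. -/
lemma LateralFactor.blend {v V θ : Pt n → Space d} (φ : ℝ → ℝ)
    (hV : LateralFactor v V) (hθ : LateralFactor v θ) :
    LateralFactor v (blend (last n) φ V θ) := by
  intro y y' h s
  simp only [SurfaceTension.blend, mk_last, hV y y' h s, hθ y y' h s]

lemma lateralFactor_refl (v : Pt n → Space d) : LateralFactor v v := fun _ _ h => h

lemma LateralFactor.trans {u v w : Pt n → Space d} (h1 : LateralFactor u v)
    (h2 : LateralFactor v w) : LateralFactor u w := fun y y' h => h2 y y' (h1 y y' h)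

lemma deriv_transition (t H s : ℝ) : deriv (fun z => step ((z - t) / H)) s =
      deriv step ((s - t) / H) / H :=
  (hasDerivAt_comp_sub_div (smooth_diff smooth_step) H t s).deriv

lemma deriv2_transition (t H s : ℝ) : deriv (deriv (fun z => step ((z - t) / H))) s =
      deriv (deriv step) ((s - t) / H) / H / H := by
  rw [show deriv (fun z => step ((z - t) / H)) = fun s =>
    deriv step ((s - t) / H) / H from funext fun s => deriv_transition t H s]
  exact ((hasDerivAt_comp_sub_div (smooth_diff (smooth_deriv smooth_step))
    H t s).div_const H).deriv

lemma contDiff_transition (t H : ℝ) : Smooth fun z => step ((z - t) / H) :=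
  smooth_step.comp ((contDiff_id.sub contDiff_const).div_const H)

/-- A function of slope `a` above the height `t` can be made affine above the height `t + 1`. The
constant is chosen by the Poincaré inequality. -/
lemma exists_cap (hwb : WellBounds W a p C) (hp : 2 ≤ p) (hW : ∀ ξ, 0 ≤ W ξ)
    (hWc : Continuous W) :
    ∃ D, 1 ≤ D ∧ ∀ σ, 0 < σ → ∃ D', 0 ≤ D' ∧ ∀ (ε l t : ℝ) (V : Pt n → Space d),
      0 < ε → ε ≤ 1 → l ≤ 0 → Smooth V →
      (∀ x, t ≤ x (last n) → V x = V (mk (lat x) t) + (x (last n) - t) • a) →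
      ∃ (U : Pt n → Space d) (c : Space d), Smooth U ∧ LateralFactor V U ∧
        (∀ x, x (last n) ≤ t → U x = V x) ∧
        (∀ x, t + 1 ≤ x (last n) → U x = affineLast a c x) ∧
        (eInt W ε l U (cyl unitCube (Ioc t (t + 1))) ≤
          ofReal D * (eInt W ε l V (cyl unitCube (Ioc t (t + 1))) + ofReal ε)) ∧
        (cInt l U (cyl unitCube (Ioc t (t + 1))) ≤
          cInt l V (cyl unitCube (Ioc t (t + 1))) +
            (ofReal σ + ofReal (D' * ε) * eInt W ε l V (cyl unitCube (Ioc t (t + 1))))) := by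
  obtain ⟨K₀, hK₀1, hK₀⟩ := exists_bound_step
  set K : ℝ := (√(d * (n + 1) : ℕ) + 2 * √(d * ((n + 1) * (n + 1)) : ℕ) + 1) * K₀ with hK
  have hs1 := Real.sqrt_nonneg ((d * (n + 1) : ℕ) : ℝ)
  have hs2 := Real.sqrt_nonneg ((d * ((n + 1) * (n + 1)) : ℕ) : ℝ)
  have hK1 : 1 ≤ K := one_le_mul_of_one_le_of_one_le (by linarith) hK₀1
  have hKa : √(d * (n + 1) : ℕ) * K₀ ≤ K := by rw [hK]; gcongr; linarith
  have hKb : 2 * √(d * ((n + 1) * (n + 1)) : ℕ) * K₀ ≤ K := by rw [hK]; gcongr; linarith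
  have hC := hwb.pos
  obtain ⟨D, hD1, hD⟩ := exists_cap_constant hp hwb.one_le hK1
  set M : ℝ := (2 ^ (p - 1)) ^ n * n with hM
  have hM0 : 0 ≤ M := by positivity
  refine ⟨D * (1 + (1 + M) * C), one_le_mul_of_one_le_of_one_le hD1
    (le_add_of_nonneg_right (by positivity)), fun σ hσ => ?_⟩
  obtain ⟨D₁, hD₁0, hD₁⟩ := exists_linear_bound hp hK1 hσ
  refine ⟨D₁ * ((1 + M) * C), by positivity, fun ε l t V hε hε1 hl hV hVt => ?_⟩
  set S := unitCube with hS
  have hSm : MeasurableSet S := measurableSet_latCube 0 1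
  set J := Ioc t (t + 1) with hJ
  have hJm : MeasurableSet J := measurableSet_Ioc
  have hJv : volume J = 1 := by simp [hJ]
  have hSJm := measurableSet_cyl hSm hJm
  set f : (Lat n) → Space d := fun y => V (mk y t) - t • a with hf
  set g : Fin n → (Lat n) → Space d :=
    fun j y => fderiv ℝ V (mk y t) (single j.castSucc 1) with hg
  have hmkc : Continuous fun y : Lat n => mk y t :=
    continuous_mk.comp (continuous_id.prodMk continuous_const)
  have hfc : Continuous f := (hV.continuous.comp hmkc).sub continuous_const
  have hgc : ∀ j, Continuous (g j) := fun j =>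
    (((hV.fderiv_right (m := ∞) (by simp)).clm_apply contDiff_const).continuous).comp hmkc
  -- the Poincaré inequality for the trace of `V` at height `t`, minus `t • a`
  obtain ⟨c, hc⟩ := exists_lintegral_sub_le (p := p) (by linarith) f g hfc hgc fun j x =>
    (hasDerivAt_comp_mk_update hV x t j).sub_const _
  set θ : Pt n → Space d := fun x => c - f (lat x) with hθ
  have hθv : ∀ x, θ x = (c + t • a) - V (vertMap (fun _ => t) x) := by
    intro x; simp only [hθ, hf, vertMap_eq]; abel
  have hvm : ∀ i, Smooth (snoc (α := fun _ => ℝ → ℝ) (fun (_ : Fin n) s => s)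
    (fun _ => t) i) := contDiff_vertMap_coord contDiff_const
  have hθs : Smooth θ := by
    rw [funext hθv]
    exact contDiff_const.sub (hV.comp (contDiff_vertMap contDiff_const))
  have hθeq : ∀ x, t ≤ x (last n) → θ x = affineLast a c x - V x := by
    intro x hx
    rw [hVt x hx]
    simp only [hθ, hf, affineLast, sub_smul]; abel
  have hθev : ∀ x, t < x (last n) → θ =ᶠ[𝓝 x] fun y => affineLast a c y - V y := by
    intro x hx
    filter_upwards [(isOpen_lt_last t).mem_nhds hx] with y hy using hθeq y (le_of_lt hy)
  have hθg : ∀ x, t < x (last n) → ∀ i j, grad θ x i j = -(grad V x - tensorLast n a) i j := by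
    intro x hx i j
    rw [grad_congr (hθev x hx), grad_sub (contDiff_affineLast a c) hV, grad_affineLast,
      Matrix.sub_apply]
    ring
  have hθh : ∀ x, t < x (last n) → ∀ i j k, hess θ x i j k = -hess V x i j k := by
    intro x hx i j k
    rw [hess_congr (hθev x hx), hess_sub (contDiff_affineLast a c) hV, hess_affineLast]
    simp
  -- the gradient of `θ` at height `t`
  have hθg2 : ∀ x i j, grad θ x i j = if j = last n then 0 else -grad V (mk (lat x) t) i j := by
    intro x i j
    have h1 : grad θ x i j = grad (fun y => affineLast 0 (c + t • a) y -
        V (vertMap (fun _ => t) y)) x i j := by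
      congr 2; ext y; rw [hθv]; simp [affineLast]
    have h2 := grad_comp_diagMap hvm hV x i j
    change grad (fun y => V (vertMap (fun _ => t) y)) x i j = _ at h2
    rw [h1, grad_sub (θ := fun y => V (vertMap (fun _ => t) y)) (contDiff_affineLast _ _)
      (hV.comp (contDiff_vertMap contDiff_const)), grad_affineLast, h2, deriv_vert_coord]
    change _ - _ * grad V (vertMap (fun _ => t) x) i j = _
    rw [vertMap_eq]
    by_cases hj : j = last n
    · simp [hj, tensorLast_last]
    · simp [hj, tensorLast_of_ne _ _ hj]
  -- `U` passes from `V` to the affine function between the heights `t` and `t + 1`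
  set φ : ℝ → ℝ := fun z => step ((z - t) / 1) with hφ
  have hφs : Smooth φ := contDiff_transition t 1
  set U := blend (last n) φ V θ with hU
  have hUs : Smooth U := contDiff_blend _ hφs hV hθs
  refine ⟨U, c, hUs, ?_, fun x hx => ?_, fun x hx => ?_, ?_⟩
  · refine LateralFactor.blend φ (lateralFactor_refl V) fun y y' h s => ?_
    simp only [hθ, hf, lat_mk, h t]
  · have : φ (x (last n)) = 0 := zero_of_nonpos (by linarith)
    simp [hU, blend, this]
  · have : φ (x (last n)) = 1 := one_of_one_le (by linarith)
    simp [hU, blend, this, hθeq x (by linarith)]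
  set fe : Pt n → ENNReal := fun x => ofReal (eDens W ε l V x) with hfe
  set fc : Pt n → ENNReal := fun x => ofReal (cDens l V x) with hfcd
  set fq : Pt n → ENNReal := fun x => ofReal (matNorm (grad V x - tens a) ^ p) with hfq
  set fr : Pt n → ENNReal := fun x => ofReal (‖θ x‖ ^ p) with hfr
  have hfem : Measurable fe := (continuous_eDens hWc hV).measurable.ennreal_ofReal
  have hfcm : Measurable fc := (continuous_cDens hV).measurable.ennreal_ofReal
  have hfqm : Measurable fq :=
    ((continuous_matNorm.comp ((continuous_grad hV).sub continuous_const)).measurable.pow_const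
      p).ennreal_ofReal
  have hfrm : Measurable fr := (hθs.continuous.norm.measurable.pow_const p).ennreal_ofReal
  have hq0 : ∀ x, 0 ≤ matNorm (grad V x - tens a) ^ p :=
    fun x => rpow_nonneg (matNorm_nonneg _) p
  have hr0 : ∀ x, 0 ≤ ‖θ x‖ ^ p := fun x => rpow_nonneg (norm_nonneg _) p
  have hQ : ∫⁻ x in cyl S J, fq x ≤ ofReal (C * ε) * ∫⁻ x in cyl S J, fe x := by
    rw [← lintegral_const_mul _ hfem]
    refine setLIntegral_mono' hSJm fun x hx => ?_
    simp only [hfq, hfe]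
    rw [← ofReal_mul (by positivity)]
    refine ofReal_mono ?_
    have h1 : matNorm (grad V x - tens a) ≤ matNorm (latPart (grad V x)) := by
      refine matNorm_le_matNorm fun i j => ?_
      by_cases hj : j = last n
      · have h3 := hθg x hx.2.1 i j
        rw [hθg2, if_pos hj] at h3
        rw [show (grad V x - tensorLast n a) i j = 0 by linarith]; simp
      · simp [latPart, hj, tensorLast_of_ne a i hj]
    have h2 : W (grad V x) ≤ ε * eDens W ε l V x := by
      have h3 := le_eFun (W := W) (l := l) hε (grad V x) (hessNorm V x)
      have h4 : 0 ≤ ε * hessNorm V x ^ 2 := by positivity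
      have h5 : 1 / ε * W (grad V x) ≤ eDens W ε l V x := by unfold eDens; linarith
      rwa [one_div, ← div_eq_inv_mul, div_le_iff₀' hε] at h5
    calc _ ≤ matNorm (latPart (grad V x)) ^ p :=
          rpow_le_rpow (matNorm_nonneg _) h1 (by linarith)
      _ ≤ C * W (grad V x) := hwb.latPart_le hp _
      _ ≤ C * (ε * eDens W ε l V x) := by gcongr
      _ = _ := by ring
  have hR : ∫⁻ x in cyl S J, fr x ≤ ofReal M * ∫⁻ x in cyl S J, fq x := by
    have h1 : ∫⁻ x in cyl S J, fr x = ∫⁻ y in S, ‖f y - c‖ₑ ^ p := by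
      rw [lintegral_cyl_swap hfrm hSm hJm]
      simp only [hfr, ofReal_norm_rpow _ (by linarith : 0 ≤ p), hθ, lat_mk]
      rw [lintegral_const, Measure.restrict_apply_univ, hJv, mul_one]
      simp only [enorm_sub_rev c]
    have h2 : ∀ j : Fin n, ∫⁻ y in S, ‖g j y‖ₑ ^ p ≤ ∫⁻ x in cyl S J, fq x := by
      intro j
      have hm : Measurable fun x : Pt n => ‖g j (lat x)‖ₑ ^ p :=
        (((hgc j).comp continuous_lat).enorm.measurable).pow_const p
      have h3 : ∫⁻ y in S, ‖g j y‖ₑ ^ p = ∫⁻ x in cyl S J, ‖g j (lat x)‖ₑ ^ p := by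
        rw [lintegral_cyl_swap hm hSm hJm]
        simp only [lat_mk]
        rw [lintegral_const, Measure.restrict_apply_univ, hJv, mul_one]
      rw [h3]
      refine setLIntegral_mono' hSJm fun x hx => ?_
      rw [← ofReal_norm_rpow _ (by linarith : 0 ≤ p)]
      refine ofReal_mono (rpow_le_rpow (norm_nonneg _) ?_ (by linarith))
      refine norm_le_matNorm_of_col j.castSucc fun i => ?_
      have h4 := hθg x hx.2.1 i j.castSucc
      rw [hθg2, if_neg (Fin.castSucc_ne_last j)] at h4
      simp only [hg]
      rw [fderiv_single_apply hV]
      linarith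
    rw [h1]
    refine hc.trans ?_
    calc _ ≤ (2 ^ (p - 1)) ^ n * ∑ _j : Fin n, ∫⁻ x in cyl S J, fq x := by
          gcongr with j; exact h2 j
      _ = _ := by
          rw [Finset.sum_const, Finset.card_univ, Fintype.card_fin, nsmul_eq_mul, hM,
            ofReal_mul (by positivity), ofReal_pow (by positivity),
            ← ENNReal.ofReal_rpow_of_pos (by norm_num), ENNReal.ofReal_ofNat,
            ENNReal.ofReal_natCast, mul_assoc]
  have hQR : (∫⁻ x in cyl S J, fq x) + ∫⁻ x in cyl S J, fr x ≤
      ofReal ((1 + M) * C * ε) * ∫⁻ x in cyl S J, fe x := by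
    calc _ ≤ (∫⁻ x in cyl S J, fq x) + ofReal M * ∫⁻ x in cyl S J, fq x := by
          gcongr
      _ = ofReal (1 + M) * ∫⁻ x in cyl S J, fq x := by
          rw [ofReal_add zero_le_one hM0, ofReal_one]; ring
      _ ≤ ofReal (1 + M) * (ofReal (C * ε) * ∫⁻ x in cyl S J, fe x) := by gcongr
      _ = _ := by rw [← mul_assoc, ← ofReal_mul (by positivity), mul_assoc (1 + M)]
  have hpt : ∀ x ∈ cyl S J, matNorm (grad U x - tens a) ≤
      matNorm (grad V x - tens a) + K * ‖θ x‖ ∧ hessNorm U x ≤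
        hessNorm V x + K * (matNorm (grad V x - tens a) + ‖θ x‖) := by
    intro x hx
    have hb1 : |deriv φ (x (last n))| ≤ K₀ := by rw [hφ, deriv_transition, div_one]; exact (hK₀ _).1
    have hb2 : |deriv (deriv φ) (x (last n))| ≤ K₀ := by
      rw [hφ, deriv2_transition, div_one, div_one]; exact (hK₀ _).2
    have h := norms_blend_le hφs hV hθs (x := x)
      ⟨smoothTransition.nonneg _, smoothTransition.le_one _⟩ hb1 hb2
      (hθg x hx.2.1) (hθh x hx.2.1)
    have hq := matNorm_nonneg (grad V x - tens a)
    have hr := norm_nonneg (θ x)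
    refine ⟨h.1.trans ?_, h.2.trans ?_⟩
    · rw [← mul_assoc]; gcongr
    · refine add_le_add le_rfl (le_trans ?_ (mul_le_mul_of_nonneg_right hKb (add_nonneg hq hr)))
      have : 0 ≤ √(d * ((n + 1) * (n + 1)) : ℕ) * K₀ * ‖θ x‖ := by positivity
      nlinarith
  constructor
  · calc _ ≤ ∫⁻ x in cyl S J, ofReal D *
          (fe x + ofReal (1 / ε) * (fq x + fr x) + ofReal ε) := by
          refine setLIntegral_mono' hSJm fun x hx => ?_
          obtain ⟨h1, h2⟩ := hpt x hx
          have hq := matNorm_nonneg (grad V x - tens a)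
          have hr := norm_nonneg (θ x)
          have hH := tensorNorm_nonneg (hess V x)
          have h3 := hD ε _ _ _ hε hε1 hq hr hH
          have he0 : 0 ≤ eDens W ε l V x := eDens_nonneg hW hε x
          have h4 : ε * hessNorm V x ^ 2 ≤ eDens W ε l V x := by
            have h5 := le_eFun (W := W) (l := l) hε (grad V x) (hessNorm V x)
            have h6 : 0 ≤ 1 / ε * W (grad V x) := by have := hW (grad V x); positivity
            unfold eDens; linarith
          simp only [hfe, hfq, hfr]
          rw [← ofReal_add (hq0 x) (hr0 x), ← ofReal_mul (by positivity),
            ← ofReal_add he0 (mul_nonneg (by positivity) (add_nonneg (hq0 x) (hr0 x))),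
            ← ofReal_add (add_nonneg he0 (mul_nonneg (by positivity)
              (add_nonneg (hq0 x) (hr0 x)))) hε.le, ← ofReal_mul (by linarith)]
          refine ofReal_mono ?_
          have h7 : W (grad U x) ≤ C * (matNorm (grad V x - tens a) + K * ‖θ x‖) ^ p := by
            refine (hwb.upper _).trans ?_
            gcongr
            exact matNorm_nonneg _
          calc eDens W ε l U x ≤ 1 / ε * W (grad U x) + 2 * (ε * hessNorm U x ^ 2) :=
                eFun_le hε _ _
            _ ≤ 1 / ε * (C * (matNorm (grad V x - tens a) + K * ‖θ x‖) ^ p) +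
                2 * (ε * (hessNorm V x +
                  K * (matNorm (grad V x - tens a) + ‖θ x‖)) ^ 2) := by
                gcongr
                exact tensorNorm_nonneg _
            _ ≤ _ := h3
            _ ≤ _ := by
                have : D * (ε * hessNorm V x ^ 2) ≤ D * eDens W ε l V x := by gcongr
                have e : (matNorm (grad V x - tens a) ^ p + ‖θ x‖ ^ p) / ε =
                  1 / ε * (matNorm (grad V x - tens a) ^ p + ‖θ x‖ ^ p) := by ring
                rw [e]; linarith
      _ = ofReal D * ((∫⁻ x in cyl S J, fe x) + ofReal (1 / ε) *
            ((∫⁻ x in cyl S J, fq x) + ∫⁻ x in cyl S J, fr x) + ofReal ε) := by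
          have hm1 : Measurable fun x => ofReal (1 / ε) * (fq x + fr x) :=
            (hfqm.add hfrm).const_mul _
          have hm2 : Measurable fun x => fe x + ofReal (1 / ε) * (fq x + fr x) := hfem.add hm1
          have hm3 : Measurable fun x => fe x + ofReal (1 / ε) * (fq x + fr x) +
            ofReal ε := hm2.add_const _
          rw [lintegral_const_mul _ hm3, lintegral_add_left hm2, lintegral_add_left hfem,
            lintegral_const_mul _ (f := fun x => fq x + fr x) (hfqm.add hfrm),
            lintegral_add_left hfqm,
            setLIntegral_const, volume_cyl hSm hJm, hJv, hS, volume_latCube_one]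
          simp
      _ ≤ ofReal D * ((∫⁻ x in cyl S J, fe x) + ofReal (1 / ε) *
            (ofReal ((1 + M) * C * ε) * ∫⁻ x in cyl S J, fe x) + ofReal ε) := by gcongr
      _ = ofReal D * (ofReal (1 + (1 + M) * C) * (∫⁻ x in cyl S J, fe x) + ofReal ε) := by
          rw [← mul_assoc (ofReal (1 / ε)), ← ofReal_mul (by positivity),
            show 1 / ε * ((1 + M) * C * ε) = (1 + M) * C by field_simp,
            ofReal_add zero_le_one (by positivity), ofReal_one, add_mul (1 : ENNReal), one_mul]
      _ ≤ _ := by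
          rw [ofReal_mul (by linarith : 0 ≤ D), mul_assoc]
          gcongr
          rw [mul_add]
          gcongr
          refine le_mul_of_one_le_left zero_le ?_
          rw [ENNReal.one_le_ofReal]
          exact le_add_of_nonneg_right (by positivity)
  · calc _ ≤ ∫⁻ x in cyl S J,
          (fc x + ofReal σ + ofReal D₁ * (fq x + fr x)) := by
          refine setLIntegral_mono' hSJm fun x hx => ?_
          obtain ⟨-, h2⟩ := hpt x hx
          have h3 := hD₁ _ _ (matNorm_nonneg (grad V x - tens a)) (norm_nonneg (θ x))
          have hc0 : 0 ≤ cDens l V x := cDens_nonneg x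
          simp only [hfcd, hfq, hfr]
          rw [← ofReal_add (hq0 x) (hr0 x), ← ofReal_mul hD₁0,
            ← ofReal_add hc0 hσ.le, ← ofReal_add (by linarith)
              (mul_nonneg hD₁0 (add_nonneg (hq0 x) (hr0 x)))]
          refine ofReal_mono (max_le ?_ ?_)
          · have : l + hessNorm V x ≤ cDens l V x := le_max_left _ _
            linarith
          · linarith [mul_nonneg hD₁0 (add_nonneg (hq0 x) (hr0 x))]
      _ = (∫⁻ x in cyl S J, fc x) + ofReal σ + ofReal D₁ *
            ((∫⁻ x in cyl S J, fq x) + ∫⁻ x in cyl S J, fr x) := by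
          have hm2 : Measurable fun x => fc x + ofReal σ := hfcm.add_const _
          rw [lintegral_add_left hm2, lintegral_add_left hfcm,
            lintegral_const_mul _ (f := fun x => fq x + fr x) (hfqm.add hfrm),
            lintegral_add_left hfqm,
            setLIntegral_const, volume_cyl hSm hJm, hJv, hS, volume_latCube_one]
          simp
      _ ≤ (∫⁻ x in cyl S J, fc x) + ofReal σ + ofReal D₁ *
            (ofReal ((1 + M) * C * ε) * ∫⁻ x in cyl S J, fe x) := by gcongr
      _ = _ := by rw [← mul_assoc, ← ofReal_mul hD₁0, add_assoc, mul_assoc D₁]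

/-! ### Continuing a column to the roof -/

lemma lintegral_cyl_congr_ae {S : Set (Lat n)} (hS : MeasurableSet S) {I I' : Set ℝ}
    (hI : MeasurableSet I) (hI' : MeasurableSet I') (h : I =ᵐ[volume] I')
    (F : Pt n → ENNReal) : ∫⁻ x in cyl S I, F x = ∫⁻ x in cyl S I', F x := by
  refine setLIntegral_congr ?_
  rw [ae_eq_set] at h ⊢
  constructor
  · refine measure_mono_null (t := cyl S (I \ I')) (fun x hx => ⟨hx.1.1, hx.1.2, fun h' =>
      hx.2 ⟨hx.1.1, h'⟩⟩) ?_
    rw [volume_cyl hS (hI.diff hI'), h.1, mul_zero]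
  · refine measure_mono_null (t := cyl S (I' \ I)) (fun x hx => ⟨hx.1.1, hx.1.2, fun h' =>
      hx.2 ⟨hx.1.1, h'⟩⟩) ?_
    rw [volume_cyl hS (hI'.diff hI), h.2, mul_zero]

lemma cyl_union (S : Set (Lat n)) (I I' : Set ℝ) :
    cyl S (I ∪ I') = cyl S I ∪ cyl S I' := by
  ext x; simp only [cyl, Set.mem_union, Set.mem_setOf_eq]; tauto

lemma lintegral_cyl_Ioi_le {S : Set (Lat n)} (hS : MeasurableSet S) (s t : ℝ)
    (F : Pt n → ENNReal) : ∫⁻ x in cyl S (Ioi s), F x ≤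
      (∫⁻ x in cyl S (Ioo s t), F x) + ∫⁻ x in cyl S (Ioi t), F x := by
  have h1 : Ioi s ⊆ Ioo s t ∪ Set.Ici t := by grind
  refine (lintegral_mono_set (cyl_mono le_rfl h1)).trans ?_
  rw [cyl_union]
  refine (lintegral_union_le _ _ _).trans (add_le_add le_rfl (le_of_eq ?_))
  exact lintegral_cyl_congr_ae hS measurableSet_Ici measurableSet_Ioi Ioi_ae_eq_Ici.symm F

/-- The additive constant of an affine function is removed at small cost over a large height. -/
lemma exists_lift (hwb : WellBounds W a p C) (hp : 2 ≤ p) (hW : ∀ ξ, 0 ≤ W ξ)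
    {V : Pt n → Space d} (hV : Smooth V) {c : Space d} {s : ℝ}
    (hVs : ∀ x, s ≤ x (last n) → V x = affineLast a c x) {ε l σ : ℝ} (hε : 0 < ε) (hl : l ≤ 0)
    (hσ : 0 < σ) :
    ∃ (U : Pt n → Space d) (T : ℝ), Smooth U ∧ LateralFactor V U ∧
      (∀ x, x (last n) ≤ s → U x = V x) ∧
      (∀ x, T ≤ x (last n) → U x = x (last n) • a) ∧
      eInt W ε l U (cyl unitCube (Ioi s)) ≤ ofReal σ ∧
      cInt l U (cyl unitCube (Ioi s)) ≤ ofReal σ := by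
  obtain ⟨K, hK1, hK⟩ := exists_bound_step
  have hC := hwb.pos
  set y : ℝ := √(d * (n + 1) : ℕ) * (K * ‖c‖) with hy
  set z : ℝ := √(d * ((n + 1) * (n + 1)) : ℕ) * (K * ‖c‖) with hz
  have hy0 : 0 ≤ y := by positivity
  have hz0 : 0 ≤ z := by positivity
  have hyp : 0 ≤ y ^ p := rpow_nonneg hy0 p
  set M : ℝ := 1 / ε * (C * y ^ p) + 2 * (ε * z ^ 2) + z with hM
  have hM0 : 0 ≤ M := by positivity
  -- the densities are at most `M / H ^ 2` over a height `H`, which costs `M / H`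
  set H : ℝ := 1 + M / σ with hH
  have hH1 : 1 ≤ H := le_add_of_nonneg_right (by positivity)
  have hH0 : 0 < H := by linarith
  set φ : ℝ → ℝ := fun r => step ((r - s) / H) with hφ
  have hφs : Smooth φ := contDiff_transition s H
  set θ : Pt n → Space d := fun _ => -c with hθ
  have hθs : Smooth θ := contDiff_const
  set U := blend (last n) φ V θ with hU
  have hUs : Smooth U := contDiff_blend _ hφs hV hθs
  have hUT : ∀ x, s + H ≤ x (last n) → U x = affineLast a 0 x := by
    intro x hx
    have : φ (x (last n)) = 1 := one_of_one_le (by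
      rw [le_div_iff₀ hH0]; linarith)
    simp [hU, blend, this, hVs x (by linarith), hθ, affineLast]
  refine ⟨U, s + H, hUs, LateralFactor.blend φ (lateralFactor_refl V) fun _ _ _ _ => rfl,
    fun x hx => ?_, fun x hx => by simpa [affineLast] using hUT x hx, ?_⟩
  · have : φ (x (last n)) = 0 := zero_of_nonpos
      (div_nonpos_of_nonpos_of_nonneg (by linarith) hH0.le)
    simp [hU, blend, this]
  have hden : ∀ x, s < x (last n) → eDens W ε l U x + cDens l U x ≤ M / H ^ 2 := by
    intro x hx
    have hev : V =ᶠ[𝓝 x] affineLast a c := by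
      filter_upwards [(isOpen_lt_last s).mem_nhds hx] with y hy using hVs y (le_of_lt hy)
    have hg0 : grad V x - tens a = 0 := by rw [grad_congr hev, grad_affineLast, sub_self]
    have hh0 : hess V x = 0 := by rw [hess_congr hev, hess_affineLast]
    have hb1 : |deriv φ (x (last n))| ≤ K / H := by
      rw [hφ, deriv_transition, abs_div, abs_of_pos hH0]
      gcongr; exact (hK _).1
    have hb2 : |deriv (deriv φ) (x (last n))| ≤ K / H ^ 2 := by
      rw [hφ, deriv2_transition, div_div, ← pow_two, abs_div, abs_of_pos (pow_pos hH0 2)]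
      gcongr; exact (hK _).2
    have hθg : ∀ i j, grad θ x i j = 0 := fun i j => pd_const _ _ _
    have hθh : ∀ i j k, hess θ x i j k = 0 := by
      intro i j k
      change pd k (pd j fun _ => (-c) i) x = 0
      rw [show (pd j fun _ : Pt n => (-c) i) = fun _ => 0 from funext fun y => pd_const _ _ _,
        pd_const]
    have h := norms_blend_le (A := tens a) hφs hV hθs (x := x)
      ⟨smoothTransition.nonneg _, smoothTransition.le_one _⟩ hb1 hb2
      (by intro i j; rw [hθg, hg0]; simp) (by intro i j k; rw [hθh, hh0]; simp)
    rw [hg0, hh0, matNorm_zero, tensorNorm_zero] at h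
    have hnθ : ‖θ x‖ = ‖c‖ := by simp [hθ]
    have h1 : matNorm (grad U x - tens a) ≤ y / H := by
      refine h.1.trans (le_of_eq ?_)
      rw [hnθ, hy]; ring
    have h2 : hessNorm U x ≤ z / H ^ 2 := by
      refine h.2.trans (le_of_eq ?_)
      rw [hnθ, hz]; ring
    have h3 : W (grad U x) ≤ C * y ^ p / H ^ 2 := by
      calc _ ≤ C * matNorm (grad U x - tens a) ^ p := hwb.upper _
        _ ≤ C * (y / H) ^ p := by
          gcongr
          exact matNorm_nonneg _
        _ = C * (y ^ p / H ^ p) := by rw [Real.div_rpow hy0 hH0.le]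
        _ ≤ C * (y ^ p / H ^ 2) := by
          gcongr
          rw [← Real.rpow_two]
          exact Real.rpow_le_rpow_of_exponent_le hH1 hp
        _ = _ := by ring
    have h4 : hessNorm U x ^ 2 ≤ z ^ 2 / H ^ 2 := by
      calc _ ≤ (z / H ^ 2) ^ 2 := by
            gcongr
            exact tensorNorm_nonneg _
        _ = z ^ 2 / (H ^ 2 * H ^ 2) := by rw [div_pow]; ring
        _ ≤ z ^ 2 / (1 * H ^ 2) := by
          gcongr
          exact one_le_pow₀ hH1
        _ = _ := by rw [one_mul]
    have h5 := eFun_le (W := W) (l := l) hε (grad U x) (hessNorm U x)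
    have h6 := cDens_le (u := U) hl x
    have h7 : 1 / ε * W (grad U x) ≤ 1 / ε * (C * y ^ p / H ^ 2) := by gcongr
    have h8 : 2 * (ε * hessNorm U x ^ 2) ≤ 2 * (ε * (z ^ 2 / H ^ 2)) := by gcongr
    have h9 : M / H ^ 2 = 1 / ε * (C * y ^ p / H ^ 2) + 2 * (ε * (z ^ 2 / H ^ 2)) + z / H ^ 2 := by
      rw [hM]; ring
    unfold eDens
    linarith
  have hfar : ∀ x, s + H < x (last n) → U =ᶠ[𝓝 x] affineLast a 0 := by
    intro x hx
    filter_upwards [(isOpen_lt_last (s + H)).mem_nhds hx] with y hy using hUT y (le_of_lt hy)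
  have hSm : MeasurableSet unitCube := measurableSet_latCube (n := n) 0 1
  have key : ∀ F : Pt n → ℝ, (∀ x, s < x (last n) → F x ≤ M / H ^ 2) →
      (∀ x, s + H < x (last n) → F x = 0) →
      ∫⁻ x in cyl unitCube (Ioi s), ofReal (F x) ≤ ofReal σ := by
    intro F h1 h2
    refine (lintegral_cyl_Ioi_le hSm s (s + H) _).trans ?_
    have e2 : ∫⁻ x in cyl unitCube (Ioi (s + H)), ofReal (F x) = 0 := by
      rw [setLIntegral_congr_fun (g := fun _ => 0) (measurableSet_cyl hSm measurableSet_Ioi)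
        fun x hx => by simp only [h2 x hx.2, ENNReal.ofReal_zero]]
      simp
    rw [e2, add_zero]
    calc _ ≤ ∫⁻ _ in cyl unitCube (Ioo s (s + H)), ofReal (M / H ^ 2) :=
          setLIntegral_mono' (measurableSet_cyl hSm measurableSet_Ioo) fun x hx =>
            ofReal_mono (h1 x hx.2.1)
      _ = ofReal (M / H ^ 2 * H) := by
          rw [setLIntegral_const, volume_cyl hSm measurableSet_Ioo, volume_latCube_one, one_mul,
            Real.volume_Ioo, add_sub_cancel_left, ← ofReal_mul (by positivity)]
      _ ≤ _ := by
          refine ofReal_mono ?_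
          have e3 : M / H ^ 2 * H = M / H := by field_simp
          rw [e3, div_le_iff₀ hH0, hH, mul_add, mul_div_cancel₀ _ hσ.ne']
          linarith
  refine ⟨key _ (fun x hx => ?_) fun x hx => ?_, key _ (fun x hx => ?_) fun x hx => ?_⟩
  · linarith [hden x hx, cDens_nonneg (l := l) (u := U) x]
  · rw [eDens_congr (hfar x hx), eDens_affineLast hwb hp hW]
  · linarith [hden x hx, eDens_nonneg (l := l) (u := U) hW hε x]
  · rw [cDens_congr (hfar x hx), cDens_affineLast hl]

/-- A function whose gradient is close to `a ⊗ e_N` on a tall column can be continued to `x_N a`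
with little additional energy. -/
lemma exists_top (hwb : WellBounds W a p C) (hp : 2 ≤ p) (hW : ∀ ξ, 0 ≤ W ξ)
    (hWc : Continuous W) :
    ∃ D, 0 ≤ D ∧ ∀ h Emax κ : ℝ, 1 < h → 0 ≤ Emax → 0 < κ → ∃ η, 0 < η ∧
      ∀ (ε l : ℝ) (v : Pt n → Space d), 0 < ε → ε ≤ η → l ≤ 0 → Smooth v →
      ∀ E G : ENNReal,
      eInt W ε l v (cyl unitCube (Icc 1 (1 + h))) = E →
      cInt l v (cyl unitCube (Icc 1 (1 + h))) = G →
      E ≤ ofReal Emax →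
      ∫⁻ x in cyl unitCube (Icc 1 (1 + h)),
        ofReal (matNorm (grad v x - tens a) ^ p) ≤ ofReal η →
      ∃ (V : Pt n → Space d) (T : ℝ), Smooth V ∧ LateralFactor v V ∧
        (∀ x, x (last n) ≤ 1 → V x = v x) ∧
        (∀ x, T ≤ x (last n) → V x = x (last n) • a) ∧
        eInt W ε l V (cyl unitCube (Ioi 1)) ≤
          E + (ofReal (D / (h - 1)) * (E + G + 1) + ofReal κ) ∧
        cInt l V (cyl unitCube (Ioi 1)) ≤
          G + (ofReal (D / (h - 1)) * (E + G + 1) + ofReal κ) := by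
  obtain ⟨D, hD1, hD⟩ := exists_cap hwb hp hW hWc
  have hC := hwb.pos
  refine ⟨(D + 2) * (2 * C ^ 2), by positivity, fun h Emax κ hh hE hκ => ?_⟩
  have hpos : 0 < h - 1 := by linarith
  obtain ⟨D', hD'0, hD'⟩ := hD (κ / 2) (by positivity)
  obtain ⟨η, hη0, hη⟩ := exists_freeze (n := n) hwb hp hW hWc hh hE
  refine ⟨min (min η 1) (min (κ / (2 * D)) (1 / (D' + 1))), by positivity, ?_⟩
  intro ε l v hε hεη hl hv E G hEdef hGdef hEmax hq
  have hε1 : ε ≤ η := hεη.trans ((min_le_left _ _).trans (min_le_left _ _))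
  have hε2 : ε ≤ 1 := hεη.trans ((min_le_left _ _).trans (min_le_right _ _))
  have hε3 : ε ≤ κ / (2 * D) := hεη.trans ((min_le_right _ _).trans (min_le_left _ _))
  have hε4 : ε ≤ 1 / (D' + 1) := hεη.trans ((min_le_right _ _).trans (min_le_right _ _))
  obtain ⟨t, ht, hL⟩ := hη ε l v hε hε1 hl hv (hEdef ▸ hEmax)
    (hq.trans (ofReal_mono ((min_le_left _ _).trans (min_le_left _ _))))
  rw [hEdef, hGdef] at hL
  obtain ⟨hE1, hG1, hE2, hG2⟩ := hL _ rfl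
  set L := ofReal (2 * C ^ 2 / (h - 1)) * (E + G + 1) with hLdef
  set F := freeze ε t a v with hF
  have hFs : Smooth F := contDiff_freeze ε t a hv
  obtain ⟨U, c, hUs, hUF, hU1, hU2, hE3, hG3⟩ := hD' ε l t F hε hε2 hl hFs (by
    intro x hx
    rw [hF, freeze_of_ge hε hx, freeze_of_ge hε (by simp)]
    simp)
  obtain ⟨V, T, hVs, hVU, hV1, hV2, hE4, hG4⟩ := exists_lift hwb hp hW hUs hU2 (l := l) hε hl
    (σ := κ / 2) (by positivity)
  have hSm : MeasurableSet unitCube := measurableSet_latCube (n := n) 0 1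
  refine ⟨V, T, hVs, (lateralFactor_freeze.trans hUF).trans hVU, fun x hx => ?_, hV2, ?_⟩
  · rw [hV1 x (by linarith [ht.1]), hU1 x (by linarith [ht.1]), hF, freeze_of_le hε (by linarith [ht.1])]
  have hopen : ∀ r : ℝ, IsOpen {x : Pt n | x (last n) < r} :=
    fun r => isOpen_lt (by fun_prop) continuous_const
  have hVF : ∀ x, x (last n) < t → V =ᶠ[𝓝 x] F := by
    intro x hx
    filter_upwards [(hopen t).mem_nhds hx] with y hy
    have hy' : y (last n) < t := hy
    rw [hV1 y (by linarith), hU1 y hy'.le]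
  have hVU' : ∀ x, x (last n) < t + 1 → V =ᶠ[𝓝 x] U := by
    intro x hx
    filter_upwards [(hopen (t + 1)).mem_nhds hx] with y hy
    rw [hV1 y (le_of_lt hy)]
  -- the frozen function up to the height `t`, the cap up to `t + 1`, and the lift above
  have hsplit : ∀ (fV fF fU : Pt n → ENNReal),
      (∀ x, x (last n) < t → fV x = fF x) → (∀ x, x (last n) < t + 1 → fV x = fU x) →
      ∫⁻ x in cyl unitCube (Ioi 1), fV x ≤
        (∫⁻ x in cyl unitCube (Icc 1 t), fF x) +
          ((∫⁻ x in cyl unitCube (Ioc t (t + 1)), fU x) +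
            ∫⁻ x in cyl unitCube (Ioi (t + 1)), fV x) := by
    intro fV fF fU h1 h2
    refine (lintegral_cyl_Ioi_le hSm 1 t _).trans (add_le_add ?_
      ((lintegral_cyl_Ioi_le hSm t (t + 1) _).trans (add_le_add ?_ le_rfl)))
    · rw [setLIntegral_congr_fun (measurableSet_cyl hSm measurableSet_Ioo)
        (fun x hx => h1 x hx.2.2)]
      exact lintegral_mono_set (cyl_mono le_rfl Set.Ioo_subset_Icc_self)
    · rw [setLIntegral_congr_fun (measurableSet_cyl hSm measurableSet_Ioo)
        (fun x hx => h2 x hx.2.2)]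
      exact lintegral_mono_set (cyl_mono le_rfl Set.Ioo_subset_Ioc_self)
  have hsub : cyl unitCube (Ioc t (t + 1)) ⊆
      cyl (latCube n 0 1) (Icc t (t + 1)) := cyl_mono le_rfl Set.Ioc_subset_Icc_self
  have hE2' := (lintegral_mono_set hsub).trans hE2
  have hG2' := (lintegral_mono_set hsub).trans hG2
  have hDL : ofReal ((D + 2) * (2 * C ^ 2) / (h - 1)) * (E + G + 1) = ofReal (D + 2) * L := by
    rw [hLdef, ← mul_assoc (ofReal (D + 2)), ← ofReal_mul (by positivity), mul_div_assoc]
  have hκ2 : ofReal κ = ofReal (κ / 2) + ofReal (κ / 2) := by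
    rw [← ofReal_add (by positivity) (by positivity), add_halves]
  have hD2 : ofReal (D + 2) = ofReal D + (1 + 1) := by
    rw [ofReal_add (by linarith) (by norm_num), ENNReal.ofReal_ofNat, one_add_one_eq_two]
  rw [hDL, hκ2, hD2]
  constructor
  · refine (hsplit (fun x => ofReal (eDens W ε l V x))
      (fun x => ofReal (eDens W ε l F x)) (fun x => ofReal (eDens W ε l U x))
      (fun x hx => by rw [eDens_congr (hVF x hx)])
      (fun x hx => by rw [eDens_congr (hVU' x hx)])).trans ?_
    have h5 : ofReal D * ofReal ε ≤ ofReal (κ / 2) := by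
      rw [← ofReal_mul (by linarith)]
      refine ofReal_mono ?_
      rw [le_div_iff₀ (by linarith)] at hε3
      linarith
    calc _ ≤ (E + L) + (ofReal D * (L + ofReal ε) + ofReal (κ / 2)) := by
          refine add_le_add hE1 (add_le_add (hE3.trans ?_) hE4)
          gcongr
      _ ≤ (E + L) + (ofReal D * L + ofReal (κ / 2) + ofReal (κ / 2)) := by rw [mul_add]; gcongr
      _ ≤ (E + L) + (ofReal D * L + ofReal (κ / 2) + ofReal (κ / 2)) + L := le_self_add
      _ = _ := by ring
  · refine (hsplit (fun x => ofReal (cDens l V x))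
      (fun x => ofReal (cDens l F x)) (fun x => ofReal (cDens l U x))
      (fun x hx => by rw [cDens_congr (hVF x hx)])
      (fun x hx => by rw [cDens_congr (hVU' x hx)])).trans ?_
    have h5 : ofReal (D' * ε) ≤ ofReal D := by
      refine ofReal_mono ?_
      rw [le_div_iff₀ (by linarith)] at hε4
      nlinarith
    calc _ ≤ (G + L) + ((L + (ofReal (κ / 2) + ofReal D * L)) +
          ofReal (κ / 2)) := by
          refine add_le_add hG1 (add_le_add (hG3.trans ?_) hG4)
          gcongr
      _ = _ := by ring

/-! ### Closing a column at both ends -/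

/-- The reflection `x_N ↦ -x_N`. -/
def vertFlip : Pt n → Pt n := signMap (snoc (α := fun _ => ℝ) (fun _ => 1) (-1)) 0

lemma flip_sign (j : Fin (n + 1)) :
    (snoc (α := fun _ => ℝ) (fun _ : Fin n => (1 : ℝ)) (-1) j = 1) ∨
      (snoc (α := fun _ => ℝ) (fun _ : Fin n => (1 : ℝ)) (-1) j = -1) := by
  refine lastCases ?_ (fun j => ?_) j
  · right; simp
  · left; simp

lemma vertFlip_mk (y : Lat n) (s : ℝ) : vertFlip (mk y s) = mk y (-s) := by
  ext i; refine lastCases ?_ (fun j => ?_) i <;> simp [vertFlip, signMap]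

lemma vertFlip_last (x : Pt n) : vertFlip x (last n) = -x (last n) := by
  simp [vertFlip, signMap]

lemma lat_vertFlip (x : Pt n) : lat (vertFlip x) = lat x := by
  ext j; simp [vertFlip, signMap, lat]

lemma vertFlip_vertFlip (x : Pt n) : vertFlip (vertFlip x) = x := by
  rw [← mk_lat x, vertFlip_mk, vertFlip_mk, neg_neg]

lemma lintegral_comp_vertFlip (F : Pt n → ENNReal) (S : Set (Lat n)) {I J : Set ℝ}
    (h : ∀ s, s ∈ I ↔ -s ∈ J) :
    ∫⁻ x in cyl S I, F (vertFlip x) = ∫⁻ x in cyl S J, F x := by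
  have := lintegral_comp_signMap (n := n) flip_sign 0 F (cyl S J)
  rw [← this]
  congr 2
  ext x
  change _ ↔ vertFlip x ∈ cyl S J
  simp only [cyl, Set.mem_setOf_eq, lat_vertFlip, vertFlip_last, h]

lemma LateralFactor.flip {v V : Pt n → Space d}
    (h : LateralFactor (fun x => v (vertFlip x)) V) : LateralFactor v fun x => V (vertFlip x) := by
  intro y y' hy s
  simp only [vertFlip_mk]
  exact h y y' (fun s => by simp only [vertFlip_mk, hy]) _

lemma contDiff_vertFlip : Smooth (vertFlip : Pt n → Pt n) := contDiff_signMap _ _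

lemma matNorm_grad_comp_vertFlip {v : Pt n → Space d} (hv : Smooth v)
    (x : Pt n) : matNorm (grad (fun y => v (vertFlip y)) x - tens a) =
      matNorm (grad v (vertFlip x) + tens a) := by
  unfold matNorm
  congr 1
  refine sum_congr rfl fun i _ => sum_congr rfl fun j _ => ?_
  have h := grad_comp_diagMap (γ := fun j s => (snoc (α := fun _ => ℝ) (fun _ : Fin n => (1 : ℝ))
    (-1) j : ℝ) * s + (0 : Lat (n + 1)) j) (fun _ => contDiff_affine _ _) hv x i j
  change grad (fun y => v (vertFlip y)) x i j = _ * grad v (vertFlip x) i j at h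
  rw [Matrix.sub_apply, Matrix.add_apply, h, deriv_affine]
  refine lastCases ?_ (fun j => ?_) j
  · simp; ring
  · simp [tensorLast_castSucc]

lemma eDens_comp_vertFlip (hWe : IsColumnEven W) {ε l : ℝ} {v : Pt n → Space d}
    (hv : Smooth v) (x : Pt n) :
    eDens W ε l (fun y => v (vertFlip y)) x = eDens W ε l v (vertFlip x) :=
  eDens_comp_signMap hWe hv flip_sign 0 x

lemma cDens_comp_vertFlip {l : ℝ} {v : Pt n → Space d} (hv : Smooth v) (x : Pt n) :
    cDens l (fun y => v (vertFlip y)) x = cDens l v (vertFlip x) :=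
  cDens_comp_signMap hv flip_sign 0 x

/-- An integral over a cylinder splits into the integrals over the part below `-1`, the middle and
the part above `1`. -/
lemma lintegral_cyl_three {S : Set (Lat n)} (hS : MeasurableSet S) {R : ℝ} (hR : 1 ≤ R)
    (F : Pt n → ENNReal) :
    (∫⁻ x in cyl S (Icc (-R) (-1)), F x) + ((∫⁻ x in cyl S (Ioo (-1) 1), F x) +
      ∫⁻ x in cyl S (Icc 1 R), F x) = ∫⁻ x in cyl S (Icc (-R) R), F x := by
  have hd : ∀ I J : Set ℝ, Disjoint I J → Disjoint (cyl S I) (cyl S J) := fun I J h =>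
    Set.disjoint_left.2 fun x hx hx' => Set.disjoint_left.1 h hx.2 hx'.2
  have h1 : Ioo (-1 : ℝ) 1 ∪ Icc 1 R = Ioc (-1) R := Set.Ioo_union_Icc_eq_Ioc (by norm_num) hR
  have h2 : Icc (-R) (-1) ∪ Ioc (-1 : ℝ) R = Icc (-R) R :=
    Set.Icc_union_Ioc_eq_Icc (by linarith) (by linarith)
  rw [← h2, cyl_union, lintegral_union (measurableSet_cyl hS measurableSet_Ioc), ← h1,
    cyl_union, lintegral_union (measurableSet_cyl hS measurableSet_Icc)]
  · exact hd _ _ (Set.disjoint_left.2 fun x hx hx' => by linarith [hx.2, hx'.1])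
  · exact hd _ _ (Set.disjoint_left.2 fun x hx hx' => by linarith [hx.2, hx'.1])

/-- A function on a tall column whose gradient is close to `a ⊗ e_N` in the upper part and to
`-a ⊗ e_N` in the lower part can be continued to `|x_N| a` with little additional energy. -/
lemma exists_closed_column (hwb : WellBounds W a p C) (hp : 2 ≤ p) (hW : ∀ ξ, 0 ≤ W ξ)
    (hWc : Continuous W) (hWe : IsColumnEven W) :
    ∃ D, 0 ≤ D ∧ ∀ h Emax κ : ℝ, 1 < h → 0 ≤ Emax → 0 < κ → ∃ η, 0 < η ∧
      ∀ (ε l : ℝ) (v : Pt n → Space d), 0 < ε → ε ≤ η → l ≤ 0 → Smooth v →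
      ∀ E G : ENNReal,
      eInt W ε l v (cyl unitCube (Icc (-(1 + h)) (1 + h))) = E →
      cInt l v (cyl unitCube (Icc (-(1 + h)) (1 + h))) = G →
      E ≤ ofReal Emax →
      ∫⁻ x in cyl unitCube (Icc 1 (1 + h)),
        ofReal (matNorm (grad v x - tens a) ^ p) ≤ ofReal η →
      ∫⁻ x in cyl unitCube (Icc (-(1 + h)) (-1)),
        ofReal (matNorm (grad v x + tens a) ^ p) ≤ ofReal η →
      ∃ (V : Pt n → Space d) (T : ℝ), Smooth V ∧ LateralFactor v V ∧
        (∀ x, T ≤ |x (last n)| → V x = |x (last n)| • a) ∧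
        eInt W ε l V (cyl unitCube univ) ≤
          E + (ofReal (D / (h - 1)) * (E + G + 1) + ofReal κ) ∧
        cInt l V (cyl unitCube univ) ≤
          G + (ofReal (D / (h - 1)) * (E + G + 1) + ofReal κ) := by
  obtain ⟨D, hD0, hD⟩ := exists_top (n := n) hwb hp hW hWc
  refine ⟨2 * D, by positivity, fun h Emax κ hh hE hκ => ?_⟩
  obtain ⟨η, hη0, hη⟩ := hD h Emax (κ / 2) hh hE (by positivity)
  refine ⟨η, hη0, fun ε l v hε hεη hl hv E G hEdef hGdef hEmax hq1 hq2 => ?_⟩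
  set S := latCube n 0 1
  have hSm : MeasurableSet S := measurableSet_latCube 0 1
  have hpos : 0 < h - 1 := by linarith
  set R := 1 + h
  have hR1 : 1 ≤ R := by linarith
  have hE3 := lintegral_cyl_three hSm hR1 fun x => ofReal (eDens W ε l v x)
  have hG3 := lintegral_cyl_three hSm hR1 fun x => ofReal (cDens l v x)
  rw [hEdef] at hE3
  rw [hGdef] at hG3
  set Eb := eInt W ε l v (cyl S (Icc (-R) (-1)))
  set Em := eInt W ε l v (cyl S (Ioo (-1) 1))
  set Et := eInt W ε l v (cyl S (Icc 1 R))
  set Gb := cInt l v (cyl S (Icc (-R) (-1)))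
  set Gm := cInt l v (cyl S (Ioo (-1) 1))
  set Gt := cInt l v (cyl S (Icc 1 R))
  have hEtE : Et ≤ E := hE3 ▸ le_add_self.trans le_add_self
  have hEbE : Eb ≤ E := hE3 ▸ le_self_add
  have hGtG : Gt ≤ G := hG3 ▸ le_add_self.trans le_add_self
  have hGbG : Gb ≤ G := hG3 ▸ le_self_add
  obtain ⟨V₁, T₁, hV₁s, hvV₁, hV₁v, hV₁T, hE1, hG1⟩ := hη ε l v hε hεη hl hv Et Gt rfl rfl
    (hEtE.trans hEmax) hq1
  have hcongr : ∀ x, x (last n) < 1 → V₁ =ᶠ[𝓝 x] v := by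
    intro x hx
    have hopen : IsOpen {x : Pt n | x (last n) < 1} := isOpen_lt (by fun_prop) continuous_const
    filter_upwards [hopen.mem_nhds hx] with y hy using hV₁v y (le_of_lt hy)
  -- the lower end is closed in the same way, after a reflection
  set w : Pt n → Space d := fun x => V₁ (vertFlip x) with hw
  have hws : Smooth w := hV₁s.comp contDiff_vertFlip
  have hIcc : ∀ s : ℝ, s ∈ Icc 1 R ↔ -s ∈ Icc (-R) (-1) := by
    intro s; simp only [Set.mem_Icc]; constructor <;> rintro ⟨h1, h2⟩ <;> constructor <;> linarith
  have hSb := measurableSet_cyl hSm (measurableSet_Icc (a := -R) (b := -1))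
  have hltb : ∀ x ∈ cyl S (Icc (-R) (-1)), x (last n) < 1 := fun x hx => by linarith [hx.2.2]
  have hwE : eInt W ε l w (cyl S (Icc 1 R)) = Eb := by
    simp only [hw, eDens_comp_vertFlip hWe hV₁s]
    rw [lintegral_comp_vertFlip (fun x => ofReal (eDens W ε l V₁ x)) S hIcc]
    exact setLIntegral_congr_fun hSb fun x hx => by simp only [eDens_congr (hcongr x (hltb x hx))]
  have hwG : cInt l w (cyl S (Icc 1 R)) = Gb := by
    simp only [hw, cDens_comp_vertFlip hV₁s]
    rw [lintegral_comp_vertFlip (fun x => ofReal (cDens l V₁ x)) S hIcc]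
    exact setLIntegral_congr_fun hSb fun x hx => by simp only [cDens_congr (hcongr x (hltb x hx))]
  have hwq : ∫⁻ x in cyl S (Icc 1 R),
      ofReal (matNorm (grad w x - tens a) ^ p) ≤ ofReal η := by
    simp only [hw, matNorm_grad_comp_vertFlip hV₁s]
    rw [lintegral_comp_vertFlip (fun x => ofReal (matNorm (grad V₁ x + tens a) ^ p)) S hIcc]
    refine le_trans (le_of_eq ?_) hq2
    exact setLIntegral_congr_fun hSb fun x hx => by simp only [grad_congr (hcongr x (hltb x hx))]
  obtain ⟨V₂, T₂, hV₂s, hwV₂, hV₂w, hV₂T, hE2, hG2⟩ := hη ε l w hε hεη hl hws Eb Gb hwE hwG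
    (hEbE.trans hEmax) hwq
  set V : Pt n → Space d := fun x => V₂ (vertFlip x) with hV
  have hVs : Smooth V := hV₂s.comp contDiff_vertFlip
  have hVV₁ : ∀ x, -1 ≤ x (last n) → V x = V₁ x := by
    intro x hx
    rw [hV]
    simp only
    rw [hV₂w _ (by rw [vertFlip_last]; linarith), hw]
    simp only [vertFlip_vertFlip]
  have hcongr2 : ∀ x, -1 < x (last n) → V =ᶠ[𝓝 x] V₁ := by
    intro x hx
    filter_upwards [(isOpen_lt_last (-1)).mem_nhds hx] with y hy using hVV₁ y (le_of_lt hy)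
  refine ⟨V, max 0 (max T₁ T₂), hVs, hvV₁.trans (LateralFactor.flip hwV₂), fun x hx => ?_, ?_⟩
  · have h1 : T₁ ≤ |x (last n)| := le_trans (by simp) hx
    have h2 : T₂ ≤ |x (last n)| := le_trans (by simp) hx
    rcases le_total 0 (x (last n)) with h0 | h0
    · rw [abs_of_nonneg h0] at h1 ⊢
      rw [hVV₁ x (by linarith), hV₁T x h1]
    · rw [abs_of_nonpos h0] at h2 ⊢
      rw [hV]
      simp only
      rw [hV₂T _ (by rwa [vertFlip_last]), vertFlip_last]
  have key : ∀ (fV fV₁ fv fV₂ : Pt n → ENNReal) (X Xb Xm Xt : ENNReal),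
      (∀ x, fV x = fV₂ (vertFlip x)) → (∀ x, -1 < x (last n) → fV x = fV₁ x) →
      (∀ x, x (last n) < 1 → fV₁ x = fv x) →
      ∫⁻ x in cyl S (Ioo (-1) 1), fv x = Xm → Xb + (Xm + Xt) = X →
      ∫⁻ x in cyl S (Ioi 1), fV₁ x ≤
        Xt + (ofReal (D / (h - 1)) * (Et + Gt + 1) + ofReal (κ / 2)) →
      ∫⁻ x in cyl S (Ioi 1), fV₂ x ≤
        Xb + (ofReal (D / (h - 1)) * (Eb + Gb + 1) + ofReal (κ / 2)) →
      ∫⁻ x in cyl S univ, fV x ≤ X + (ofReal (2 * D / (h - 1)) * (E + G + 1) + ofReal κ) := by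
    intro fV fV₁ fv fV₂ X Xb Xm Xt h1 h2 h3 h4 h5 h6 h7
    have e1 : ∫⁻ x in cyl S univ, fV x ≤
        (∫⁻ x in cyl S (Set.Iio (-1)), fV x) + ∫⁻ x in cyl S (Ioi (-1)), fV x := by
      have hu : (univ : Set ℝ) = Set.Iio (-1) ∪ Set.Ici (-1) := Set.Iio_union_Ici.symm
      rw [hu, cyl_union]
      refine (lintegral_union_le _ _ _).trans (add_le_add le_rfl (le_of_eq ?_))
      exact lintegral_cyl_congr_ae hSm measurableSet_Ici measurableSet_Ioi Ioi_ae_eq_Ici.symm _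
    have e2 : ∫⁻ x in cyl S (Set.Iio (-1)), fV x = ∫⁻ x in cyl S (Ioi 1), fV₂ x := by
      simp only [h1]
      exact lintegral_comp_vertFlip fV₂ S fun s => by simp [lt_neg]
    have e3 : ∫⁻ x in cyl S (Ioi (-1)), fV x ≤ Xm + ∫⁻ x in cyl S (Ioi 1), fV₁ x := by
      rw [setLIntegral_congr_fun (measurableSet_cyl hSm measurableSet_Ioi)
        (fun x hx => h2 x hx.2)]
      refine (lintegral_cyl_Ioi_le hSm (-1) 1 fV₁).trans (add_le_add ?_ le_rfl)
      rw [setLIntegral_congr_fun (measurableSet_cyl hSm measurableSet_Ioo)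
        (fun x hx => h3 x hx.2.2), h4]
    have e4 : ofReal (2 * D / (h - 1)) = ofReal (D / (h - 1)) + ofReal (D / (h - 1)) := by
      rw [← ofReal_add (by positivity) (by positivity)]; congr 1; ring
    have e5 : ofReal κ = ofReal (κ / 2) + ofReal (κ / 2) := by
      rw [← ofReal_add (by positivity) (by positivity), add_halves]
    calc _ ≤ (Xb + (ofReal (D / (h - 1)) * (E + G + 1) + ofReal (κ / 2))) +
          (Xm + (Xt + (ofReal (D / (h - 1)) * (E + G + 1) + ofReal (κ / 2)))) := by
          refine e1.trans (add_le_add (e2 ▸ h7.trans ?_) (e3.trans (add_le_add le_rfl (h6.trans ?_))))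
          · gcongr
          · gcongr
      _ = _ := by rw [e4, e5, ← h5]; ring
  exact ⟨key _ (fun x => ofReal (eDens W ε l V₁ x)) (fun x => ofReal (eDens W ε l v x))
      (fun x => ofReal (eDens W ε l V₂ x)) E Eb Em Et
      (fun x => by rw [hV, eDens_comp_vertFlip hWe hV₂s])
      (fun x hx => by simp only [eDens_congr (hcongr2 x hx)])
      (fun x hx => by simp only [eDens_congr (hcongr x hx)]) rfl hE3 hE1 hE2,
    key _ (fun x => ofReal (cDens l V₁ x)) (fun x => ofReal (cDens l v x))
      (fun x => ofReal (cDens l V₂ x)) G Gb Gm Gt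
      (fun x => by rw [hV, cDens_comp_vertFlip hV₂s])
      (fun x hx => by simp only [cDens_congr (hcongr2 x hx)])
      (fun x hx => by simp only [cDens_congr (hcongr x hx)]) rfl hG3 hG1 hG2⟩

/-! ### Closeness of the gradient -/

/-- The scalar product of `a` with the last column of `ξ`. -/
def slopeAlong (a : Space d) (ξ : Mat d n) : ℝ := ∑ i, ξ i (last n) * a i

lemma abs_slopeAlong_le (a : Space d) (ξ : Mat d n) :
    |slopeAlong a ξ| ≤ matNorm ξ * ‖a‖ := by
  set v : Space d := WithLp.toLp 2 fun i => ξ i (last n) with hv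
  have h1 : slopeAlong a ξ = inner ℝ a v := by simp [slopeAlong, PiLp.inner_apply, hv]
  rw [h1]
  calc |inner ℝ a v| ≤ ‖a‖ * ‖v‖ := abs_real_inner_le_norm _ _
    _ ≤ ‖a‖ * matNorm ξ := by
      gcongr
      exact norm_le_matNorm_of_col (last n) fun i => by simp [hv]
    _ = _ := mul_comm _ _

lemma slopeAlong_tensorLast (a : Space d) : slopeAlong a (tensorLast n a) = ‖a‖ ^ 2 := by
  simp only [slopeAlong, tensorLast_last]
  rw [EuclideanSpace.norm_sq_eq]
  simp [sq]

lemma slopeAlong_sub (ξ ζ : Mat d n) :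
    slopeAlong a (ξ - ζ) = slopeAlong a ξ - slopeAlong a ζ := by
  simp [slopeAlong, sub_mul]

lemma slopeAlong_add (ξ ζ : Mat d n) :
    slopeAlong a (ξ + ζ) = slopeAlong a ξ + slopeAlong a ζ := by
  simp [slopeAlong, add_mul, sum_add_distrib]

/-- The distance to the well `a ⊗ e_N` is controlled by `W` and, linearly, by the defect of the
slope along `a`, which distinguishes the two wells. -/
lemma exists_dist_le_slope (hwb : WellBounds W a p C) (hp : 2 ≤ p) (hW : ∀ ξ, 0 ≤ W ξ)
    (ha : a ≠ 0) : ∃ B, 0 ≤ B ∧ ∀ τ, 0 < τ → ∃ D, 0 ≤ D ∧ ∀ ξ,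
      matNorm (ξ - tens a) ^ p ≤ D * W ξ + τ + B * (1 - slopeAlong a ξ / ‖a‖ ^ 2) := by
  set A := tens a
  have ha0 : 0 < ‖a‖ := norm_pos_iff.2 ha
  have hC := hwb.pos
  set M : ℝ := matNorm (A + A) ^ p
  have hM0 : 0 ≤ M := rpow_nonneg (matNorm_nonneg _) p
  set B : ℝ := 2 ^ p * M / 2 with hB
  have hB0 : 0 ≤ B := by positivity
  refine ⟨B, hB0, fun τ hτ => ?_⟩
  set τ' : ℝ := τ * ‖a‖ / (B + 1) with hτ'
  have hτ'0 : 0 < τ' := by positivity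
  set c : ℝ := τ' ^ (1 - p / 1)
  have hc0 : 0 ≤ c := by positivity
  refine ⟨2 ^ p * C + B * (c * C / ‖a‖), by positivity, fun ξ => ?_⟩
  have hW0 := hW ξ
  have hlow := hwb.lower ξ
  -- a distance `q` to one of the wells with `q ^ p ≤ C W` is small up to a multiple of `W`
  have hsmall : ∀ q : ℝ, 0 ≤ q → q ^ p ≤ C * W ξ → B * (q / ‖a‖) ≤ τ + B * (c * C / ‖a‖) * W ξ := by
    intro q hq hqC
    have h1 := rpow_le_add_mul_rpow (q := 1) (p := p) one_pos (by linarith) hτ'0 hq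
    rw [Real.rpow_one] at h1
    have h2 : q ≤ τ' + c * (C * W ξ) := h1.trans (by gcongr)
    have h3 : B * (τ' / ‖a‖) ≤ τ := by
      rw [hτ']
      have : τ * ‖a‖ / (B + 1) / ‖a‖ = τ / (B + 1) := by field_simp
      rw [this, mul_div_assoc', div_le_iff₀ (by positivity)]
      nlinarith
    calc B * (q / ‖a‖) ≤ B * ((τ' + c * (C * W ξ)) / ‖a‖) := by gcongr
      _ = B * (τ' / ‖a‖) + B * (c * C / ‖a‖) * W ξ := by ring
      _ ≤ _ := by linarith
  have h2p : (1 : ℝ) ≤ 2 ^ p := Real.one_le_rpow (by norm_num) (by linarith)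
  have hcw : 0 ≤ C * W ξ := by positivity
  rcases min_choice (matNorm (ξ - A)) (matNorm (ξ + A)) with h' | h' <;> rw [h'] at hlow
  · have h1 := hsmall _ (matNorm_nonneg _) hlow
    have h2 := abs_slopeAlong_le a (ξ - A)
    rw [slopeAlong_sub, slopeAlong_tensorLast] at h2
    have h3 : -(matNorm (ξ - A) / ‖a‖) ≤ 1 - slopeAlong a ξ / ‖a‖ ^ 2 := by
      have h4 := (abs_le.1 h2).2
      have h5 : 1 - slopeAlong a ξ / ‖a‖ ^ 2 = -((slopeAlong a ξ - ‖a‖ ^ 2) / ‖a‖ ^ 2) := by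
        field_simp; ring
      rw [h5, neg_le_neg_iff, div_le_div_iff₀ (by positivity) ha0]
      nlinarith
    have h6 := mul_le_mul_of_nonneg_left h3 hB0
    nlinarith
  · have h1 := hsmall _ (matNorm_nonneg _) hlow
    have h2 := abs_slopeAlong_le a (ξ + A)
    rw [slopeAlong_add, slopeAlong_tensorLast] at h2
    have h3 : 2 - matNorm (ξ + A) / ‖a‖ ≤ 1 - slopeAlong a ξ / ‖a‖ ^ 2 := by
      have h4 := (abs_le.1 h2).2
      have h5 : 1 - slopeAlong a ξ / ‖a‖ ^ 2 = 2 - ((slopeAlong a ξ + ‖a‖ ^ 2) / ‖a‖ ^ 2) := by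
        field_simp; ring
      rw [h5]
      refine sub_le_sub_left ?_ _
      rw [div_le_div_iff₀ (by positivity) ha0]
      nlinarith
    have h6 := mul_le_mul_of_nonneg_left h3 hB0
    have h7 : matNorm (ξ - A) ^ p ≤ 2 ^ p * (matNorm (ξ + A) ^ p + M) := by
      refine le_trans (rpow_le_rpow (matNorm_nonneg _) ?_ (by linarith))
        (add_rpow_le (matNorm_nonneg _) (matNorm_nonneg _) (by linarith))
      have e : ξ - A = (ξ + A) + -(A + A) := by abel
      rw [e]
      exact (matNorm_add_le _ _).trans (by rw [matNorm_neg])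
    have h8 : 2 ^ p * matNorm (ξ + A) ^ p ≤ 2 ^ p * (C * W ξ) := by gcongr
    have h9 : 2 ^ p * M = 2 * B := by rw [hB]; ring
    nlinarith

lemma exists_smooth_cutoff {K O : Set (Pt n)} (hK : IsCompact K) (hO : IsOpen O)
    (hKO : K ⊆ O) : ∃ ζ : Pt n → ℝ, Smooth ζ ∧ HasCompactSupport ζ ∧
      tsupport ζ ⊆ O ∧ (∀ x ∈ K, ζ x = 1) ∧ ∀ x, ζ x ∈ Icc (0 : ℝ) 1 := by
  obtain ⟨L, hL, hKL, hLO⟩ := exists_compact_between hK hO hKO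
  obtain ⟨f, hf0, hf1, hf⟩ := exists_contMDiffMap_zero_one_of_isClosed (n := ⊤)
    (modelWithCornersSelf ℝ (Pt n)) (s := (interior L)ᶜ) (t := K)
    isOpen_interior.isClosed_compl hK.isClosed (Set.disjoint_left.2 fun x hx hx' => hx (hKL hx'))
  have hts : tsupport f ⊆ L := closure_minimal (fun x hx => by
    by_contra h
    exact hx (hf0 fun h' => h (interior_subset h'))) hL.isClosed
  exact ⟨f, f.contMDiff.contDiff, hL.of_isClosed_subset (isClosed_tsupport _) hts, hts.trans hLO,
    fun x hx => hf1 hx, hf⟩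

/-- If a function is close to `x_N a` and has bounded energy, then its gradient is close to
`a ⊗ e_N` on compact subsets. -/
lemma exists_grad_close (hwb : WellBounds W a p C) (hp : 2 ≤ p) (hW : ∀ ξ, 0 ≤ W ξ)
    (hWc : Continuous W) (ha : a ≠ 0) {K O : Set (Pt n)} (hK : IsCompact K)
    (hO : IsOpen O) (hKO : K ⊆ O) {Emax η : ℝ} (hE : 0 ≤ Emax) (hη : 0 < η) :
    ∃ η₀, 0 < η₀ ∧ ∀ (ε l : ℝ) (u : Pt n → Space d), 0 < ε → ε ≤ η₀ → Smooth u →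
      eInt W ε l u O ≤ ofReal Emax →
      ∫⁻ x in O, ‖u x - x (last n) • a‖ₑ ≤ ofReal η₀ →
      ∫⁻ x in K, ofReal (matNorm (grad u x - tens a) ^ p) ≤ ofReal η := by
  obtain ⟨ζ, hζs, hζc, hζO, hζ1, hζ01⟩ := exists_smooth_cutoff hK hO hKO
  obtain ⟨B, hB0, hB⟩ := exists_dist_le_slope hwb hp hW ha
  have ha0 : 0 < ‖a‖ := norm_pos_iff.2 ha
  have hζi : Integrable ζ := hζs.continuous.integrable_of_hasCompactSupport hζc
  have hI0 : 0 ≤ ∫ x, ζ x := integral_nonneg fun x => (hζ01 x).1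
  obtain ⟨D, hD0, hD⟩ := hB (η / (3 * ((∫ x, ζ x) + 1))) (by positivity)
  have hpζ : Continuous (pd (last n) ζ) := (contDiff_pd hζs _).continuous
  have hpζc : HasCompactSupport (pd (last n) ζ) :=
    (hζc.fderiv (𝕜 := ℝ)).comp_left (g := fun L : Pt n →L[ℝ] ℝ =>
      L (single (last n) 1)) (by simp)
  obtain ⟨M, hM⟩ := hpζc.exists_bound_of_continuous hpζ
  have hM0 : 0 ≤ M := (norm_nonneg _).trans (hM 0)
  refine ⟨min (η / (3 * (D * Emax + 1))) (η / (3 * (B * (M / ‖a‖) + 1))), by positivity, ?_⟩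
  intro ε l u hε hεη hu hEu hL1
  have hε1 : ε ≤ η / (3 * (D * Emax + 1)) := hεη.trans (min_le_left _ _)
  have hL1' := hL1.trans (ofReal_mono (min_le_right _ _))
  set η₁ : ℝ := η / (3 * (B * (M / ‖a‖) + 1)) with hη₁
  have hη₁0 : 0 < η₁ := by positivity
  have hgc := continuous_grad hu
  have hζc' := hζs.continuous
  have hcomp : ∀ f : Pt n → ℝ, Continuous f → Integrable fun x => ζ x * f x := fun f hf =>
    (hζc'.mul hf).integrable_of_hasCompactSupport hζc.mul_right
  -- the function `g` is small in `L¹`, and its vertical derivative is the defect of the slope; this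
  -- defect controls the distance from the well `a ⊗ e_N`, up to a multiple of `W`
  set g : Pt n → ℝ := fun x => x (last n) - (∑ i, u x i * a i) / ‖a‖ ^ 2 with hg
  have hus : Smooth fun x => ∑ i, u x i * a i :=
    ContDiff.sum fun i _ => (ContDiff.coord hu i).mul contDiff_const
  have hgs : Smooth g := (smooth_comp_coord contDiff_id (last n)).sub (hus.div_const _)
  have hpg : ∀ x, pd (last n) g x = 1 - slopeAlong a (grad u x) / ‖a‖ ^ 2 := by
    intro x
    have h1 : pd (last n) (fun x => ∑ i, u x i * a i) x = slopeAlong a (grad u x) := by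
      unfold pd slopeAlong
      rw [fderiv_fun_sum fun i _ => ((smooth_diff (ContDiff.coord hu i)) x).mul_const _]
      rw [_root_.sum_apply]
      refine sum_congr rfl fun i _ => ?_
      rw [fderiv_mul_const (smooth_diff (ContDiff.coord hu i) x), grad_apply, pd]
      simp [mul_comm]
    have h2 : g = fun x => x (last n) - (‖a‖ ^ 2)⁻¹ * ∑ i, u x i * a i := by
      ext x; simp only [hg]; ring
    rw [h2, pd_sub (f := fun x => x (last n)) (g := fun x => (‖a‖ ^ 2)⁻¹ * ∑ i, u x i * a i)
      (smooth_diff (smooth_comp_coord contDiff_id (last n)))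
      (smooth_diff (contDiff_const.mul hus)),
      pd_const_mul (smooth_diff hus), h1]
    have h3 := pd_comp_coord (φ := fun s => s) differentiable_id (last n) (last n) x
    rw [h3]
    simp only [if_true, deriv_id'']
    ring
  have hslc : Continuous fun x => 1 - slopeAlong a (grad u x) / ‖a‖ ^ 2 := by
    rw [← funext hpg]; exact (contDiff_pd hgs _).continuous
  have hWuc : Continuous fun x => W (grad u x) := hWc.comp hgc
  -- integration by parts
  have hibp : ∫ x, ζ x * (1 - slopeAlong a (grad u x) / ‖a‖ ^ 2) = -∫ x, pd (last n) ζ x * g x := by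
    simp only [← hpg]
    refine integral_mul_fderiv_eq_neg_fderiv_mul_of_integrable (f := ζ) (g := g)
      (v := single (last n) (1 : ℝ)) ?_ ?_ ?_ ?_ ?_
    · exact (hpζ.mul hgs.continuous).integrable_of_hasCompactSupport hpζc.mul_right
    · exact hcomp _ (contDiff_pd hgs (last n)).continuous
    · exact hcomp _ hgs.continuous
    · exact fun x _ => smooth_diff hζs x
    · exact fun x _ => smooth_diff hgs x
  have hζ0 : ∀ x, x ∉ O → ζ x = 0 := fun x hx => image_eq_zero_of_notMem_tsupport fun h => hx (hζO h)
  have hpζ0 : ∀ x, x ∉ O → pd (last n) ζ x = 0 := by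
    intro x hx
    have : x ∉ tsupport ζ := fun h => hx (hζO h)
    unfold pd
    rw [image_eq_zero_of_notMem_tsupport fun h => this (tsupport_fderiv_subset ℝ h)]
    simp
  have hOm := hO.measurableSet
  have htoO : ∀ F : Pt n → ℝ, Continuous F → HasCompactSupport F → (∀ x, 0 ≤ F x) →
      (∀ x, x ∉ O → F x = 0) → ∀ G : Pt n → ENNReal,
      (∀ x ∈ O, ofReal (F x) ≤ G x) → ∀ r : ℝ, 0 ≤ r → ∫⁻ x in O, G x ≤ ofReal r →
      ∫ x, F x ≤ r := by
    intro F hF hFc hF0 hFO G hFG r hr hGr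
    rw [← ENNReal.ofReal_le_ofReal_iff hr, ofReal_integral_eq_lintegral_ofReal
      (hF.integrable_of_hasCompactSupport hFc) (.of_forall hF0)]
    refine le_trans ?_ hGr
    rw [← setLIntegral_eq_of_support_subset (s := O)]
    · exact setLIntegral_mono' hOm hFG
    · intro x hx
      by_contra h
      exact hx (by simp [hFO x h])
  have hWint : ∫ x, ζ x * W (grad u x) ≤ ε * Emax := by
    refine htoO _ (hζc'.mul hWuc) hζc.mul_right (fun x => mul_nonneg (hζ01 x).1 (hW _))
      (fun x hx => by simp [hζ0 x hx])
      (fun x => ofReal ε * ofReal (eDens W ε l u x)) (fun x _ => ?_) _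
      (by positivity) ?_
    · rw [← ofReal_mul hε.le]
      refine ofReal_mono ?_
      have h3 := le_eFun (W := W) (l := l) hε (grad u x) (hessNorm u x)
      have h4 : 0 ≤ ε * hessNorm u x ^ 2 := by positivity
      have h5 : 1 / ε * W (grad u x) ≤ eDens W ε l u x := by unfold eDens; linarith
      rw [one_div, ← div_eq_inv_mul, div_le_iff₀' hε] at h5
      exact (mul_le_of_le_one_left (hW _) (hζ01 x).2).trans h5
    · rw [lintegral_const_mul _ (continuous_eDens hWc hu).measurable.ennreal_ofReal,
        ofReal_mul hε.le]
      gcongr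
  have hgint : ∫ x, |pd (last n) ζ x * g x| ≤ M / ‖a‖ * η₁ := by
    refine htoO _ (hpζ.mul hgs.continuous).abs ?_ (fun x => abs_nonneg _)
      (fun x hx => by simp [hpζ0 x hx])
      (fun x => ofReal (M / ‖a‖) * ‖u x - x (last n) • a‖ₑ) (fun x _ => ?_) _
      (by positivity) ?_
    · exact (hpζc.mul_right (f' := g)).comp_left (g := fun r : ℝ => |r|) (by simp)
    · rw [← ofReal_norm, ← ofReal_mul (by positivity)]
      refine ofReal_mono ?_
      have h1 : |g x| ≤ ‖u x - x (last n) • a‖ / ‖a‖ := by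
        have h2 : g x = -(inner ℝ (u x - x (last n) • a) a / ‖a‖ ^ 2) := by
          have h3 : inner ℝ (u x) a = ∑ i, u x i * a i := by simp [PiLp.inner_apply, mul_comm]
          rw [inner_sub_left, inner_smul_left, h3, real_inner_self_eq_norm_sq, hg]
          simp only [conj_trivial]
          field_simp
          ring
        rw [h2, abs_neg, abs_div, abs_of_nonneg (sq_nonneg ‖a‖), div_le_div_iff₀ (by positivity) ha0]
        have h4 := abs_real_inner_le_norm (u x - x (last n) • a) a
        nlinarith
      simp only [Pi.mul_apply, abs_mul]
      calc _ ≤ M * (‖u x - x (last n) • a‖ / ‖a‖) :=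
            mul_le_mul (hM x) h1 (abs_nonneg _) hM0
        _ = _ := by ring
    · have hm : Measurable fun x : Pt n => ‖u x - x (last n) • a‖ₑ :=
        (hu.continuous.sub ((by fun_prop : Continuous fun x : Pt n =>
          x (last n)).smul continuous_const)).enorm.measurable
      rw [lintegral_const_mul _ hm, ofReal_mul (by positivity)]
      gcongr
  set τ := η / (3 * ((∫ x, ζ x) + 1)) with hτ
  set f : Pt n → ℝ := fun x =>
    D * (ζ x * W (grad u x)) + τ * ζ x + B * (ζ x * (1 - slopeAlong a (grad u x) / ‖a‖ ^ 2)) with hf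
  have hfeq : ∀ x, f x = ζ x * (D * W (grad u x) + τ + B * (1 - slopeAlong a (grad u x) / ‖a‖ ^ 2)) :=
    fun x => by simp only [hf]; ring
  have hf0 : ∀ x, 0 ≤ f x := by
    intro x
    rw [hfeq]
    exact mul_nonneg (hζ01 x).1 ((rpow_nonneg (matNorm_nonneg _) p).trans (hD _))
  have hi1 : Integrable fun x => D * (ζ x * W (grad u x)) := (hcomp _ hWuc).const_mul D
  have hi2 : Integrable fun x => τ * ζ x := hζi.const_mul τ
  have hi3 : Integrable fun x => B * (ζ x * (1 - slopeAlong a (grad u x) / ‖a‖ ^ 2)) :=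
    (hcomp _ hslc).const_mul B
  have hfi : Integrable f := (hi1.add hi2).add hi3
  have hfint : ∫ x, f x ≤ η := by
    have e1 : ∫ x, f x = D * (∫ x, ζ x * W (grad u x)) + τ * (∫ x, ζ x) +
        B * ∫ x, ζ x * (1 - slopeAlong a (grad u x) / ‖a‖ ^ 2) := by
      simp only [hf]
      rw [integral_add (f := fun x => D * (ζ x * W (grad u x)) + τ * ζ x) (hi1.add hi2) hi3,
        integral_add hi1 hi2, integral_const_mul,
        integral_const_mul, integral_const_mul]
    have e2 : D * (∫ x, ζ x * W (grad u x)) ≤ η / 3 := by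
      calc _ ≤ D * (ε * Emax) := by gcongr
        _ = ε * (D * Emax) := by ring
        _ ≤ ε * (D * Emax + 1) := by gcongr; linarith
        _ ≤ η / 3 := by
          rw [le_div_iff₀ (by positivity)] at hε1
          linarith
    have e3 : τ * (∫ x, ζ x) ≤ η / 3 := by
      have h : τ * (3 * ((∫ x, ζ x) + 1)) = η := by rw [hτ]; field_simp
      have h0 : 0 ≤ τ := by positivity
      nlinarith
    have e4 : B * ∫ x, ζ x * (1 - slopeAlong a (grad u x) / ‖a‖ ^ 2) ≤ η / 3 := by
      have h1 : ∫ x, ζ x * (1 - slopeAlong a (grad u x) / ‖a‖ ^ 2) ≤ M / ‖a‖ * η₁ := by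
        rw [hibp]
        refine le_trans ?_ hgint
        exact (neg_le_abs _).trans abs_integral_le_integral_abs
      have h2 : η₁ * (3 * (B * (M / ‖a‖) + 1)) = η := by rw [hη₁]; field_simp
      calc _ ≤ B * (M / ‖a‖ * η₁) := by gcongr
        _ ≤ η / 3 := by nlinarith
    rw [e1]; linarith
  calc ∫⁻ x in K, ofReal (matNorm (grad u x - tens a) ^ p)
      ≤ ∫⁻ x in K, ofReal (f x) := by
        refine setLIntegral_mono' hK.measurableSet fun x hx => ofReal_mono ?_
        rw [hfeq, hζ1 x hx, one_mul]
        exact hD _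
    _ ≤ ∫⁻ x, ofReal (f x) := setLIntegral_le_lintegral _ _
    _ = ofReal (∫ x, f x) :=
        (ofReal_integral_eq_lintegral_ofReal hfi (.of_forall hf0)).symm
    _ ≤ _ := ofReal_mono hfint

/-! ### Periodic cells -/

/-- A smooth function of lateral period `P` that equals `|x_N| a` away from the hyperplane
`x_N = 0`. -/
structure IsCell (a : Space d) (P : ℕ) (V : Pt n → Space d) : Prop where
  pos : 0 < P
  smooth : Smooth V
  periodic : ∀ (z : Fin n → ℤ) (y : Lat n) (s : ℝ),
    V (mk (fun j => y j + P * z j) s) = V (mk y s)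
  roof : ∃ T : ℝ, ∀ x, T ≤ |x (last n)| → V x = |x (last n)| • a

/-- The lateral isometry `y ↦ σ y + c`, which does not change the last coordinate. -/
def latMap (σ c : Lat n) : Pt n → Pt n :=
  signMap (snoc (α := fun _ => ℝ) σ 1) (snoc (α := fun _ => ℝ) c 0)

lemma latMap_mk (σ c : Lat n) (y : Lat n) (s : ℝ) :
    latMap σ c (mk y s) = mk (fun j => σ j * y j + c j) s := by
  ext i; refine lastCases ?_ (fun j => ?_) i <;> simp [latMap, signMap]

lemma latMap_eq (σ c : Lat n) (x : Pt n) :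
    latMap σ c x = mk (fun j => σ j * lat x j + c j) (x (last n)) := by
  rw [← latMap_mk, mk_lat]

lemma snoc_sign {σ : Fin n → ℝ} (hσ : ∀ j, σ j = 1 ∨ σ j = -1) (j : Fin (n + 1)) :
    (snoc (α := fun _ => ℝ) σ 1 j = 1) ∨ (snoc (α := fun _ => ℝ) σ 1 j = -1) := by
  refine lastCases ?_ (fun j => ?_) j
  · left; simp
  · simpa using hσ j

lemma eDens_latMap (hWe : IsColumnEven W) {V : Pt n → Space d} (hV : Smooth V)
    {σ c : Fin n → ℝ} (hσ : ∀ j, σ j = 1 ∨ σ j = -1) (h : ∀ x, V (latMap σ c x) = V x)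
    (x : Pt n) : eDens W ε l V (latMap σ c x) = eDens W ε l V x := by
  have := eDens_comp_signMap (ε := ε) (l := l) hWe hV (snoc_sign hσ)
    (snoc (α := fun _ => ℝ) c 0) x
  change eDens W ε l (fun y => V (latMap σ c y)) x = eDens W ε l V (latMap σ c x) at this
  rw [← this]
  simp only [h]

lemma cDens_latMap {V : Pt n → Space d} (hV : Smooth V)
    {σ c : Fin n → ℝ} (hσ : ∀ j, σ j = 1 ∨ σ j = -1) (h : ∀ x, V (latMap σ c x) = V x)
    (x : Pt n) : cDens l V (latMap σ c x) = cDens l V x := by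
  have := cDens_comp_signMap (l := l) hV (snoc_sign hσ) (snoc (α := fun _ => ℝ) c 0) x
  change cDens l (fun y => V (latMap σ c y)) x = cDens l V (latMap σ c x) at this
  rw [← this]
  simp only [h]

lemma lintegral_latMap {σ c : Fin n → ℝ} (hσ : ∀ j, σ j = 1 ∨ σ j = -1)
    {f : Pt n → ENNReal} (hf : ∀ x, f (latMap σ c x) = f x) {S S' : Set (Lat n)}
    (h : ∀ y, y ∈ S ↔ (fun j => σ j * y j + c j) ∈ S') :
    ∫⁻ x in cyl S' univ, f x = ∫⁻ x in cyl S univ, f x := by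
  rw [← lintegral_comp_signMap (snoc_sign hσ) (snoc (α := fun _ => ℝ) c 0) f]
  change ∫⁻ x in latMap σ c ⁻¹' _, f (latMap σ c x) = _
  simp only [hf]
  congr 2
  ext x
  simp only [Set.mem_preimage, latMap_eq, cyl, Set.mem_ofPred_eq, lat_mk, h (lat x), mem_univ]

lemma one_sign (j : Fin n) : (fun _ : Fin n => (1 : ℝ)) j = 1 ∨ (fun _ : Fin n => (1 : ℝ)) j = -1 :=
  Or.inl rfl

/-- Integrals of periodic functions over boxes made of periods. -/
lemma lintegral_periodic_box_le {P : ℕ} (hP : 0 < P) {f : Pt n → ENNReal}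
    (hf : ∀ (z : Fin n → ℤ) (y : Lat n) (s : ℝ), f (mk (fun j => y j + P * z j) s) = f (mk y s))
    (z : Fin n → ℤ) (m : Fin n → ℕ) (hm : ∀ j, 0 < m j) :
    ∫⁻ x in cyl (Icc (fun j => (P : ℝ) * z j) (fun j => (P : ℝ) * (z j + m j))) univ, f x ≤
      (∏ j, (m j : ENNReal)) * ∫⁻ x in cyl (latCube n 0 P) univ, f x := by
  have hP0 : (0 : ℝ) < P := by exact_mod_cast hP
  have hcov : cyl (Icc (fun j => (P : ℝ) * z j) (fun j => (P : ℝ) * (z j + m j))) univ ⊆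
      ⋃ t : (∀ j, Fin (m j)), cyl
        (Icc (fun j => (P : ℝ) * (z j + (t j : ℕ))) (fun j => (P : ℝ) * (z j + (t j : ℕ)) + P))
          (univ : Set ℝ) := by
    rintro x ⟨⟨hx1, hx2⟩, -⟩
    have hex : ∀ j, ∃ t : Fin (m j), (P : ℝ) * (z j + (t : ℕ)) ≤ lat x j ∧
        lat x j ≤ (P : ℝ) * (z j + (t : ℕ)) + P := by
      intro j
      have h1 := hx1 j
      have h2 := hx2 j
      set r : ℝ := lat x j / P - z j with hr
      have hr0 : 0 ≤ r := by rw [hr, sub_nonneg, le_div_iff₀ hP0]; linarith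
      have hlat : lat x j = P * (z j + r) := by rw [hr]; field_simp; ring
      rcases lt_or_ge ⌊r⌋₊ (m j) with h | h
      · refine ⟨⟨⌊r⌋₊, h⟩, ?_, ?_⟩
        · rw [hlat]
          have := Nat.floor_le hr0
          simp only
          gcongr
        · rw [hlat]
          have := (Nat.lt_floor_add_one r).le
          have h3 : (P : ℝ) * (z j + r) ≤ P * (z j + (⌊r⌋₊ + 1)) := by gcongr
          simp only
          linarith
      · refine ⟨⟨m j - 1, Nat.sub_lt (hm j) one_pos⟩, ?_, ?_⟩
        · rw [hlat]
          have h3 : (m j : ℝ) ≤ r := (Nat.cast_le.2 h).trans (Nat.floor_le hr0)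
          have h4 : ((m j - 1 : ℕ) : ℝ) ≤ m j := Nat.cast_le.2 (Nat.sub_le _ _)
          simp only
          gcongr
          linarith
        · have h3 : ((m j - 1 : ℕ) : ℝ) = m j - 1 := by rw [Nat.cast_sub (hm j)]; simp
          simp only [h3]
          linarith
    choose t ht using hex
    exact Set.mem_iUnion.2 ⟨t, ⟨fun j => (ht j).1, fun j => (ht j).2⟩, mem_univ _⟩
  refine (lintegral_mono_set hcov).trans ((lintegral_iUnion_le _ _).trans ?_)
  rw [tsum_fintype]
  have heq : ∀ t : (∀ j, Fin (m j)), ∫⁻ x in cyl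
      (Icc (fun j => (P : ℝ) * (z j + (t j : ℕ))) (fun j => (P : ℝ) * (z j + (t j : ℕ)) + P))
      (univ : Set ℝ), f x = ∫⁻ x in cyl (latCube n 0 P) univ, f x := by
    intro t
    refine lintegral_latMap (σ := fun _ => 1) (c := fun j => (P : ℝ) * (z j + (t j : ℕ))) one_sign
      (fun x => ?_) fun y => ?_
    · rw [latMap_eq]
      have := hf (fun j => z j + (t j : ℕ)) (lat x) (x (last n))
      rw [mk_lat] at this
      rw [← this]
      congr 2
      ext j; push_cast; ring
    · simp only [mem_latCube, Set.mem_Icc, Pi.le_def, one_mul]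
      constructor
      · intro h
        exact ⟨fun j => by linarith [(h j).1], fun j => by linarith [(h j).2]⟩
      · rintro ⟨h1, h2⟩ j
        exact ⟨by linarith [h1 j], by linarith [h2 j]⟩
  rw [sum_congr rfl fun t _ => heq t, Finset.sum_const, Finset.card_univ, Fintype.card_pi,
    nsmul_eq_mul]
  simp

lemma IsCell.latMap_eq_self {P : ℕ} {V : Pt n → Space d} (hV : IsCell a P V)
    (z : Fin n → ℤ) (x : Pt n) : V (latMap (fun _ => 1) (fun j => (P : ℝ) * z j) x) = V x := by
  rw [latMap_eq]
  have := hV.periodic z (lat x) (x (last n))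
  rw [mk_lat] at this
  rw [← this]; congr 2; ext j; ring

lemma IsCell.eDens_periodic (hWe : IsColumnEven W) {P : ℕ} {V : Pt n → Space d}
    (hV : IsCell a P V) (z : Fin n → ℤ) (y : Lat n) (s : ℝ) :
    eDens W ε l V (SurfaceTension.mk (fun j => y j + P * z j) s) = eDens W ε l V (SurfaceTension.mk y s) := by
  rw [← eDens_latMap hWe hV.smooth one_sign (hV.latMap_eq_self z) (SurfaceTension.mk y s), latMap_mk]
  congr 2; ext j; ring

lemma IsCell.cDens_periodic {P : ℕ} {V : Pt n → Space d}
    (hV : IsCell a P V) (z : Fin n → ℤ) (y : Lat n) (s : ℝ) :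
    cDens l V (SurfaceTension.mk (fun j => y j + P * z j) s) = cDens l V (SurfaceTension.mk y s) := by
  rw [← cDens_latMap hV.smooth one_sign (hV.latMap_eq_self z) (SurfaceTension.mk y s), latMap_mk]
  congr 2; ext j; ring

lemma tensorLast_neg (a : Space d) : tensorLast n (-a) = -tens a := by
  ext i j
  by_cases hj : j = last n
  · subst hj; simp [tensorLast_last]
  · simp [tensorLast_of_ne _ _ hj]

lemma WellBounds.neg (h : WellBounds W a p C) : WellBounds W (-a) p C where
  one_le := h.one_le
  upper ξ := by rw [tensorLast_neg, sub_neg_eq_add]; exact h.upper_neg ξ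
  upper_neg ξ := by rw [tensorLast_neg, ← sub_eq_add_neg]; exact h.upper ξ
  lower ξ := by rw [tensorLast_neg, sub_neg_eq_add, ← sub_eq_add_neg, min_comm]; exact h.lower ξ

/-- Where a function agrees with `|x_N| a`, away from the hyperplane `x_N = 0`, it is locally
affine. -/
lemma eventuallyEq_affineLast_of_roof {V : Pt n → Space d} {T : ℝ} (hT : 0 ≤ T)
    (hV : ∀ x, T ≤ |x (last n)| → V x = |x (last n)| • a) (x : Pt n) :
    (T < x (last n) → V =ᶠ[𝓝 x] affineLast a 0) ∧
      (x (last n) < -T → V =ᶠ[𝓝 x] affineLast (-a) 0) := by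
  constructor <;> intro h
  · filter_upwards [(isOpen_lt_last T).mem_nhds h] with y (hy : T < y (last n))
    rw [hV y (hy.le.trans (le_abs_self _)), abs_of_pos (hT.trans_lt hy)]
    simp [affineLast]
  · have hopen : IsOpen {x : Pt n | x (last n) < -T} := isOpen_lt (by fun_prop) continuous_const
    filter_upwards [hopen.mem_nhds h] with y (hy : y (last n) < -T)
    rw [hV y ((le_neg.2 hy.le).trans (neg_le_abs _)), abs_of_neg (by linarith)]
    simp [affineLast]

lemma dens_eq_zero_of_roof (hwb : WellBounds W a p C) (hp : 2 ≤ p) (hW : ∀ ξ, 0 ≤ W ξ)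
    (hl : l ≤ 0) {V : Pt n → Space d} {T : ℝ} (hT : 0 ≤ T)
    (hV : ∀ x, T ≤ |x (last n)| → V x = |x (last n)| • a) {x : Pt n}
    (hx : T < |x (last n)|) : eDens W ε l V x = 0 ∧ cDens l V x = 0 := by
  obtain ⟨h1, h2⟩ := eventuallyEq_affineLast_of_roof hT hV x
  rcases lt_abs.1 hx with h | h
  · rw [eDens_congr (h1 h), cDens_congr (h1 h)]
    exact ⟨eDens_affineLast hwb hp hW 0 x, cDens_affineLast hl 0 x⟩
  · rw [eDens_congr (h2 (by linarith)), cDens_congr (h2 (by linarith))]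
    exact ⟨eDens_affineLast hwb.neg hp hW 0 x, cDens_affineLast hl 0 x⟩

/-- The pairs of energy and constraint per unit area that are approximately attained by cells. -/
def Attain (W : Mat d n → ℝ) (a : Space d) (ε l : ℝ) (E G : ENNReal) : Prop :=
  ∀ κ : ℝ, 0 < κ → ∃ (P : ℕ) (V : Pt n → Space d), IsCell a P V ∧
    eInt W ε l V (cyl (latCube n 0 P) univ) ≤ (P : ENNReal) ^ n * (E + ofReal κ) ∧
    cInt l V (cyl (latCube n 0 P) univ) ≤ (P : ENNReal) ^ n * (G + ofReal κ)

/-- A function with reflection symmetries, given on the unit tile, is a cell of period two. -/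
lemma attain_of_symmetric (hWe : IsColumnEven W) {V : Pt n → Space d} (hV : Smooth V)
    (hsym : ∀ y y' : Lat n, (∀ j, (∃ z : ℤ, y' j = y j + 2 * z) ∨ ∃ z : ℤ, y' j = -y j + 2 * z) →
      ∀ s, V (mk y' s) = V (mk y s))
    (hroof : ∃ T : ℝ, ∀ x, T ≤ |x (last n)| → V x = |x (last n)| • a) :
    Attain W a ε l (eInt W ε l V (cyl unitCube univ))
      (cInt l V (cyl unitCube univ)) := by
  have key : ∀ f : Pt n → ENNReal,
      (∀ σ c : Lat n, (∀ j, σ j = 1 ∨ σ j = -1) → (∀ x, V (latMap σ c x) = V x) →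
        ∀ x, f (latMap σ c x) = f x) →
      ∫⁻ x in cyl (latCube n 0 (2 : ℕ)) univ, f x ≤
        ((2 : ℕ) : ENNReal) ^ n * ∫⁻ x in cyl unitCube univ, f x := by
    intro f hf
    -- the period consists of `2 ^ n` reflected copies of the unit tile
    have hcov : cyl (latCube n 0 (2 : ℕ)) univ ⊆ ⋃ t : Fin n → Bool, cyl
        {y : Lat n | ∀ j, if t j then y j ∈ Icc 1 2 else y j ∈ Icc 0 1} (univ : Set ℝ) := by
      rintro x ⟨hx, -⟩
      rw [mem_latCube] at hx
      refine Set.mem_iUnion.2 ⟨fun j => decide (1 ≤ lat x j), fun j => ?_, mem_univ _⟩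
      have h := hx j
      push_cast at h
      by_cases h1 : 1 ≤ lat x j
      · simp only [h1, decide_true, if_true]; exact ⟨h1, by linarith [h.2]⟩
      · simp only [h1, decide_false]; exact ⟨h.1, by linarith⟩
    refine (lintegral_mono_set hcov).trans ((lintegral_iUnion_le _ _).trans ?_)
    rw [tsum_fintype]
    have heq : ∀ t : Fin n → Bool, ∫⁻ x in cyl
        {y : Lat n | ∀ j, if t j then y j ∈ Icc 1 2 else y j ∈ Icc 0 1}
          (univ : Set ℝ), f x = ∫⁻ x in cyl unitCube univ, f x := by
      intro t
      have hσ : ∀ j, (fun j => if t j then (-1 : ℝ) else 1) j = 1 ∨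
          (fun j => if t j then (-1 : ℝ) else 1) j = -1 := by
        intro j; by_cases h : t j <;> simp [h]
      refine lintegral_latMap (σ := fun j => if t j then (-1 : ℝ) else 1)
        (c := fun j => if t j then 2 else 0) hσ (hf _ _ hσ fun x => ?_) fun y => ?_
      · rw [latMap_eq]
        conv_rhs => rw [← mk_lat x]
        refine hsym _ _ (fun j => ?_) _
        by_cases h : t j
        · right; exact ⟨1, by simp [h]⟩
        · left; exact ⟨0, by simp [h]⟩
      · rw [mem_latCube]
        refine forall_congr' fun j => ?_
        by_cases h : t j
        · simp only [h, if_true, Set.mem_Icc]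
          constructor <;> rintro ⟨h1, h2⟩ <;> constructor <;> linarith
        · simp [h]
    rw [sum_congr rfl fun t _ => heq t, Finset.sum_const, Finset.card_univ, Fintype.card_pi,
      nsmul_eq_mul]
    simp
  intro κ hκ
  refine ⟨2, V, ⟨two_pos, hV, fun z y s => hsym _ _ (fun j => Or.inl ⟨z j, by simp⟩) s, hroof⟩, ?_, ?_⟩
  · refine (key _ fun σ c hσ h x => ?_).trans ?_
    · rw [eDens_latMap hWe hV hσ h]
    · gcongr; exact le_self_add
  · refine (key _ fun σ c hσ h x => ?_).trans ?_
    · rw [cDens_latMap hV hσ h]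
    · gcongr; exact le_self_add

/-! ### Convex combinations of cells -/

/-- A smooth function of period `S` that equals one on `[1, S/2 - 1]` and zero on
`[S/2 + 1, S - 1]`. -/
def switch (S s : ℝ) : ℝ := step (1 / 2 + S / 8 * sin (2 * π / S * s))

lemma contDiff_switch (S : ℝ) : Smooth (switch S) := smooth_step.comp (by fun_prop)

lemma switch_mem (S s : ℝ) : switch S s ∈ Icc (0 : ℝ) 1 :=
  ⟨smoothTransition.nonneg _, smoothTransition.le_one _⟩

lemma switch_add_mul {S : ℝ} (hS : 0 < S) (s : ℝ) (z : ℤ) : switch S (s + S * z) = switch S s := by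
  have : 2 * π / S * (s + S * z) = 2 * π / S * s + z * (2 * π) := by field_simp
  rw [switch, this, Real.sin_add_int_mul_two_pi]; rfl

lemma le_sin_of_mem {S s : ℝ} (hS : 0 < S) (h1 : 1 ≤ s) (h2 : s ≤ S / 2 - 1) :
    4 / S ≤ sin (2 * π / S * s) := by
  have hpi := pi_pos
  have key : ∀ r : ℝ, 1 ≤ r → r ≤ S / 4 → 4 / S ≤ sin (2 * π / S * r) := by
    intro r hr1 hr2
    have hx : 2 * π / S * r ≤ π / 2 := by rw [div_mul_eq_mul_div, div_le_iff₀ hS]; nlinarith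
    refine le_trans ?_ (Real.mul_le_sin (by positivity) hx)
    have : 2 / π * (2 * π / S * r) = 4 / S * r := by field_simp; norm_num
    rw [this]
    have : 0 < 4 / S := by positivity
    nlinarith
  rcases le_total s (S / 4) with h | h
  · exact key s h1 h
  · have h3 := key (S / 2 - s) (by linarith) (by linarith)
    have : 2 * π / S * (S / 2 - s) = π - 2 * π / S * s := by field_simp
    rwa [this, Real.sin_pi_sub] at h3

lemma switch_eq_one {S s : ℝ} (hS : 0 < S) (h1 : 1 ≤ s) (h2 : s ≤ S / 2 - 1) : switch S s = 1 := by
  refine one_of_one_le ?_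
  have h := le_sin_of_mem hS h1 h2
  rw [div_le_iff₀ hS] at h
  linarith

lemma switch_eq_zero {S s : ℝ} (hS : 0 < S) (h1 : S / 2 + 1 ≤ s) (h2 : s ≤ S - 1) :
    switch S s = 0 := by
  refine zero_of_nonpos ?_
  have h := le_sin_of_mem hS (s := s - S / 2) (by linarith) (by linarith)
  have h3 : 2 * π / S * (s - S / 2) = 2 * π / S * s - π := by field_simp
  rw [h3, Real.sin_sub_pi, div_le_iff₀ hS] at h
  linarith

lemma exists_bound_deriv_switch : ∃ K, 0 ≤ K ∧ ∀ S, 1 ≤ S → ∀ s, |deriv (switch S) s| ≤ K ∧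
    |deriv (deriv (switch S)) s| ≤ K := by
  obtain ⟨C, hC1, hC⟩ := exists_bound_step
  have hpi := pi_pos
  refine ⟨C * (π / 4) ^ 2 + C * (π / 4) + C * (π ^ 2 / 2), by positivity, fun S hS s => ?_⟩
  have hS0 : 0 < S := by linarith
  have hin : ∀ s, HasDerivAt (fun s => 1 / 2 + S / 8 * sin (2 * π / S * s))
      (π / 4 * cos (2 * π / S * s)) s := by
    intro s
    have h := (((Real.hasDerivAt_sin (2 * π / S * s)).comp s
      ((hasDerivAt_id s).const_mul (2 * π / S))).const_mul (S / 8)).const_add (1 / 2)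
    refine HasDerivAt.congr_deriv h ?_
    field_simp; ring
  have hco : HasDerivAt (fun s => π / 4 * cos (2 * π / S * s))
      (-(π ^ 2 / 2 / S) * sin (2 * π / S * s)) s := by
    have h := ((Real.hasDerivAt_cos (2 * π / S * s)).comp s
      ((hasDerivAt_id s).const_mul (2 * π / S))).const_mul (π / 4)
    refine HasDerivAt.congr_deriv h ?_
    field_simp; norm_num
  have hd := smooth_diff smooth_step
  have hd2 := smooth_diff (smooth_deriv smooth_step)
  have e1 : deriv (switch S) = fun s => deriv step
      (1 / 2 + S / 8 * sin (2 * π / S * s)) * (π / 4 * cos (2 * π / S * s)) := by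
    ext r
    exact ((hd _).hasDerivAt.comp r (hin r)).deriv
  have e2 := (((hd2 (1 / 2 + S / 8 * sin (2 * π / S * s))).hasDerivAt.comp s (hin s)).mul hco).deriv
  obtain ⟨b1, b2⟩ := hC (1 / 2 + S / 8 * sin (2 * π / S * s))
  have c1 : |π / 4 * cos (2 * π / S * s)| ≤ π / 4 := by
    rw [abs_mul, abs_of_pos (by positivity)]
    exact mul_le_of_le_one_right (by positivity) (Real.abs_cos_le_one _)
  have c2 : |-(π ^ 2 / 2 / S) * sin (2 * π / S * s)| ≤ π ^ 2 / 2 := by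
    rw [abs_mul, abs_neg, abs_of_nonneg (by positivity)]
    refine (mul_le_of_le_one_right (by positivity) (Real.abs_sin_le_one _)).trans ?_
    exact div_le_self (by positivity) hS
  have p1 : 0 ≤ C * (π / 4) ^ 2 := by positivity
  have p2 : 0 ≤ C * (π / 4) := by positivity
  have p3 : 0 ≤ C * (π ^ 2 / 2) := by positivity
  constructor
  · rw [e1, abs_mul]
    have := mul_le_mul b1 c1 (abs_nonneg _) (by linarith)
    linarith
  · rw [e1]
    change |deriv (fun y => deriv step (1 / 2 + S / 8 * sin (2 * π / S * y)) *
        (π / 4 * cos (2 * π / S * y))) s| ≤ _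
    refine (congrArg abs e2).le.trans ((abs_add_le _ _).trans ?_)
    have h1 : |deriv (deriv step) (1 / 2 + S / 8 * sin (2 * π / S * s)) *
        (π / 4 * cos (2 * π / S * s)) *
        (π / 4 * cos (2 * π / S * s))| ≤ C * (π / 4) * (π / 4) := by
      rw [abs_mul, abs_mul]
      gcongr
    have h2 : |deriv step (1 / 2 + S / 8 * sin (2 * π / S * s)) *
        (-(π ^ 2 / 2 / S) * sin (2 * π / S * s))| ≤ C * (π ^ 2 / 2) := by
      rw [abs_mul]
      gcongr
    refine (add_le_add h1 h2).trans ?_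
    nlinarith

lemma pd_add_of_periodic {m : ℕ} {g : Space m → ℝ} {w : Space m} (h : ∀ x, g (x + w) = g x)
    (j : Fin m) (x : Space m) : pd j g (x + w) = pd j g x := by
  unfold pd
  rw [← fderiv_comp_add_right]
  simp only [h]

lemma mk_add_mul (y : Lat n) (P : ℝ) (z : Fin n → ℤ) (s : ℝ) :
    mk (fun j => y j + P * z j) s = mk y s + mk (fun j => P * (z j : ℝ)) 0 := by
  ext i; refine lastCases ?_ (fun j => ?_) i <;> simp

lemma IsCell.add_eq {P : ℕ} {V : Pt n → Space d} (hV : IsCell a P V) (z : Fin n → ℤ)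
    (x : Pt n) : V (x + SurfaceTension.mk (fun j => (P : ℝ) * (z j : ℝ)) 0) = V x := by
  have := hV.periodic z (lat x) (x (last n))
  rwa [mk_add_mul, mk_lat] at this

lemma IsCell.mul {P m : ℕ} {V : Pt n → Space d} (hV : IsCell a P V) (hm : 0 < m) :
    IsCell a (P * m) V where
  pos := Nat.mul_pos hV.pos hm
  smooth := hV.smooth
  periodic z y s := by
    rw [← hV.periodic (fun j => m * z j) y s]
    congr 2; ext j; push_cast; ring
  roof := hV.roof

lemma exists_bound_of_periodic {P : ℕ} (hP : 0 < P) {g : Pt n → ℝ} (hg : Continuous g)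
    (h : ∀ (z : Fin n → ℤ) (x : Pt n), g (x + mk (fun j => (P : ℝ) * (z j : ℝ)) 0) = g x)
    (T : ℝ) : ∃ B, ∀ x, |x (last n)| ≤ T → |g x| ≤ B := by
  have hP0 : (0 : ℝ) < P := by exact_mod_cast hP
  have hK : IsCompact ((fun q : (Lat n) × ℝ => mk q.1 q.2) '' (latCube n 0 P ×ˢ Icc (-T) T)) :=
    (isCompact_Icc.prod isCompact_Icc).image continuous_mk
  obtain ⟨B, hB⟩ := hK.exists_bound_of_continuousOn hg.continuousOn
  refine ⟨B, fun x hx => ?_⟩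
  rw [← h (fun j => -⌊lat x j / P⌋) x, ← Real.norm_eq_abs]
  refine hB _ ⟨(fun j => lat x j + P * ((-⌊lat x j / P⌋ : ℤ) : ℝ), x (last n)), ⟨?_, abs_le.1 hx⟩, ?_⟩
  · refine mem_latCube.2 fun j => ?_
    have h1 := Int.floor_le (lat x j / P)
    have h2 := (Int.lt_floor_add_one (lat x j / P)).le
    rw [le_div_iff₀ hP0] at h1
    rw [div_le_iff₀ hP0] at h2
    push_cast
    constructor <;> nlinarith
  · simp only
    rw [mk_add_mul, mk_lat]

lemma IsCell.exists_bound {P : ℕ} {V : Pt n → Space d} (hV : IsCell a P V) (T : ℝ) :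
    ∃ B, ∀ x, |x (last n)| ≤ T →
      ‖V x‖ ≤ B ∧ matNorm (grad V x) ≤ B ∧ hessNorm V x ≤ B := by
  have hg : ∀ (z : Fin n → ℤ) x, grad V (x + SurfaceTension.mk (fun j => (P : ℝ) * (z j : ℝ)) 0) =
      grad V x := by
    intro z x; ext i j
    exact pd_add_of_periodic (fun x => by rw [hV.add_eq]) j x
  have hh : ∀ (z : Fin n → ℤ) x, hess V (x + SurfaceTension.mk (fun j => (P : ℝ) * (z j : ℝ)) 0) =
      hess V x := by
    intro z x; ext i j k
    exact pd_add_of_periodic (pd_add_of_periodic (fun x => by rw [hV.add_eq]) j) k x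
  obtain ⟨B, hB⟩ := exists_bound_of_periodic hV.pos (g := fun x => ‖V x‖ + matNorm (grad V x) +
    hessNorm V x) ((hV.smooth.continuous.norm.add
      (continuous_matNorm.comp (continuous_grad hV.smooth))).add
        (continuous_tensorNorm.comp (continuous_hess hV.smooth)))
    (fun z x => by simp only [hV.add_eq, hg, hh]) T
  refine ⟨B, fun x hx => ?_⟩
  have h := (le_abs_self _).trans (hB x hx)
  have h1 := norm_nonneg (V x)
  have h2 := matNorm_nonneg (grad V x)
  have h3 := tensorNorm_nonneg (hess V x)
  exact ⟨by linarith, by linarith, by linarith⟩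

lemma volume_layer_le {m : ℕ} {S : ℝ} (s t : ℝ) :
    volume {y : Fin (m + 1) → ℝ | y ∈ latCube (m + 1) 0 S ∧ y 0 ∈ Icc s t} ≤
      ofReal (t - s) * ofReal S ^ m := by
  have : {y : Fin (m + 1) → ℝ | y ∈ latCube (m + 1) 0 S ∧ y 0 ∈ Icc s t} ⊆
      Set.univ.pi fun j => if j = 0 then Icc s t else Icc 0 S := by
    rintro y ⟨h1, h2⟩ j -
    rw [mem_latCube] at h1
    by_cases hj : j = 0
    · subst hj; simpa using h2
    · simpa [hj] using h1 j
  refine (measure_mono this).trans ?_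
  rw [volume_pi_pi, Fin.prod_univ_succ]
  simp [Fin.succ_ne_zero]

end Columns

/-! ### Midpoints and averages of attained pairs -/

section Midpoint

variable {n d : ℕ} {W : Matrix (Fin d) (Fin (n + 2)) ℝ → ℝ} {a : Space d} {p C ε l : ℝ}

/-- A function that coincides with one periodic function on one half of a large box, and with
another one on the other half, except for layers of bounded width. -/
lemma lintegral_switch_le {Q M : ℕ} (hQ : 0 < Q) (hM : 0 < M) {F f g : Space (n + 2) → ENNReal}
    (hf : ∀ (z : Fin (n + 1) → ℤ) (y : Lat (n + 1)) (s : ℝ),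
      f (mk (fun j => y j + Q * z j) s) = f (mk y s))
    (hg : ∀ (z : Fin (n + 1) → ℤ) (y : Lat (n + 1)) (s : ℝ),
      g (mk (fun j => y j + Q * z j) s) = g (mk y s))
    {B T : ℝ}
    (h1 : ∀ x, lat x 0 ∈ Ioo (1 : ℝ) (M * Q - 1) → F x = f x)
    (h2 : ∀ x, lat x 0 ∈ Ioo (M * Q + 1 : ℝ) (2 * (M * Q) - 1) → F x = g x)
    (h3 : ∀ x, |x (last (n + 1))| ≤ T → F x ≤ ofReal B)
    (h4 : ∀ x, T < |x (last (n + 1))| → F x = 0) :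
    ∫⁻ x in cyl (latCube (n + 1) 0 (2 * M * Q : ℕ)) univ, F x ≤
      ((2 * M * Q : ℕ) : ENNReal) ^ (n + 1) * (2⁻¹ *
        ((((Q : ENNReal) ^ (n + 1))⁻¹ * ∫⁻ x in cyl (latCube (n + 1) 0 Q) univ, f x) +
          (((Q : ENNReal) ^ (n + 1))⁻¹ * ∫⁻ x in cyl (latCube (n + 1) 0 Q) univ, g x))) +
      ofReal B * (4 * ((2 * M * Q : ℕ) : ENNReal) ^ n * ofReal (2 * T)) := by
  set S : ℕ := 2 * M * Q with hS
  have hSr : (S : ℝ) = 2 * (M * Q) := by rw [hS]; push_cast; ring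
  have hM0 : (0 : ℝ) < M := by exact_mod_cast hM
  have hQ0 : (0 : ℝ) < Q := by exact_mod_cast hQ
  set Lay : ℝ → ℝ → Set (Lat (n + 1)) := fun s t =>
    {y | y ∈ latCube (n + 1) 0 S ∧ y 0 ∈ Icc s t}
  set L : Set (Lat (n + 1)) := Lay 0 1 ∪ (Lay (M * Q - 1) (M * Q + 1) ∪ Lay (S - 1) S)
  have hLm : ∀ s t, MeasurableSet (Lay s t) := fun s t =>
    (measurableSet_latCube _ _).inter (measurableSet_Icc.preimage (measurable_pi_apply 0))
  have hLm' : MeasurableSet L := (hLm _ _).union ((hLm _ _).union (hLm _ _))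
  set m : Fin (n + 1) → ℕ := fun j => if j = 0 then M else 2 * M with hm
  have hm0 : ∀ j, 0 < m j := by intro j; simp only [hm]; split_ifs <;> omega
  have hprod : (∏ j, (m j : ENNReal)) = (S : ENNReal) ^ (n + 1) * (2⁻¹ * ((Q : ENNReal) ^ (n + 1))⁻¹) := by
    have hQt : (Q : ENNReal) ^ (n + 1) ≠ ⊤ := by simp
    have hQz : (Q : ENNReal) ^ (n + 1) ≠ 0 := by simp; omega
    rw [Fin.prod_univ_succ]
    simp only [hm, if_true, Fin.succ_ne_zero, if_false, Finset.prod_const, Finset.card_univ,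
      Fintype.card_fin, hS]
    push_cast
    have e : (2 * (M : ENNReal) * Q) ^ (n + 1) * (2⁻¹ * ((Q : ENNReal) ^ (n + 1))⁻¹) =
        M * (2 * (M : ENNReal)) ^ n * ((Q : ENNReal) ^ (n + 1) * ((Q : ENNReal) ^ (n + 1))⁻¹) * (2 * 2⁻¹) := by
      ring
    rw [e, ENNReal.mul_inv_cancel hQz hQt, ENNReal.mul_inv_cancel two_ne_zero (by simp), mul_one,
      mul_one]
  set z : Fin (n + 1) → ℤ := fun j => if j = 0 then M else 0 with hz
  set B₁ := Icc (fun j => (Q : ℝ) * ((0 : Fin (n + 1) → ℤ) j : ℤ))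
    (fun j => (Q : ℝ) * (((0 : Fin (n + 1) → ℤ) j : ℤ) + m j))
  set B₂ := Icc (fun j => (Q : ℝ) * (z j : ℤ)) (fun j => (Q : ℝ) * ((z j : ℤ) + m j))
  have i1 := lintegral_periodic_box_le hQ hf 0 m hm0
  have i2 := lintegral_periodic_box_le hQ hg z m hm0
  have hcov : cyl (latCube (n + 1) 0 (S : ℕ)) univ ⊆
      (cyl {y | y ∈ latCube (n + 1) 0 S ∧ y 0 ∈ Ioo (1 : ℝ) (M * Q - 1)} univ ∪
      cyl {y | y ∈ latCube (n + 1) 0 S ∧ y 0 ∈ Ioo (M * Q + 1 : ℝ) (2 * (M * Q) - 1)}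
        univ) ∪ (cyl L (Icc (-T) T) ∪ {x | T < |x (last (n + 1))|}) := by
    rintro x ⟨hx, -⟩
    by_cases hT : T < |x (last (n + 1))|
    · exact Or.inr (Or.inr hT)
    have hT' := abs_le.1 (not_lt.1 hT)
    have h0 := (mem_latCube.1 hx) 0
    rw [zero_add] at h0
    by_cases c1 : lat x 0 ≤ 1
    · exact Or.inr (Or.inl ⟨Or.inl ⟨hx, h0.1, c1⟩, hT'⟩)
    by_cases c2 : lat x 0 < M * Q - 1
    · exact Or.inl (Or.inl ⟨⟨hx, not_le.1 c1, c2⟩, trivial⟩)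
    by_cases c3 : lat x 0 ≤ M * Q + 1
    · exact Or.inr (Or.inl ⟨Or.inr (Or.inl ⟨hx, not_lt.1 c2, c3⟩), hT'⟩)
    by_cases c4 : lat x 0 < 2 * (M * Q) - 1
    · exact Or.inl (Or.inr ⟨⟨hx, not_le.1 c3, c4⟩, trivial⟩)
    · refine Or.inr (Or.inl ⟨Or.inr (Or.inr ⟨hx, ?_, h0.2⟩), hT'⟩)
      rw [hSr]; exact not_lt.1 c4
  have hms1 : ∀ s t : ℝ, MeasurableSet (cyl
      {y : Fin (n + 1) → ℝ | y ∈ latCube (n + 1) 0 S ∧ y 0 ∈ Ioo s t} (univ : Set ℝ)) :=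
    fun s t => measurableSet_cyl ((measurableSet_latCube _ _).inter
      (measurableSet_Ioo.preimage (measurable_pi_apply 0))) MeasurableSet.univ
  have j1 : ∫⁻ x in cyl {y | y ∈ latCube (n + 1) 0 S ∧ y 0 ∈ Ioo (1 : ℝ) (M * Q - 1)}
      univ, F x ≤ ∫⁻ x in cyl B₁ univ, f x := by
    rw [setLIntegral_congr_fun (hms1 _ _) (g := f) fun x hx => h1 x hx.1.2]
    refine lintegral_mono_set (cyl_mono (fun y hy => ?_) le_rfl)
    have hy1 := mem_latCube.1 hy.1
    refine ⟨fun j => by simpa using (hy1 j).1, fun j => ?_⟩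
    by_cases hj : j = 0
    · subst hj
      have := hy.2.2
      simp [hm]; nlinarith
    · have := (hy1 j).2
      simp [hm, hj]; rw [zero_add, hSr] at this; linarith
  have j2 : ∫⁻ x in cyl {y | y ∈ latCube (n + 1) 0 S ∧ y 0 ∈
      Ioo (M * Q + 1 : ℝ) (2 * (M * Q) - 1)} univ, F x ≤ ∫⁻ x in cyl B₂ univ, g x := by
    rw [setLIntegral_congr_fun (hms1 _ _) (g := g) fun x hx => h2 x hx.1.2]
    refine lintegral_mono_set (cyl_mono (fun y hy => ?_) le_rfl)
    have hy1 := mem_latCube.1 hy.1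
    refine ⟨fun j => ?_, fun j => ?_⟩
    · by_cases hj : j = 0
      · subst hj
        have := hy.2.1
        simp [hz]; nlinarith
      · simpa [hz, hj] using (hy1 j).1
    · by_cases hj : j = 0
      · subst hj
        have := hy.2.2
        simp [hm, hz]; nlinarith
      · have := (hy1 j).2
        simp [hm, hz, hj]; rw [zero_add, hSr] at this; linarith
  have j3 : ∫⁻ x in cyl L (Icc (-T) T), F x ≤
      ofReal B * (4 * (S : ENNReal) ^ n * ofReal (2 * T)) := by
    refine (setLIntegral_mono measurable_const fun x hx => h3 x (abs_le.2 hx.2)).trans ?_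
    rw [setLIntegral_const, volume_cyl hLm' measurableSet_Icc, Real.volume_Icc]
    have hvol : volume L ≤ 4 * (S : ENNReal) ^ n := by
      have e : (4 : ENNReal) = ofReal 1 + (ofReal 2 + ofReal 1) := by
        rw [← ofReal_add, ← ofReal_add] <;> norm_num
      have hv := fun s t : ℝ => volume_layer_le (m := n) (S := S) s t
      rw [ENNReal.ofReal_natCast] at hv
      rw [e, add_mul, add_mul]
      refine (measure_union_le _ _).trans (add_le_add ?_
        ((measure_union_le _ _).trans (add_le_add ?_ ?_)))
      · refine (hv _ _).trans (le_of_eq ?_); rw [sub_zero]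
      · refine (hv _ _).trans (le_of_eq ?_); congr 2; ring
      · refine (hv _ _).trans (le_of_eq ?_); congr 2; ring
    rw [show T - -T = 2 * T by ring]
    gcongr
  have j4 : ∫⁻ x in {x : Space (n + 2) | T < |x (last (n + 1))|}, F x = 0 := by
    have hmeas : MeasurableSet {x : Space (n + 2) | T < |x (last (n + 1))|} :=
      measurableSet_lt measurable_const (measurable_last.abs)
    rw [setLIntegral_congr_fun hmeas (g := fun _ => 0) fun x hx => h4 x hx]
    simp
  calc _ ≤ _ := lintegral_mono_set hcov
    _ ≤ _ := (lintegral_union_le _ _ _).trans (add_le_add (lintegral_union_le _ _ _)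
        (lintegral_union_le _ _ _))
    _ ≤ _ := by
      rw [j4, add_zero]
      refine add_le_add ((add_le_add (j1.trans i1) (j2.trans i2)).trans (le_of_eq ?_)) j3
      rw [hprod]; ring

lemma lintegral_period_mul_le {P m : ℕ} (hP : 0 < P) (hm : 0 < m) {f : Space (n + 2) → ENNReal}
    (hf : ∀ (z : Fin (n + 1) → ℤ) (y : Lat (n + 1)) (s : ℝ),
      f (mk (fun j => y j + P * z j) s) = f (mk y s)) {X : ENNReal}
    (h : ∫⁻ x in cyl (latCube (n + 1) 0 P) univ, f x ≤ (P : ENNReal) ^ (n + 1) * X) :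
    (((P * m : ℕ) : ENNReal) ^ (n + 1))⁻¹ *
      ∫⁻ x in cyl (latCube (n + 1) 0 (P * m : ℕ)) univ, f x ≤ X := by
  have h1 := lintegral_periodic_box_le hP hf 0 (fun _ => m) fun _ => hm
  have e : latCube (n + 1) 0 (P * m : ℕ) = Icc (fun j => (P : ℝ) * ((0 : Fin (n + 1) → ℤ) j : ℤ))
      (fun j => (P : ℝ) * (((0 : Fin (n + 1) → ℤ) j : ℤ) + (m : ℝ))) := by
    simp [latCube]
  rw [e]
  have h2 := h1.trans (mul_le_mul_right h _)
  rw [ENNReal.inv_mul_le_iff (by simp; omega) (by finiteness)]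
  refine h2.trans (le_of_eq ?_)
  simp
  ring

/-- Blending two cells gives a function whose densities are bounded near the interface of zero
energy, uniformly in the period of the blend. -/
lemma exists_blend_bound (hwb : WellBounds W a p C) (hp : 2 ≤ p) (hε : 0 < ε) (hl : l ≤ 0)
    {Q : ℕ} {V V' : Space (n + 2) → Space d} (hV : IsCell a Q V) (hV' : IsCell a Q V') (T : ℝ) :
    ∃ B : ℝ, 0 ≤ B ∧ ∀ S : ℝ, 1 ≤ S → ∀ x, |x (last (n + 1))| ≤ T →
      eDens W ε l (blend (castSucc 0) (switch S) V' fun y => V y - V' y) x ≤ B ∧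
      cDens l (blend (castSucc 0) (switch S) V' fun y => V y - V' y) x ≤ B := by
  obtain ⟨B₁, hB₁⟩ := hV.exists_bound T
  obtain ⟨B₂, hB₂⟩ := hV'.exists_bound T
  obtain ⟨K, hK, hsw⟩ := exists_bound_deriv_switch
  set B₀ := max 0 (max B₁ B₂)
  have hB0 : 0 ≤ B₀ := le_max_left _ _
  have l1 : B₁ ≤ B₀ := (le_max_left _ _).trans (le_max_right _ _)
  have l2 : B₂ ≤ B₀ := (le_max_right _ _).trans (le_max_right _ _)
  set b := 3 * B₀ + 6 * K * B₀ with hb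
  have hb0 : 0 ≤ b := by positivity
  set R := √(d * (n + 1 + 1) : ℕ) * b with hR
  set R' := √(d * ((n + 1 + 1) * (n + 1 + 1)) : ℕ) * b with hR'
  have hR0 : 0 ≤ R := by positivity
  have hR0' : 0 ≤ R' := by positivity
  have hC := hwb.pos
  have hA := matNorm_nonneg (tensorLast (n + 1) a)
  refine ⟨1 / ε * (C * (R + matNorm (tensorLast (n + 1) a)) ^ p) + 2 * (ε * R' ^ 2) + R',
    by positivity, fun S hS x hx => ?_⟩
  set θ := fun y => V y - V' y with hθ
  have hθs : Smooth θ := hV.smooth.sub hV'.smooth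
  obtain ⟨a1, a2, a3⟩ := hB₁ x hx
  obtain ⟨b1, b2, b3⟩ := hB₂ x hx
  obtain ⟨k1, k2⟩ := hsw S hS (x (castSucc 0))
  have hφ := switch_mem S (x (castSucc 0))
  have hφ1 : |switch S (x (castSucc 0))| ≤ 1 := by rw [abs_of_nonneg hφ.1]; exact hφ.2
  have t0 : ∀ i, |θ x i| ≤ 2 * B₀ := fun i => by
    have u1 := (abs_coord_le_norm (V x) i)
    have u2 := (abs_coord_le_norm (V' x) i)
    have : θ x i = V x i - V' x i := rfl
    rw [this]
    exact (abs_sub _ _).trans (by linarith)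
  have t1 : ∀ i j, |grad θ x i j| ≤ 2 * B₀ := fun i j => by
    rw [hθ, grad_sub hV.smooth hV'.smooth]
    have u1 := abs_le_matNorm (grad V x) i j
    have u2 := abs_le_matNorm (grad V' x) i j
    exact (abs_sub _ _).trans (by linarith)
  have t2 : ∀ i j k, |hess θ x i j k| ≤ 2 * B₀ := fun i j k => by
    rw [hθ, hess_sub hV.smooth hV'.smooth]
    have u1 := abs_le_tensorNorm (hess V x) i j k
    have u2 := abs_le_tensorNorm (hess V' x) i j k
    exact (abs_sub _ _).trans (by linarith)
  have m1 : ∀ {r s : ℝ}, |r| ≤ 1 → |s| ≤ 2 * B₀ → |r * s| ≤ 2 * B₀ := fun hr hs => by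
    rw [abs_mul]; exact (mul_le_of_le_one_left (abs_nonneg _) hr).trans hs
  have m2 : ∀ {r s : ℝ}, |r| ≤ K → |s| ≤ 2 * B₀ → |r * s| ≤ K * (2 * B₀) := fun hr hs => by
    rw [abs_mul]; exact mul_le_mul hr hs (abs_nonneg _) hK
  have hif : ∀ (q : Prop) [Decidable q] (r : ℝ), |r| ≤ K → |if q then r else 0| ≤ K := by
    intro q _ r hr; split_ifs
    · exact hr
    · simpa using hK
  have hg : matNorm (grad (blend (castSucc 0) (switch S) V' θ) x) ≤ R := by
    have := matNorm_le_of_abs_le (ξ := grad (blend (castSucc 0) (switch S) V' θ) x) (ζ := 0)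
      le_rfl hb0 fun i j => ?_
    · simpa [hR] using this
    · rw [grad_blend (contDiff_switch S) hV'.smooth hθs]
      have u2 := abs_le_matNorm (grad V' x) i j
      have u3 := m1 hφ1 (t1 i j)
      have u4 := m2 (hif (j = castSucc 0) _ k1) (t0 i)
      refine (abs_add_le _ _).trans ((add_le_add le_rfl (abs_add_le _ _)).trans ?_)
      have := mul_nonneg hK hB0
      rw [zero_mul, zero_add, hb]
      linarith
  have hh : tensorNorm (hess (blend (castSucc 0) (switch S) V' θ) x) ≤ R' := by
    have := tensorNorm_le_of_abs_le (T := hess (blend (castSucc 0) (switch S) V' θ) x)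
      (S := fun _ _ _ => 0) le_rfl hb0 fun i j k => ?_
    · simpa [hR'] using this
    · rw [hess_blend (contDiff_switch S) hV'.smooth hθs]
      have u2 := abs_le_tensorNorm (hess V' x) i j k
      have u3 := m1 hφ1 (t2 i j k)
      have u4 := m2 (hif (k = castSucc 0) _ k1) (t1 i j)
      have u5 := m2 (hif (j = castSucc 0) _ k1) (t1 i k)
      have u6 := m2 (hif (j = castSucc 0) _ (hif (k = castSucc 0) _ k2)) (t0 i)
      refine (abs_add_le _ _).trans ((add_le_add le_rfl ((abs_add_le _ _).trans
        (add_le_add ((abs_add_le _ _).trans (add_le_add (abs_add_le _ _) le_rfl)) le_rfl))).trans ?_)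
      have := mul_nonneg hK hB0
      rw [zero_mul, zero_add, hb]
      linarith
  have hpos1 : 0 ≤ 1 / ε * (C * (R + matNorm (tensorLast (n + 1) a)) ^ p) + 2 * (ε * R' ^ 2) := by
    positivity
  constructor
  · refine (eFun_le hε _ _).trans ?_
    have h0 := tensorNorm_nonneg (hess (blend (castSucc 0) (switch S) V' θ) x)
    have hW' := hwb.upper (grad (blend (castSucc 0) (switch S) V' θ) x)
    have h3 : matNorm (grad (blend (castSucc 0) (switch S) V' θ) x - tensorLast (n + 1) a) ≤
        R + matNorm (tensorLast (n + 1) a) := by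
      rw [sub_eq_add_neg]
      refine (matNorm_add_le _ _).trans ?_
      rw [matNorm_neg]; gcongr
    have h4 := rpow_le_rpow (matNorm_nonneg _) h3 (by linarith : 0 ≤ p)
    have h5 : W (grad (blend (castSucc 0) (switch S) V' θ) x) ≤
        C * (R + matNorm (tensorLast (n + 1) a)) ^ p := hW'.trans (by gcongr)
    refine le_trans ?_ (le_add_of_nonneg_right hR0')
    gcongr
  · exact ((cDens_le hl x).trans hh).trans (le_add_of_nonneg_left hpos1)

/-- Two cells are placed next to each other, each of them on half of a large period. -/
lemma Attain.midpoint (hwb : WellBounds W a p C) (hp : 2 ≤ p) (hW : ∀ ξ, 0 ≤ W ξ)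
    (hWe : IsColumnEven W) (hε : 0 < ε) (hl : l ≤ 0) {E G E' G' : ENNReal} (h : Attain W a ε l E G)
    (h' : Attain W a ε l E' G') : Attain W a ε l (2⁻¹ * (E + E')) (2⁻¹ * (G + G')) := by
  intro κ hκ
  obtain ⟨P, V, hV, hVe, hVc⟩ := h (κ / 2) (by positivity)
  obtain ⟨P', V', hV', hVe', hVc'⟩ := h' (κ / 2) (by positivity)
  have he := lintegral_period_mul_le hV.pos hV'.pos (f := fun x => ofReal (eDens W ε l V x))
    (fun z y s => by rw [hV.eDens_periodic hWe]) hVe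
  have hc := lintegral_period_mul_le hV.pos hV'.pos (f := fun x => ofReal (cDens l V x))
    (fun z y s => by rw [hV.cDens_periodic]) hVc
  have he' := lintegral_period_mul_le hV'.pos hV.pos (f := fun x => ofReal (eDens W ε l V' x))
    (fun z y s => by rw [hV'.eDens_periodic hWe]) hVe'
  have hc' := lintegral_period_mul_le hV'.pos hV.pos (f := fun x => ofReal (cDens l V' x))
    (fun z y s => by rw [hV'.cDens_periodic]) hVc'
  -- both cells have the common period `Q = P * P'`
  have gV := hV.mul hV'.pos
  have gV' := hV'.mul hV.pos
  rw [mul_comm P' P] at he' hc' gV'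
  set Q := P * P'
  have hQ0 : 0 < Q := gV.pos
  obtain ⟨T₁, hT₁⟩ := gV.roof
  obtain ⟨T₂, hT₂⟩ := gV'.roof
  set T := max 0 (max T₁ T₂)
  have hT0 : 0 ≤ T := le_max_left _ _
  have l1 : T₁ ≤ T := (le_max_left _ _).trans (le_max_right _ _)
  have l2 : T₂ ≤ T := (le_max_right _ _).trans (le_max_right _ _)
  obtain ⟨B, hB0, hB⟩ := exists_blend_bound (ε := ε) hwb hp hε hl gV gV' T
  -- the interfaces have volume of order `S ^ n` in a period of volume `S ^ (n + 1)`
  obtain ⟨M, hM⟩ := exists_nat_gt (8 * B * T / (κ / 2))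
  have hM0 : 0 < M := by
    have : (0 : ℝ) ≤ 8 * B * T / (κ / 2) := by positivity
    exact_mod_cast this.trans_lt hM
  set S : ℕ := 2 * M * Q with hS
  have hS1 : 1 ≤ S := Nat.succ_le_of_lt (by positivity)
  have hSr : (S : ℝ) = 2 * (M * Q) := by rw [hS]; push_cast; ring
  have hSpos : (0 : ℝ) < S := by exact_mod_cast hS1
  set θ := fun y => V y - V' y with hθ
  have hθs : Smooth θ := hV.smooth.sub hV'.smooth
  set U := blend (castSucc 0) (switch S) V' θ with hU
  have hroof : ∀ x, T ≤ |x (last (n + 1))| → U x = |x (last (n + 1))| • a := by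
    intro x hx
    simp only [hU, blend, hθ, hT₁ x (l1.trans hx), hT₂ x (l2.trans hx), sub_self, smul_zero, add_zero]
  have hUs : Smooth U := contDiff_blend _ (contDiff_switch S) hV'.smooth hθs
  have hlat : ∀ x : Space (n + 2), lat x 0 = x (castSucc 0) := fun x => rfl
  have n1 : ∀ x, lat x 0 ∈ Ioo (1 : ℝ) (M * Q - 1) → U =ᶠ[𝓝 x] V := by
    intro x hx
    have hopen : IsOpen {y : Space (n + 2) | lat y 0 ∈ Ioo (1 : ℝ) (M * Q - 1)} :=
      isOpen_Ioo.preimage ((continuous_apply 0).comp continuous_lat)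
    filter_upwards [hopen.mem_nhds hx] with y hy
    have : switch S (y (castSucc 0)) = 1 :=
      switch_eq_one hSpos hy.1.le (by rw [hSr]; linarith [hy.2.le, hlat y])
    simp only [hU, blend, this, one_smul, hθ]
    exact add_sub_cancel _ _
  have n2 : ∀ x, lat x 0 ∈ Ioo (M * Q + 1 : ℝ) (2 * (M * Q) - 1) → U =ᶠ[𝓝 x] V' := by
    intro x hx
    have hopen : IsOpen {y : Space (n + 2) | lat y 0 ∈ Ioo (M * Q + 1 : ℝ) (2 * (M * Q) - 1)} :=
      isOpen_Ioo.preimage ((continuous_apply 0).comp continuous_lat)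
    filter_upwards [hopen.mem_nhds hx] with y hy
    have : switch S (y (castSucc 0)) = 0 :=
      switch_eq_zero hSpos (by rw [hSr]; linarith [hy.1.le, hlat y])
        (by rw [hSr]; linarith [hy.2.le, hlat y])
    simp only [hU, blend, this, zero_smul, add_zero]
  have hcell : IsCell a S U := by
    refine ⟨hS1, hUs, fun z y s => ?_, ⟨T, hroof⟩⟩
    have e1 := (gV.mul (m := 2 * M) (by positivity)).periodic z y s
    have e2 := (gV'.mul (m := 2 * M) (by positivity)).periodic z y s
    rw [show Q * (2 * M) = S by rw [hS]; ring] at e1 e2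
    simp only [hU, blend, hθ, e1, e2, mk_castSucc]
    rw [switch_add_mul hSpos]
  have hsmall : ofReal B * (4 * (S : ENNReal) ^ n * ofReal (2 * T)) ≤
      (S : ENNReal) ^ (n + 1) * ofReal (κ / 2) := by
    have h4 : (4 : ENNReal) = ofReal 4 := by norm_num
    have : ofReal B * (4 * (S : ENNReal) ^ n * ofReal (2 * T)) =
        (S : ENNReal) ^ n * ofReal (8 * B * T) := by
      rw [show 8 * B * T = 4 * (B * (2 * T)) by ring,
        ofReal_mul (by norm_num : (0 : ℝ) ≤ 4), ofReal_mul hB0, ← h4]; ring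
    rw [this, pow_succ, mul_assoc ((S : ENNReal) ^ n), ← ENNReal.ofReal_natCast S, ← ofReal_mul hSpos.le]
    refine mul_le_mul_right (ofReal_mono ?_) _
    rw [div_lt_iff₀ (by positivity)] at hM
    have hMS : (M : ℝ) ≤ S := by
      rw [hSr]
      have : (1 : ℝ) ≤ Q := by exact_mod_cast hQ0
      have : (0 : ℝ) ≤ M := by positivity
      nlinarith
    have : (M : ℝ) * (κ / 2) ≤ S * (κ / 2) := by gcongr
    linarith
  have final : ∀ (I X Y A A' : ENNReal), X ≤ A + ofReal (κ / 2) →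
      Y ≤ A' + ofReal (κ / 2) → I ≤ (S : ENNReal) ^ (n + 1) * (2⁻¹ * (X + Y)) +
        ofReal B * (4 * (S : ENNReal) ^ n * ofReal (2 * T)) →
      I ≤ (S : ENNReal) ^ (n + 1) * (2⁻¹ * (A + A') + ofReal κ) := by
    intro I X Y A A' hX hY hI
    refine hI.trans ((add_le_add (mul_le_mul_right (mul_le_mul_right (add_le_add hX hY) _) _)
      hsmall).trans (le_of_eq ?_))
    rw [← mul_add]
    congr 1
    have e2 : (2 : ENNReal)⁻¹ * (ofReal (κ / 2) + ofReal (κ / 2)) = ofReal (κ / 2) := by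
      rw [← two_mul, ← mul_assoc, ENNReal.inv_mul_cancel two_ne_zero (by simp), one_mul]
    calc _ = 2⁻¹ * (A + A') + 2⁻¹ * (ofReal (κ / 2) + ofReal (κ / 2)) +
          ofReal (κ / 2) := by ring
      _ = _ := by rw [e2, add_assoc, ← ofReal_add (by positivity) (by positivity), add_halves]
  refine ⟨S, U, hcell, final _ _ _ _ _ he he' ?_, final _ _ _ _ _ hc hc' ?_⟩
  · refine lintegral_switch_le hQ0 hM0 (fun z y s => by rw [gV.eDens_periodic hWe])
      (fun z y s => by rw [gV'.eDens_periodic hWe]) (fun x hx => ?_) (fun x hx => ?_)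
      (fun x hx => ?_) (fun x hx => ?_)
    · rw [eDens_congr (n1 x hx)]
    · rw [eDens_congr (n2 x hx)]
    · exact ofReal_mono (hB S (by exact_mod_cast hS1) x hx).1
    · rw [(dens_eq_zero_of_roof hwb hp hW hl hT0 hroof hx).1, ENNReal.ofReal_zero]
  · refine lintegral_switch_le hQ0 hM0 (fun z y s => by rw [gV.cDens_periodic])
      (fun z y s => by rw [gV'.cDens_periodic]) (fun x hx => ?_) (fun x hx => ?_)
      (fun x hx => ?_) (fun x hx => ?_)
    · rw [cDens_congr (n1 x hx)]
    · rw [cDens_congr (n2 x hx)]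
    · exact ofReal_mono (hB S (by exact_mod_cast hS1) x hx).2
    · rw [(dens_eq_zero_of_roof (ε := ε) hwb hp hW hl hT0 hroof hx).2, ENNReal.ofReal_zero]

/-- Iterated midpoints are averages over `2 ^ q` pairs. -/
lemma Attain.average (hwb : WellBounds W a p C) (hp : 2 ≤ p) (hW : ∀ ξ, 0 ≤ W ξ)
    (hWe : IsColumnEven W) (hε : 0 < ε) (hl : l ≤ 0) (q : ℕ) : ∀ E G : ℕ → ENNReal,
    (∀ i, Attain W a ε l (E i) (G i)) →
    Attain W a ε l (((2 : ENNReal) ^ q)⁻¹ * ∑ i ∈ Finset.range (2 ^ q), E i)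
      (((2 : ENNReal) ^ q)⁻¹ * ∑ i ∈ Finset.range (2 ^ q), G i) := by
  induction q with
  | zero => intro E G h; simpa using h 0
  | succ q ih =>
    intro E G h
    have h1 := ih E G h
    have h2 := ih (fun i => E (2 ^ q + i)) (fun i => G (2 ^ q + i)) fun i => h _
    have := Attain.midpoint hwb hp hW hWe hε hl h1 h2
    have e : ∀ F : ℕ → ENNReal, 2⁻¹ * (((2 : ENNReal) ^ q)⁻¹ * ∑ i ∈ Finset.range (2 ^ q), F i +
        ((2 : ENNReal) ^ q)⁻¹ * ∑ i ∈ Finset.range (2 ^ q), F (2 ^ q + i)) =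
        ((2 : ENNReal) ^ (q + 1))⁻¹ * ∑ i ∈ Finset.range (2 ^ (q + 1)), F i := by
      intro F
      rw [pow_succ (2 : ℕ) q, mul_two, Finset.sum_range_add, pow_succ,
        ENNReal.mul_inv (Or.inr (by simp)) (Or.inr (by simp))]
      ring
    rwa [e, e] at this

end Midpoint

/-- Averages of attained pairs over a dyadic grid of tiles are attained. -/
lemma Attain.average_tiles {n d : ℕ} {W : Mat d n → ℝ} {a : Space d}
    {p C ε l : ℝ} (hwb : WellBounds W a p C) (hp : 2 ≤ p) (hW : ∀ ξ, 0 ≤ W ξ)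
    (hWe : IsColumnEven W) (hε : 0 < ε) (hl : l ≤ 0) {q k : ℕ} (hk : k = 2 ^ q)
    {E G : (Fin n → Fin k) → ENNReal} (h : ∀ j, Attain W a ε l (E j) (G j)) :
    Attain W a ε l (((k : ENNReal) ^ n)⁻¹ * ∑ j, E j) (((k : ENNReal) ^ n)⁻¹ * ∑ j, G j) := by
  cases n with
  -- in dimension one there is a single tile and nothing to average
  | zero => simpa using h default
  | succ n =>
    have hk0 : 0 < k := by rw [hk]; positivity
    have hcard : Fintype.card (Fin (n + 1) → Fin k) = 2 ^ (q * (n + 1)) := by simp [hk, pow_mul]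
    set e := Fintype.equivFinOfCardEq hcard
    have key : ∀ F : (Fin (n + 1) → Fin k) → ENNReal, ((2 : ENNReal) ^ (q * (n + 1)))⁻¹ *
        ∑ i ∈ Finset.range (2 ^ (q * (n + 1))),
          (if hi : i < 2 ^ (q * (n + 1)) then F (e.symm ⟨i, hi⟩) else F fun _ => ⟨0, hk0⟩) =
        ((k : ENNReal) ^ (n + 1))⁻¹ * ∑ j, F j := by
      intro F
      rw [Finset.sum_range, ← e.symm.sum_comp F]
      congr 1
      · rw [hk, pow_mul]; simp
      · exact sum_congr rfl fun i _ => by rw [dif_pos i.2]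
    rw [← key E, ← key G]
    refine Attain.average hwb hp hW hWe hε hl _ _ _ fun i => ?_
    split_ifs
    · exact h _
    · exact h _

/-! ### Cells from functions on a large cube -/

section FromCube

variable {n d : ℕ} {W : Mat d n → ℝ} {a : Space d} {p C ε l : ℝ}

lemma Attain.mono {E G E' G' : ENNReal} (h : Attain W a ε l E G) (hE : E ≤ E') (hG : G ≤ G') :
    Attain W a ε l E' G' := by
  intro κ hκ
  obtain ⟨P, V, hV, h1, h2⟩ := h κ hκ
  exact ⟨P, V, hV, h1.trans (by gcongr), h2.trans (by gcongr)⟩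

/-- The folding function is even and of period two, as a primitive of `foldSlope`. -/
lemma foldFun_eq_of_symm (ε : ℝ) {s t : ℝ} (h : (∃ z : ℤ, t = s + 2 * z) ∨ ∃ z : ℤ, t = -s + 2 * z) :
    foldFun ε t = foldFun ε s := by
  have hper : Function.Periodic (foldFun ε) 2 := foldFun_add_two ε
  rcases h with ⟨z, rfl⟩ | ⟨z, rfl⟩
  · rw [mul_comm]; exact hper.int_mul z s
  · rw [mul_comm]; exact (hper.int_mul z (-s)).trans (foldFun_neg ε s)

/-- A symmetric extension of a closed column is a cell. -/
lemma attain_of_lateralFactor (hWe : IsColumnEven W) {u V : Pt n → Space d} {b : Fin n → ℝ}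
    (hV : Smooth V) (hf : LateralFactor (fun y => u (foldMap ε b y)) V) {T : ℝ}
    (hT : ∀ x, T ≤ |x (last n)| → V x = |x (last n)| • a) {E G : ENNReal}
    (hE : eInt W ε l V (cyl unitCube univ) ≤ E)
    (hG : cInt l V (cyl unitCube univ) ≤ G) :
    Attain W a ε l E G := by
  refine (attain_of_symmetric hWe hV (fun y y' h s => ?_) ⟨T, hT⟩).mono hE hG
  refine hf y' y (fun s => ?_) s
  simp only [foldMap_mk]
  congr 2
  ext i
  rw [foldFun_eq_of_symm ε (h i)]

/-- The open cube of side `r` centred at the origin. -/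
def openCube (m : ℕ) (r : ℝ) : Set (Space m) := {x | ∀ i, x i ∈ Ioo (-r / 2) (r / 2)}

lemma isOpen_openCube (m : ℕ) (r : ℝ) : IsOpen (openCube m r) := by
  have : openCube m r = ⋂ i, {x : Space m | x i ∈ Ioo (-r / 2) (r / 2)} := by ext x; simp [openCube]
  rw [this]
  exact isOpen_iInter_of_finite fun i => isOpen_Ioo.preimage (by fun_prop)

/-- A function on a large cube that is close to `|x_N| a` yields a cell with nearly the same energy
and constraint per unit area: the cube is cut into tiles, the function is reflected across the
lateral faces of each tile and joined to the affine functions of gradients `a ⊗ e_N` and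
`-a ⊗ e_N` above and below, and the resulting cells are placed next to each other. -/
lemma exists_attain_of_openCube (hwb : WellBounds W a p C) (hp : 2 ≤ p) (hW : ∀ ξ, 0 ≤ W ξ)
    (hWc : Continuous W) (hWe : IsColumnEven W) (ha : a ≠ 0) :
    ∃ D, 0 ≤ D ∧ ∀ (q k : ℕ), k = 2 ^ q → 4 ≤ k → ∀ Emax κ : ℝ, 0 ≤ Emax → 0 < κ →
      ∃ η, 0 < η ∧ ∀ (ε l : ℝ) (u : Pt n → Space d), 0 < ε → ε ≤ η → l ≤ 0 →
      Smooth u → ∀ E G : ENNReal,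
      eInt W ε l u (openCube (n + 1) (k + 2)) ≤ E →
      cInt l u (openCube (n + 1) (k + 2)) ≤ G →
      E ≤ ofReal Emax →
      ∫⁻ x in openCube (n + 1) (k + 2), ‖u x - |x (last n)| • a‖ₑ ≤ ofReal η →
      Attain W a ε l (((k : ENNReal) ^ n)⁻¹ * E + (ofReal (D / (k - 3)) *
          (((k : ENNReal) ^ n)⁻¹ * E + ((k : ENNReal) ^ n)⁻¹ * G + 1) + ofReal κ))
        (((k : ENNReal) ^ n)⁻¹ * G + (ofReal (D / (k - 3)) *
          (((k : ENNReal) ^ n)⁻¹ * E + ((k : ENNReal) ^ n)⁻¹ * G + 1) + ofReal κ)) := by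
  obtain ⟨D, hD0, hD⟩ := exists_closed_column (n := n) hwb hp hW hWc hWe
  refine ⟨2 * D, by positivity, fun q k hk hk4 Emax κ hE hκ => ?_⟩
  have hk4r : (4 : ℝ) ≤ k := by exact_mod_cast hk4
  -- the columns extend from `-(1 + h)` to `1 + h`; the grid of `k` tiles per direction and its
  -- shifts fit into a cube of side `k + 1`
  set h : ℝ := (k - 1) / 2 with hh
  have hh1 : 1 < h := by rw [hh]; linarith
  have hDk : D / (h - 1) = 2 * D / (k - 3) := by
    rw [hh, div_eq_div_iff (by linarith) (by linarith)]; ring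
  set D' := 2 * D / ((k : ℝ) - 3) with hD'
  have hD'0 : 0 ≤ D' := div_nonneg (by positivity) (by linarith)
  set κ₀ := κ / (2 * (2 * D' + 2)) with hκ₀
  have hκ₀0 : 0 < κ₀ := by positivity
  obtain ⟨ηc, hηc0, hηc⟩ := hD h (Emax + κ₀) (κ / 2) hh1 (by positivity) (by positivity)
  set κ₁ := min κ₀ (ηc / 2) with hκ₁
  have hκ₁0 : 0 < κ₁ := by positivity
  set R : ℝ := 1 + h with hR
  have hRk : R = (k + 1) / 2 := by rw [hR, hh]; ring
  set c : ℝ := -((k + 1) / 2) with hc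
  obtain ⟨ε₁, hε₁0, hε₁h, hfold⟩ := exists_folded_tiles (n := n) hwb hp hW hWc k (R := R) (κ := κ₁)
    (Emax := Emax + ηc) (by linarith) hκ₁0 (by positivity) c
  set O := openCube (n + 1) (k + 2) with hO
  have hOo : IsOpen O := isOpen_openCube _ _
  have hcube : ∀ {x : Pt n}, lat x ∈ latCube n c (k + 1) → |x (last n)| ≤ R → x ∈ O := by
    intro x h1 h2 i
    rw [mem_latCube] at h1
    have h2' := abs_le.1 h2
    refine lastCases ?_ (fun j => ?_) i
    · constructor <;> linarith [h2'.1, h2'.2]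
    · have := h1 j
      change c ≤ x j.castSucc ∧ x j.castSucc ≤ c + (k + 1) at this
      constructor <;> linarith [this.1, this.2]
  have hcompact : ∀ s t : ℝ, IsCompact (cyl (latCube n c (k + 1)) (Icc s t)) := by
    intro s t
    have hi := (isCompact_Icc.prod (isCompact_Icc (a := s) (b := t))).image
      (continuous_mk (n := n)) (s := latCube n c (k + 1) ×ˢ Icc s t)
    convert hi using 1
    ext x
    constructor
    · rintro ⟨h1, h2⟩; exact ⟨(lat x, x (last n)), ⟨h1, h2⟩, mk_lat x⟩
    · rintro ⟨⟨y, s⟩, ⟨h1, h2⟩, rfl⟩; exact ⟨by simpa using h1, by simpa using h2⟩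
  have htop := exists_grad_close hwb hp hW hWc ha (hcompact 1 (1 + h))
    (hOo.inter (isOpen_lt_last 0)) (fun x hx => ⟨hcube hx.1 (abs_le.2 ⟨by linarith [hx.2.1], hx.2.2⟩),
      by have := hx.2.1; simp only [Set.mem_ofPred_eq]; linarith⟩) hE (by positivity : 0 < ηc / 4)
  have hopen' : IsOpen {x : Pt n | x (last n) < 0} := isOpen_lt (by fun_prop) continuous_const
  have hbot := exists_grad_close hwb.neg hp hW hWc (neg_ne_zero.2 ha) (hcompact (-(1 + h)) (-1))
    (hOo.inter hopen') (fun x hx => ⟨hcube hx.1 (abs_le.2 ⟨hx.2.1, by linarith [hx.2.2]⟩),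
      by have := hx.2.2; simp only [Set.mem_ofPred_eq]; linarith⟩) hE (by positivity : 0 < ηc / 4)
  obtain ⟨η₁, hη₁0, htop⟩ := htop
  obtain ⟨η₂, hη₂0, hbot⟩ := hbot
  refine ⟨min (min ηc ε₁) (min η₁ η₂), by positivity, ?_⟩
  intro ε l u hε hεη hl hu E G hEu hGu hEmax hL1
  have ie1 : ε ≤ ηc := hεη.trans ((min_le_left _ _).trans (min_le_left _ _))
  have ie2 : ε ≤ ε₁ := hεη.trans ((min_le_left _ _).trans (min_le_right _ _))
  have ie3 : min (min ηc ε₁) (min η₁ η₂) ≤ η₁ := (min_le_right _ _).trans (min_le_left _ _)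
  have ie4 : min (min ηc ε₁) (min η₁ η₂) ≤ η₂ := (min_le_right _ _).trans (min_le_right _ _)
  have hmO : MeasurableSet O := hOo.measurableSet
  have ktop := htop ε l u hε (hεη.trans ie3) hu
    ((lintegral_mono_set Set.inter_subset_left).trans (hEu.trans hEmax)) (by
      rw [setLIntegral_congr_fun (g := fun x => ‖u x - |x (last n)| • a‖ₑ)
        (hmO.inter (isOpen_lt_last 0).measurableSet) fun x hx => by
          have hx2 : 0 < x (last n) := hx.2
          simp only [abs_of_pos hx2]]
      exact ((lintegral_mono_set Set.inter_subset_left).trans hL1).trans (ofReal_mono ie3))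
  have kbot := hbot ε l u hε (hεη.trans ie4) hu
    ((lintegral_mono_set Set.inter_subset_left).trans (hEu.trans hEmax)) (by
      rw [setLIntegral_congr_fun (g := fun x => ‖u x - |x (last n)| • a‖ₑ)
        (hmO.inter hopen'.measurableSet) fun x hx => by
          have hx2 : x (last n) < 0 := hx.2
          simp only [abs_of_neg hx2, smul_neg, neg_smul]]
      exact ((lintegral_mono_set Set.inter_subset_left).trans hL1).trans (ofReal_mono ie4))
  have hgc := continuous_grad hu
  set g₁ : Pt n → ENNReal := fun x => ofReal (matNorm (grad u x - tens a) ^ p)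
  set g₂ : Pt n → ENNReal := fun x => ofReal (matNorm (grad u x - tensorLast n (-a)) ^ p)
  have hp0 : 0 ≤ p := by linarith
  have hgm : ∀ A : Mat d n, Measurable fun x => ofReal (matNorm (grad u x - A) ^ p) := fun A =>
    ((continuous_matNorm.comp (hgc.sub continuous_const)).rpow_const
      fun _ => Or.inr hp0).measurable.ennreal_ofReal
  have hM1 : MeasurableSet {x : Pt n | 1 ≤ x (last n)} :=
    measurableSet_le measurable_const measurable_last
  have hM2 : MeasurableSet {x : Pt n | x (last n) ≤ -1} :=
    measurableSet_le measurable_last measurable_const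
  -- the distance from the wells, which folding does not increase, has to be small on every tile
  set f : Pt n → ENNReal := fun x => Set.indicator {x | 1 ≤ x (last n)} g₁ x +
    Set.indicator {x | x (last n) ≤ -1} g₂ x with hf
  have hfm : Measurable f := ((hgm _).indicator hM1).add ((hgm _).indicator hM2)
  have hfint : ∫⁻ x in cyl (latCube n c (k + 1)) (Icc (-R) R), f x ≤ ofReal (ηc / 2) := by
    rw [hf, lintegral_add_left ((hgm _).indicator hM1), setLIntegral_indicator hM1,
      setLIntegral_indicator hM2, show ηc / 2 = ηc / 4 + ηc / 4 by ring,
      ofReal_add (by positivity) (by positivity)]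
    refine add_le_add (le_trans (lintegral_mono_set ?_) ktop) (le_trans (lintegral_mono_set ?_) kbot)
    · rintro x ⟨h1, h2, h3⟩; exact ⟨h2, h1, h3.2⟩
    · rintro x ⟨h1, h2, h3⟩; exact ⟨h2, h3.1, h1⟩
  have hsub : cyl (latCube n c (k + 1)) (Icc (-R) R) ⊆ O := fun x hx =>
    hcube hx.1 (abs_le.2 hx.2)
  have hem : Measurable fun x => ofReal (eDens W ε l u x) :=
    (continuous_eDens hWc hu).measurable.ennreal_ofReal
  obtain ⟨b, hb1, hb2, hb3⟩ := hfold ε l u hε ie2 hl hu f hfm (by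
    rw [lintegral_add_left hem, ofReal_add hE hηc0.le]
    exact add_le_add ((lintegral_mono_set hsub).trans (hEu.trans hEmax))
      (hfint.trans (ofReal_mono (by linarith))))
  set v : (Fin n → Fin k) → Pt n → Space d := fun j y => u (tileFold ε b j y) with hv
  set Ej : (Fin n → Fin k) → ENNReal := fun j =>
    eInt W ε l (v j) (cyl unitCube (Icc (-R) R)) with hEj
  set Gj : (Fin n → Fin k) → ENNReal := fun j =>
    cInt l (v j) (cyl unitCube (Icc (-R) R)) with hGj
  have sE : ∑ j, Ej j ≤ E + ofReal κ₀ := hb1.trans (add_le_add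
    ((lintegral_mono_set hsub).trans hEu) (ofReal_mono (min_le_left _ _)))
  have sG : ∑ j, Gj j ≤ G + ofReal κ₀ := hb2.trans (add_le_add
    ((lintegral_mono_set hsub).trans hGu) (ofReal_mono (min_le_left _ _)))
  have sf : ∀ j : Fin n → Fin k, ∫⁻ x in cyl unitCube (Icc (-R) R),
      f (tileFold ε b j x) ≤ ofReal ηc := by
    intro j
    refine (Finset.single_le_sum (f := fun j : Fin n → Fin k => ∫⁻ x in cyl unitCube (Icc (-R) R),
      f (tileFold ε b j x)) (fun _ _ => zero_le) (Finset.mem_univ j)).trans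
      (hb3.trans ?_)
    rw [← add_halves ηc, ofReal_add (by positivity) (by positivity)]
    exact add_le_add hfint (ofReal_mono (min_le_right _ _))
  -- each tile yields a cell
  have hcol : ∀ j, Attain W a ε l (Ej j + (ofReal D' * (Ej j + Gj j + 1) +
      ofReal (κ / 2))) (Gj j + (ofReal D' * (Ej j + Gj j + 1) +
      ofReal (κ / 2))) := by
    intro j
    have hvs : Smooth (v j) := hu.comp (contDiff_foldMap ε _)
    have t1 : ∫⁻ x in cyl unitCube (Icc 1 (1 + h)),
        ofReal (matNorm (grad (v j) x - tens a) ^ p) ≤ ofReal ηc := by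
      refine le_trans ?_ ((lintegral_mono_set (cyl_mono le_rfl (show Icc 1 (1 + h) ⊆ Icc (-R) R
        from fun t ht => ⟨by linarith [ht.1], ht.2⟩))).trans (sf j))
      refine setLIntegral_mono' (measurableSet_cyl (measurableSet_latCube 0 1) measurableSet_Icc)
        fun x hx => ?_
      have hx1 : 1 ≤ tileFold ε b j x (last n) := by rw [foldMap_last]; exact hx.2.1
      refine le_trans ?_ le_self_add
      rw [Set.indicator_of_mem (by exact hx1)]
      exact ofReal_mono (rpow_le_rpow (matNorm_nonneg _)
        (matNorm_grad_foldMap_sub_le hu _ x a) hp0)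
    have t2 : ∫⁻ x in cyl unitCube (Icc (-(1 + h)) (-1)),
        ofReal (matNorm (grad (v j) x + tens a) ^ p) ≤ ofReal ηc := by
      refine le_trans ?_ ((lintegral_mono_set (cyl_mono le_rfl (show Icc (-(1 + h)) (-1) ⊆ Icc (-R) R
        from fun t ht => ⟨ht.1, by linarith [ht.2]⟩))).trans (sf j))
      refine setLIntegral_mono' (measurableSet_cyl (measurableSet_latCube 0 1) measurableSet_Icc)
        fun x hx => ?_
      have hx1 : tileFold ε b j x (last n) ≤ -1 := by rw [foldMap_last]; exact hx.2.2
      refine le_trans ?_ le_add_self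
      rw [Set.indicator_of_mem (by exact hx1), ← sub_neg_eq_add, ← tensorLast_neg]
      exact ofReal_mono (rpow_le_rpow (matNorm_nonneg _)
        (matNorm_grad_foldMap_sub_le hu _ x (-a)) hp0)
    have hEle : Ej j ≤ ofReal (Emax + κ₀) := by
      rw [ofReal_add hE hκ₀0.le]
      exact (Finset.single_le_sum (fun _ _ => zero_le) (Finset.mem_univ j)).trans
        (sE.trans (by gcongr))
    obtain ⟨V, T, hVs, hVf, hT, hVe, hVc⟩ := hηc ε l (v j) hε ie1 hl hvs (Ej j) (Gj j) rfl rfl hEle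
      t1 t2
    rw [hDk] at hVe hVc
    exact attain_of_lateralFactor hWe hVs hVf hT hVe hVc
  -- the tiles share `E` and `G` up to a constant, so that averages are close to `E / k ^ n`
  have havg := Attain.average_tiles hwb hp hW hWe hε hl hk hcol
  have hkz : (k : ENNReal) ^ n ≠ 0 := by simp; omega
  have hkt : (k : ENNReal) ^ n ≠ ⊤ := by finiteness
  have hk1 : ((k : ENNReal) ^ n)⁻¹ ≤ 1 := by
    rw [ENNReal.inv_le_one]
    exact one_le_pow₀ (by exact_mod_cast (by omega : 1 ≤ k))
  have key : ∀ F : (Fin n → Fin k) → ENNReal, ∀ X, ∑ j, F j ≤ X + ofReal κ₀ →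
      ((k : ENNReal) ^ n)⁻¹ * ∑ j, (F j + (ofReal D' * (Ej j + Gj j + 1) +
        ofReal (κ / 2))) ≤ ((k : ENNReal) ^ n)⁻¹ * X + (ofReal D' *
          (((k : ENNReal) ^ n)⁻¹ * E + ((k : ENNReal) ^ n)⁻¹ * G + 1) + ofReal κ) := by
    intro F X hF
    rw [sum_add_distrib, sum_add_distrib, ← Finset.mul_sum, sum_add_distrib,
      sum_add_distrib, Finset.sum_const, Finset.sum_const, Finset.card_univ, Fintype.card_fun,
      Fintype.card_fin, Fintype.card_fin, nsmul_eq_mul, nsmul_eq_mul, Nat.cast_pow, mul_one]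
    set r := ((k : ENNReal) ^ n)⁻¹ with hr
    have hrk : r * (k : ENNReal) ^ n = 1 := ENNReal.inv_mul_cancel hkz hkt
    have hκsum : ofReal κ₀ + ofReal D' * (ofReal κ₀ + ofReal κ₀) + ofReal (κ / 2) ≤ ofReal κ := by
      rw [← ofReal_add hκ₀0.le hκ₀0.le, ← ofReal_mul hD'0,
        ← ofReal_add hκ₀0.le (by positivity), ← ofReal_add (by positivity) (by positivity)]
      refine ofReal_mono ?_
      have : κ₀ * (2 * (2 * D' + 2)) = κ := by rw [hκ₀]; field_simp
      nlinarith
    calc r * (∑ j, F j + (ofReal D' * (∑ j, Ej j + ∑ j, Gj j + (k : ENNReal) ^ n) +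
          (k : ENNReal) ^ n * ofReal (κ / 2)))
        ≤ r * (X + ofReal κ₀ + (ofReal D' * (E + ofReal κ₀ +
            (G + ofReal κ₀) + (k : ENNReal) ^ n) + (k : ENNReal) ^ n * ofReal (κ / 2))) := by
          gcongr
      _ = r * X + r * ofReal κ₀ + (ofReal D' * (r * E + r * G + (r * (k : ENNReal) ^ n) +
            r * (ofReal κ₀ + ofReal κ₀)) + (r * (k : ENNReal) ^ n) * ofReal (κ / 2)) := by ring
      _ ≤ r * X + 1 * ofReal κ₀ + (ofReal D' * (r * E + r * G + 1 +
            1 * (ofReal κ₀ + ofReal κ₀)) + 1 * ofReal (κ / 2)) := by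
          rw [hrk]; gcongr
      _ = r * X + (ofReal D' * (r * E + r * G + 1) + (ofReal κ₀ +
            ofReal D' * (ofReal κ₀ + ofReal κ₀) + ofReal (κ / 2))) := by ring
      _ ≤ _ := by gcongr
  exact havg.mono (key Ej E sE) (key Gj G sG)

end FromCube

/-! ### Weak derivatives -/

section WeakDerivatives

variable {m d : ℕ} {U : Set (Space m)} {j : Fin m} {f f' g g' : Space m → ℝ}

lemma HasWeakPartial.isWeakPartial (h : HasWeakPartial U j f) :
    IsWeakPartial U j f (weakPartial U j f) := by
  rw [weakPartial, dif_pos h]; exact h.choose_spec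

lemma locallyIntegrableOn_congr_ae (hU : IsOpen U) (h : f =ᵐ[volume.restrict U] f')
    (hf : LocallyIntegrableOn f U) : LocallyIntegrableOn f' U := by
  rw [locallyIntegrableOn_iff hU.isLocallyClosed] at *
  intro k hk hkc
  exact (hf k hk hkc).congr_fun_ae (ae_restrict_of_ae_restrict_of_subset hk h)

lemma IsWeakPartial.congr (hU : IsOpen U) (h : IsWeakPartial U j f g)
    (hf : f =ᵐ[volume.restrict U] f') : IsWeakPartial U j f' g := by
  refine ⟨locallyIntegrableOn_congr_ae hU hf h.1, h.2.1, fun φ h1 h2 h3 => ?_⟩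
  rw [← h.2.2 φ h1 h2 h3]
  refine integral_congr_ae ?_
  filter_upwards [hf] with x hx
  rw [hx]

lemma setIntegral_eq_of_tsupport_subset {φ F : Space m → ℝ} (h : tsupport φ ⊆ U)
    (hF : ∀ x, φ x = 0 → F x = 0) : ∫ x in U, F x = ∫ x, F x :=
  setIntegral_eq_integral_of_forall_compl_eq_zero fun x hx =>
    hF x (image_eq_zero_of_notMem_tsupport fun h' => hx (h h'))

lemma integrable_mul_of_tsupport_subset (hg : LocallyIntegrableOn g U) {φ : Space m → ℝ}
    (h1 : Continuous φ) (h2 : HasCompactSupport φ) (h3 : tsupport φ ⊆ U) :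
    Integrable fun x => φ x * g x := by
  have h := (hg.integrableOn_compact_subset h3 h2).continuousOn_mul h1.continuousOn h2
  rwa [integrableOn_iff_integrable_of_support_subset] at h
  intro x hx
  exact subset_tsupport φ fun h0 => hx (by simp [h0])

lemma IsWeakPartial.unique (hU : IsOpen U) (h : IsWeakPartial U j f g)
    (h' : IsWeakPartial U j f g') : g =ᵐ[volume.restrict U] g' := by
  have := hU.ae_eq_zero_of_integral_contDiff_smul_eq_zero (μ := volume) (f := fun x => g x - g' x)
    (h.2.1.sub h'.2.1) fun φ h1 h2 h3 => by
      have e1 := h.2.2 φ h1 h2 h3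
      rw [h'.2.2 φ h1 h2 h3, neg_inj,
        setIntegral_eq_of_tsupport_subset (F := fun x => g' x * φ x) h3 (fun x hx => by simp [hx]),
        setIntegral_eq_of_tsupport_subset (F := fun x => g x * φ x) h3 (fun x hx => by simp [hx])] at e1
      have i1 := integrable_mul_of_tsupport_subset h.2.1 h1.continuous h2 h3
      have i2 := integrable_mul_of_tsupport_subset h'.2.1 h1.continuous h2 h3
      simp only [smul_eq_mul, mul_sub]
      rw [integral_sub i1 i2, sub_eq_zero]
      simp only [mul_comm (φ _)]
      exact e1.symm
  rw [Filter.EventuallyEq, ae_restrict_iff' hU.measurableSet]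
  filter_upwards [this] with x hx hxU
  exact sub_eq_zero.1 (hx hxU)

lemma isWeakPartial_pd (U : Set (Space m)) (j : Fin m) (hf : Smooth f) :
    IsWeakPartial U j f (pd j f) := by
  have hc := (contDiff_pd hf j).continuous
  refine ⟨(hf.continuous.locallyIntegrable).locallyIntegrableOn _,
    hc.locallyIntegrable.locallyIntegrableOn _, fun φ h1 h2 h3 => ?_⟩
  have hφc : HasCompactSupport fun x => fderiv ℝ φ x (single j 1) :=
    (h2.fderiv (𝕜 := ℝ)).comp_left (g := fun L : Space m →L[ℝ] ℝ => L (single j 1))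
      (by simp)
  have hφd : Continuous fun x => fderiv ℝ φ x (single j 1) :=
    (contDiff_pd h1 j).continuous
  have key := integral_mul_fderiv_eq_neg_fderiv_mul_of_integrable (μ := volume) (f := f) (g := φ)
    (v := single j 1)
    ((hc.mul h1.continuous).integrable_of_hasCompactSupport h2.mul_left)
    ((hf.continuous.mul hφd).integrable_of_hasCompactSupport hφc.mul_left)
    ((hf.continuous.mul h1.continuous).integrable_of_hasCompactSupport h2.mul_left)
    (fun x _ => smooth_diff hf x) (fun x _ => smooth_diff h1 x)
  rw [setIntegral_eq_of_tsupport_subset (φ := φ) (F := fun x => pd j f x * φ x) h3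
    (fun x hx => by simp [hx]), setIntegral_eq_integral_of_forall_compl_eq_zero]
  · exact key
  · intro x hx
    have : fderiv ℝ φ x = 0 :=
      image_eq_zero_of_notMem_tsupport fun h' => hx (h3 (tsupport_fderiv_subset ℝ h'))
    simp [this]

lemma weakPartial_ae_eq (hU : IsOpen U) (h : IsWeakPartial U j f g) :
    weakPartial U j f =ᵐ[volume.restrict U] g :=
  (HasWeakPartial.isWeakPartial ⟨g, h⟩).unique hU h

lemma weakPartial_ae_eq_pd (hU : IsOpen U) (j : Fin m) (hf : Smooth f) :
    weakPartial U j f =ᵐ[volume.restrict U] pd j f :=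
  weakPartial_ae_eq hU (isWeakPartial_pd U j hf)

lemma isWeakPartial_weakPartial (hU : IsOpen U) (j k : Fin m) (hf : Smooth f) :
    IsWeakPartial U k (weakPartial U j f) (pd k (pd j f)) :=
  (isWeakPartial_pd U k (contDiff_pd hf j)).congr hU (weakPartial_ae_eq_pd hU j hf).symm

variable {u : Space m → Space d}

lemma weakGrad_ae_eq (hU : IsOpen U) (hu : Smooth u) :
    ∀ᵐ x ∂volume.restrict U, weakGrad U u x = grad u x := by
  have h : ∀ i j, ∀ᵐ x ∂volume.restrict U, weakPartial U j (fun y => u y i) x = grad u x i j :=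
    fun i j => weakPartial_ae_eq_pd hU j (ContDiff.coord hu i)
  filter_upwards [eventually_all.2 fun i => eventually_all.2 (h i)] with x hx
  ext i j
  exact hx i j

lemma weakHess_ae_eq (hU : IsOpen U) (hu : Smooth u) :
    ∀ᵐ x ∂volume.restrict U, weakHess U u x = hess u x := by
  have h : ∀ i j k, ∀ᵐ x ∂volume.restrict U,
      weakPartial U k (weakPartial U j fun y => u y i) x = hess u x i j k :=
    fun i j k => weakPartial_ae_eq hU (isWeakPartial_weakPartial hU j k (ContDiff.coord hu i))
  filter_upwards [eventually_all.2 fun i => eventually_all.2 fun j => eventually_all.2 (h i j)]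
    with x hx
  ext i j k
  exact hx i j k

lemma memW2_of_smooth (hU : IsOpen U) {q : ENNReal} (hu : Smooth u)
    (h0 : ∀ i, MemLp (fun x => u x i) q (volume.restrict U))
    (h1 : ∀ i j, MemLp (fun x => grad u x i j) q (volume.restrict U))
    (h2 : ∀ i j k, MemLp (fun x => hess u x i j k) q (volume.restrict U)) : MemW2 q U u where
  memLp := h0
  hasGrad i j := ⟨_, isWeakPartial_pd U j (ContDiff.coord hu i)⟩
  memLp_grad i j := (h1 i j).ae_eq (weakPartial_ae_eq_pd hU j (ContDiff.coord hu i)).symm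
  hasHess i j k := ⟨_, isWeakPartial_weakPartial hU j k (ContDiff.coord hu i)⟩
  memLp_hess i j k :=
    (h2 i j k).ae_eq (weakPartial_ae_eq hU (isWeakPartial_weakPartial hU j k (ContDiff.coord hu i))).symm

lemma cube_eq_openCube (m : ℕ) : cube m = openCube m 1 := rfl

lemma isOpen_cube (m : ℕ) : IsOpen (cube m) := isOpen_openCube m 1

lemma openCube_eq_preimage (m : ℕ) (r : ℝ) : openCube m r =
    (fun x : Space m => (WithLp.ofLp x : Fin m → ℝ)) ⁻¹' (Set.univ.pi fun _ => Ioo (-r / 2) (r / 2)) := by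
  ext x; simp [openCube]

lemma volume_openCube (m : ℕ) (r : ℝ) : volume (openCube m r) = ofReal r ^ m := by
  rw [openCube_eq_preimage, (PiLp.volume_preserving_ofLp (Fin m)).measure_preimage
    (MeasurableSet.univ_pi fun _ => measurableSet_Ioo).nullMeasurableSet, volume_pi_pi]
  simp only [Real.volume_Ioo, Finset.prod_const, Finset.card_univ, Fintype.card_fin]
  congr 2; ring

lemma isFiniteMeasure_cube (m : ℕ) : IsFiniteMeasure (volume.restrict (cube m)) :=
  ⟨by rw [Measure.restrict_apply_univ, cube_eq_openCube, volume_openCube]; simp⟩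

end WeakDerivatives

/-! ### Mollification -/

section Mollification

variable {m : ℕ}

/-- The convolution of a function with a normalized bump function. -/
def moll (φ : ContDiffBump (0 : Space m)) (f : Space m → ℝ) : Space m → ℝ :=
  convolution (φ.normed volume) f (ContinuousLinearMap.lsmul ℝ ℝ) volume

/-- The convolution of a nonnegative function with a normalized bump function. -/
def lmoll (φ : ContDiffBump (0 : Space m)) (F : Space m → ENNReal) (x : Space m) : ENNReal :=
  ∫⁻ y, ofReal (φ.normed volume y) * F (x - y)

variable (φ : ContDiffBump (0 : Space m)) {f g : Space m → ℝ} {F G : Space m → ENNReal}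

lemma contDiff_moll (hf : LocallyIntegrable f) : Smooth (moll φ f) :=
  φ.hasCompactSupport_normed.contDiff_convolution_left _ φ.contDiff_normed hf

lemma moll_eq_swap (f : Space m → ℝ) (x : Space m) :
    moll φ f x = ∫ y, φ.normed volume (x - y) * f y := by
  rw [moll, convolution_lsmul_swap]; rfl

lemma normed_eq_zero_of_lt {x : Space m} (hx : φ.rOut ≤ ‖x‖) : φ.normed volume x = 0 := by
  have : x ∉ Function.support (φ.normed volume) := by rw [φ.support_normed_eq]; simpa using hx
  simpa using this

/-- The derivative of a mollification is the mollification of the weak derivative. -/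
lemma pd_moll {U : Set (Space m)} {j : Fin m} (hfi : Integrable f) (hf0 : ∀ x ∉ U, f x = 0)
    (hg0 : ∀ x ∉ U, g x = 0) (h : IsWeakPartial U j f g) {x : Space m}
    (hx : Metric.closedBall x φ.rOut ⊆ U) : pd j (moll φ f) x = moll φ g x := by
  have hφs : Smooth (φ.normed volume) := φ.contDiff_normed
  have hd := (φ.hasCompactSupport_normed (μ := volume)).hasFDerivAt_convolution_left
    (ContinuousLinearMap.lsmul ℝ ℝ) (φ.contDiff_normed (n := 1)) hfi.locallyIntegrable x
  set ψ : Space m → ℝ := fun y => φ.normed volume (x - y) with hψ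
  have hψs : Smooth ψ := hφs.comp (contDiff_const.sub contDiff_id)
  have hψt : tsupport ψ ⊆ Metric.closedBall x φ.rOut := by
    refine closure_minimal (fun y hy => ?_) Metric.isClosed_closedBall
    by_contra hn
    refine hy (normed_eq_zero_of_lt φ ?_)
    rw [Metric.mem_closedBall, not_le, dist_comm, dist_eq_norm] at hn
    exact hn.le
  have hψc : HasCompactSupport ψ :=
    (isCompact_closedBall x φ.rOut).of_isClosed_subset (isClosed_tsupport _) hψt
  have hψd : ∀ y, fderiv ℝ ψ y (single j 1) =
      -fderiv ℝ (φ.normed volume) (x - y) (single j 1) := by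
    intro y
    have h1 : HasFDerivAt ψ ((fderiv ℝ (φ.normed volume) (x - y)).comp
        (-ContinuousLinearMap.id ℝ (Space m))) y :=
      ((smooth_diff hφs (x - y)).hasFDerivAt).comp y ((hasFDerivAt_id y).const_sub x)
    rw [h1.fderiv]; simp
  have hw := h.2.2 ψ hψs hψc (hψt.trans hx)
  have hU : ∀ F : Space m → ℝ, (∀ y ∉ U, F y = 0) → ∫ y in U, F y = ∫ y, F y := fun F hF =>
    setIntegral_eq_integral_of_forall_compl_eq_zero hF
  rw [hU _ fun y hy => by rw [hf0 y hy, zero_mul], hU _ fun y hy => by rw [hg0 y hy, zero_mul]] at hw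
  have e1 : pd j (moll φ f) x = ∫ y, fderiv ℝ (φ.normed volume) (x - y)
      (single j 1) * f y := by
    have hd' : fderiv ℝ (moll φ f) x = _ := hd.fderiv
    rw [pd, hd', convolution_eq_swap]
    have hint : Integrable fun y => ((ContinuousLinearMap.lsmul ℝ ℝ).precompL (Space m))
        (fderiv ℝ (φ.normed volume) (x - y)) (f y) := by
      have := ((φ.hasCompactSupport_normed (μ := volume)).fderiv (𝕜 := ℝ)).convolutionExists_left
        ((ContinuousLinearMap.lsmul ℝ ℝ).precompL (Space m))
        (hφs.continuous_fderiv (by simp)) hfi.locallyIntegrable x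
      exact this.integrable_swap
    rw [ContinuousLinearMap.integral_apply hint]
    rfl
  rw [e1, moll_eq_swap]
  simp only [hψd] at hw
  simp only [mul_neg, integral_neg, neg_inj] at hw
  simp only [hψ] at hw
  simp only [mul_comm _ (f _), mul_comm _ (g _)]
  exact hw

lemma lintegral_normed : ∫⁻ y, ofReal (φ.normed volume y) = 1 := by
  rw [← ofReal_integral_eq_lintegral_ofReal φ.integrable_normed
    (.of_forall φ.nonneg_normed), φ.integral_normed, ofReal_one]

lemma measurable_ofReal_normed : Measurable fun y => ofReal (φ.normed volume y) :=
  φ.continuous_normed.measurable.ennreal_ofReal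

lemma lmoll_add (hF : Measurable F) (x : Space m) :
    lmoll φ (fun y => F y + G y) x = lmoll φ F x + lmoll φ G x := by
  simp only [lmoll, mul_add]
  exact lintegral_add_left ((measurable_ofReal_normed φ).mul (hF.comp (measurable_const.sub measurable_id))) _

lemma lmoll_sum {ι : Type*} (s : Finset ι) {F : ι → Space m → ENNReal} (hF : ∀ i, Measurable (F i))
    (x : Space m) : lmoll φ (fun y => ∑ i ∈ s, F i y) x = ∑ i ∈ s, lmoll φ (F i) x := by
  simp only [lmoll, Finset.mul_sum]
  exact lintegral_finsetSum s fun i _ =>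
    (measurable_ofReal_normed φ).mul ((hF i).comp (measurable_const.sub measurable_id))

lemma measurable_lmoll (hF : Measurable F) : Measurable (lmoll φ F) := by
  refine Measurable.lintegral_prod_right' (f := fun q : Space m × Space m =>
    ofReal (φ.normed volume q.2) * F (q.1 - q.2)) ?_
  exact ((measurable_ofReal_normed φ).comp measurable_snd).mul
    (hF.comp (measurable_fst.sub measurable_snd))

/-- Jensen's inequality for mollifications. -/
lemma enorm_moll_rpow_le (hf : Measurable f) {q : ℝ} (hq : 1 ≤ q) (x : Space m) :
    ‖moll φ f x‖ₑ ^ q ≤ lmoll φ (fun y => ‖f y‖ₑ ^ q) x := by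
  set ν := volume.withDensity fun y => ofReal (φ.normed volume y) with hν
  have hp : IsProbabilityMeasure ν := ⟨by
    rw [hν, withDensity_apply _ MeasurableSet.univ, Measure.restrict_univ, lintegral_normed]⟩
  have hm : Measurable fun y => ‖f (x - y)‖ₑ := (hf.comp (measurable_const.sub measurable_id)).enorm
  have h1 : ‖moll φ f x‖ₑ ≤ ∫⁻ y, ‖f (x - y)‖ₑ ∂ν := by
    rw [hν, lintegral_withDensity_eq_lintegral_mul _ (measurable_ofReal_normed φ) hm]
    refine (enorm_integral_le_lintegral_enorm _).trans (le_of_eq (lintegral_congr fun y => ?_))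
    simp only [ContinuousLinearMap.lsmul_apply, smul_eq_mul, enorm_mul, Pi.mul_apply]
    rw [Real.enorm_eq_ofReal (φ.nonneg_normed y)]
  calc _ ≤ (∫⁻ y, ‖f (x - y)‖ₑ ∂ν) ^ q := by gcongr
    _ ≤ ∫⁻ y, ‖f (x - y)‖ₑ ^ q ∂ν := rpow_lintegral_le_lintegral_rpow hm.aemeasurable hq
    _ = _ := by
      rw [hν, lintegral_withDensity_eq_lintegral_mul _ (measurable_ofReal_normed φ) (hm.pow_const q)]
      rfl

lemma openCube_sub_mem {r t : ℝ} {x y : Space m} (hx : x ∈ openCube m r) (hy : ‖y‖ ≤ t) :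
    x - y ∈ openCube m (r + 2 * t) := by
  intro i
  have h1 := hx i
  have h2 := abs_le.1 ((by simpa using PiLp.norm_apply_le y i : |y i| ≤ ‖y‖).trans hy)
  simp only [PiLp.sub_apply]
  constructor <;> linarith [h1.1, h1.2, h2.1, h2.2]

lemma lintegral_lmoll_le (hF : Measurable F) (r : ℝ) :
    ∫⁻ x in openCube m r, lmoll φ F x ≤ ∫⁻ x in openCube m (r + 2 * φ.rOut), F x := by
  have hO : MeasurableSet (openCube m (r + 2 * φ.rOut)) := (isOpen_openCube _ _).measurableSet
  have hmeas : Measurable (Function.uncurry fun (x y : Space m) =>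
      ofReal (φ.normed volume y) * F (x - y)) :=
    ((measurable_ofReal_normed φ).comp measurable_snd).mul
      (hF.comp (measurable_fst.sub measurable_snd))
  simp only [lmoll]
  rw [lintegral_lintegral_swap hmeas.aemeasurable]
  calc _ ≤ ∫⁻ y, ofReal (φ.normed volume y) * ∫⁻ x in openCube m (r + 2 * φ.rOut), F x := by
        refine lintegral_mono fun y => ?_
        rcases le_or_gt φ.rOut ‖y‖ with h | h
        · simp [normed_eq_zero_of_lt φ h]
        · simp only
          rw [lintegral_const_mul _ (show Measurable fun x => F (x - y) from
            hF.comp (measurable_id.sub measurable_const))]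
          refine mul_le_mul_right ?_ _
          have hmp := (measurePreserving_sub_right (volume : Measure (Space m)) y)
          rw [← hmp.setLIntegral_comp_preimage hO hF]
          exact lintegral_mono_set fun x hx => openCube_sub_mem hx h.le
    _ = _ := by rw [lintegral_mul_const _ (measurable_ofReal_normed φ), lintegral_normed, one_mul]

lemma lmoll_ofReal {h : Space m → ℝ} (hi : Integrable h) (h0 : ∀ x, 0 ≤ h x) (x : Space m) :
    lmoll φ (fun y => ofReal (h y)) x = ofReal (moll φ h x) := by
  have hint : Integrable fun y => φ.normed volume y * h (x - y) :=
    φ.hasCompactSupport_normed.convolutionExists_left (ContinuousLinearMap.lsmul ℝ ℝ)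
      φ.continuous_normed hi.locallyIntegrable x
  have e : moll φ h x = ∫ y, φ.normed volume y * h (x - y) := rfl
  rw [e, ofReal_integral_eq_lintegral_ofReal hint
    (.of_forall fun y => mul_nonneg (φ.nonneg_normed y) (h0 _))]
  exact lintegral_congr fun y => (ofReal_mul (φ.nonneg_normed y)).symm

/-- A sequence of bump functions with supports that shrink to the origin. -/
def bump (m i : ℕ) : ContDiffBump (0 : Space m) :=
  ⟨1 / (2 * (i + 1)), 1 / (i + 1), by positivity, by
    rw [one_div, one_div]; gcongr; linarith [(Nat.cast_nonneg i : (0 : ℝ) ≤ i)]⟩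

lemma tendsto_rOut_bump : Tendsto (fun i => (bump m i).rOut) atTop (𝓝 0) :=
  tendsto_one_div_add_atTop_nhds_zero_nat

lemma ae_tendsto_moll (hf : LocallyIntegrable f) :
    ∀ᵐ x, Tendsto (fun i => moll (bump m i) f x) atTop (𝓝 (f x)) :=
  ContDiffBump.ae_convolution_tendsto_right_of_locallyIntegrable (K := 2) tendsto_rOut_bump
    (.of_forall fun i => by
      have : (0 : ℝ) < i + 1 := by positivity
      simp only [bump]; rw [mul_one_div]; field_simp; rfl) hf

lemma ae_tendsto_lmoll (hF : Measurable F) (hfin : ∫⁻ x, F x ≠ ⊤) :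
    ∀ᵐ x, Tendsto (fun i => lmoll (bump m i) F x) atTop (𝓝 (F x)) := by
  have hi : Integrable fun x => (F x).toReal := integrable_toReal_of_lintegral_ne_top hF.aemeasurable hfin
  have hft := ae_lt_top hF hfin
  filter_upwards [ae_tendsto_moll hi.locallyIntegrable, hft] with x hx hxt
  have e : ∀ i, lmoll (bump m i) F x = ofReal (moll (bump m i) (fun y => (F y).toReal) x) := by
    intro i
    rw [← lmoll_ofReal _ hi fun _ => ENNReal.toReal_nonneg]
    refine lintegral_congr_ae ?_
    have hft' : ∀ᵐ y, F (x - y) < ⊤ :=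
      (Measure.measurePreserving_sub_left volume x).quasiMeasurePreserving.ae hft
    filter_upwards [hft'] with y hy
    rw [ofReal_toReal hy.ne]
  simp only [e]
  rw [← ofReal_toReal hxt.ne]
  exact (ENNReal.continuous_ofReal.tendsto _).comp hx

/-- A form of the dominated convergence theorem, for upper bounds only and with a convergent
sequence of dominating functions. -/
lemma eventually_lintegral_le_of_dominated {α : Type*} [MeasurableSpace α] {μ : Measure α}
    {e h : ℕ → α → ENNReal} {e' h' : α → ENNReal} (hem : ∀ i, Measurable (e i))
    (hhm : ∀ i, Measurable (h i)) (hem' : AEMeasurable e' μ) (hle : ∀ᶠ i in atTop, ∀ᵐ x ∂μ, e i x ≤ h i x)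
    (hte : ∀ᵐ x ∂μ, Tendsto (fun i => e i x) atTop (𝓝 (e' x)))
    (hth : ∀ᵐ x ∂μ, Tendsto (fun i => h i x) atTop (𝓝 (h' x))) (hfin : ∫⁻ x, h' x ∂μ ≠ ⊤)
    (hh'm : AEMeasurable h' μ)
    (hlim : ∀ τ : ℝ, 0 < τ → ∀ᶠ i in atTop, ∫⁻ x, h i x ∂μ ≤ ∫⁻ x, h' x ∂μ + ofReal τ)
    {τ : ℝ} (hτ : 0 < τ) :
    ∀ᶠ i in atTop, ∫⁻ x, e i x ∂μ ≤ ∫⁻ x, e' x ∂μ + ofReal τ := by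
  have hle' : ∀ᵐ x ∂μ, e' x ≤ h' x := by
    obtain ⟨N, hN⟩ := eventually_atTop.1 hle
    have : ∀ᵐ x ∂μ, ∀ i, N ≤ i → e i x ≤ h i x := ae_all_iff.2 fun i => by
        by_cases hi : N ≤ i <;> simp_all
    filter_upwards [this, hte, hth] with x h1 h2 h3
    exact le_of_tendsto_of_tendsto h2 h3 (eventually_atTop.2 ⟨N, fun i hi => h1 i hi⟩)
  have hft : ∀ᵐ x ∂μ, h' x < ⊤ := ae_lt_top' hh'm hfin
  have hfatou : ∫⁻ x, (h' x - e' x) ∂μ ≤ liminf (fun i => ∫⁻ x, (h i x - e i x) ∂μ) atTop := by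
    refine le_trans (le_of_eq (lintegral_congr_ae ?_))
      (lintegral_liminf_le fun i => (hhm i).sub (hem i))
    filter_upwards [hte, hth, hft] with x h1 h2 h3
    exact (ENNReal.Tendsto.sub h2 h1 (Or.inl h3.ne)).liminf_eq.symm
  have hsplit : ∫⁻ x, h' x ∂μ = ∫⁻ x, e' x ∂μ + ∫⁻ x, (h' x - e' x) ∂μ := by
    rw [← lintegral_add_left' hem']
    refine lintegral_congr_ae ?_
    filter_upwards [hle'] with x hx
    rw [add_tsub_cancel_of_le hx]
  have hDfin : ∫⁻ x, (h' x - e' x) ∂μ ≠ ⊤ := by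
    intro hD; rw [hD, add_top] at hsplit; exact hfin hsplit
  have hev : ∀ᶠ i in atTop, ∫⁻ x, (h' x - e' x) ∂μ ≤ ∫⁻ x, (h i x - e i x) ∂μ + ofReal (τ / 2) := by
    by_cases h0 : ∫⁻ x, (h' x - e' x) ∂μ = 0
    · rw [h0]; exact .of_forall fun _ => zero_le
    · have hlt : ∫⁻ x, (h' x - e' x) ∂μ - ofReal (τ / 2) <
          liminf (fun i => ∫⁻ x, (h i x - e i x) ∂μ) atTop :=
        (ENNReal.sub_lt_self hDfin h0 (by simpa using hτ)).trans_le hfatou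
      filter_upwards [eventually_lt_of_lt_liminf hlt] with i hi
      exact tsub_le_iff_right.1 hi.le
  filter_upwards [hev, hlim (τ / 2) (by positivity), hle] with i h1 h2 h3
  have hs : ∫⁻ x, h i x ∂μ = ∫⁻ x, e i x ∂μ + ∫⁻ x, (h i x - e i x) ∂μ := by
    rw [← lintegral_add_left (hem i)]
    refine lintegral_congr_ae ?_
    filter_upwards [h3] with x hx
    rw [add_tsub_cancel_of_le hx]
  have hDi : ∫⁻ x, (h i x - e i x) ∂μ ≠ ⊤ := by
    intro hD
    rw [hs, hD, add_top, top_le_iff] at h2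
    exact absurd h2 (by finiteness)
  have : ∫⁻ x, (h i x - e i x) ∂μ + ∫⁻ x, e i x ∂μ ≤
      ∫⁻ x, (h i x - e i x) ∂μ + (∫⁻ x, e' x ∂μ + ofReal τ) := by
    calc _ = ∫⁻ x, h i x ∂μ := by rw [hs, add_comm]
      _ ≤ ∫⁻ x, e' x ∂μ + ∫⁻ x, (h' x - e' x) ∂μ + ofReal (τ / 2) := by rw [← hsplit]; exact h2
      _ ≤ ∫⁻ x, e' x ∂μ + (∫⁻ x, (h i x - e i x) ∂μ + ofReal (τ / 2)) + ofReal (τ / 2) := by gcongr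
      _ = ∫⁻ x, (h i x - e i x) ∂μ + (∫⁻ x, e' x ∂μ + (ofReal (τ / 2) + ofReal (τ / 2))) := by ring
      _ = _ := by rw [← ofReal_add (by positivity) (by positivity), add_halves]
  exact (ENNReal.add_le_add_iff_left hDi).1 this

end Mollification

/-! ### Smooth approximation -/

section Approximation

variable {n d : ℕ} {W : Mat d n → ℝ} {a : Space d} {p C γ ε l : ℝ} {u : Pt n → Space d}

lemma exists_measurable_rep {m : ℕ} {U : Set (Space m)} (hU : MeasurableSet U)
    [IsFiniteMeasure (volume.restrict U)] {f : Space m → ℝ} (hf : MemLp f 2 (volume.restrict U)) :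
    ∃ g : Space m → ℝ, Measurable g ∧ Integrable g ∧ g =ᵐ[volume.restrict U] f ∧ (∀ x ∉ U, g x = 0) ∧
      ∫⁻ x, ‖g x‖ₑ ^ (2 : ℝ) ≠ ⊤ := by
  have hm := hf.1.stronglyMeasurable_mk.measurable
  have he : U.indicator (hf.1.mk f) =ᵐ[volume.restrict U] f :=
    (indicator_ae_eq_restrict hU).trans hf.1.ae_eq_mk.symm
  refine ⟨U.indicator (hf.1.mk f), hm.indicator hU, ?_, he, fun x hx => Set.indicator_of_notMem hx _, ?_⟩
  · rw [integrable_indicator_iff hU]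
    exact (hf.integrable (by norm_num)).congr hf.1.ae_eq_mk
  · have e : (fun x => ‖U.indicator (hf.1.mk f) x‖ₑ ^ (2 : ℝ)) =
        U.indicator fun x => ‖hf.1.mk f x‖ₑ ^ (2 : ℝ) := by
      ext x; by_cases hx : x ∈ U <;> simp [hx]
    rw [e, lintegral_indicator hU]
    have h2 := lintegral_rpow_enorm_lt_top_of_eLpNorm_lt_top two_ne_zero (by simp)
      ((hf.ae_eq hf.1.ae_eq_mk).2)
    simpa using h2.ne

/-- The quantity that dominates all densities. -/
def domSum (p : ℝ) (w : Fin d → ℝ) (ξ : Mat d n)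
    (T : Fin d → Fin (n + 1) → Fin (n + 1) → ℝ) : ENNReal :=
  ∑ i, ‖w i‖ₑ ^ (2 : ℝ) + (∑ i, ∑ j, ‖ξ i j‖ₑ ^ p + ∑ i, ∑ j, ∑ k, ‖T i j k‖ₑ ^ (2 : ℝ))

lemma matNorm_rpow_le (hp : 2 ≤ p) (ξ : Mat d n) :
    matNorm ξ ^ p ≤ √(d * (n + 1) : ℕ) ^ p * ∑ i, ∑ j, |ξ i j| ^ p := by
  have hp0 : 0 < p := by linarith
  set s := ∑ i, ∑ j, |ξ i j| ^ p
  have hs0 : 0 ≤ s := sum_nonneg fun i _ => sum_nonneg fun j _ => by positivity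
  have hb : ∀ i j, |ξ i j| ≤ s ^ (1 / p) := by
    intro i j
    rw [one_div, Real.le_rpow_inv_iff_of_pos (abs_nonneg _) hs0 hp0]
    exact (Finset.single_le_sum (f := fun j => |ξ i j| ^ p) (fun j _ => by positivity)
      (Finset.mem_univ j)).trans (Finset.single_le_sum (f := fun i => ∑ j, |ξ i j| ^ p)
      (fun i _ => sum_nonneg fun j _ => by positivity) (Finset.mem_univ i))
  have h := matNorm_le_of_abs_le (ξ := ξ) (ζ := 0) (α := 0) (b := s ^ (1 / p)) le_rfl (by positivity)
    (fun i j => by simpa using hb i j)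
  rw [zero_mul, zero_add] at h
  calc matNorm ξ ^ p ≤ (√(d * (n + 1) : ℕ) * s ^ (1 / p)) ^ p :=
        rpow_le_rpow (matNorm_nonneg _) h hp0.le
    _ = _ := by
      rw [Real.mul_rpow (by positivity) (by positivity), ← Real.rpow_mul hs0,
        one_div_mul_cancel hp0.ne', Real.rpow_one]

lemma tensorNorm_sq {m : ℕ} (T : Fin d → Fin m → Fin m → ℝ) :
    tensorNorm T ^ 2 = ∑ i, ∑ j, ∑ k, T i j k ^ 2 :=
  Real.sq_sqrt (sum_nonneg fun i _ => sum_nonneg fun j _ =>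
    sum_nonneg fun k _ => sq_nonneg _)

lemma domSum_eq_ofReal (p : ℝ) (w : Fin d → ℝ) (ξ : Mat d n)
    (T : Fin d → Fin (n + 1) → Fin (n + 1) → ℝ) (hp : 2 ≤ p) : domSum p w ξ T =
      ofReal (∑ i, w i ^ 2 + (∑ i, ∑ j, |ξ i j| ^ p + tensorNorm T ^ 2)) := by
  have h2 : ∀ r : ℝ, ‖r‖ₑ ^ (2 : ℝ) = ofReal (r ^ 2) := fun r => by
    rw [← sq_abs, ← Real.norm_eq_abs, ← ofReal_norm, ENNReal.ofReal_rpow_of_nonneg (norm_nonneg _)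
      (by norm_num)]
    norm_num
  have h3 : ∀ r : ℝ, ‖r‖ₑ ^ p = ofReal (|r| ^ p) := fun r => by
    rw [← ofReal_norm, ENNReal.ofReal_rpow_of_nonneg (norm_nonneg _) (by linarith), Real.norm_eq_abs]
  have p1 : 0 ≤ ∑ i, w i ^ 2 := sum_nonneg fun i _ => sq_nonneg _
  have p2 : ∀ i, 0 ≤ ∑ j, |ξ i j| ^ p := fun i => sum_nonneg fun j _ => by positivity
  have p3 : ∀ i j, 0 ≤ ∑ k, T i j k ^ 2 := fun i j => sum_nonneg fun k _ => sq_nonneg _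
  have p4 : ∀ i, 0 ≤ ∑ j, ∑ k, T i j k ^ 2 := fun i => sum_nonneg fun j _ => p3 i j
  rw [domSum, ofReal_add p1 (add_nonneg (sum_nonneg fun _ _ => p2 _) (sq_nonneg _)),
    ofReal_add (sum_nonneg fun _ _ => p2 _) (sq_nonneg _), tensorNorm_sq,
    ENNReal.ofReal_sum_of_nonneg fun _ _ => sq_nonneg _, ENNReal.ofReal_sum_of_nonneg fun _ _ => p2 _,
    ENNReal.ofReal_sum_of_nonneg fun _ _ => p4 _]
  simp only [h2, h3, ENNReal.ofReal_sum_of_nonneg fun _ (_ : _ ∈ Finset.univ) => p3 _ _]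
  congr 2
  · refine sum_congr rfl fun i _ => ?_
    rw [ENNReal.ofReal_sum_of_nonneg fun _ _ => by positivity]
  · refine sum_congr rfl fun i _ => sum_congr rfl fun j _ => ?_
    rw [ENNReal.ofReal_sum_of_nonneg fun _ _ => sq_nonneg _]

/-- The densities of the energy, the constraint and the distance to `|x_N| a` are dominated. -/
lemma exists_domSum_bound (hwb : WellBounds W a p C) (hp : 2 ≤ p) (hε : 0 < ε) (hl : l ≤ 0) :
    ∃ K : ℝ, 0 ≤ K ∧ ∀ (w : Space d) (ξ : Mat d n)
      (T : Fin d → Fin (n + 1) → Fin (n + 1) → ℝ) (s : ℝ), |s| ≤ 1 →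
      ofReal (eFun W ε l ξ (tensorNorm T)) ≤ ofReal K * (domSum p w ξ T + 1) ∧
      ofReal (max (l + tensorNorm T) 0) ≤ ofReal K * (domSum p w ξ T + 1) ∧
      ‖w - s • a‖ₑ ≤ ofReal K * (domSum p w ξ T + 1) := by
  have hC := hwb.pos
  set A := matNorm (tensorLast n a)
  have hA0 : 0 ≤ A := matNorm_nonneg _
  set c := √(d * (n + 1) : ℕ) ^ p
  have hc0 : 0 ≤ c := by positivity
  have hAp : 0 ≤ A ^ p := by positivity
  set K₁ := 1 / ε * (C * 2 ^ p * (c + A ^ p)) with hK₁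
  have hK₁0 : 0 ≤ K₁ := by positivity
  refine ⟨K₁ + 2 * ε + 1 + ‖a‖, by positivity, fun w ξ T s hs => ?_⟩
  set σ := ∑ i, ∑ j, |ξ i j| ^ p
  have hσ0 : 0 ≤ σ := sum_nonneg fun i _ => sum_nonneg fun j _ => by positivity
  set t := tensorNorm T
  have ht0 : 0 ≤ t := tensorNorm_nonneg _
  have hw : ∑ i, w i ^ 2 = ‖w‖ ^ 2 := (EuclideanSpace.real_norm_sq_eq w).symm
  have hS0 : 0 ≤ ‖w‖ ^ 2 + (σ + t ^ 2) := by positivity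
  have hK0 : 0 ≤ K₁ + 2 * ε + 1 + ‖a‖ := by positivity
  have hrhs : ofReal (K₁ + 2 * ε + 1 + ‖a‖) * (domSum p (fun i => w i) ξ T + 1) =
      ofReal ((K₁ + 2 * ε + 1 + ‖a‖) * (‖w‖ ^ 2 + (σ + t ^ 2) + 1)) := by
    rw [domSum_eq_ofReal p _ ξ T hp, hw, ← ofReal_one, ← ofReal_add hS0 zero_le_one,
      ← ofReal_mul hK0]
  have hSw : 0 ≤ ‖w‖ ^ 2 := sq_nonneg _
  have ht2 : 0 ≤ t ^ 2 := sq_nonneg _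
  have ha := norm_nonneg a
  refine ⟨?_, ?_, ?_⟩
  · refine (ofReal_mono ?_).trans hrhs.ge
    have hW' : W ξ ≤ C * (2 ^ p * (c * σ + A ^ p)) := by
      refine (hwb.upper ξ).trans ?_
      have h3 : matNorm (ξ - tens a) ≤ matNorm ξ + A := by
        rw [sub_eq_add_neg]; refine (matNorm_add_le _ _).trans ?_; rw [matNorm_neg]
      have h4 := (rpow_le_rpow (matNorm_nonneg _) h3 (by linarith : 0 ≤ p)).trans
        (add_rpow_le (matNorm_nonneg ξ) hA0 (by linarith))
      have h5 := matNorm_rpow_le hp ξ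
      refine mul_le_mul_of_nonneg_left (h4.trans ?_) hC.le
      gcongr
    refine (eFun_le hε ξ t).trans ?_
    have h6 : 1 / ε * W ξ ≤ K₁ * (σ + 1) := by
      calc _ ≤ 1 / ε * (C * (2 ^ p * (c * σ + A ^ p))) := by gcongr
        _ = 1 / ε * (C * 2 ^ p) * (c * σ + A ^ p) := by ring
        _ ≤ 1 / ε * (C * 2 ^ p) * ((c + A ^ p) * (σ + 1)) := by gcongr; nlinarith
        _ = _ := by rw [hK₁]; ring
    have h7 : K₁ * (σ + 1) ≤ K₁ * (‖w‖ ^ 2 + (σ + t ^ 2) + 1) := by gcongr; linarith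
    have h8 : 2 * ε * t ^ 2 ≤ 2 * ε * (‖w‖ ^ 2 + (σ + t ^ 2) + 1) := by gcongr; linarith
    have h9 : 0 ≤ (1 + ‖a‖) * (‖w‖ ^ 2 + (σ + t ^ 2) + 1) := by positivity
    nlinarith
  · refine (ofReal_mono ?_).trans hrhs.ge
    have h1 : max (l + t) 0 ≤ t := max_le (by linarith) ht0
    have h2 : t ≤ t ^ 2 + 1 := by nlinarith [sq_nonneg (t - 1)]
    have h3 : 0 ≤ (K₁ + 2 * ε + ‖a‖) * (‖w‖ ^ 2 + (σ + t ^ 2) + 1) := by positivity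
    nlinarith
  · rw [← ofReal_norm]
    refine (ofReal_mono ?_).trans hrhs.ge
    have h1 : ‖w - s • a‖ ≤ ‖w‖ + ‖a‖ := by
      refine (norm_sub_le _ _).trans ?_
      rw [norm_smul, Real.norm_eq_abs]
      nlinarith
    have h2 : ‖w‖ ≤ ‖w‖ ^ 2 + 1 := by nlinarith [sq_nonneg (‖w‖ - 1)]
    have h3 : 0 ≤ (K₁ + 2 * ε) * (‖w‖ ^ 2 + (σ + t ^ 2) + 1) := by positivity
    have h4 : 0 ≤ ‖a‖ * (‖w‖ ^ 2 + (σ + t ^ 2)) := by positivity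
    nlinarith

lemma abs_rpow_le_of_wellBounds (hwb : WellBounds W a p C) (hp : 2 ≤ p)
    (ξ : Mat d n) (i : Fin d) (j : Fin (n + 1)) :
    |ξ i j| ^ p ≤ 2 ^ p * (C * W ξ + matNorm (tensorLast n a) ^ p) := by
  set A := matNorm (tensorLast n a)
  have hA0 : 0 ≤ A := matNorm_nonneg _
  set r := min (matNorm (ξ - tens a)) (matNorm (ξ + tens a)) with hr
  have hr0 : 0 ≤ r := le_min (matNorm_nonneg _) (matNorm_nonneg _)
  have h1 : matNorm ξ ≤ r + A := by
    rcases min_choice (matNorm (ξ - tens a)) (matNorm (ξ + tens a)) with h | h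
    · rw [hr, h]
      have := matNorm_add_le (ξ - tens a) (tens a)
      rwa [sub_add_cancel] at this
    · rw [hr, h]
      have := matNorm_add_le (ξ + tens a) (-tens a)
      rwa [add_neg_cancel_right, matNorm_neg] at this
  calc |ξ i j| ^ p ≤ (r + A) ^ p :=
        rpow_le_rpow (abs_nonneg _) ((abs_le_matNorm ξ i j).trans h1) (by linarith)
    _ ≤ 2 ^ p * (r ^ p + A ^ p) := add_rpow_le hr0 hA0 (by linarith)
    _ ≤ _ := by gcongr; exact hwb.lower ξ

/-! ### Approximation in energy -/

lemma IsWeakPartial.congr_right {m : ℕ} {U : Set (Space m)} {j : Fin m} {f g g' : Space m → ℝ}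
    (hU : IsOpen U) (h : IsWeakPartial U j f g) (hg : g =ᵐ[volume.restrict U] g') :
    IsWeakPartial U j f g' := by
  refine ⟨h.1, locallyIntegrableOn_congr_ae hU hg h.2.1, fun φ h1 h2 h3 => ?_⟩
  rw [h.2.2 φ h1 h2 h3]
  congr 1
  refine integral_congr_ae ?_
  filter_upwards [hg] with x hx
  rw [hx]

lemma closedBall_subset_of_mem_openCube {m : ℕ} {r s t : ℝ} (h : r + 2 * t ≤ s) {x : Space m}
    (hx : x ∈ openCube m r) : Metric.closedBall x t ⊆ openCube m s := by
  intro y hy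
  have h1 : ‖x - y‖ ≤ t := by rw [← dist_eq_norm, dist_comm]; exact hy
  have h2 := openCube_sub_mem hx h1
  rw [sub_sub_cancel] at h2
  intro i
  exact ⟨by linarith [(h2 i).1], by linarith [(h2 i).2]⟩

lemma openCube_mono {m : ℕ} {r s : ℝ} (h : r ≤ s) : openCube m r ⊆ openCube m s := fun x hx i =>
  ⟨by linarith [(hx i).1], by linarith [(hx i).2]⟩

/-- Integrals over slightly larger cubes are close to the one over the cube. -/
lemma eventually_lintegral_openCube_le {m : ℕ} {F : Space m → ENNReal} (hfin : ∫⁻ x, F x ≠ ⊤) (r : ℝ)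
    {t : ℕ → ℝ} (ht0 : ∀ i, 0 ≤ t i) (ht : Tendsto t atTop (𝓝 0)) {τ : ℝ} (hτ : 0 < τ) :
    ∀ᶠ i in atTop, ∫⁻ x in openCube m (r + 2 * t i), F x ≤
      (∫⁻ x in openCube m r, F x) + ofReal τ := by
  obtain ⟨δ, hδ, h⟩ := exists_pos_setLIntegral_lt_of_measure_lt hfin (ε := ofReal τ)
    (by simpa using hτ)
  have hO : MeasurableSet (openCube m r) := (isOpen_openCube m r).measurableSet
  have hlim : Tendsto (fun i => volume (openCube m (r + 2 * t i) \ openCube m r)) atTop (𝓝 0) := by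
    have e : ∀ i, volume (openCube m (r + 2 * t i) \ openCube m r) =
        ofReal (r + 2 * t i) ^ m - ofReal r ^ m := fun i => by
      rw [measure_sdiff (openCube_mono (by linarith [ht0 i])) hO.nullMeasurableSet
        (by rw [volume_openCube]; finiteness), volume_openCube, volume_openCube]
    simp only [e]
    have h1 : Tendsto (fun i => r + 2 * t i) atTop (𝓝 r) := by
      simpa using (ht.const_mul 2).const_add r
    have h2 := ENNReal.Tendsto.pow (n := m) ((ENNReal.continuous_ofReal.tendsto r).comp h1)
    have h3 := ENNReal.Tendsto.sub h2 (tendsto_const_nhds (x := ofReal r ^ m))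
      (Or.inl (by finiteness))
    simpa using h3
  filter_upwards [hlim.eventually (gt_mem_nhds hδ)] with i hi
  calc _ ≤ ∫⁻ x in openCube m r ∪ (openCube m (r + 2 * t i) \ openCube m r), F x :=
        lintegral_mono_set fun x hx => by by_cases hx' : x ∈ openCube m r <;> simp_all
    _ ≤ _ := (lintegral_union_le _ _ _).trans (add_le_add le_rfl (h _ hi).le)

/-- A function of finite energy can be approximated, on a smaller cube, by smooth functions without
increasing the energy and the constraint by much. -/
lemma exists_smooth_approx (hwb : WellBounds W a p C) (hp : 2 ≤ p) (hW : ∀ ξ, 0 ≤ W ξ)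
    (hWc : Continuous W) (hε : 0 < ε) (hl : l ≤ 0) {u : Pt n → Space d}
    (hu : MemW2 2 (cube (n + 1)) u) (hfin : energy W ε u l ≠ ⊤) {r : ℝ} (hr : r < 1) {τ : ℝ}
    (hτ : 0 < τ) : ∃ w : Pt n → Space d, Smooth w ∧
      eInt W ε l w (openCube (n + 1) r) ≤ energy W ε u l + ofReal τ ∧
      cInt l w (openCube (n + 1) r) ≤
        (∫⁻ x in cube (n + 1), ofReal (max (l + tensorNorm (weakHess (cube (n + 1)) u x)) 0)) +
          ofReal τ ∧
      ∫⁻ x in openCube (n + 1) r, ‖w x - |x (last n)| • a‖ₑ ≤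
        (∫⁻ x in cube (n + 1), ‖u x - |x (last n)| • a‖ₑ) + ofReal τ := by
  have hQo : IsOpen (cube (n + 1)) := isOpen_cube _
  have hQm : MeasurableSet (cube (n + 1)) := hQo.measurableSet
  have hfm := isFiniteMeasure_cube (n + 1)
  choose f hfmeas hfint hfae hf0 hf2 using fun i => exists_measurable_rep hQm (hu.memLp i)
  choose g hgmeas hgint hgae hg0 hg2 using fun i j => exists_measurable_rep hQm (hu.memLp_grad i j)
  choose H hHmeas hHint hHae hH0 hH2 using fun i j k => exists_measurable_rep hQm (hu.memLp_hess i j k)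
  have wfg : ∀ i j, IsWeakPartial (cube (n + 1)) j (f i) (g i j) := fun i j =>
    ((hu.hasGrad i j).isWeakPartial.congr hQo (hfae i).symm).congr_right hQo (hgae i j).symm
  have wgH : ∀ i j k, IsWeakPartial (cube (n + 1)) k (g i j) (H i j k) := fun i j k =>
    ((hu.hasHess i j k).isWeakPartial.congr hQo (hgae i j).symm).congr_right hQo (hHae i j k).symm
  set fV : Pt n → Space d := fun x => WithLp.toLp 2 fun i => f i x with hfV
  set gM : Pt n → Mat d n := fun x => Matrix.of fun i j => g i j x
  set HT : Pt n → Fin d → Fin (n + 1) → Fin (n + 1) → ℝ := fun x i j k => H i j k x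
  have aef : ∀ᵐ x ∂volume.restrict (cube (n + 1)), fV x = u x := by
    filter_upwards [eventually_all.2 hfae] with x hx
    ext i; exact hx i
  have aeg : ∀ᵐ x ∂volume.restrict (cube (n + 1)), gM x = weakGrad (cube (n + 1)) u x := by
    filter_upwards [eventually_all.2 fun i => eventually_all.2 (hgae i)] with x hx
    ext i j; exact hx i j
  have aeH : ∀ᵐ x ∂volume.restrict (cube (n + 1)), HT x = weakHess (cube (n + 1)) u x := by
    filter_upwards [eventually_all.2 fun i => eventually_all.2 fun j => eventually_all.2 (hHae i j)]
      with x hx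
    ext i j k; exact hx i j k
  set F : Pt n → ENNReal := fun x => domSum p (fun i => f i x) (gM x) (HT x)
  have m1 : ∀ i, Measurable fun x => ‖f i x‖ₑ ^ (2 : ℝ) := fun i => (hfmeas i).enorm.pow_const _
  have m2 : ∀ i j, Measurable fun x => ‖g i j x‖ₑ ^ p := fun i j => (hgmeas i j).enorm.pow_const _
  have m3 : ∀ i j k, Measurable fun x => ‖H i j k x‖ₑ ^ (2 : ℝ) := fun i j k =>
    (hHmeas i j k).enorm.pow_const _
  have s1 : Measurable fun x => ∑ i, ‖f i x‖ₑ ^ (2 : ℝ) := Finset.measurable_sum _ fun i _ => m1 i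
  have s2 : ∀ i, Measurable fun x => ∑ j, ‖g i j x‖ₑ ^ p := fun i =>
    Finset.measurable_sum _ fun j _ => m2 i j
  have s2' : Measurable fun x => ∑ i, ∑ j, ‖g i j x‖ₑ ^ p := Finset.measurable_sum _ fun i _ => s2 i
  have s3 : ∀ i j, Measurable fun x => ∑ k, ‖H i j k x‖ₑ ^ (2 : ℝ) := fun i j =>
    Finset.measurable_sum _ fun k _ => m3 i j k
  have s3' : ∀ i, Measurable fun x => ∑ j, ∑ k, ‖H i j k x‖ₑ ^ (2 : ℝ) := fun i =>
    Finset.measurable_sum _ fun j _ => s3 i j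
  have s3'' : Measurable fun x => ∑ i, ∑ j, ∑ k, ‖H i j k x‖ₑ ^ (2 : ℝ) :=
    Finset.measurable_sum _ fun i _ => s3' i
  have hFeq : F = fun x => (∑ i, ‖f i x‖ₑ ^ (2 : ℝ)) + ((∑ i, ∑ j, ‖g i j x‖ₑ ^ p) +
      ∑ i, ∑ j, ∑ k, ‖H i j k x‖ₑ ^ (2 : ℝ)) := rfl
  have hFm : Measurable F := s1.add (s2'.add s3'')
  have hgp : ∀ i j, ∫⁻ x, ‖g i j x‖ₑ ^ p ≠ ⊤ := by
    intro i j
    set A := matNorm (tens a)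
    have hC := hwb.pos
    have hA0 : 0 ≤ A := matNorm_nonneg _
    have e : ∫⁻ x, ‖g i j x‖ₑ ^ p = ∫⁻ x in cube (n + 1), ‖g i j x‖ₑ ^ p := by
      rw [← lintegral_indicator hQm]
      refine lintegral_congr fun x => ?_
      by_cases hx : x ∈ cube (n + 1)
      · simp [hx]
      · simp [hx, hg0 i j x hx, (by linarith : 0 < p)]
    rw [e]
    have hle : ∫⁻ x in cube (n + 1), ‖g i j x‖ₑ ^ p ≤ ofReal (2 ^ p * C * ε) * energy W ε u l +
        ofReal (2 ^ p * A ^ p) * volume (cube (n + 1)) := by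
      rw [energy, ← lintegral_const_mul' _ _ ofReal_ne_top, ← setLIntegral_const,
        ← lintegral_add_right _ measurable_const]
      refine lintegral_mono_ae ?_
      filter_upwards [aeg] with x hx
      have hb := abs_rpow_le_of_wellBounds hwb hp (gM x) i j
      have hgx : gM x i j = g i j x := rfl
      rw [hgx, hx] at hb
      have hnn : 0 ≤ eFun W ε l (weakGrad (cube (n + 1)) u x)
        (tensorNorm (weakHess (cube (n + 1)) u x)) := eFun_nonneg hW hε _ _
      change _ ≤ ofReal (2 ^ p * C * ε) * ofReal (eFun W ε l
        (weakGrad (cube (n + 1)) u x) (tensorNorm (weakHess (cube (n + 1)) u x))) +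
          ofReal (2 ^ p * A ^ p)
      rw [← ofReal_mul (by positivity), ← ofReal_add (by positivity) (by positivity),
        ← ofReal_norm, ENNReal.ofReal_rpow_of_nonneg (norm_nonneg _) (by linarith), Real.norm_eq_abs]
      refine ofReal_mono (hb.trans ?_)
      have h2 := le_eFun (W := W) (l := l) hε (weakGrad (cube (n + 1)) u x)
        (tensorNorm (weakHess (cube (n + 1)) u x))
      have h3 : W (weakGrad (cube (n + 1)) u x) ≤ ε * eFun W ε l (weakGrad (cube (n + 1)) u x)
          (tensorNorm (weakHess (cube (n + 1)) u x)) := by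
        have h4 : 0 ≤ ε * tensorNorm (weakHess (cube (n + 1)) u x) ^ 2 := by positivity
        have h5 : 1 / ε * W (weakGrad (cube (n + 1)) u x) ≤ eFun W ε l (weakGrad (cube (n + 1)) u x)
          (tensorNorm (weakHess (cube (n + 1)) u x)) := by linarith
        rw [one_div, inv_mul_le_iff₀ hε] at h5
        exact h5
      calc _ = 2 ^ p * C * W (weakGrad (cube (n + 1)) u x) + 2 ^ p * A ^ p := by ring
        _ ≤ 2 ^ p * C * (ε * eFun W ε l (weakGrad (cube (n + 1)) u x)
          (tensorNorm (weakHess (cube (n + 1)) u x))) + 2 ^ p * A ^ p := by gcongr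
        _ = _ := by ring
    refine ne_top_of_le_ne_top ?_ hle
    have : volume (cube (n + 1)) ≠ ⊤ := by rw [cube_eq_openCube, volume_openCube]; finiteness
    finiteness
  have hFfin : ∫⁻ x, F x ≠ ⊤ := by
    rw [hFeq, lintegral_add_left s1, lintegral_add_left s2', lintegral_finsetSum _ fun i _ => m1 i,
      lintegral_finsetSum _ fun i _ => s2 i, lintegral_finsetSum _ fun i _ => s3' i]
    refine ENNReal.add_ne_top.2 ⟨ENNReal.sum_ne_top.2 fun i _ => hf2 i, ENNReal.add_ne_top.2
      ⟨ENNReal.sum_ne_top.2 fun i _ => ?_, ENNReal.sum_ne_top.2 fun i _ => ?_⟩⟩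
    · rw [lintegral_finsetSum _ fun j _ => m2 i j]
      exact ENNReal.sum_ne_top.2 fun j _ => hgp i j
    · rw [lintegral_finsetSum _ fun j _ => s3 i j]
      refine ENNReal.sum_ne_top.2 fun j _ => ?_
      rw [lintegral_finsetSum _ fun k _ => m3 i j k]
      exact ENNReal.sum_ne_top.2 fun k _ => hH2 i j k
  -- by Jensen's inequality, the sum for the mollified functions is at most its mollification
  have hFmoll : ∀ (N : ℕ) x, domSum p (fun i => moll (bump (n + 1) N) (f i) x)
      (Matrix.of fun i j => moll (bump (n + 1) N) (g i j) x)
      (fun i j k => moll (bump (n + 1) N) (H i j k) x) ≤ lmoll (bump (n + 1) N) F x := by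
    intro N x
    have e2 : lmoll (bump (n + 1) N) (fun x => ∑ i, ∑ j, ‖g i j x‖ₑ ^ p) x =
        ∑ i, ∑ j, lmoll (bump (n + 1) N) (fun x => ‖g i j x‖ₑ ^ p) x := by
      rw [lmoll_sum _ _ s2]
      exact sum_congr rfl fun i _ => lmoll_sum _ _ (m2 i) _
    have e3 : lmoll (bump (n + 1) N) (fun x => ∑ i, ∑ j, ∑ k, ‖H i j k x‖ₑ ^ (2 : ℝ)) x =
        ∑ i, ∑ j, ∑ k, lmoll (bump (n + 1) N) (fun x => ‖H i j k x‖ₑ ^ (2 : ℝ)) x := by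
      rw [lmoll_sum _ _ s3']
      refine sum_congr rfl fun i _ => (lmoll_sum _ _ (s3 i) _).trans ?_
      exact sum_congr rfl fun j _ => lmoll_sum _ _ (m3 i j) _
    rw [hFeq, lmoll_add _ s1, lmoll_add _ s2', lmoll_sum _ _ m1, e2, e3]
    refine add_le_add (sum_le_sum fun i _ => enorm_moll_rpow_le _ (hfmeas i) one_le_two x)
      (add_le_add (sum_le_sum fun i _ => sum_le_sum fun j _ =>
        enorm_moll_rpow_le _ (hgmeas i j) (by linarith) x) (sum_le_sum fun i _ =>
        sum_le_sum fun j _ => sum_le_sum fun k _ =>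
        enorm_moll_rpow_le _ (hHmeas i j k) one_le_two x))
  obtain ⟨K, hK0, hK⟩ := exists_domSum_bound (W := W) (a := a) hwb hp hε hl
  set w : ℕ → Pt n → Space d := fun N x =>
    WithLp.toLp 2 fun i => moll (bump (n + 1) N) (f i) x
  set gN : ℕ → Pt n → Mat d n := fun N x =>
    Matrix.of fun i j => moll (bump (n + 1) N) (g i j) x
  set HN : ℕ → Pt n → Fin d → Fin (n + 1) → Fin (n + 1) → ℝ := fun N x i j k =>
    moll (bump (n + 1) N) (H i j k) x
  have cw : ∀ N, Smooth (w N) := fun N =>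
    contDiff_euclidean.2 fun i => contDiff_moll _ (hfint i).locallyIntegrable
  have cg : ∀ N, Continuous (gN N) := fun N => continuous_pi fun i => continuous_pi fun j =>
    (contDiff_moll _ (hgint i j).locallyIntegrable).continuous
  have cH : ∀ N, Continuous (HN N) := fun N => continuous_pi fun i => continuous_pi fun j =>
    continuous_pi fun k => (contDiff_moll _ (hHint i j k).locallyIntegrable).continuous
  have ceF : Continuous fun q : Mat d n × (Fin d → Fin (n + 1) → Fin (n + 1) → ℝ) =>
      eFun W ε l q.1 (tensorNorm q.2) := by
    have h2 := continuous_tensorNorm.comp (continuous_snd (X := Mat d n)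
      (Y := Fin d → Fin (n + 1) → Fin (n + 1) → ℝ))
    unfold eFun
    exact ((continuous_const.mul (hWc.comp continuous_fst)).add (continuous_const.mul (h2.pow 2))).add
      (continuous_const.mul (continuous_const.min (h2.pow 2)))
  have ccF : Continuous fun T : Fin d → Fin (n + 1) → Fin (n + 1) → ℝ => max (l + tensorNorm T) 0 :=
    (continuous_const.add continuous_tensorNorm).max continuous_const
  -- on the smaller cube, the derivatives of the mollifications are the mollified weak derivatives
  have hder : ∀ᶠ N in atTop, ∀ x ∈ openCube (n + 1) r, grad (w N) x = gN N x ∧ hess (w N) x = HN N x := by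
    have hev : ∀ᶠ N in atTop, (bump (n + 1) N).rOut < (1 - r) / 4 :=
      tendsto_rOut_bump.eventually (gt_mem_nhds (by linarith))
    filter_upwards [hev] with N hN
    have hball : ∀ x ∈ openCube (n + 1) ((1 + r) / 2),
        Metric.closedBall x (bump (n + 1) N).rOut ⊆ cube (n + 1) := fun x hx =>
      closedBall_subset_of_mem_openCube (s := 1) (by linarith) hx
    have hg1 : ∀ i j, ∀ x ∈ openCube (n + 1) ((1 + r) / 2),
        pd j (moll (bump (n + 1) N) (f i)) x = moll (bump (n + 1) N) (g i j) x := fun i j x hx =>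
      pd_moll _ (hfint i) (hf0 i) (hg0 i j) (wfg i j) (hball x hx)
    intro x hx
    have hx' : x ∈ openCube (n + 1) ((1 + r) / 2) := openCube_mono (by linarith) hx
    constructor
    · ext i j; exact hg1 i j x hx'
    · ext i j k
      have hloc : pd j (moll (bump (n + 1) N) (f i)) =ᶠ[𝓝 x] moll (bump (n + 1) N) (g i j) := by
        filter_upwards [(isOpen_openCube _ _).mem_nhds hx'] with y hy using hg1 i j y hy
      exact (pd_congr hloc k).trans
        (pd_moll _ (hgint i j) (hg0 i j) (hH0 i j k) (wgH i j k) (hball x hx'))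
  have tf : ∀ᵐ x, Tendsto (fun N => w N x) atTop (𝓝 (fV x)) := by
    filter_upwards [eventually_all.2 fun i => ae_tendsto_moll (hfint i).locallyIntegrable] with x hx
    exact ((PiLp.continuous_toLp 2 _).tendsto _).comp (tendsto_pi_nhds.2 hx)
  have tgH : ∀ᵐ x, Tendsto (fun N => (gN N x, HN N x)) atTop (𝓝 (gM x, HT x)) := by
    filter_upwards [eventually_all.2 fun i => eventually_all.2 fun j =>
      ae_tendsto_moll (hgint i j).locallyIntegrable, eventually_all.2 fun i => eventually_all.2 fun j =>
      eventually_all.2 fun k => ae_tendsto_moll (hHint i j k).locallyIntegrable] with x hx hx'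
    exact Tendsto.prodMk_nhds (tendsto_pi_nhds.2 fun i => tendsto_pi_nhds.2 fun j => hx i j)
      (tendsto_pi_nhds.2 fun i => tendsto_pi_nhds.2 fun j => tendsto_pi_nhds.2 fun k => hx' i j k)
  let _ : MeasurableSpace (Mat d n) := inferInstanceAs (MeasurableSpace (Fin d → Fin (n + 1) → ℝ))
  have : OpensMeasurableSpace (Mat d n) :=
    inferInstanceAs (OpensMeasurableSpace (Fin d → Fin (n + 1) → ℝ))
  have : SecondCountableTopology (Mat d n) :=
    inferInstanceAs (SecondCountableTopology (Fin d → Fin (n + 1) → ℝ))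
  have mgM : Measurable gM := measurable_pi_iff.2 fun i => measurable_pi_iff.2 fun j => hgmeas i j
  have mHT : Measurable HT := measurable_pi_iff.2 fun i => measurable_pi_iff.2 fun j =>
    measurable_pi_iff.2 fun k => hHmeas i j k
  set O := openCube (n + 1) r with hO
  have hOm : MeasurableSet O := (isOpen_openCube _ _).measurableSet
  have hOvol : volume O ≠ ⊤ := by rw [hO, volume_openCube]; finiteness
  have hOQ : O ⊆ cube (n + 1) := openCube_mono hr.le
  set hd : ℕ → Pt n → ENNReal := fun N x => ofReal K * (lmoll (bump (n + 1) N) F x + 1) with hhd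
  set hd' : Pt n → ENNReal := fun x => ofReal K * (F x + 1) with hhd'
  have mhd : ∀ N, Measurable (hd N) := fun N => ((measurable_lmoll _ hFm).add measurable_const).const_mul _
  have mhd' : Measurable hd' := (hFm.add measurable_const).const_mul _
  have thd : ∀ᵐ x ∂volume.restrict O, Tendsto (fun N => hd N x) atTop (𝓝 (hd' x)) := by
    refine ae_restrict_of_ae ?_
    filter_upwards [ae_tendsto_lmoll hFm hFfin] with x hx
    exact ENNReal.Tendsto.const_mul (hx.add_const 1) (Or.inr ofReal_ne_top)
  have hFO : ∫⁻ x in O, F x ≠ ⊤ := ne_top_of_le_ne_top hFfin (setLIntegral_le_lintegral _ _)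
  have hdint : ∀ G : Pt n → ENNReal, ∫⁻ x in O, ofReal K * (G x + 1) =
      ofReal K * (∫⁻ x in O, G x) + ofReal K * volume O := by
    intro G
    rw [lintegral_const_mul' _ _ ofReal_ne_top, lintegral_add_right _ measurable_const,
      setLIntegral_const, one_mul, mul_add]
  have hdfin : ∫⁻ x in O, hd' x ≠ ⊤ := by rw [hhd', hdint F]; finiteness
  have hdlim : ∀ τ : ℝ, 0 < τ → ∀ᶠ N in atTop, ∫⁻ x in O, hd N x ≤
      (∫⁻ x in O, hd' x) + ofReal τ := by
    intro τ hτ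
    filter_upwards [eventually_lintegral_openCube_le hFfin r (fun N => (bump (n + 1) N).rOut_pos.le)
      tendsto_rOut_bump (τ := τ / (K + 1)) (by positivity)] with N hN
    rw [hhd, hhd', hdint, hdint F]
    have h1 := (lintegral_lmoll_le (bump (n + 1) N) hFm r).trans hN
    calc _ ≤ ofReal K * ((∫⁻ x in O, F x) + ofReal (τ / (K + 1))) +
          ofReal K * volume O := by gcongr
      _ = ofReal K * (∫⁻ x in O, F x) + ofReal K * volume O + ofReal (K * (τ / (K + 1))) := by
        rw [ofReal_mul hK0]; ring
      _ ≤ _ := by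
        gcongr
        rw [mul_div_assoc', div_le_iff₀ (by positivity)]
        nlinarith
  have hdom : ∀ N, ∀ x ∈ O, ofReal (eFun W ε l (gN N x) (tensorNorm (HN N x))) ≤ hd N x ∧
      ofReal (max (l + tensorNorm (HN N x)) 0) ≤ hd N x ∧
      ‖w N x - |x (last n)| • a‖ₑ ≤ hd N x := by
    intro N x hx
    have hxl := hx (last n)
    have hs : |(|x (last n)|)| ≤ 1 := by
      rw [abs_abs, abs_le]; constructor <;> linarith [hxl.1, hxl.2]
    have h := hK (w N x) (gN N x) (HN N x) _ hs
    have hm : ofReal K * (domSum p (fun i => w N x i) (gN N x) (HN N x) + 1) ≤ hd N x :=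
      mul_le_mul_right (add_le_add (hFmoll N x) le_rfl) _
    exact ⟨h.1.trans hm, h.2.1.trans hm, h.2.2.trans hm⟩
  have hdom' : ∀ {e : ℕ → Pt n → ENNReal}, (∀ N, ∀ x ∈ O, e N x ≤ hd N x) →
      ∀ᶠ N in atTop, ∀ᵐ x ∂volume.restrict O, e N x ≤ hd N x := fun h =>
    .of_forall fun N => (ae_restrict_iff' hOm).2 (.of_forall (h N))
  -- generalized dominated convergence for energy, constraint and the distance from the roof
  have ev1 := eventually_lintegral_le_of_dominated (μ := volume.restrict O)
    (e := fun N x => ofReal (eFun W ε l (gN N x) (tensorNorm (HN N x))))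
    (e' := fun x => ofReal (eFun W ε l (gM x) (tensorNorm (HT x))))
    (fun N => (ceF.comp ((cg N).prodMk (cH N))).measurable.ennreal_ofReal) mhd
    (ceF.measurable.comp (mgM.prodMk mHT)).ennreal_ofReal.aemeasurable
    (hdom' fun N x hx => (hdom N x hx).1)
    (ae_restrict_of_ae (by
      filter_upwards [tgH] with x hx
      exact (ENNReal.continuous_ofReal.tendsto _).comp ((ceF.tendsto _).comp hx)))
    thd hdfin mhd'.aemeasurable hdlim hτ
  have ev2 := eventually_lintegral_le_of_dominated (μ := volume.restrict O)
    (e := fun N x => ofReal (max (l + tensorNorm (HN N x)) 0))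
    (e' := fun x => ofReal (max (l + tensorNorm (HT x)) 0))
    (fun N => (ccF.comp (cH N)).measurable.ennreal_ofReal) mhd
    (ccF.measurable.comp mHT).ennreal_ofReal.aemeasurable
    (hdom' fun N x hx => (hdom N x hx).2.1)
    (ae_restrict_of_ae (by
      filter_upwards [tgH] with x hx
      exact (ENNReal.continuous_ofReal.tendsto _).comp ((ccF.tendsto _).comp
        ((continuous_snd.tendsto _).comp hx))))
    thd hdfin mhd'.aemeasurable hdlim hτ
  have cr : Continuous fun x : Pt n => |x (last n)| • a := by fun_prop
  have mfV : Measurable fV :=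
    (PiLp.continuous_toLp 2 _).measurable.comp (measurable_pi_iff.2 hfmeas)
  have ev3 := eventually_lintegral_le_of_dominated (μ := volume.restrict O)
    (e := fun N x => ‖w N x - |x (last n)| • a‖ₑ)
    (e' := fun x => ‖fV x - |x (last n)| • a‖ₑ)
    (fun N => ((cw N).continuous.sub cr).measurable.enorm) mhd
    (mfV.sub cr.measurable).enorm.aemeasurable
    (hdom' fun N x hx => (hdom N x hx).2.2)
    (ae_restrict_of_ae (by
      filter_upwards [tf] with x hx
      exact (continuous_enorm.tendsto _).comp (hx.sub_const _)))
    thd hdfin mhd'.aemeasurable hdlim hτ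
  obtain ⟨N, hN, h1, h2, h3⟩ := (hder.and (ev1.and (ev2.and ev3))).exists
  refine ⟨w N, cw N, ?_, ?_, ?_⟩
  · rw [setLIntegral_congr_fun (g := fun x => ofReal (eFun W ε l (gN N x)
      (tensorNorm (HN N x)))) hOm fun x hx => by simp only [eDens, (hN x hx).1, (hN x hx).2]]
    refine h1.trans (add_le_add ((lintegral_mono_set hOQ).trans (le_of_eq ?_)) le_rfl)
    refine lintegral_congr_ae ?_
    filter_upwards [aeg, aeH] with x hx hx'
    rw [hx, hx']; rfl
  · rw [setLIntegral_congr_fun (g := fun x => ofReal (max (l + tensorNorm (HN N x)) 0))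
      hOm fun x hx => by simp only [cDens, (hN x hx).2]]
    refine h2.trans (add_le_add ((lintegral_mono_set hOQ).trans (le_of_eq ?_)) le_rfl)
    refine lintegral_congr_ae ?_
    filter_upwards [aeH] with x hx
    rw [hx]
  · refine h3.trans (add_le_add ((lintegral_mono_set hOQ).trans (le_of_eq ?_)) le_rfl)
    refine lintegral_congr_ae ?_
    filter_upwards [aef] with x hx
    rw [hx]

/-! ### From almost optimal functions to cells -/

/-- Almost optimal admissible functions for `PhiTilde`. -/
lemma exists_admissible_of_phiTilde_ne_top (hΦ : PhiTilde W a γ ≠ ⊤) {κ η : ℝ} (hκ : 0 < κ)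
    (hη : 0 < η) : ∃ (ε : ℝ) (u : Pt n → Space d) (l : ℝ), 0 < ε ∧ ε ≤ η ∧
      (u, l) ∈ Admissible n d γ ∧ energy W ε u l ≤ PhiTilde W a γ + ofReal κ ∧
      ∫⁻ x in cube (n + 1), ‖u x - |x (last n)| • a‖ₑ ≤ ofReal η := by
  have hlt : PhiTilde W a γ < PhiTilde W a γ + ofReal κ :=
    ENNReal.lt_add_right hΦ (by simpa using hκ)
  obtain ⟨_, ⟨ε, u, l, hε, hu, hr, rfl⟩, hs⟩ := sInf_lt_iff.1 hlt
  have h1 := frequently_lt_of_liminf_lt (by isBoundedDefault) hs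
  have h2 := hε.2.eventually (gt_mem_nhds hη)
  have h3 := hr.eventually (gt_mem_nhds (ENNReal.ofReal_pos.2 hη))
  obtain ⟨h, hh1, hh2, hh3⟩ := (h1.and_eventually (h2.and h3)).exists
  refine ⟨ε h, u h, l h, hε.1 h, hh2.le, hu h, hh1.le, ?_⟩
  rw [← eLpNorm_one_eq_lintegral_enorm]
  exact hh3.le

lemma lintegral_constraint_le {u : Pt n → Space d} {l : ℝ}
    (hu : (u, l) ∈ Admissible n d γ) : ∫⁻ x in cube (n + 1),
      ofReal (max (l + tensorNorm (weakHess (cube (n + 1)) u x)) 0) ≤ ofReal γ := by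
  obtain ⟨hu2, hl, hG⟩ := hu
  have := isFiniteMeasure_cube (n + 1)
  have hmeas : AEStronglyMeasurable (fun x => max (l + tensorNorm (weakHess (cube (n + 1)) u x)) 0)
      (volume.restrict (cube (n + 1))) := by
    have h : AEMeasurable (fun x => weakHess (cube (n + 1)) u x) (volume.restrict (cube (n + 1))) :=
      aemeasurable_pi_lambda _ fun i => aemeasurable_pi_lambda _ fun j => aemeasurable_pi_lambda _
        fun k => (hu2.memLp_hess i j k).aestronglyMeasurable.aemeasurable
    exact (((continuous_const.add continuous_tensorNorm).max continuous_const).measurable.comp_aemeasurable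
      h).aestronglyMeasurable
  have hint : Integrable (fun x => max (l + tensorNorm (weakHess (cube (n + 1)) u x)) 0)
      (volume.restrict (cube (n + 1))) := by
    have hb : Integrable (fun x => ∑ i, ∑ j, ∑ k, |weakHess (cube (n + 1)) u x i j k|)
        (volume.restrict (cube (n + 1))) :=
      integrable_finsetSum _ fun i _ => integrable_finsetSum _ fun j _ =>
        integrable_finsetSum _ fun k _ => ((hu2.memLp_hess i j k).integrable one_le_two).abs
    refine hb.mono' hmeas (.of_forall fun x => ?_)
    have h0 : 0 ≤ ∑ i, ∑ j, ∑ k, |weakHess (cube (n + 1)) u x i j k| := by positivity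
    have h1 : tensorNorm (weakHess (cube (n + 1)) u x) ≤
        ∑ i, ∑ j, ∑ k, |weakHess (cube (n + 1)) u x i j k| := by
      refine Real.sqrt_le_iff.2 ⟨h0, ?_⟩
      have hs : ∀ {ι : Type} [Fintype ι] (f g : ι → ℝ), (∀ i, 0 ≤ g i) → (∀ i, f i ≤ g i ^ 2) →
          ∑ i, f i ≤ (∑ i, g i) ^ 2 := fun f g hg h =>
        (sum_le_sum fun i _ => h i).trans (Finset.sum_sq_le_sq_sum_of_nonneg fun i _ => hg i)
      refine hs _ _ (fun i => by positivity) fun i => hs _ _ (fun j => by positivity) fun j =>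
        hs _ _ (fun k => by positivity) fun k => (sq_abs _).ge
    rw [Real.norm_of_nonneg (le_max_right _ _)]
    exact max_le (by linarith) h0
  rw [← ofReal_integral_eq_lintegral_ofReal hint (.of_forall fun x => le_max_right _ _)]
  exact ofReal_mono hG

lemma smul_mem_openCube_iff {m : ℕ} {s r : ℝ} (hs : 0 < s) (x : Space m) :
    s • x ∈ openCube m r ↔ x ∈ openCube m (s⁻¹ * r) := by
  refine forall_congr' fun i => ?_
  simp only [PiLp.smul_apply, smul_eq_mul, Set.mem_Ioo]
  rw [show -(s⁻¹ * r) / 2 = s⁻¹ * (-r / 2) by ring, show s⁻¹ * r / 2 = s⁻¹ * (r / 2) by ring,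
    inv_mul_lt_iff₀ hs, lt_inv_mul_iff₀ hs]

/-- Blowing up a cube scales the energy and the constraint like the area of its lateral face. -/
lemma lintegral_rescale {f g : Pt n → ENNReal} {K : ℕ} (hK : 0 < K) {r c : ℝ}
    (hc : 0 ≤ c) (hf : ∀ x, f x = ofReal c * g ((K : ℝ)⁻¹ • x)) :
    ∫⁻ x in openCube (n + 1) (K * r), f x =
      ofReal (c * K ^ (n + 1)) * ∫⁻ x in openCube (n + 1) r, g x := by
  have hK0 : (0 : ℝ) < K := by exact_mod_cast hK
  have h := lintegral_comp_smul_preimage (inv_pos.2 hK0) g (openCube (n + 1) r)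
  have he : (fun x : Pt n => (K : ℝ)⁻¹ • x) ⁻¹' openCube (n + 1) r =
      openCube (n + 1) (K * r) := by
    ext x
    rw [Set.mem_preimage, smul_mem_openCube_iff (inv_pos.2 hK0), inv_inv]
  rw [he] at h
  simp only [hf]
  rw [lintegral_const_mul' _ _ ofReal_ne_top, h, ← mul_assoc, ← ofReal_mul hc]
  simp

/-- Cells are almost as good as the competitors for `PhiTilde`. With `K = k + 3`, the competitor is
blown up by the factor `K`, of which mollification loses a boundary layer, so that a function on the
cube of side `k + 2` remains. -/
lemma exists_attain_of_phiTilde_ne_top (hwb : WellBounds W a p C) (hp : 2 ≤ p)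
    (hW : ∀ ξ, 0 ≤ W ξ) (hWc : Continuous W) (hWe : IsColumnEven W) (ha : a ≠ 0) (hγ : 0 ≤ γ)
    (hΦ : PhiTilde W a γ ≠ ⊤) {τ : ℝ} (hτ : 0 < τ) : ∃ ε l : ℝ, 0 < ε ∧ l ≤ 0 ∧
      Attain W a ε l (PhiTilde W a γ + ofReal τ) (ofReal (γ + τ)) := by
  obtain ⟨D, hD0, hD⟩ := exists_attain_of_openCube hwb hp hW hWc hWe ha
  set Φ := (PhiTilde W a γ).toReal
  have hΦ0 : 0 ≤ Φ := ENNReal.toReal_nonneg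
  have hΦe : PhiTilde W a γ = ofReal Φ := (ofReal_toReal hΦ).symm
  set κ := τ / 4 with hκ
  have hκ0 : 0 < κ := by positivity
  -- the loss in the passage to a cell vanishes as the tile count grows
  have hx : Tendsto (fun q : ℕ => ((2 ^ q : ℕ) : ℝ)) atTop atTop :=
    tendsto_natCast_atTop_atTop.comp (tendsto_pow_atTop_atTop_of_one_lt one_lt_two)
  have hρ : Tendsto (fun q : ℕ => (((2 ^ q : ℕ) + 3 : ℝ) / (2 ^ q : ℕ)) ^ n) atTop (𝓝 1) := by
    have h := ((hx.const_div_atTop 3).const_add 1).pow n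
    rw [add_zero, one_pow] at h
    refine h.congr fun q => ?_
    rw [add_div, div_self (by positivity)]
  have hDk : Tendsto (fun q : ℕ => D / (((2 ^ q : ℕ) : ℝ) - 3)) atTop (𝓝 0) :=
    (tendsto_atTop_add_const_right _ (-3) hx).const_div_atTop D
  have hlim : ∀ M : ℝ, ∀ᶠ q : ℕ in atTop, (((2 ^ q : ℕ) + 3 : ℝ) / (2 ^ q : ℕ)) ^ n * (M + κ) +
      (D / (((2 ^ q : ℕ) : ℝ) - 3) * ((((2 ^ q : ℕ) + 3 : ℝ) / (2 ^ q : ℕ)) ^ n * (Φ + κ) +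
        (((2 ^ q : ℕ) + 3 : ℝ) / (2 ^ q : ℕ)) ^ n * (γ + κ) + 1) + κ) < M + τ := by
    intro M
    have h := (hρ.mul_const (M + κ)).add ((hDk.mul (((hρ.mul_const (Φ + κ)).add
      (hρ.mul_const (γ + κ))).add_const 1)).add_const κ)
    refine h.eventually (gt_mem_nhds ?_)
    rw [hκ]; linarith
  obtain ⟨q, hq1, hq2, hq3⟩ := ((hlim Φ).and ((hlim γ).and (eventually_ge_atTop 2))).exists
  set k : ℕ := 2 ^ q with hk
  have hk4 : 4 ≤ k := by
    calc 4 = 2 ^ 2 := rfl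
      _ ≤ 2 ^ q := Nat.pow_le_pow_right two_pos hq3
  have hk4r : (4 : ℝ) ≤ k := by exact_mod_cast hk4
  obtain ⟨η, hη0, hη⟩ := hD q k hk hk4 ((k + 3) ^ n * (Φ + κ)) κ (by positivity) hκ0
  set K : ℕ := k + 3 with hK
  have hKr : (K : ℝ) = k + 3 := by rw [hK]; push_cast; ring
  have hK0 : (0 : ℝ) < K := by rw [hKr]; positivity
  set η₀ := min (η / K) (η / (2 * K ^ (n + 2)))
  have hη₀0 : 0 < η₀ := by positivity
  have hη₀1 : K * η₀ ≤ η := (le_div_iff₀' hK0).1 (min_le_left _ _)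
  have hη₀2 : K * K ^ (n + 1) * (η₀ + η₀) ≤ η := by
    have h : η₀ * (2 * K ^ (n + 2)) ≤ η := (le_div_iff₀ (by positivity)).1 (min_le_right _ _)
    calc _ = η₀ * (2 * K ^ (n + 2)) := by ring
      _ ≤ η := h
  -- the competitor, with `ε` small enough for the passage to cells on the blown-up cube
  obtain ⟨ε, u, l, hε, hεη, hu, hE, hL⟩ :=
    exists_admissible_of_phiTilde_ne_top hΦ (half_pos hκ0) hη₀0
  have hl : l ≤ 0 := hu.2.1
  have hEfin : energy W ε u l ≠ ⊤ := ne_top_of_le_ne_top (by finiteness) hE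
  have hr : ((k : ℝ) + 2) / K < 1 := by rw [hKr, div_lt_one (by linarith)]; linarith
  obtain ⟨w, hw, hwE, hwG, hwL⟩ := exists_smooth_approx hwb hp hW hWc hε hl hu.1 hEfin hr
    (τ := min (κ / 2) η₀) (by positivity)
  have hKi : 0 < (K : ℝ)⁻¹ := inv_pos.2 hK0
  have hKK : (K : ℝ)⁻¹ * K ^ (n + 1) = K ^ n := by rw [pow_succ]; field_simp
  have hside : (k : ℝ) + 2 = K * ((k + 2) / K) := by field_simp
  have hmin : ofReal (min (κ / 2) η₀) ≤ ofReal (κ / 2) :=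
    ofReal_mono (min_le_left _ _)
  have hE' : eInt W (ε / (K : ℝ)⁻¹) ((K : ℝ)⁻¹ * l) (rescale (K : ℝ)⁻¹ w)
      (openCube (n + 1) (k + 2)) ≤ ofReal (K ^ n * (Φ + κ)) := by
    rw [hside, lintegral_rescale (g := fun x => ofReal (eDens W ε l w x)) (by omega) hKi.le
      fun x => by rw [eDens_rescale hKi hw, ofReal_mul hKi.le], hKK,
      ofReal_mul (by positivity)]
    refine mul_le_mul_right (hwE.trans ((add_le_add hE hmin).trans (le_of_eq ?_))) _
    rw [hΦe, ← ofReal_add (by positivity) (by positivity),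
      ← ofReal_add (by positivity) (by positivity)]
    congr 1; ring
  have hG' : cInt ((K : ℝ)⁻¹ * l) (rescale (K : ℝ)⁻¹ w)
      (openCube (n + 1) (k + 2)) ≤ ofReal (K ^ n * (γ + κ)) := by
    rw [hside, lintegral_rescale (g := fun x => ofReal (cDens l w x)) (by omega) hKi.le
      fun x => by rw [cDens_rescale hKi hw, ofReal_mul hKi.le], hKK,
      ofReal_mul (by positivity)]
    refine mul_le_mul_right (hwG.trans ((add_le_add (lintegral_constraint_le hu) hmin).trans ?_)) _
    rw [← ofReal_add (by positivity) (by positivity)]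
    exact ofReal_mono (by linarith)
  have hL' : ∫⁻ x in openCube (n + 1) (k + 2),
      ‖rescale (K : ℝ)⁻¹ w x - |x (last n)| • a‖ₑ ≤ ofReal η := by
    rw [hside, lintegral_rescale (g := fun x => ‖w x - |x (last n)| • a‖ₑ) (by omega) hK0.le
      fun x => ?_]
    · refine (mul_le_mul_right (hwL.trans (add_le_add hL (ofReal_mono
        (min_le_right _ _)))) _).trans ?_
      rw [← ofReal_add (by positivity) (by positivity), ← ofReal_mul (by positivity)]
      exact ofReal_mono hη₀2
    · rw [← Real.enorm_eq_ofReal hK0.le, ← enorm_smul, smul_sub, smul_smul, rescale, inv_inv]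
      congr 3
      simp only [PiLp.smul_apply, smul_eq_mul, abs_mul, abs_of_pos hKi]
      field_simp
  have hεK : ε / (K : ℝ)⁻¹ = K * ε := by field_simp
  have hεη' : K * ε ≤ K * η₀ := by gcongr
  have hat := hη (ε / (K : ℝ)⁻¹) ((K : ℝ)⁻¹ * l) (rescale (K : ℝ)⁻¹ w) (by positivity)
    (by rw [hεK]; linarith) (mul_nonpos_of_nonneg_of_nonpos hKi.le hl) (contDiff_rescale _ hw) _ _ hE' hG'
    (by rw [hKr]) hL'
  refine ⟨_, _, by positivity, mul_nonpos_of_nonneg_of_nonpos hKi.le hl,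
    hat.mono ?_ ?_⟩
  all_goals
    have hkn : ∀ M : ℝ, 0 ≤ M → (((k : ENNReal) ^ n)⁻¹) * ofReal (K ^ n * M) =
        ofReal (((k + 3 : ℝ) / k) ^ n * M) := by
      intro M hM
      have hk0 : (0 : ℝ) < k := by linarith
      rw [← ENNReal.ofReal_natCast, ← ofReal_pow hk0.le,
        ← ENNReal.ofReal_inv_of_pos (by positivity), ← ofReal_mul (by positivity), hKr, div_pow]
      congr 1; ring
    have hDp : 0 ≤ D / ((k : ℝ) - 3) := div_nonneg hD0 (by linarith)
    rw [hkn _ (by positivity), hkn _ (by positivity), ← ofReal_one,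
      ← ofReal_add (by positivity) (by positivity),
      ← ofReal_add (by positivity) (by positivity), ← ofReal_mul hDp,
      ← ofReal_add (by positivity) (by positivity),
      ← ofReal_add (by positivity) (by positivity)]
  · rw [hΦe, ← ofReal_add hΦ0 hτ.le]
    exact ofReal_mono hq1.le
  · exact ofReal_mono hq2.le

/-! ### Periodic profiles on the cube -/

/-- A smooth function of lateral period one that equals `|x_N| a` away from a thin layer around the
hyperplane `x_N = 0` and is bounded on the slab, together with its first two derivatives. -/
structure IsProfile (a : Space d) (u : Pt n → Space d) : Prop where
  smooth : Smooth u
  roof : ∀ x, 1 / 4 ≤ |x (last n)| → u x = |x (last n)| • a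
  periodic : ∀ x (j : Fin n), u (x + single j.castSucc 1) = u x
  bound : ∃ B, ∀ x ∈ slab n, ‖u x‖ ≤ B ∧ matNorm (grad u x) ≤ B ∧ hessNorm u x ≤ B

lemma MemW2.mono_exponent {m : ℕ} {U : Set (Space m)} {v : Space m → Space d} {q r : ENNReal}
    [IsFiniteMeasure (volume.restrict U)] (h : MemW2 r U v) (hqr : q ≤ r) : MemW2 q U v where
  memLp i := (h.memLp i).mono_exponent hqr
  hasGrad := h.hasGrad
  memLp_grad i j := (h.memLp_grad i j).mono_exponent hqr
  hasHess := h.hasHess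
  memLp_hess i j k := (h.memLp_hess i j k).mono_exponent hqr

lemma cube_subset_slab : cube (n + 1) ⊆ slab n := fun _ hx => hx _

lemma isOpen_slab : IsOpen (slab n) :=
  isOpen_Ioo.preimage (f := fun x : Pt n => x (last n)) (by fun_prop)

lemma IsProfile.memW2 (hu : IsProfile a u) {U : Set (Pt n)} (hU : IsOpen U)
    (hUs : U ⊆ slab n) : MemW2 ∞ U u := by
  obtain ⟨B, hB⟩ := hu.bound
  have key : ∀ f : Pt n → ℝ, Continuous f → (∀ x ∈ slab n, |f x| ≤ B) →
      MemLp f ∞ (volume.restrict U) := fun f hf h =>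
    memLp_top_of_bound hf.aestronglyMeasurable B
      ((ae_restrict_iff' hU.measurableSet).2 (.of_forall fun x hx => h x (hUs hx)))
  refine memW2_of_smooth hU hu.smooth (fun i => key _ (ContDiff.coord hu.smooth i).continuous
    fun x hx => (PiLp.norm_apply_le (u x) i).trans (hB x hx).1) (fun i j => key _
      (contDiff_pd (ContDiff.coord hu.smooth i) j).continuous
        fun x hx => (abs_le_matNorm _ i j).trans (hB x hx).2.1) fun i j k => key _
      (contDiff_pd (contDiff_pd (ContDiff.coord hu.smooth i) j) k).continuous
        fun x hx => (abs_le_tensorNorm _ i j k).trans (hB x hx).2.2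

lemma IsProfile.isPeriodicW2 (hu : IsProfile a u) : IsPeriodicW2 u :=
  ⟨fun x _ j => hu.periodic x j, hu.memW2 isOpen_slab subset_rfl⟩

lemma IsProfile.grad_eq (hu : IsProfile a u) (x : Pt n) :
    (1 / 4 < x (last n) → grad u x = tens a) ∧
      (x (last n) < -(1 / 4) → grad u x = -tens a) := by
  obtain ⟨h1, h2⟩ := eventuallyEq_affineLast_of_roof (by norm_num) hu.roof x
  refine ⟨fun h => ?_, fun h => ?_⟩
  · rw [grad_congr (h1 h), grad_affineLast]
  · rw [grad_congr (h2 h), grad_affineLast, tensorLast_neg]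

lemma IsProfile.gradMatches (hu : IsProfile a u) : GradMatches a u := by
  refine ⟨1 / 4, by norm_num, ?_⟩
  filter_upwards [weakGrad_ae_eq (isOpen_cube (n + 1)) hu.smooth] with x hx
  rw [hx]
  exact ⟨fun h => (hu.grad_eq x).1 (by linarith), fun h => (hu.grad_eq x).2 (by linarith)⟩

lemma energy_eq_of_smooth (hu : Smooth u) : energy W ε u l = eInt W ε l u (cube (n + 1)) := by
  refine lintegral_congr_ae ?_
  filter_upwards [weakGrad_ae_eq (isOpen_cube (n + 1)) hu, weakHess_ae_eq (isOpen_cube (n + 1)) hu]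
    with x h1 h2
  rw [h1, h2]; rfl

lemma IsProfile.mem_admissible (hu : IsProfile a u) (hl : l ≤ 0) (hγ : 0 ≤ γ)
    (h : cInt l u (cube (n + 1)) ≤ ofReal γ) :
    (u, l) ∈ Admissible n d γ := by
  have := isFiniteMeasure_cube (n + 1)
  refine ⟨(hu.memW2 (isOpen_cube _) cube_subset_slab).mono_exponent le_top, hl, ?_⟩
  have he : ∫ x in cube (n + 1), max (l + tensorNorm (weakHess (cube (n + 1)) u x)) 0 =
      ∫ x in cube (n + 1), cDens l u x := by
    refine integral_congr_ae ?_
    filter_upwards [weakHess_ae_eq (isOpen_cube (n + 1)) hu.smooth] with x hx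
    rw [hx]; rfl
  change ∫ x in cube (n + 1), max (l + tensorNorm (weakHess (cube (n + 1)) u x)) 0 ≤ γ
  rw [he, integral_eq_lintegral_of_nonneg_ae (.of_forall cDens_nonneg)
    (continuous_cDens hu.smooth).aestronglyMeasurable]
  exact ENNReal.toReal_le_of_le_ofReal hγ h

/-- The gradient of a profile passes from one well to the other, so that it leaves the wells. -/
lemma IsProfile.exists_potential_pos (hu : IsProfile a u) (ha : a ≠ 0)
    (hW : ∀ ξ, W ξ = 0 → ξ = tens a ∨ ξ = -tens a) :
    ∃ x ∈ cube (n + 1), W (grad u x) ≠ 0 := by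
  -- the component of the gradient along the jump is `|a|²` at the top and `-|a|²` at the bottom
  set g : Mat d n → ℝ := fun ξ => ∑ i, ξ i (last n) * a i with hg
  have ha2 : 0 < ∑ i, a i * a i := by
    refine lt_of_le_of_ne (sum_nonneg fun i _ => mul_self_nonneg _) fun h => ha ?_
    ext i
    exact mul_self_eq_zero.1 ((Finset.sum_eq_zero_iff_of_nonneg fun i _ => mul_self_nonneg _).1 h.symm i
      (Finset.mem_univ i))
  have hA : g (tens a) = ∑ i, a i * a i := by simp [hg, tensorLast_last]
  have hB : g (-tens a) = -∑ i, a i * a i := by simp [hg, tensorLast_last]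
  have hgc : Continuous g := by unfold g; fun_prop
  set z : ℝ → Pt n := fun s => SurfaceTension.mk 0 s with hz
  have hc : Continuous fun s => g (grad u (z s)) :=
    hgc.comp ((continuous_grad hu.smooth).comp (continuous_mk.comp
      (continuous_const.prodMk continuous_id)))
  have h1 : g (grad u (z (3 / 8))) = ∑ i, a i * a i := by
    rw [(hu.grad_eq _).1 (by simp [hz]; norm_num), hA]
  have h2 : g (grad u (z (-(3 / 8)))) = -∑ i, a i * a i := by
    rw [(hu.grad_eq _).2 (by simp [hz]; norm_num), hB]
  obtain ⟨s, hs, hs0⟩ := intermediate_value_Icc (a := -(3 / 8 : ℝ)) (b := 3 / 8) (by norm_num)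
    hc.continuousOn (show (0 : ℝ) ∈ _ by rw [h1, h2]; constructor <;> linarith)
  refine ⟨z s, fun i => ?_, fun h => ?_⟩
  · refine lastCases ?_ (fun j => ?_) i
    · simp only [hz, mk_last]; constructor <;> linarith [hs.1, hs.2]
    · simp only [hz, mk_castSucc, Pi.zero_apply]; norm_num
  · simp only at hs0
    rcases hW _ h with h | h
    · rw [h, hA] at hs0; linarith
    · rw [h, hB] at hs0; linarith

/-- Decreasing `ε` raises the energy of a profile to any prescribed larger value. -/
lemma IsProfile.exists_energy_eq (hu : IsProfile a u) (ha : a ≠ 0) (hW : IsTwoWell W a)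
    (hε : 0 < ε) {M : ℝ} (hM : energy W ε u l ≤ ofReal M) :
    ∃ θ, 0 < θ ∧ θ ≤ ε ∧ energy W θ u l = ofReal M := by
  set w : Pt n → ℝ := fun x => W (grad u x) with hw
  set h : Pt n → ℝ := fun x =>
    hessNorm u x ^ 2 + min (l ^ 2) (hessNorm u x ^ 2) with hh
  have hw0 : ∀ x, 0 ≤ w x := fun x => hW.nonneg _
  have hh0 : ∀ x, 0 ≤ h x := fun x => by positivity
  have hwc : Continuous w := hW.cont.comp (continuous_grad hu.smooth)
  have hhc : Continuous h := by
    have := continuous_tensorNorm.comp (continuous_hess hu.smooth)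
    exact (this.pow 2).add (continuous_const.min (this.pow 2))
  have split : ∀ θ, 0 < θ → energy W θ u l = ofReal (1 / θ) * (∫⁻ x in cube (n + 1), ofReal (w x)) +
        ofReal θ * ∫⁻ x in cube (n + 1), ofReal (h x) := by
    intro θ hθ
    rw [energy_eq_of_smooth hu.smooth, ← lintegral_const_mul' _ _ ofReal_ne_top,
      ← lintegral_const_mul' _ _ ofReal_ne_top,
      ← lintegral_add_left (hwc.measurable.ennreal_ofReal.const_mul _)]
    refine lintegral_congr fun x => ?_
    rw [← ofReal_mul (by positivity), ← ofReal_mul hθ.le,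
      ← ofReal_add (mul_nonneg (by positivity) (hw0 x)) (mul_nonneg hθ.le (hh0 x))]
    congr 1
    simp only [eDens, eFun, hw, hh]; ring
  have hfin : ofReal (1 / ε) * (∫⁻ x in cube (n + 1), ofReal (w x)) +
      ofReal ε * ∫⁻ x in cube (n + 1), ofReal (h x) ≠ ⊤ := by
    rw [← split ε hε]; exact ne_top_of_le_ne_top ofReal_ne_top hM
  obtain ⟨hf1, hf2⟩ := ENNReal.add_ne_top.1 hfin
  set I := ∫⁻ x in cube (n + 1), ofReal (w x) with hI
  set J := ∫⁻ x in cube (n + 1), ofReal (h x)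
  have hIt : I ≠ ⊤ := fun h => hf1 (by rw [h]; exact ENNReal.mul_top (by simpa using hε))
  have hJt : J ≠ ⊤ := fun h => hf2 (by rw [h]; exact ENNReal.mul_top (by simpa using hε))
  have hI0 : 0 < I.toReal := by
    refine ENNReal.toReal_pos (fun h0 => ?_) hIt
    obtain ⟨x, hx, hx0⟩ := hu.exists_potential_pos ha fun ξ => (hW.zero_iff ξ).1
    rw [hI, lintegral_eq_zero_iff hwc.measurable.ennreal_ofReal] at h0
    have := Measure.eqOn_open_of_ae_eq h0 (isOpen_cube _)
      (ENNReal.continuous_ofReal.comp hwc).continuousOn continuousOn_const hx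
    exact hx0 (le_antisymm (ENNReal.ofReal_eq_zero.1 this) (hw0 x))
  have split' : ∀ θ, 0 < θ → energy W θ u l = ofReal (1 / θ * I.toReal + θ * J.toReal) := by
    intro θ hθ
    rw [split θ hθ, ofReal_add (by positivity) (by positivity), ofReal_mul (by positivity),
      ofReal_mul hθ.le, ofReal_toReal hIt, ofReal_toReal hJt]
  have hεpos : 0 < 1 / ε * I.toReal + ε * J.toReal := by positivity
  have hM0 : 0 < M := by
    by_contra hM0
    rw [split' ε hε, ENNReal.ofReal_of_nonpos (not_lt.1 hM0)] at hM
    exact absurd (ENNReal.ofReal_eq_zero.1 (le_zero_iff.1 hM)) (not_le.2 hεpos)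
  have hM' : 1 / ε * I.toReal + ε * J.toReal ≤ M := by
    rwa [split' ε hε, ENNReal.ofReal_le_ofReal_iff hM0.le] at hM
  -- at `θ = t` the first term of the energy alone is at least `M`
  set t := min ε (I.toReal / M)
  have ht0 : 0 < t := by positivity
  have htM : M ≤ 1 / t * I.toReal + t * J.toReal := by
    have h1 : t * M ≤ I.toReal := (le_div_iff₀ hM0).1 (min_le_right _ _)
    have h2 : M ≤ 1 / t * I.toReal := by rw [one_div, le_inv_mul_iff₀ ht0]; exact h1
    have h3 : 0 ≤ t * J.toReal := by positivity
    linarith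
  have hcont : ContinuousOn (fun θ : ℝ => 1 / θ * I.toReal + θ * J.toReal) (Icc t ε) := by
    refine ContinuousOn.add (ContinuousOn.mul (continuousOn_const.div continuousOn_id fun θ hθ =>
      (ht0.trans_le hθ.1).ne') continuousOn_const) (continuousOn_id.mul continuousOn_const)
  obtain ⟨θ, hθ, hθM⟩ := intermediate_value_Icc' (min_le_left _ _) hcont ⟨hM', htM⟩
  have hθ0 : 0 < θ := ht0.trans_le hθ.1
  exact ⟨θ, hθ0, hθ.2, by rw [split' θ hθ0]; exact congrArg _ hθM⟩

/-! ### Scaling cells down -/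

/-- The cube contains a whole number of scaled periods, so that scaling a cell does not increase its
integral per unit area. -/
lemma lintegral_cube_rescale_le {P M : ℕ} (hP : 0 < P) (hM : 0 < M) {f g : Pt n → ENNReal}
    (hf : ∀ (z : Fin n → ℤ) (y : Lat n) (s : ℝ), f (mk (fun j => y j + P * z j) s) = f (mk y s))
    (hg : ∀ x, g x = ofReal (P * (2 * M)) * f (((P : ℝ) * (2 * M)) • x)) {E : ENNReal}
    (hE : ∫⁻ x in cyl (latCube n 0 P) univ, f x ≤ (P : ENNReal) ^ n * E) :
    ∫⁻ x in cube (n + 1), g x ≤ E := by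
  set m : ℝ := P * (2 * M) with hm
  have hP0 : (0 : ℝ) < P := by exact_mod_cast hP
  have hM0 : (0 : ℝ) < M := by exact_mod_cast hM
  have hm0 : 0 < m := by positivity
  have hpre : cube (n + 1) = (fun x : Pt n => m • x) ⁻¹' openCube (n + 1) m := by
    ext x
    rw [Set.mem_preimage, smul_mem_openCube_iff hm0, inv_mul_cancel₀ hm0.ne', cube_eq_openCube]
  have hsub : openCube (n + 1) m ⊆ cyl (Icc (fun _ => (P : ℝ) * ((-M : ℤ) : ℝ))
      (fun _ => (P : ℝ) * (((-M : ℤ) : ℝ) + (2 * M : ℕ)))) univ := by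
    refine fun x hx => ⟨⟨fun j => ?_, fun j => ?_⟩, mem_univ _⟩ <;>
      have h : _ ∧ _ := hx j.castSucc <;> push_cast <;> simp only [lat] <;> linarith [h.1, h.2]
  have h1 := (lintegral_mono_set hsub).trans ((lintegral_periodic_box_le hP hf (fun _ => -M)
    (fun _ => 2 * M) fun _ => by omega).trans (mul_le_mul_right hE _))
  simp only [hg]
  rw [lintegral_const_mul' _ _ ofReal_ne_top]
  conv_lhs => rw [hpre]
  rw [lintegral_comp_smul_preimage hm0]
  refine (mul_le_mul_right (mul_le_mul_right h1 _) _).trans (le_of_eq ?_)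
  have h2 : (∏ _j : Fin n, ((2 * M : ℕ) : ENNReal)) * (P : ENNReal) ^ n = ofReal (m ^ n) := by
    rw [Finset.prod_const, Finset.card_univ, Fintype.card_fin, ← mul_pow, ofReal_pow hm0.le, hm,
      ofReal_mul hP0.le, ofReal_mul zero_le_two]
    simp [mul_comm]
  rw [← mul_assoc (∏ _j : Fin n, _), h2, ← mul_assoc, ← mul_assoc, ← ofReal_mul hm0.le,
    ← ofReal_mul (by positivity), pow_succ]
  rw [show m * (m ^ n * m)⁻¹ * m ^ n = 1 by field_simp, ofReal_one, one_mul]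

/-- Scaling a cell down yields a profile with the same energy and constraint per unit area and with
arbitrarily small `ε`. -/
lemma IsCell.exists_profile (hWe : IsColumnEven W) {P : ℕ} {V : Pt n → Space d}
    (hV : IsCell a P V) (hε : 0 < ε) (hl : l ≤ 0) (hγ : 0 ≤ γ) {E : ENNReal}
    (hE : eInt W ε l V (cyl (latCube n 0 P) univ) ≤ (P : ENNReal) ^ n * E)
    (hG : cInt l V (cyl (latCube n 0 P) univ) ≤
      (P : ENNReal) ^ n * ofReal γ) {τ : ℝ} (hτ : 0 < τ) :
    ∃ (θ : ℝ) (u : Pt n → Space d) (m : ℝ), 0 < θ ∧ θ ≤ τ ∧ IsProfile a u ∧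
      (u, m) ∈ Admissible n d γ ∧ energy W θ u m ≤ E ∧
      ∫⁻ x in cube (n + 1), ‖u x - |x (last n)| • a‖ₑ ≤ ofReal τ := by
  obtain ⟨T, hT⟩ := hV.roof
  obtain ⟨B, hB⟩ := hV.exists_bound T
  set S : ℝ := max B 0 + |T| * ‖a‖
  have hS0 : 0 ≤ S := by positivity
  -- the scaling factor `r = 2 M P` is an even multiple of the period, so that the cube is a union
  -- of scaled periods, and it is large enough for the layer, the distance from the roof and `ε / r`
  obtain ⟨M, hM⟩ := exists_nat_ge (1 + 4 * |T| + S / τ + ε / τ)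
  have hP1 : (1 : ℝ) ≤ P := by exact_mod_cast hV.pos
  have hSτ : 0 ≤ S / τ := by positivity
  have hετ : 0 ≤ ε / τ := by positivity
  have hM1 : (1 : ℝ) ≤ M := by linarith [abs_nonneg T]
  have hM0 : 0 < M := by exact_mod_cast one_pos.trans_le hM1
  set r : ℝ := P * (2 * M) with hr
  have hrM : (M : ℝ) ≤ r := by rw [hr]; nlinarith
  have hr1 : 1 ≤ r := hM1.trans hrM
  have hr0 : 0 < r := by linarith
  have hlast : ∀ x : Pt n, |(r • x) (last n)| = r * |x (last n)| := fun x => by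
    rw [PiLp.smul_apply, smul_eq_mul, abs_mul, abs_of_pos hr0]
  have hroof : ∀ x : Pt n, T ≤ r * |x (last n)| → rescale r V x = |x (last n)| • a := fun x hx => by
    rw [rescale, hT _ ((hlast x).symm ▸ hx), hlast, smul_smul, inv_mul_cancel_left₀ hr0.ne']
  have hu : IsProfile a (rescale r V) := by
    refine ⟨contDiff_rescale r hV.smooth, fun x hx => hroof x ?_, fun x j => ?_, ?_⟩
    · have : 1 + 4 * |T| ≤ r := by linarith
      nlinarith [le_abs_self T]
    · have h := hV.add_eq (fun i => if i = j then 2 * M else 0) (r • x)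
      rw [rescale, rescale, smul_add, ← h]
      congr 3
      ext i
      refine lastCases ?_ (fun i => ?_) i
      · simp [(Fin.castSucc_lt_last j).ne']
      · by_cases hij : i = j
        · subst hij; simp [hr]
        · simp [hij]
    · obtain ⟨B', hB'⟩ := hV.exists_bound (r / 2)
      refine ⟨r * B', fun x hx => ?_⟩
      have hxr : |(r • x) (last n)| ≤ r / 2 := by
        have : |x (last n)| ≤ 1 / 2 := abs_le.2 ⟨by linarith [hx.1], hx.2.le⟩
        rw [hlast]; nlinarith
      obtain ⟨h1, h2, h3⟩ := hB' _ hxr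
      have hB0 : 0 ≤ B' := (norm_nonneg _).trans h1
      refine ⟨?_, ?_, ?_⟩
      · rw [rescale, norm_smul, norm_inv, Real.norm_of_nonneg hr0.le, inv_mul_le_iff₀ hr0]
        have h4 := le_mul_of_one_le_left hB0 hr1
        exact h1.trans (h4.trans (le_mul_of_one_le_left (hB0.trans h4) hr1))
      · rw [grad_rescale hr0 hV.smooth]; nlinarith
      · rw [hess_rescale hr0 hV.smooth, tensorNorm_smul hr0.le]; gcongr
  have hrl : r * l ≤ 0 := mul_nonpos_of_nonneg_of_nonpos hr0.le hl
  refine ⟨ε / r, rescale r V, r * l, by positivity,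
    (div_le_comm₀ hr0 hτ).2 (by linarith [abs_nonneg T]), hu,
    hu.mem_admissible hrl hγ ?_, ?_, ?_⟩
  · refine lintegral_cube_rescale_le hV.pos hM0 (fun z y s => by rw [hV.cDens_periodic]) (fun x => ?_) hG
    rw [cDens_rescale hr0 hV.smooth, ofReal_mul hr0.le]
  · rw [energy_eq_of_smooth hu.smooth]
    refine lintegral_cube_rescale_le hV.pos hM0 (fun z y s => by rw [hV.eDens_periodic hWe])
      (fun x => ?_) hE
    rw [eDens_rescale hr0 hV.smooth, ofReal_mul hr0.le]
  · have hb : ∀ x : Pt n, ‖rescale r V x - |x (last n)| • a‖ₑ ≤ ofReal τ := by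
      intro x
      rw [← ofReal_norm]
      refine ofReal_mono ?_
      rcases le_total T (r * |x (last n)|) with h | h
      · rw [hroof x h, sub_self, norm_zero]; exact hτ.le
      · have h1 : ‖V (r • x)‖ ≤ max B 0 := ((hB _ ((hlast x).trans_le h)).1).trans (le_max_left _ _)
        have h2 : ‖(r * |x (last n)|) • a‖ ≤ |T| * ‖a‖ := by
          rw [norm_smul, Real.norm_of_nonneg (by positivity)]
          gcongr
          exact h.trans (le_abs_self _)
        have h3 : rescale r V x - |x (last n)| • a =
            r⁻¹ • (V (r • x) - (r * |x (last n)|) • a) := by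
          rw [smul_sub, smul_smul, inv_mul_cancel_left₀ hr0.ne', rescale]
        rw [h3, norm_smul, norm_inv, Real.norm_of_nonneg hr0.le, inv_mul_le_iff₀ hr0]
        have h4 : S ≤ r * τ := by rw [← div_le_iff₀ hτ]; linarith [abs_nonneg T]
        linarith [norm_sub_le (V (r • x)) ((r * |x (last n)|) • a)]
    refine (lintegral_mono hb).trans (le_of_eq ?_)
    rw [setLIntegral_const, cube_eq_openCube, volume_openCube]
    simp

/-- A smoothed roof is a cell of finite energy, with a multiplier that makes the constraint void. -/
lemma exists_cell (hwb : WellBounds W a p C) (hp : 2 ≤ p) (hW : ∀ ξ, 0 ≤ W ξ) (hWc : Continuous W) :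
    ∃ (V : Pt n → Space d) (l : ℝ), IsCell a 1 V ∧ l ≤ 0 ∧ (∀ x, cDens l V x = 0) ∧
      eInt W 1 l V (cyl (latCube n 0 (1 : ℕ)) univ) ≠ ⊤ := by
  set V : Pt n → Space d := fun x => (x (last n) * smoothSign (x (last n))) • a with hVd
  have hroof : ∀ x : Pt n, 1 ≤ |x (last n)| → V x = |x (last n)| • a := by
    intro x hx
    rcases le_abs.1 hx with h | h
    · rw [hVd]
      simp only [smoothSign_of_one_le h, mul_one, abs_of_pos (one_pos.trans_le h)]
    · have h1 : smoothSign (x (last n)) = -1 := by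
        rw [← neg_neg (x (last n)), smoothSign_neg, smoothSign_of_one_le h]
      rw [hVd]
      simp only [h1, mul_neg, mul_one, abs_of_neg (show x (last n) < 0 by linarith)]
  have hV : IsCell a 1 V := by
    refine ⟨one_pos, ?_, fun z y s => by simp [hVd], 1, hroof⟩
    exact (smooth_comp_coord (contDiff_id.mul contDiff_smoothSign) (last n)).smul contDiff_const
  obtain ⟨B, hB⟩ := hV.exists_bound 1
  have hl : -max B 0 ≤ 0 := by simp
  refine ⟨V, -max B 0, hV, hl, fun x => ?_, ?_⟩
  · rcases le_or_gt |x (last n)| 1 with h | h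
    · have := (hB x h).2.2.trans (le_max_left B 0)
      exact max_eq_right (by linarith)
    · exact (dens_eq_zero_of_roof (ε := 1) hwb hp hW hl zero_le_one hroof h).2
  · set K := (fun q : (Lat n) × ℝ => mk q.1 q.2) '' (latCube n 0 (1 : ℕ) ×ˢ Icc (-1) 1)
    have hKc : IsCompact K := (isCompact_Icc.prod isCompact_Icc).image continuous_mk
    have hfc := continuous_eDens (ε := 1) (l := -max B 0) hWc hV.smooth
    have hle : eInt W 1 (-max B 0) V (cyl (latCube n 0 (1 : ℕ)) univ) ≤
          eInt W 1 (-max B 0) V K := by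
      rw [← lintegral_indicator hKc.measurableSet,
        ← lintegral_indicator (measurableSet_cyl (measurableSet_latCube _ _) MeasurableSet.univ)]
      refine lintegral_mono fun x => Set.indicator_apply_le fun hx => ?_
      rcases le_or_gt |x (last n)| 1 with h | h
      · rw [Set.indicator_of_mem (show x ∈ K from ⟨(lat x, x (last n)), ⟨hx.1, abs_le.1 h⟩, mk_lat x⟩)]
      · rw [(dens_eq_zero_of_roof (ε := 1) hwb hp hW hl zero_le_one hroof h).1]; simp
    refine ne_top_of_le_ne_top ?_ hle
    exact (hfc.continuousOn.integrableOn_compact hKc).lintegral_lt_top.ne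

lemma isVanishing_of_le {θ : ℕ → ℝ} (h0 : ∀ h, 0 < θ h) (h1 : ∀ h : ℕ, θ h ≤ 1 / ((h : ℝ) + 1)) :
    IsVanishing θ :=
  ⟨h0, squeeze_zero (fun h => (h0 h).le) h1 tendsto_one_div_add_atTop_nhds_zero_nat⟩

lemma tendsto_ofReal_one_div : Tendsto (fun h : ℕ => ofReal (1 / ((h : ℝ) + 1))) atTop (𝓝 0) := by
  have := ENNReal.tendsto_ofReal (tendsto_one_div_add_atTop_nhds_zero_nat (𝕜 := ℝ))
  rwa [ENNReal.ofReal_zero] at this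

lemma tendstoRoof_of_le {u : ℕ → Pt n → Space d} (h : ∀ h : ℕ,
    ∫⁻ x in cube (n + 1), ‖u h x - |x (last n)| • a‖ₑ ≤ ofReal (1 / ((h : ℝ) + 1))) :
    TendstoRoof a u :=
  tendsto_of_tendsto_of_tendsto_of_le_of_le tendsto_const_nhds tendsto_ofReal_one_div
    (fun _ => zero_le) fun k => by rw [eLpNorm_one_eq_lintegral_enorm]; exact h k

/-- Every admissible cell gives an upper bound for `PhiTilde`. -/
lemma phiTilde_le_of_cell (hWe : IsColumnEven W) {P : ℕ} {V : Pt n → Space d}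
    (hV : IsCell a P V) (hε : 0 < ε) (hl : l ≤ 0) (hγ : 0 ≤ γ) {E : ENNReal}
    (hE : eInt W ε l V (cyl (latCube n 0 P) univ) ≤ (P : ENNReal) ^ n * E)
    (hG : cInt l V (cyl (latCube n 0 P) univ) ≤
      (P : ENNReal) ^ n * ofReal γ) : PhiTilde W a γ ≤ E := by
  choose θ u m h1 h2 h3 h4 h5 h6 using fun k : ℕ =>
    hV.exists_profile hWe hε hl hγ hE hG (τ := 1 / ((k : ℝ) + 1)) (by positivity)
  refine sInf_le_of_le ⟨θ, u, m, isVanishing_of_le h1 h2, h4, tendstoRoof_of_le h6, rfl⟩ ?_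
  exact (liminf_le_liminf (.of_forall h5)).trans (liminf_const E).le

/-- Profiles whose energy approximates `PhiTilde` from above. -/
lemma exists_profile_near_phiTilde (hp : 2 ≤ p) (hW₁ : IsTwoWell W a) (hwb : WellBounds W a p C)
    (hWe : IsColumnEven W) {δ : ℝ} (hγ : 0 ≤ γ) (hδ : 0 < δ) {τ : ℝ} (hτ : 0 < τ) :
    ∃ (θ : ℝ) (u : Pt n → Space d) (m : ℝ), 0 < θ ∧ θ ≤ τ ∧ IsProfile a u ∧
      (u, m) ∈ Admissible n d (γ + δ) ∧
      ∫⁻ x in cube (n + 1), ‖u x - |x (last n)| • a‖ₑ ≤ ofReal τ ∧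
      PhiTilde W a γ ≤ energy W θ u m ∧ energy W θ u m ≤ PhiTilde W a γ + ofReal τ := by
  have hW := hW₁.nonneg
  have hWc := hW₁.cont
  rcases eq_or_ne a 0 with rfl | ha
  · -- the roof is flat, and both the energy and its infimum vanish
    have hV : IsCell (0 : Space d) 1 (fun _ : Pt n => (0 : Space d)) :=
      ⟨one_pos, contDiff_const, fun _ _ _ => rfl, 0, fun _ _ => by simp⟩
    have he : (fun _ : Pt n => (0 : Space d)) = affineLast 0 0 := by ext x i; simp [affineLast]
    have hE : eInt W 1 0 (fun _ => 0) (cyl (latCube n 0 (1 : ℕ)) univ) ≤ ((1 : ℕ) : ENNReal) ^ n * 0 := by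
      simp [he, eDens_affineLast hwb hp hW]
    have hG : ∀ γ, cInt 0 (fun _ : Pt n => (0 : Space d)) (cyl (latCube n 0 (1 : ℕ)) univ) ≤
        ((1 : ℕ) : ENNReal) ^ n * ofReal γ := by
      simp [he, cDens_affineLast]
    obtain ⟨θ, u, m, h1, h2, h3, h4, h5, h6⟩ := hV.exists_profile hWe one_pos le_rfl
      (add_nonneg hγ hδ.le) hE (hG _) hτ
    have hΦ := phiTilde_le_of_cell hWe hV one_pos le_rfl hγ hE (hG _)
    exact ⟨θ, u, m, h1, h2, h3, h4, h6, hΦ.trans (zero_le), h5.trans (zero_le)⟩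
  -- the infimum is finite, so that it can be approximated from above
  have hΦ : PhiTilde W a γ ≠ ⊤ := by
    obtain ⟨V, l, hV, hl, hG, hE⟩ := exists_cell (n := n) hwb hp hW hWc
    exact ne_top_of_le_ne_top hE (phiTilde_le_of_cell hWe hV one_pos hl hγ (by simp) (by simp [hG]))
  set σ := min (τ / 2) (δ / 2)
  have hσ0 : 0 < σ := by positivity
  have hσ1 : σ + σ ≤ τ := by linarith [min_le_left (τ / 2) (δ / 2)]
  have hσ2 : σ + σ ≤ δ := by linarith [min_le_right (τ / 2) (δ / 2)]
  obtain ⟨ε, l, hε, hl, hat⟩ := exists_attain_of_phiTilde_ne_top hwb hp hW hWc hWe ha hγ hΦ hσ0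
  obtain ⟨P, V, hV, hE, hG⟩ := hat σ hσ0
  rw [add_assoc, ← ofReal_add hσ0.le hσ0.le] at hE
  rw [← ofReal_add (by positivity) hσ0.le] at hG
  obtain ⟨θ, u, m, h1, h2, h3, h4, h5, h6⟩ := hV.exists_profile hWe hε hl (add_nonneg hγ hδ.le) hE
    (hG.trans (mul_le_mul_right (ofReal_mono (by linarith)) _)) hτ
  have h5' := h5.trans (add_le_add_right (ofReal_mono hσ1) _)
  rcases le_total (PhiTilde W a γ) (energy W θ u m) with h | h
  · exact ⟨θ, u, m, h1, h2, h3, h4, h6, h, h5'⟩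
  · -- an energy below the infimum for `γ` is possible, as the constraint is weaker
    rw [← ofReal_toReal hΦ] at h
    obtain ⟨θ', h1', h2', he⟩ := h3.exists_energy_eq ha hW₁ h1 h
    rw [ofReal_toReal hΦ] at he
    exact ⟨θ', u, m, h1', h2'.trans h2, h3, h4, h6, he.ge, he.le.trans le_self_add⟩

end Approximation

end SurfaceTension

end

open SurfaceTension
theorem mainTheorem7 (n d : ℕ) (p : ℝ) (hp : 2 ≤ p) (a : Space d)
    (W : Matrix (Fin d) (Fin (n + 1)) ℝ → ℝ)
    (hW₁ : IsTwoWell W a) (hW₂ : HasGrowth W p) (hW₃ : HasWellGrowth W a p)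
    (hW₄ : IsColumnEven W)
    (γ δ : ℝ) (hγ : 0 ≤ γ) (hδ : 0 < δ) :
    ∃ (ε : ℕ → ℝ) (u : ℕ → Space (n + 1) → Space d) (l : ℕ → ℝ), IsVanishing ε ∧
      (∀ h, (u h, l h) ∈ Admissible n d (γ + δ)) ∧
      (∀ h, MemW2 ∞ (cube (n + 1)) (u h)) ∧
      TendstoRoof a u ∧
      (∀ h, GradMatches a (u h)) ∧
      (∀ h, IsPeriodicW2 (u h)) ∧
      Tendsto (fun h => energy W (ε h) (u h) (l h)) atTop (𝓝 (PhiTilde W a γ)) := by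
  obtain ⟨C, hwb⟩ := exists_wellBounds hp hW₁ hW₂ hW₃
  choose ε u l h1 h2 h3 h4 h5 h6 h7 using fun k : ℕ =>
    exists_profile_near_phiTilde hp hW₁ hwb hW₄ hγ hδ (τ := 1 / ((k : ℝ) + 1)) (by positivity)
  refine ⟨ε, u, l, isVanishing_of_le h1 h2, h4, fun k => (h3 k).memW2 (isOpen_cube _) cube_subset_slab,
    tendstoRoof_of_le h5, fun k => (h3 k).gradMatches, fun k => (h3 k).isPeriodicW2, ?_⟩
  refine tendsto_of_tendsto_of_tendsto_of_le_of_le tendsto_const_nhds ?_ h6 h7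
  simpa using tendsto_ofReal_one_div.const_add (PhiTilde W a γ)
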